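/- **Setting.** Let $p$ be a prime and $N\ge 1$. Let $B$ be one of the two $N$-dimensional local fields $\mathbb Q_p\{\{t_N\}\}\dots\{\{t_2\}\}$ (put $t_1=p$) or $\mathbb F_p((t_N))\dots((t_1))$. For $1\le i\le N$ let $B(i)\subset B$ be the closed subfield with local parameters $t_1,\dots,t_i$. Fix an algebraic closure $\bar B$. All fields below are subfields of $\bar B$. A *local field* $K$ is a finite extension of $B$. For $i\ge 1$, $K(i)$ is the algebraic closure of $B(i)$ in $K$, and $K(0)$ is the maximal unramified extension of $\mathbb Q_p$ (resp. of $\mathbb F_p$) in $K$. For $K\subset L$ the vector ramification index is $\bar e(L/K)=(e_1,\dots,e_N)$, $e_r=[L(r):K(r)]/[L(r-1):K(r-1)]$. Vectors in $\mathbb Q^N$ are ordered lexicographically (the first coordinate dominates) and are multiplied coordinatewise. Let $v_B:\bar B\to\mathbb Q^N\cup\{\infty\}$ be the valuation for which $v_B(t_i)$ is the $i$-th standard basis vector, and let $v_K=\bar e(K/B)\,v_B$. Let $M$ be an $r$-dimensional local field and $E\subset M$ a subfield of $(r-1)$-dimensional constants, i.e. a field of dimension $r-1$, algebraically closed in $M$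 (for $r=1$: the maximal unramified subfield of $M$). An $r$-th local parameter of $M$ with respect to $E$ is a $\theta\in M$ such that, for some system $s_1,\dots,s_{r-1}$ of local parameters of $E$, $s_1,\dots,s_{r-1},\theta$ is a system of local parameters of $M$. If such a $\theta$ exists, $(M,E)$ is called standard. $\mathcal O_M$ is the ring of the elements of $M$ with non-negative (vector) valuation. Let $J(N)=\coprod_{1\le r\le N}\{j\in\mathbb Q^r: j\ge 0\}$, where all elements of $\mathbb Q^{r_1}$ are larger than those of $\mathbb Q^{r_2}$ if $r_1>r_2$. For $j\in\mathbb Q^r$ the set $I_{L/K,j}$ is defined as follows. Take a finite extension $E'$ of $L(r-1)$ such that $(L(r)E',E')$ is standard and $\mathcal O_{L(r)E'}=\mathcal O_{K(r)E'}[\theta']$ for an $r$-th local parameter $\theta'$ of $L(r)E'$. Then $I_{L/K,j}$ is the set of embeddings $\tau$ of $L(r)E'$ over $K(r)E'$ with $v_L(\tau\theta'-\theta')\ge v_L(\theta')+j$ (first $r$ coordinates), identified with their restrictions to $L(r)$. The Herbrand function $\varphi_{L/K}$ is given by $\varphi_{L/K}(j)=\bar e(L(r)/K(r))^{-1}\int_0^j|I_{L/K,x}|\,dx$.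 Its one-sided slopes are natural numbers divided by $\bar e(L(r)/K(r))$; at $0\in\mathbb Q^r$ the left one is, by definition, $[L(r):K(r)L(r-1)]\,\bar e(L(r)/K(r))^{-1}$. An edge point is a point where the left and right slopes differ, and $i(L/K)$, $j(L/K)$ are the first and the second coordinate of the last edge point of the graph of $\varphi_{L/K}$ (both are $0\in\mathbb Q^N$, by convention, if there is none). **Hypotheses.** Let $K\subset L$ be local fields with $L/K$ separable and $L(N-1)=K(N-1)$. Let $E$ be a finite extension of $L(N-1)$ with $[LE:L]=[E:L(N-1)]$ (given the next condition, this is automatic if $E/L(N-1)$ is separable, in particular in characteristic $0$), such that $E$ is a field of $(N-1)$-dimensional constants in $LE$ and $(LE,E)$ is standard. Let $\theta$ be an $N$-th local parameter of $LE$ with respect to $E$, let $F$ be the minimal polynomial of $\theta$ over $KE$, let $\theta_1,\dots,\theta_d\in\bar B$ be all its roots, and let $D(F)$ be its discriminant. **Proposition (Krasner's lemma).** Let $\alpha\in\bar B$ satisfy $v_K(F(\alpha))=A+(0,\dots,0,1)$ with $A\in\mathbb Q^N$, $A>0$. Then: 1. there are an index $1\le l_0\le d$ and a vector $a\ge 0$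 in $\mathbb Q^N$ such that $v_L(\alpha-\theta_{l_0})=a+(0,\dots,0,1)$ and $\varphi_{L/K}(a)=A$; 2. if $A>j(L/K)$, the index $l_0$ in 1. is unique. **Corollaries.** If $L\ne K$, then $i(L/K),j(L/K)\in\mathbb Q^N$ and $$v_L(F'(\theta))=(1,\dots,1,d)\,j(L/K)-i(L/K)+(0,\dots,0,d-1),$$ $$v_K(D(F))=(d,\dots,d,1)\,v_L(F'(\theta)),\qquad j(L/K)\le 2\,v_K(D(F)).$$ -/

import Mathlib

open Polynomial

noncomputable section

namespace HigherLocal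

/-! ## Lexicographically ordered rational vectors -/

/-- `ℚ ^ r` with the lexicographic order; the coordinate `0` dominates. -/
abbrev QLex (r : ℕ) : Type := Lex (Fin r → ℚ)

/-- Coordinatewise multiplication of a vector `x` by a vector `c`. -/
def scale {r : ℕ} (c : Fin r → ℚ) (x : QLex r) : QLex r :=
  toLex fun k => c k * ofLex x k

/-- The first `r` coordinates of a vector. -/
def trunc {N r : ℕ} (h : r ≤ N) (x : QLex N) : QLex r :=
  toLex fun k => ofLex x (Fin.castLE h k)

/-- The vector `(0, …, 0, x)`. -/
def lastVec (n : ℕ) (x : ℚ) : QLex (n + 1) := toLex (Pi.single (Fin.last n) x)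

/-- Multi-exponents: `ℤ ^ r` with the lexicographic order. -/
abbrev ZLex (r : ℕ) : Type := Lex (Fin r → ℤ)

/-! ## The two basic `N`-dimensional local fields, `N = n + 1` -/

/-- The data carried by a basic local field of dimension `n + 1`: a field, its `(n + 1)`-valuation,
and its subfields `B(i)` of `i`-dimensional constants.  Only the two explicit terms `basicZero`
and `basicPos` below are ever used. -/
structure BasicField (n : ℕ) where
  carrier : Type
  [field : Field carrier]
  val : carrier → WithTop (QLex (n + 1))
  const : ℕ → Subfield carrier

attribute [instance] BasicField.field

section CharP

variable (p n : ℕ) [Fact p.Prime]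

/-- `𝔽_p((t_N))…((t_1))`.  An iterated Laurent series is a Hahn series with exponents in
`ℤ ^ N`: the well-ordered subsets of `ℤ ^ N` are those for which the first exponent is bounded
below, the second one is bounded below by a function of the first, and so on.
The coordinate `k : Fin N` is the exponent of `t_{k+1}`. -/
abbrev LaurentField : Type := HahnSeries (ZLex (n + 1)) (ZMod p)

/-- The basic local field of characteristic `p`, with the valuation for which
`v(t_i)` is the `i`-th standard vector; `B(i)` consists of the series in `t_1, …, t_i` only. -/
def basicPos : BasicField n where
  carrier := LaurentField p n
  val := fun x : LaurentField p n => x.orderTop.map fun g : ZLex (n + 1) =>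
    (toLex fun k => (ofLex g k : ℚ) : QLex (n + 1))
  const i := Subfield.closure
    {x : LaurentField p n | ∀ g ∈ x.support, ∀ k : Fin (n + 1), i ≤ (k : ℕ) → ofLex g k = 0}

end CharP

section CharZero

variable (p n : ℕ) [Fact p.Prime]

/-- `ℤ_p((t_N))…((t_2))`; the coordinate `k : Fin n` is the exponent of `t_{k+2}`. -/
abbrev LaurentRing : Type := HahnSeries (ZLex n) ℤ_[p]

/-- The first valuation ring of `ℚ_p{{t_N}}…{{t_2}}`: the `p`-adic completion of
`ℤ_p((t_N))…((t_2))`. -/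
abbrev IntegerRing : Type :=
  AdicCompletion (Ideal.span {(p : LaurentRing p n)}) (LaurentRing p n)

variable {p n}

lemma dvd_of_coeff {u : LaurentRing p n} (h : ∀ g, (p : ℤ_[p]) ∣ u.coeff g) :
    (p : LaurentRing p n) ∣ u := by
  classical
  choose c hc using h
  have hp : (p : ℤ_[p]) ≠ 0 := by exact_mod_cast (Fact.out : p.Prime).ne_zero
  refine ⟨⟨c, u.isPWO_support.mono ?_⟩, ?_⟩
  · intro g hg hu
    apply hg
    have h1 := hc g
    rw [hu] at h1
    rcases mul_eq_zero.1 h1.symm with h2 | h2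
    · exact absurd h2 hp
    · exact h2
  · ext g
    rw [← nsmul_eq_mul, HahnSeries.coeff_nsmul]
    simp [hc g]

lemma coeff_of_dvd {u : LaurentRing p n} (h : (p : LaurentRing p n) ∣ u) (g : ZLex n) :
    (p : ℤ_[p]) ∣ u.coeff g := by
  obtain ⟨w, rfl⟩ := h
  rw [← nsmul_eq_mul, HahnSeries.coeff_nsmul]
  simp

/-- Modulo `p`, a series not divisible by `p` may be replaced by one whose leading coefficient is
prime to `p`. -/
lemma exists_unit_leading {u : LaurentRing p n} (h : ¬ (p : LaurentRing p n) ∣ u) :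
    ∃ w : LaurentRing p n, (p : LaurentRing p n) ∣ u - w ∧ ¬ (p : ℤ_[p]) ∣ w.leadingCoeff := by
  classical
  let w : LaurentRing p n :=
    ⟨fun g => if (p : ℤ_[p]) ∣ u.coeff g then 0 else u.coeff g, u.isPWO_support.mono (by
      intro g hg hu
      apply hg
      simp [hu])⟩
  have hw : ∀ g, w.coeff g = if (p : ℤ_[p]) ∣ u.coeff g then 0 else u.coeff g := fun g => rfl
  refine ⟨w, dvd_of_coeff fun g => ?_, ?_⟩
  · rw [HahnSeries.coeff_sub, hw]
    split_ifs with hg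
    · simpa using hg
    · simp
  · have hw0 : w ≠ 0 := by
      intro h0
      apply h
      apply dvd_of_coeff
      intro g
      by_contra hg
      have h1 := hw g
      rw [if_neg hg, h0] at h1
      apply hg
      rw [← h1]
      simp
    intro hd
    rw [HahnSeries.leadingCoeff_eq, hw] at hd
    have hne := HahnSeries.coeff_order_eq_zero.not.2 hw0
    rw [hw] at hne
    split_ifs at hd hne with hg
    · exact hne rfl
    · exact hg hd

lemma prime_p : Prime (p : LaurentRing p n) := by
  have hpz : Prime (p : ℤ_[p]) := PadicInt.prime_p
  refine ⟨?_, ?_, ?_⟩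
  · intro h
    have h1 : ((p : LaurentRing p n)).coeff 0 = (p : ℤ_[p]) := by
      rw [← nsmul_one, HahnSeries.coeff_nsmul]
      simp
    rw [h] at h1
    exact hpz.ne_zero h1.symm
  · intro h
    have h1 := coeff_of_dvd (isUnit_iff_dvd_one.1 h) 0
    rw [HahnSeries.coeff_one, if_pos rfl] at h1
    exact hpz.not_isUnit (isUnit_of_dvd_one h1)
  · intro a b hab
    by_contra hcon
    push Not at hcon
    obtain ⟨a', ha, hla⟩ := exists_unit_leading hcon.1
    obtain ⟨b', hb, hlb⟩ := exists_unit_leading hcon.2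
    have h1 : (p : LaurentRing p n) ∣ a' * b' := by
      have h2 : a' * b' = a * b - ((a - a') * b + a' * (b - b')) := by ring
      rw [h2]
      exact dvd_sub hab (dvd_add (ha.mul_right _) (hb.mul_left _))
    have h3 := coeff_of_dvd h1 (a'.order + b'.order)
    rw [HahnSeries.coeff_mul_order_add_order] at h3
    rcases hpz.dvd_or_dvd h3 with h4 | h4
    · exact hla h4
    · exact hlb h4

/-- A nonzero element of the completion is congruent to `p ^ a * u` modulo any high enough power
of `p`, where `u` is not divisible by `p`. -/
lemma exists_lead {x : IntegerRing p n} (hx : x ≠ 0) :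
    ∃ a : ℕ, ∀ m, a < m → ∃ u : LaurentRing p n, ¬ (p : LaurentRing p n) ∣ u ∧
      AdicCompletion.evalₐ _ m x = Ideal.Quotient.mk _ ((p : LaurentRing p n) ^ a * u) := by
  classical
  have hex : ∃ k, AdicCompletion.evalₐ (Ideal.span {(p : LaurentRing p n)}) k x ≠ 0 := by
    by_contra hcon
    push Not at hcon
    exact hx (AdicCompletion.ext_evalₐ fun k => by rw [hcon k, map_zero])
  have hk := Nat.find_spec hex
  have hmin : ∀ j, j < Nat.find hex → _ := fun j hj => not_not.1 (Nat.find_min hex hj)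
  set k := Nat.find hex with hkdef
  have hk0 : k ≠ 0 := by
    intro h0
    apply hk
    obtain ⟨r, hr⟩ := Ideal.Quotient.mk_surjective
      (AdicCompletion.evalₐ (Ideal.span {(p : LaurentRing p n)}) k x)
    rw [← hr, Ideal.Quotient.eq_zero_iff_mem, h0]
    simp
  have key : ∀ m j, j ≤ m → ∀ r : LaurentRing p n,
      AdicCompletion.evalₐ (Ideal.span {(p : LaurentRing p n)}) m x = Ideal.Quotient.mk _ r →
      AdicCompletion.evalₐ (Ideal.span {(p : LaurentRing p n)}) j x = Ideal.Quotient.mk _ r := by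
    intro m j hj r hr
    obtain ⟨s, rfl⟩ := AdicCompletion.mk_surjective _ _ x
    rw [AdicCompletion.evalₐ_mk, Ideal.Quotient.eq] at hr ⊢
    have h1 := Ideal.pow_le_pow_right hj hr
    have h2 := (Ideal.Quotient.eq).1 (AdicCompletion.Ideal.mk_eq_mk _ hj s)
    have h3 : s.val j - r = s.val m - r - (s.val m - s.val j) := by ring
    rw [h3]
    exact Ideal.sub_mem _ h1 h2
  refine ⟨k - 1, fun m hm => ?_⟩
  obtain ⟨r, hr⟩ := Ideal.Quotient.mk_surjective
    (AdicCompletion.evalₐ (Ideal.span {(p : LaurentRing p n)}) m x)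
  have h1 := key m (k - 1) (by omega) r hr.symm
  rw [hmin (k - 1) (by omega), eq_comm, Ideal.Quotient.eq_zero_iff_mem, Ideal.span_singleton_pow,
    Ideal.mem_span_singleton] at h1
  obtain ⟨u, rfl⟩ := h1
  refine ⟨u, ?_, hr.symm⟩
  rintro ⟨w, rfl⟩
  apply hk
  rw [key m k (by omega) _ hr.symm, Ideal.Quotient.eq_zero_iff_mem, Ideal.span_singleton_pow,
    Ideal.mem_span_singleton]
  refine ⟨w, ?_⟩
  rw [← mul_assoc, ← pow_succ]
  congr 2
  omega

instance : NoZeroDivisors (IntegerRing p n) where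
  eq_zero_or_eq_zero_of_mul_eq_zero := by
    intro x y hxy
    by_contra hcon
    push Not at hcon
    obtain ⟨a, ha⟩ := exists_lead hcon.1
    obtain ⟨b, hb⟩ := exists_lead hcon.2
    obtain ⟨u, hu, hxu⟩ := ha (a + b + 1) (by omega)
    obtain ⟨w, hw, hyw⟩ := hb (a + b + 1) (by omega)
    have h1 : AdicCompletion.evalₐ (Ideal.span {(p : LaurentRing p n)}) (a + b + 1) (x * y) = 0 := by
      rw [hxy, map_zero]
    rw [map_mul, hxu, hyw, ← map_mul, Ideal.Quotient.eq_zero_iff_mem, Ideal.span_singleton_pow,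
      Ideal.mem_span_singleton] at h1
    have h2 : (p : LaurentRing p n) ^ a * u * ((p : LaurentRing p n) ^ b * w)
        = (p : LaurentRing p n) ^ (a + b) * (u * w) := by ring
    rw [h2, pow_succ] at h1
    have h3 := (mul_dvd_mul_iff_left (pow_ne_zero _ prime_p.ne_zero)).1 h1
    rcases prime_p.dvd_or_dvd h3 with h4 | h4
    · exact hu h4
    · exact hw h4

instance : Nontrivial (IntegerRing p n) := by
  refine ⟨⟨0, 1, fun h => ?_⟩⟩
  have h1 := congrArg (AdicCompletion.evalₐ (Ideal.span {(p : LaurentRing p n)}) 1) h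
  rw [map_zero, map_one, eq_comm, ← map_one (Ideal.Quotient.mk _), Ideal.Quotient.eq_zero_iff_mem,
    pow_one, Ideal.mem_span_singleton] at h1
  exact prime_p.not_isUnit (isUnit_of_dvd_one h1)

instance : IsDomain (IntegerRing p n) := NoZeroDivisors.to_isDomain _

variable (p n)

/-- `ℚ_p{{t_N}}…{{t_2}}`. -/
abbrev MixedField : Type := FractionRing (IntegerRing p n)

variable {p n}

/-- `x = p ^ m * (r + p * z)`, where `r` is a series in `t_2, …, t_N` with lowest exponent `g` and
with leading coefficient prime to `p`, and `z` belongs to the first valuation ring: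
the valuation of `x` is then `(m, g)`. -/
def HasValue (x : MixedField p n) (m : ℤ) (g : ZLex n) : Prop :=
  ∃ (r : LaurentRing p n) (z : IntegerRing p n), r.order = g ∧ IsUnit r.leadingCoeff ∧
    x = (p : MixedField p n) ^ m *
      algebraMap (IntegerRing p n) (MixedField p n)
        (algebraMap (LaurentRing p n) (IntegerRing p n) r + (p : IntegerRing p n) * z)

variable (p n)

open Classical in
/-- The basic local field of characteristic `0`, with the valuation for which `v(p)`, `v(t_2)`, …,
`v(t_N)` are the standard vectors; `B(i)` is generated by the `p`-adic limits of series
in `t_2, …, t_i` only (so that `B(0) = B(1) = ℚ_p`). -/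
def basicZero : BasicField n where
  carrier := MixedField p n
  val x := if h : ∃ mg : ℤ × ZLex n, HasValue x mg.1 mg.2 then
      ((toLex (Fin.cons (h.choose.1 : ℚ) fun k => ((ofLex h.choose.2 k : ℤ) : ℚ)) :
        QLex (n + 1)) : WithTop (QLex (n + 1)))
    else ⊤
  const i := Subfield.closure (algebraMap (IntegerRing p n) (MixedField p n) ''
    {x | ∀ m : ℕ, ∃ r : LaurentRing p n,
      (∀ g ∈ r.support, ∀ k : Fin n, i ≤ (k : ℕ) + 1 → ofLex g k = 0) ∧
      AdicCompletion.evalₐ _ m x = Ideal.Quotient.mk _ r})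

end CharZero

/-- The two possible characteristics of a local field of residue characteristic `p`. -/
inductive CharKind
  | zero
  | pos

/-- The basic local field of the given characteristic. -/
def basicField (p n : ℕ) [Fact p.Prime] : CharKind → BasicField n
  | CharKind.zero => basicZero p n
  | CharKind.pos => basicPos p n

/-! ## Local fields with `F`-structure -/

variable (p : ℕ) {n : ℕ} (B : BasicField n)

/-- The algebraic closure of the basic field. -/
abbrev BasicField.Closure : Type := AlgebraicClosure B.carrier

namespace BasicField

variable {B}

/-- The basic field as a subfield of its algebraic closure. -/
def base (B : BasicField n) : Subfield B.Closure := (algebraMap B.carrier B.Closure).fieldRange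

/-- A local field with `F`-structure: a finite extension of the basic field inside the
algebraic closure. -/
structure IsLF (K : Subfield B.Closure) : Prop where
  base_le : B.base ≤ K
  finite : B.base.relfinrank K ≠ 0

/-- The subfield `K(i)` of `i`-dimensional constants, `0 ≤ i ≤ n + 1`.  For `i ≥ 1` it consists of
the elements of `K` which are algebraic over `B(i)`.  The field `K(0)` is the maximal
unramified extension of `ℚ_p` (of `𝔽_p`, in characteristic `p`) in `K`: the maximal unramified
extension is generated by the roots of unity of order prime to `p`. -/
def constants (K : Subfield B.Closure) (i : ℕ) : Subfield B.Closure :=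
  K ⊓ (if i = 0 then
      (B.const 0).map (algebraMap B.carrier B.Closure) ⊔
        Subfield.closure {z | ∃ m : ℕ, 0 < m ∧ ¬ p ∣ m ∧ z ^ m = 1}
    else
      (algebraicClosure ((B.const i).map (algebraMap B.carrier B.Closure)) B.Closure).toSubfield)

/-- The unique extension of the valuation of the basic field to its algebraic closure:
`1 / d` times the valuation of the norm, where `d` is the degree of `x`. -/
def valBar (x : B.Closure) : WithTop (QLex (n + 1)) :=
  (B.val ((minpoly B.carrier x).coeff 0)).map
    (scale fun _ => (((minpoly B.carrier x).natDegree : ℚ))⁻¹)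

/-- The component with number `k` (counted from `0`) of the vector ramification index of `L / K`:
`[L(k+1) : K(k+1)] / [L(k) : K(k)]`. -/
def ramIndex (K L : Subfield B.Closure) (k : ℕ) : ℚ :=
  ((constants p K (k + 1)).relfinrank (constants p L (k + 1)) : ℚ) /
    ((constants p K k).relfinrank (constants p L k) : ℚ)

/-- The canonical valuation `v_L`, on the whole algebraic closure: the valuation extending that of
the basic field, renormalised by the vector ramification index of `L` over the basic field.
If `L` has a standard `F`-structure with local parameters `t_1, …, t_N` then `v_L(t_i)` is the
`i`-th standard vector, and `v_K` is `v_L` divided by the ramification index of `L / K`. -/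
def canonVal (L : Subfield B.Closure) (x : B.Closure) : WithTop (QLex (n + 1)) :=
  (valBar x).map (scale fun k => ramIndex p B.base L k)

/-! ### Local parameters and standard pairs -/

/-- `t ∈ M`, and the image of `t` in the `k`-th iterated residue field of `M` is a uniformiser of
the first valuation of that residue field.  (The elements of the `k`-th iterated residue field
come from the elements of `M` with vanishing valuations number `0, …, k - 1`, and the first
valuation of this field is the coordinate `k` of the valuation of `M`.) -/
def IsUniformizerAt (M : Subfield B.Closure) (k : Fin (n + 1)) (t : B.Closure) : Prop :=
  t ∈ M ∧ ∃ g : QLex (n + 1), valBar t = g ∧ (∀ l < k, ofLex g l = 0) ∧ 0 < ofLex g k ∧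
    ∀ x ∈ M, ∀ h : QLex (n + 1), valBar x = h → (∀ l < k, ofLex h l = 0) →
      ∃ z : ℤ, ofLex h k = z * ofLex g k

/-- `t_1, …, t_r` is a system of local parameters of the `r`-dimensional local field `M`. -/
def IsLocalParams (M : Subfield B.Closure) (r : ℕ) (t : Fin r → B.Closure) : Prop :=
  ∀ (k : Fin (n + 1)) (hk : (k : ℕ) < r), IsUniformizerAt M k (t ⟨k, hk⟩)

/-- `(M, E)` is a local field `M` of dimension `r + 1` together with a field `E` of `r`-dimensional
constants, for a finite extension `E` of a field `L(r)`: the field `E` is algebraically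
closed in `M` or, if `r = 0`, it is the maximal unramified subfield of `M`. -/
def IsLC (r : ℕ) (M E : Subfield B.Closure) : Prop := E = constants p M r

/-- `(M, E)` is a pair as above, it is standard, and `θ` is an `(r+1)`-th local parameter of `M` with
respect to `E`: adding `θ` to a system of local parameters of `E` gives a system of local parameters
of `M`. -/
def IsLastParam (r : ℕ) (M E : Subfield B.Closure) (θ : B.Closure) : Prop :=
  IsLC p r M E ∧ ∃ t : Fin r → B.Closure, IsLocalParams E r t ∧
    IsLocalParams M (r + 1) (Fin.snoc t θ : Fin (r + 1) → B.Closure)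

/-- The valuation ring `𝒪_M` of the higher valuation. -/
def integers (M : Subfield B.Closure) : Set B.Closure := {x | x ∈ M ∧ 0 ≤ valBar x}

/-! ### Ramification filtration and Herbrand function -/

/-- The set of indices is the part `0 ≤ j` of the disjoint union of the `ℚ ^ r`, `1 ≤ r ≤ N`, where
the elements with larger `r` are larger.  The number `r : Fin (n + 1)` stands for the
dimension `r + 1`. -/
abbrev RamIdx (n : ℕ) : Type := Σₗ r : Fin (n + 1), QLex ((r : ℕ) + 1)

/-- An element of `ℚ ^ N` as an index. -/
def topIdx (x : QLex (n + 1)) : RamIdx n := toLex ⟨Fin.last n, x⟩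

/-- The auxiliary choice in the ramification filtration of `L / K` in dimension `r + 1`: a finite
extension `E` of `L(r)` such that `(L(r+1)E, E)` is standard, and a last local
parameter `θ`, which generates the valuation ring of `L(r+1)E` over that of `K(r+1)E`. -/
structure IsRamDatum (K L : Subfield B.Closure) (r : ℕ) (E : Subfield B.Closure)
    (θ : B.Closure) : Prop where
  le : constants p L r ≤ E
  finite : (constants p L r).relfinrank E ≠ 0
  param : IsLastParam p r (constants p L (r + 1) ⊔ E) E θ
  generates : integers (constants p L (r + 1) ⊔ E) =
    (Subring.closure (integers (constants p K (r + 1) ⊔ E) ∪ {θ}) : Set B.Closure)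

/-- The set `I_{L/K,j}`, for `j` in dimension `r + 1`.  Its elements are the embeddings `τ` of
`L(r+1)` over `K(r+1)` whose extension `σ` to `L(r+1)E`, the identity on `K(r+1)E`, satisfies
`v_L(σ θ - θ) ≥ v_L(θ) + j`. -/
def lowerRam (K L : Subfield B.Closure) (r : Fin (n + 1)) (j : QLex ((r : ℕ) + 1)) :
    Set (↥(constants p L ((r : ℕ) + 1)) →+* B.Closure) :=
  {τ | ∃ (E : Subfield B.Closure) (θ : B.Closure), IsRamDatum p K L r E θ ∧
    ∃ σ : B.Closure ≃ₐ[↥(constants p K ((r : ℕ) + 1) ⊔ E)] B.Closure,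
      (∀ x : ↥(constants p L ((r : ℕ) + 1)), σ (x : B.Closure) = τ x) ∧
      (canonVal p L θ).map (trunc r.2) + j ≤ (canonVal p L (σ θ - θ)).map (trunc r.2)}

/-- `I` is the integral over `[0, b]` of the step function `f` with values in `ℕ`. -/
def IsStepIntegral {r : ℕ} (f : QLex r → ℕ) (b I : QLex r) : Prop :=
  ∃ (m : ℕ) (x : ℕ → QLex r) (c : ℕ → ℕ), x 0 = 0 ∧ x m = b ∧
    (∀ k < m, x k < x (k + 1) ∧ ∀ y, x k < y → y < x (k + 1) → f y = c k) ∧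
    I = ∑ k ∈ Finset.range m, c k • (x (k + 1) - x k)

open Classical in
/-- The integral over `[0, b]` of a step function with values in `ℕ`. -/
def stepIntegral {r : ℕ} (f : QLex r → ℕ) (b : QLex r) : QLex r :=
  if h : ∃ I, IsStepIntegral f b I then h.choose else 0

/-- The inverse of the vector ramification index of `L(r+1) / K(r+1)`. -/
def ramIndexInv (K L : Subfield B.Closure) (r : Fin (n + 1)) : Fin ((r : ℕ) + 1) → ℚ :=
  fun k => (ramIndex p K L k)⁻¹

/-- The Herbrand function in dimension `r + 1`. -/
def herbrandAt (K L : Subfield B.Closure) (r : Fin (n + 1)) (j : QLex ((r : ℕ) + 1)) :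
    QLex ((r : ℕ) + 1) :=
  scale (ramIndexInv p K L r) (stepIntegral (fun y => (lowerRam p K L r y).ncard) j)

/-- The Herbrand function `φ_{L/K}`. -/
def herbrand (K L : Subfield B.Closure) (j : RamIdx n) : RamIdx n :=
  toLex ⟨(ofLex j).1, herbrandAt p K L (ofLex j).1 (ofLex j).2⟩

/-- The slope of the Herbrand function to the right of `j` is `g` divided by the vector ramification
index. -/
def HasRightSlope (K L : Subfield B.Closure) (r : Fin (n + 1)) (j : QLex ((r : ℕ) + 1))
    (g : ℕ) : Prop :=
  ∃ y, j < y ∧ ∀ x, j ≤ x → x ≤ y → herbrandAt p K L r x =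
    herbrandAt p K L r j + scale (fun k => (g : ℚ) * ramIndexInv p K L r k) (x - j)

/-- The slope of the Herbrand function to the left of `j` is `g` divided by the vector ramification
index; at `j = 0` one takes `g = [L(r+1) : K(r+1)L(r)]` by definition. -/
def HasLeftSlope (K L : Subfield B.Closure) (r : Fin (n + 1)) (j : QLex ((r : ℕ) + 1))
    (g : ℕ) : Prop :=
  (j = 0 ∧ g = (constants p K ((r : ℕ) + 1) ⊔ constants p L r).relfinrank
    (constants p L ((r : ℕ) + 1))) ∨
  (0 < j ∧ ∃ y, 0 ≤ y ∧ y < j ∧ ∀ x, y ≤ x → x ≤ j → herbrandAt p K L r j =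
    herbrandAt p K L r x + scale (fun k => (g : ℚ) * ramIndexInv p K L r k) (j - x))

/-- The edge points of the graph of the Herbrand function: the left and the right slopes differ. -/
def IsEdge (K L : Subfield B.Closure) (j : RamIdx n) : Prop :=
  0 ≤ (ofLex j).2 ∧ ∃ g g', HasLeftSlope p K L (ofLex j).1 (ofLex j).2 g ∧
    HasRightSlope p K L (ofLex j).1 (ofLex j).2 g' ∧ g ≠ g'

open Classical in
/-- `i(L/K)`: the first coordinate of the last edge point (the zero vector of `ℚ ^ N`, by convention,
if there is no last edge point). -/
def lastLower (K L : Subfield B.Closure) : RamIdx n :=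
  if h : ∃ j, IsGreatest {j | IsEdge p K L j} j then h.choose else topIdx 0

/-- `j(L/K)`: the second coordinate of the last edge point. -/
def lastUpper (K L : Subfield B.Closure) : RamIdx n := herbrand p K L (lastLower p K L)

end BasicField

end HigherLocal

end

/-!
# Krasner's lemma for higher local fields

**Valuations.**  Both basic fields are valued by lexicographically ordered integral vectors, have a
prime residue field, and are spherically complete together with their subfields `B(i)`: any family
of pairwise compatible balls has a common point (`Good`, `good_basic`).  Spherical completeness
replaces completeness throughout.  It gives best approximations and hence orthogonal bases of finite
extensions (`exists_isOrth_span`), it passes to finite extensions, it gives Newton approximation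
(`IsSC.exists_root`), and with it the uniqueness of the extension of the valuation to the algebraic
closure (`extension_unique`).  Newton approximation also lifts the residue of a unit of a local
field to a root of unity of order prime to `p`, which is a constant
(`GoodBar.exists_residue_lift`).

**Standard pairs.**  Let `θ` be a last local parameter of `M` with respect to `E`.  Every nonzero
element of `M` is then approximated by an element `e * θ ^ z` with `e ∈ E`.  Therefore the powers of
`θ` up to some exponent form an orthogonal basis of `M` over each local field between `E` and `M`
(`StdPair.exists_power_basis`); in particular `θ` generates `M` and its valuation ring.
Moreover families of constants that are orthogonal over `E` remain orthogonal over `M`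
(`StdPair.transfer`), so that finite extensions of constants are linearly disjoint from `M` over
`E`.

**The ramification filtration.**  In terms of orthogonal bases, an automorphism moves all elements
of `M` by `γ` at least, relative to their values, as soon as it moves `θ` by `γ` at least
(`StdPair.isDisp`), even after an extension of the constants.  So the set `I_{L/K,j}`
does not depend on the auxiliary field of constants and on the parameter
(`StdDatum.exists_of_ramDatum`), and its cardinality is the number of the roots `θ_l` for which
`i_l = v_L(θ_l - θ) - v_L(θ)` is at least `j` (`StdDatum.ncard_lowerRam`).  The Herbrand function
is therefore, up to normalisation, the sum `∑ l, min (i_l, a)` (`stepIntegral_eq_capSum`), and its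
last edge point is the largest finite `i_l` (`RootData.isGreatest_edge`).

**Conclusion.**  If `θ_m` is the root closest to `α`, then `v_L(α - θ_l)` is the minimum of
`v_L(α - θ_m)` and `v_L(θ_l - θ_m)`.  As the conjugates of `θ` are permuted by automorphisms that
preserve the valuation, the value of `F(α)` is the above sum at `a = v_L(α - θ_m) - v_L(θ)`, which
is Krasner's lemma (`RootData.exists_root`).  The difference of two such roots would have a value of
`a + v_L(θ)` at least, whence `a` is not beyond the last edge point (`RootData.root_unique`).  At the last edge
point the sum is that of all finite `i_l` plus the largest of them, and the former is the value of
`F'(θ)` up to a multiple of `v_L(θ)` (`RootData.last_formulas`); the discriminant is the product of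
the values of `F'` at all roots, up to sign (`exists_discr_eq_prod`).
-/

namespace HigherLocal

open BasicField

/-! ### Spherical completeness and orthogonal families -/

section Norms

variable {Δ : Type*} [LinearOrderedAddCommGroupWithTop Δ]

lemma sub_le_iff_of_ne_top {a b c : Δ} (h : b ≠ ⊤) : a - b ≤ c ↔ a ≤ c + b := by
  rw [← add_le_add_iff_left_of_ne_top h, sub_eq_add_neg,
    LinearOrderedAddCommGroupWithTop.neg_add_cancel_right_of_ne_top h]

/-- `N` is an additively written non-archimedean norm on the `k`-vector space `E`, compatible with
the valuation `v` of `k`. -/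
structure IsNorm {k E : Type*} [Field k] [AddCommGroup E] [Module k E] (v : AddValuation k Δ)
    (N : E → Δ) : Prop where
  top_iff : ∀ x, N x = ⊤ ↔ x = 0
  min_le : ∀ x y, min (N x) (N y) ≤ N (x + y)
  smul : ∀ (a : k) (x : E), N (a • x) = v a + N x

/-- `S` is spherically complete: a family of balls with centres in `S`, each two of which are
compatible, has a common point in `S`.  A ball is encoded by its centre and its radius. -/
def IsSC {E : Type*} [AddCommGroup E] (N : E → Δ) (S : Set E) : Prop :=
  ∀ 𝓑 : Set (E × Δ), (∀ b ∈ 𝓑, b.1 ∈ S) → (∀ b ∈ 𝓑, ∀ b' ∈ 𝓑, min b.2 b'.2 ≤ N (b.1 - b'.1)) →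
    ∃ c ∈ S, ∀ b ∈ 𝓑, b.2 ≤ N (c - b.1)

/-- An orthogonal family: the norm of a linear combination is the minimum of the norms of its
terms. -/
def IsOrth (k : Type*) {E ι : Type*} [Field k] [AddCommGroup E] [Module k E] [Fintype ι]
    (N : E → Δ) (ω : ι → E) : Prop :=
  (∀ i, ω i ≠ 0) ∧ ∀ (a : ι → k) (i : ι), N (∑ j, a j • ω j) ≤ N (a i • ω i)

section

variable {k E ι : Type*} [Field k] [AddCommGroup E] [Module k E] {v : AddValuation k Δ}
  {N : E → Δ}

namespace IsNorm

lemma map_zero (h : IsNorm v N) : N 0 = ⊤ := (h.top_iff 0).2 rfl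

lemma map_neg (h : IsNorm v N) (x : E) : N (-x) = N x := by
  have := h.smul (-1) x
  simpa using this

lemma min_le_sub (h : IsNorm v N) (x y : E) : min (N x) (N y) ≤ N (x - y) := by
  have := h.min_le x (-y)
  rwa [h.map_neg, ← sub_eq_add_neg] at this

lemma le_add (h : IsNorm v N) {x y : E} {g : Δ} (hx : g ≤ N x) (hy : g ≤ N y) : g ≤ N (x + y) :=
  (le_min hx hy).trans (h.min_le x y)

lemma le_sub (h : IsNorm v N) {x y : E} {g : Δ} (hx : g ≤ N x) (hy : g ≤ N y) : g ≤ N (x - y) :=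
  (le_min hx hy).trans (h.min_le_sub x y)

lemma lt_add (h : IsNorm v N) {x y : E} {g : Δ} (hx : g < N x) (hy : g < N y) : g < N (x + y) :=
  (lt_min hx hy).trans_le (h.min_le x y)

lemma le_sum (h : IsNorm v N) {s : Finset ι} {f : ι → E} {g : Δ} (hf : ∀ i ∈ s, g ≤ N (f i)) :
    g ≤ N (∑ i ∈ s, f i) := by
  classical
  induction s using Finset.induction_on with
  | empty => simp [h.map_zero]
  | insert a s ha ih =>
    rw [Finset.sum_insert ha]
    exact h.le_add (hf a (by simp)) (ih fun i hi => hf i (by simp [hi]))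

lemma lt_sum (h : IsNorm v N) {s : Finset ι} {f : ι → E} {g : Δ} (hg : g ≠ ⊤)
    (hf : ∀ i ∈ s, g < N (f i)) : g < N (∑ i ∈ s, f i) := by
  classical
  induction s using Finset.induction_on with
  | empty => simpa [h.map_zero] using hg.lt_top
  | insert a s ha ih =>
    rw [Finset.sum_insert ha]
    exact h.lt_add (hf a (by simp)) (ih fun i hi => hf i (by simp [hi]))

end IsNorm

/-- Best approximation by the elements of a spherically complete subgroup. -/
lemma IsSC.exists_best (h : IsNorm v N) {S : Set E} (hS : IsSC N S) (x : E) :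
    ∃ y ∈ S, ∀ z ∈ S, N (x - z) ≤ N (x - y) := by
  obtain ⟨c, hc, hb⟩ := hS {b | b.1 ∈ S ∧ b.2 = N (x - b.1)} (fun b hb => hb.1) (by
    rintro ⟨b, r⟩ ⟨hb, hr⟩ ⟨b', r'⟩ ⟨hb', hr'⟩
    dsimp only at hb hr hb' hr' ⊢
    subst hr hr'
    have := h.min_le_sub (x - b') (x - b)
    simpa [min_comm] using this)
  refine ⟨c, hc, fun z hz => ?_⟩
  have h1 := hb (z, N (x - z)) ⟨hz, rfl⟩
  have h2 := h.le_sub (x := x - z) (y := c - z) le_rfl h1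
  simpa using h2

/-- If every nonzero element of `S` can be approximated by the subgroup `V ⊆ S`, and `V` is
spherically complete, then `S = V`. -/
lemma IsSC.mem_of_approx (h : IsNorm v N) {V : AddSubgroup E} (hV : IsSC N (V : Set E))
    {S : AddSubgroup E} (hVS : V ≤ S) (happ : ∀ x ∈ S, x ≠ 0 → ∃ y ∈ V, N x < N (x - y))
    {x : E} (hx : x ∈ S) : x ∈ V := by
  obtain ⟨y, hy, hb⟩ := hV.exists_best h x
  by_contra hxV
  have hne : x - y ≠ 0 := fun h0 => hxV (by rw [sub_eq_zero.1 h0]; exact hy)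
  obtain ⟨z, hz, hlt⟩ := happ (x - y) (S.sub_mem hx (hVS hy)) hne
  have := hb (y + z) (V.add_mem hy hz)
  rw [← sub_sub] at this
  exact absurd hlt this.not_gt

/-- Newton approximation in a spherically complete set: `f` has a zero in `T` if it is isometric on
`T` and each nonzero value of `f` on `T` can be improved. -/
lemma IsSC.exists_root (h : IsNorm v N) {M : Set E} (hM : IsSC N M) {T : Set E} (hTM : T ⊆ M)
    (hT : T.Nonempty) (f : E → E)
    (hiso : ∀ x ∈ T, ∀ y ∈ T, N (f x - f y) = N (x - y))
    (hclosed : ∀ c ∈ M, ∀ x ∈ T, N (f x) ≤ N (c - x) → c ∈ T)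
    (himp : ∀ c ∈ T, f c ≠ 0 → ∃ c' ∈ T, N (f c) < N (f c')) : ∃ c ∈ T, f c = 0 := by
  obtain ⟨x₀, hx₀⟩ := hT
  obtain ⟨c, hc, hb⟩ := hM {b | b.1 ∈ T ∧ b.2 = N (f b.1)} (fun b hb => hTM hb.1) (by
    rintro ⟨b, r⟩ ⟨hb, hr⟩ ⟨b', r'⟩ ⟨hb', hr'⟩
    dsimp only at hb hr hb' hr' ⊢
    subst hr hr'
    rw [← hiso b hb b' hb']
    exact h.min_le_sub _ _)
  have hcT : c ∈ T := hclosed c hc x₀ hx₀ (hb (x₀, N (f x₀)) ⟨hx₀, rfl⟩)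
  refine ⟨c, hcT, ?_⟩
  by_contra hne
  obtain ⟨c', hc', hlt⟩ := himp c hcT hne
  have h1 := hb (c', N (f c')) ⟨hc', rfl⟩
  have h2 : N (f c') ≤ N (f c - f c') := by
    rw [hiso c hcT c' hc']
    exact h1
  have h3 := h.le_add h2 le_rfl
  rw [sub_add_cancel] at h3
  exact absurd hlt h3.not_gt

variable [Fintype ι]

lemma IsOrth.linearIndependent (h : IsNorm v N) {ω : ι → E} (hω : IsOrth k N ω) :
    LinearIndependent k ω := by
  rw [Fintype.linearIndependent_iff]
  intro a ha i
  have h1 := hω.2 a i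
  rw [ha, h.map_zero, top_le_iff, h.top_iff] at h1
  exact (smul_eq_zero.1 h1).resolve_right (hω.1 i)

/-- The span of an orthogonal family over a spherically complete field is spherically complete:
balls have a common point if their coordinates have. -/
lemma IsOrth.isSC_span (h : IsNorm v N) (hk : IsSC v (Set.univ : Set k)) {ω : ι → E}
    (hω : IsOrth k N ω) : IsSC N (Submodule.span k (Set.range ω) : Set E) := by
  intro 𝓑 h𝓑 hc
  have hmem : ∀ b ∈ 𝓑, ∃ a : ι → k, ∑ i, a i • ω i = b.1 := fun b hb =>
    (Submodule.mem_span_range_iff_exists_fun k).1 (h𝓑 b hb)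
  choose! a ha using hmem
  have hne : ∀ i, N (ω i) ≠ ⊤ := fun i => (h.top_iff _).not.2 (hω.1 i)
  -- in each coordinate, the balls have radii shifted by the norm of the basis vector
  have key : ∀ i, ∃ c : k, ∀ b ∈ 𝓑, b.2 - N (ω i) ≤ v (c - a b i) := by
    intro i
    obtain ⟨c, -, hc⟩ := hk {q | ∃ b ∈ 𝓑, q = (a b i, b.2 - N (ω i))} (fun _ _ => trivial) (by
      rintro _ ⟨b, hb, rfl⟩ _ ⟨b', hb', rfl⟩
      have h1 := hc b hb b' hb'
      have h2 := hω.2 (fun j => a b j - a b' j) i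
      simp only [sub_smul, Finset.sum_sub_distrib, ha b hb, ha b' hb'] at h2
      rw [← sub_smul, h.smul] at h2
      have h3 := h1.trans h2
      rcases min_le_iff.1 h3 with h4 | h4
      · exact (min_le_left _ _).trans ((sub_le_iff_of_ne_top (hne i)).2 h4)
      · exact (min_le_right _ _).trans ((sub_le_iff_of_ne_top (hne i)).2 h4))
    exact ⟨c, fun b hb => hc _ ⟨b, hb, rfl⟩⟩
  choose c hc using key
  refine ⟨∑ i, c i • ω i, (Submodule.mem_span_range_iff_exists_fun k).2 ⟨c, rfl⟩, fun b hb => ?_⟩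
  rw [← ha b hb, ← Finset.sum_sub_distrib]
  refine h.le_sum fun i _ => ?_
  rw [← sub_smul, h.smul]
  exact (sub_le_iff_of_ne_top (hne i)).1 (hc i b hb)

/-- Over a spherically complete field every finite-dimensional normed space has an orthogonal
basis. -/
lemma exists_isOrth_span (h : IsNorm v N) (hk : IsSC v (Set.univ : Set k)) (V : Submodule k E)
    (hV : V.FG) : ∃ (m : ℕ) (ω : Fin m → E), IsOrth k N ω ∧ Submodule.span k (Set.range ω) = V := by
  classical
  obtain ⟨s, rfl⟩ := hV
  induction s using Finset.induction_on with
  | empty => exact ⟨0, Fin.elim0, ⟨fun i => i.elim0, fun a i => i.elim0⟩,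
      by simp [Set.range_eq_empty]⟩
  | insert x s hxs ih =>
    obtain ⟨m, ω, hω, hspan⟩ := ih
    -- replacing `x` by its difference to a best approximation makes it orthogonal to the span
    obtain ⟨y, hy, hbest⟩ := (hω.isSC_span h hk).exists_best h x
    rw [hspan] at hy hbest
    rw [Finset.coe_insert]
    by_cases hx : x - y = 0
    · refine ⟨m, ω, hω, ?_⟩
      rw [hspan, eq_comm, Submodule.span_insert_eq_span]
      rw [sub_eq_zero.1 hx]
      exact hy
    · refine ⟨m + 1, Fin.cons (x - y) ω, ⟨fun i => ?_, fun a i => ?_⟩, ?_⟩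
      · refine Fin.cases ?_ (fun i => ?_) i
        · simpa using hx
        · simpa using hω.1 i
      · rw [Fin.sum_univ_succ]
        simp only [Fin.cons_zero, Fin.cons_succ]
        set z := ∑ i : Fin m, a i.succ • ω i with hz
        have hzs : z ∈ Submodule.span k (s : Set E) := by
          rw [← hspan]
          exact Submodule.sum_mem _ fun i _ =>
            Submodule.smul_mem _ _ (Submodule.subset_span ⟨i, rfl⟩)
        have h0 : N (a 0 • (x - y) + z) ≤ N (a 0 • (x - y)) := by
          by_cases ha : a 0 = 0
          · simp [ha, h.map_zero]
          · have h1 := hbest (y - (a 0)⁻¹ • z)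
              (Submodule.sub_mem _ hy (Submodule.smul_mem _ _ hzs))
            have h2 : a 0 • (x - y) + z = a 0 • (x - (y - (a 0)⁻¹ • z)) := by
              rw [sub_sub_eq_add_sub, add_sub_right_comm, smul_add, smul_inv_smul₀ ha]
            rw [h2, h.smul, h.smul]
            gcongr
        have h1 : N (a 0 • (x - y) + z) ≤ N z := by
          have := h.le_sub le_rfl h0
          simpa using this
        refine Fin.cases ?_ (fun i => ?_) i
        · simpa using h0
        · simpa using h1.trans (hω.2 (fun i => a i.succ) i)
      · rw [Fin.range_cons, Submodule.span_insert, Submodule.span_insert, hspan]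
        apply le_antisymm
        · refine sup_le ?_ le_sup_right
          rw [Submodule.span_singleton_le_iff_mem]
          exact Submodule.sub_mem _ (Submodule.mem_sup_left (Submodule.mem_span_singleton_self x))
            (Submodule.mem_sup_right hy)
        · refine sup_le ?_ le_sup_right
          rw [Submodule.span_singleton_le_iff_mem]
          have : x = (x - y) + y := by simp
          rw [this]
          exact Submodule.add_mem _ (Submodule.mem_sup_left (by
            simp)) (Submodule.mem_sup_right hy)

end

end Norms

/-! ### Extension of valuations to algebraic extensions -/

/-- The value group of an algebraic extension is torsion over that of the base field. -/
lemma exists_pow_value_eq {k Ω Γ₀ : Type*} [Field k] [Field Ω] [Algebra k Ω]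
    [LinearOrderedCommGroupWithZero Γ₀] (W : Valuation Ω Γ₀) {x : Ω} (hx : x ≠ 0)
    (hal : IsAlgebraic k x) :
    ∃ m : ℕ, 0 < m ∧ ∃ a : k, a ≠ 0 ∧ W (x ^ m) = W (algebraMap k Ω a) := by
  classical
  obtain ⟨q, hq, hqx⟩ := hal
  rw [aeval_eq_sum_range, ← Finset.sum_filter_of_ne (p := fun i => q.coeff i ≠ 0)
    (by intro i _ h h0; exact h (by simp [h0]))] at hqx
  set s := (Finset.range (q.natDegree + 1)).filter fun i => q.coeff i ≠ 0 with hs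
  have hne : s.Nonempty := ⟨q.natDegree, by simp [hs, hq]⟩
  have hterm : ∀ i ∈ s, W (q.coeff i • x ^ i) ≠ 0 := by
    intro i hi
    rw [W.ne_zero_iff, Algebra.smul_def]
    exact mul_ne_zero ((_root_.map_ne_zero _).2 (Finset.mem_filter.1 hi).2) (pow_ne_zero _ hx)
  -- in a relation which sums to zero, the largest value is taken by two terms at least
  obtain ⟨j, hj, hmax⟩ := s.exists_max_image (fun i => W (q.coeff i • x ^ i)) hne
  have hex : ∃ i ∈ s, i ≠ j ∧ W (q.coeff i • x ^ i) = W (q.coeff j • x ^ j) := by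
    by_contra hcon
    push Not at hcon
    have h1 := W.map_sum_eq_of_lt hj (f := fun i => q.coeff i • x ^ i)
      (fun i hi => by
        rw [Finset.mem_sdiff, Finset.mem_singleton] at hi
        exact lt_of_le_of_ne (hmax i hi.1) (hcon i hi.1 hi.2))
    rw [hqx, map_zero] at h1
    exact hterm j hj h1.symm
  have key : ∀ i ∈ s, ∀ j ∈ s, i < j → W (q.coeff i • x ^ i) = W (q.coeff j • x ^ j) →
      ∃ m : ℕ, 0 < m ∧ ∃ a : k, a ≠ 0 ∧ W (x ^ m) = W (algebraMap k Ω a) := by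
    intro i hi j hj hij h
    have hi0 := (Finset.mem_filter.1 hi).2
    have hj0 := (Finset.mem_filter.1 hj).2
    have hWj : W (algebraMap k Ω (q.coeff j)) ≠ 0 :=
      W.ne_zero_iff.2 ((_root_.map_ne_zero _).2 hj0)
    have hWx : W (x ^ i) ≠ 0 := W.ne_zero_iff.2 (pow_ne_zero _ hx)
    refine ⟨j - i, by omega, q.coeff i / q.coeff j, div_ne_zero hi0 hj0, ?_⟩
    rw [map_div₀, map_div₀, eq_div_iff hWj]
    apply mul_right_cancel₀ hWx
    rw [Algebra.smul_def, Algebra.smul_def, map_mul, map_mul] at h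
    rw [h, mul_right_comm, ← map_mul, ← pow_add, Nat.sub_add_cancel hij.le, mul_comm]
  obtain ⟨i, hi, hij, h⟩ := hex
  rcases lt_or_gt_of_ne hij with hlt | hlt
  · exact key i hi j hj hlt h
  · exact key j hj i hi hlt h.symm

section Extension

variable {Γ : Type*} [AddCommGroup Γ] [LinearOrder Γ] [IsOrderedAddMonoid Γ]

/-- The same statement for additive valuations. -/
lemma exists_nsmul_value_eq {k Ω : Type*} [Field k] [Field Ω] [Algebra k Ω]
    (w : AddValuation Ω (WithTop Γ)) {x : Ω} (hx : x ≠ 0) (hal : IsAlgebraic k x) :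
    ∃ m : ℕ, 0 < m ∧ ∃ a : k, a ≠ 0 ∧ m • w x = w (algebraMap k Ω a) := by
  obtain ⟨m, hm, a, ha, h⟩ := exists_pow_value_eq (k := k) w.toValuation hx hal
  refine ⟨m, hm, a, ha, ?_⟩
  rw [← w.map_pow]
  exact h

/-- A valuation with values in a divisible ordered group extends to algebraic extensions. -/
theorem exists_extension {B Ω : Type*} [Field B] [Field Ω] [Algebra B Ω] [Algebra.IsAlgebraic B Ω]
    (hdiv : ∀ m : ℕ, 0 < m → ∀ g : Γ, ∃ h : Γ, m • h = g) (v : AddValuation B (WithTop Γ)) :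
    ∃ w : AddValuation Ω (WithTop Γ), ∀ b, w (algebraMap B Ω b) = v b := by
  classical
  -- a valuation ring of `Ω` which dominates that of `v`
  let O := v.toValuation.valuationSubring
  have hO : ∀ b : B, b ∈ O ↔ 0 ≤ v b := fun b => Iff.rfl
  let f : O →+* Ω := (algebraMap B Ω).comp O.subtype
  obtain ⟨V, hV, hloc⟩ := IsLocalRing.exists_factor_valuationRing f
  let W := V.valuation
  have hle : ∀ b : B, 0 ≤ v b → W (algebraMap B Ω b) ≤ 1 := fun b hb =>
    (V.valuation_le_one_iff _).2 (hV ⟨b, (hO b).2 hb⟩)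
  have hlt : ∀ b : B, 0 < v b → W (algebraMap B Ω b) < 1 := by
    intro b hb
    refine lt_of_le_of_ne (hle b hb.le) fun h1 => ?_
    have hb0 : b ≠ 0 := by
      rintro rfl
      simp at h1
    let o : O := ⟨b, (hO b).2 hb.le⟩
    have hinv : (algebraMap B Ω b)⁻¹ ∈ V := by
      rw [← V.valuation_le_one_iff, map_inv₀]
      change (W _)⁻¹ ≤ 1
      rw [h1, inv_one]
    have hu : IsUnit (f.codRestrict V.toSubring hV o) := by
      refine IsUnit.of_mul_eq_one ⟨_, hinv⟩ (Subtype.ext ?_)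
      change algebraMap B Ω b * (algebraMap B Ω b)⁻¹ = 1
      exact mul_inv_cancel₀ ((_root_.map_ne_zero _).2 hb0)
    obtain ⟨o', ho'⟩ := isUnit_iff_exists_inv.1 (hloc.map_nonunit o hu)
    have h2 : b * o'.1 = 1 := congrArg Subtype.val ho'
    have h3 := congrArg v h2
    rw [v.map_mul, v.map_one] at h3
    have h4 : 0 ≤ v o'.1 := (hO _).1 o'.2
    have := add_pos_of_pos_of_nonneg hb h4
    rw [h3] at this
    exact lt_irrefl _ this
  have hW1 : ∀ b : B, b ≠ 0 → (W (algebraMap B Ω b) ≤ 1 ↔ 0 ≤ v b) := by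
    intro b hb
    refine ⟨fun h => ?_, hle b⟩
    by_contra hneg
    rw [not_le] at hneg
    have hb' : v b⁻¹ > 0 := by
      have h1 : v b + v b⁻¹ = 0 := by rw [← v.map_mul, mul_inv_cancel₀ hb, v.map_one]
      by_contra h2
      rw [gt_iff_lt, not_lt] at h2
      have := add_neg_of_neg_of_nonpos hneg h2
      rw [h1] at this
      exact lt_irrefl _ this
    have h2 := hlt _ hb'
    have h3 := mul_lt_one_of_nonneg_of_lt_one_right h zero_le h2
    rw [← map_mul, ← map_mul, mul_inv_cancel₀ hb, map_one, map_one] at h3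
    exact lt_irrefl _ h3
  -- `g` is the value of `x`: as the value group of `W` is torsion over that of `B`, it is
  -- determined by a power of `x`
  let R : Ω → Γ → Prop := fun x g => ∃ m : ℕ, 0 < m ∧ ∃ a : B, a ≠ 0 ∧
    W (x ^ m) = W (algebraMap B Ω a) ∧ v a = ((m • g : Γ) : WithTop Γ)
  have hRex : ∀ x, x ≠ 0 → ∃ g, R x g := by
    intro x hx
    obtain ⟨m, hm, a, ha, h⟩ := exists_pow_value_eq (k := B) W hx
      (Algebra.IsAlgebraic.isAlgebraic x)
    obtain ⟨h1, hh⟩ := WithTop.ne_top_iff_exists.1 ((v.ne_top_iff).2 ha)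
    obtain ⟨g, hg⟩ := hdiv m hm h1
    exact ⟨g, m, hm, a, ha, h, by rw [hg, hh]⟩
  have hRle : ∀ x g, R x g → (W x ≤ 1 ↔ 0 ≤ g) := by
    rintro x g ⟨m, hm, a, ha, h1, h2⟩
    rw [← pow_le_one_iff_of_nonneg (zero_le (a := W x)) hm.ne', ← map_pow, h1, hW1 a ha, h2,
      ← WithTop.coe_zero, WithTop.coe_le_coe]
    exact nsmul_nonneg_iff hm.ne'
  have hRmul : ∀ x y g h, R x g → R y h → R (x * y) (g + h) := by
    rintro x y g h ⟨m, hm, a, ha, h1, h2⟩ ⟨l, hl, b, hb, h3, h4⟩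
    refine ⟨m * l, Nat.mul_pos hm hl, a ^ l * b ^ m, mul_ne_zero (pow_ne_zero _ ha)
      (pow_ne_zero _ hb), ?_, ?_⟩
    · rw [mul_pow, pow_mul, mul_comm m l, pow_mul, map_mul, map_mul, map_mul, map_pow, h1,
        map_pow W (y ^ l), h3, map_pow, map_pow, map_pow, map_pow]
    · rw [v.map_mul, v.map_pow, v.map_pow, h2, h4, ← WithTop.coe_nsmul, ← WithTop.coe_nsmul,
        ← WithTop.coe_add, smul_add, mul_smul, mul_comm m l, mul_smul, smul_comm m l g]
      congr 2
      exact smul_comm _ _ _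
  have hRinv : ∀ x g, x ≠ 0 → R x g → R x⁻¹ (-g) := by
    rintro x g hx ⟨m, hm, a, ha, h1, h2⟩
    refine ⟨m, hm, a⁻¹, inv_ne_zero ha, by rw [inv_pow, map_inv₀, h1, map_inv₀, map_inv₀], ?_⟩
    have h3 : v a + v a⁻¹ = 0 := by rw [← v.map_mul, mul_inv_cancel₀ ha, v.map_one]
    have hne := v.ne_top_iff.2 (inv_ne_zero ha)
    obtain ⟨q, hq⟩ := WithTop.ne_top_iff_exists.1 hne
    rw [h2, ← hq] at h3
    rw [← hq, smul_neg]
    norm_cast at h3 ⊢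
    exact (neg_eq_of_add_eq_zero_right h3).symm
  have hRone : R 1 0 := ⟨1, one_pos, 1, one_ne_zero, by simp, by simp⟩
  have hRuniq : ∀ x g h, x ≠ 0 → R x g → R x h → g = h := by
    have key : ∀ x g h, x ≠ 0 → R x g → R x h → h ≤ g := by
      intro x g h hx hg hh
      have h1 := hRmul _ _ _ _ hg (hRinv _ _ hx hh)
      rw [mul_inv_cancel₀ hx] at h1
      have h2 := (hRle _ _ h1).1 (by rw [map_one])
      simpa using h2
    exact fun x g h hx hg hh => le_antisymm (key x h g hx hh hg) (key x g h hx hg hh)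
  choose! val hval using hRex
  let F : Ω → WithTop Γ := fun x => if x = 0 then ⊤ else ((val x : Γ) : WithTop Γ)
  have hF : ∀ x, x ≠ 0 → F x = val x := fun x hx => if_neg hx
  have hFR : ∀ x g, x ≠ 0 → R x g → F x = g := fun x g hx h => by
    rw [hF x hx, hRuniq x _ _ hx (hval x hx) h]
  have hFmul : ∀ x y, F (x * y) = F x + F y := by
    intro x y
    by_cases hx : x = 0
    · simp [F, hx]
    by_cases hy : y = 0
    · simp [F, hy]
    rw [hFR _ _ (mul_ne_zero hx hy) (hRmul _ _ _ _ (hval x hx) (hval y hy)), hF x hx, hF y hy,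
      WithTop.coe_add]
  have hFle : ∀ x, W x ≤ 1 → 0 ≤ F x := by
    intro x h
    by_cases hx : x = 0
    · simp [F, hx]
    · rw [hF x hx, ← WithTop.coe_zero, WithTop.coe_le_coe, ← hRle x _ (hval x hx)]
      exact h
  have hFle' : ∀ x y, y ≠ 0 → F y ≤ F x → F y ≤ F (x + y) := by
    intro x y hy hxy
    by_cases hx : x = 0
    · simp [hx]
    have h1 : W (x / y) ≤ 1 := by
      have h2 := hRmul _ _ _ _ (hval x hx) (hRinv _ _ hy (hval y hy))
      rw [div_eq_mul_inv, hRle _ _ h2]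
      rw [hF x hx, hF y hy, WithTop.coe_le_coe] at hxy
      simpa using hxy
    have h2 : x + y = y * (x / y + 1) := by
      field_simp
    rw [h2, hFmul]
    refine le_add_of_nonneg_right (hFle _ (W.map_add_le h1 (by rw [map_one])))
  refine ⟨AddValuation.of F (if_pos rfl) (by rw [hFR 1 0 one_ne_zero hRone, WithTop.coe_zero])
    (fun x y => ?_) hFmul, fun b => ?_⟩
  · rcases le_total (F x) (F y) with h | h
    · rw [min_eq_left h]
      by_cases hx : x = 0
      · simp [hx] at h ⊢
        simpa [F] using h
      · rw [add_comm]
        exact hFle' y x hx h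
    · rw [min_eq_right h]
      by_cases hy : y = 0
      · simp [hy] at h ⊢
        simpa [F] using h
      · exact hFle' x y hy h
  · rw [AddValuation.of_apply]
    by_cases hb : b = 0
    · simp [hb, F]
    · obtain ⟨q, hq⟩ := WithTop.ne_top_iff_exists.1 ((v.ne_top_iff).2 hb)
      rw [← hq]
      exact hFR _ _ ((_root_.map_ne_zero _).2 hb) ⟨1, one_pos, b, hb, by simp, by simp [hq]⟩

/-- An element congruent to `1` modulo the maximal ideal is a unit. -/
lemma value_eq_zero_of_sub_one {Ω : Type*} [Field Ω] {w : AddValuation Ω (WithTop Γ)} {y : Ω}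
    (h : 0 < w (y - 1)) : w y = 0 := by
  have h1 : w 1 < w (y - 1) := by rwa [w.map_one]
  rw [w.map_eq_of_lt_sub h1, w.map_one]

/-- A valuation is a norm over each field that is valued compatibly. -/
lemma isNorm_of_algebraMap {B Ω : Type*} [Field B] [Field Ω] [Algebra B Ω]
    {v : AddValuation B (WithTop Γ)} {w : AddValuation Ω (WithTop Γ)}
    (h : ∀ b, w (algebraMap B Ω b) = v b) : IsNorm v w where
  top_iff _ := w.top_iff
  min_le := w.map_add
  smul a x := by rw [Algebra.smul_def, w.map_mul, h]

lemma isNorm_min {B Ω : Type*} [Field B] [Field Ω] [Algebra B Ω]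
    {v : AddValuation B (WithTop Γ)} {w w' : AddValuation Ω (WithTop Γ)}
    (h : ∀ b, w (algebraMap B Ω b) = v b) (h' : ∀ b, w' (algebraMap B Ω b) = v b) :
    IsNorm v (fun x => min (w x) (w' x)) where
  top_iff x := by
    rw [min_eq_top, w.top_iff, w'.top_iff, and_self]
  min_le x y := by
    refine le_min (le_trans ?_ (w.map_add x y)) (le_trans ?_ (w'.map_add x y))
    · exact min_le_min (min_le_left _ _) (min_le_left _ _)
    · exact min_le_min (min_le_right _ _) (min_le_right _ _)
  smul a x := by
    rw [Algebra.smul_def, w.map_mul, h, w'.map_mul, h', min_add_add_left]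

/-- Two different extensions of a valuation are separated by an approximate idempotent. -/
lemma exists_approx_idempotent {B Ω : Type*} [Field B] [Field Ω] [Algebra B Ω]
    [Algebra.IsAlgebraic B Ω] {v : AddValuation B (WithTop Γ)} {w w' : AddValuation Ω (WithTop Γ)}
    (h : ∀ b, w (algebraMap B Ω b) = v b) (h' : ∀ b, w' (algebraMap B Ω b) = v b)
    {x : Ω} (hx : w' x < w x) : ∃ e : Ω, 0 < w (e - 1) ∧ 0 < w' e := by
  have hx0 : x ≠ 0 := by
    rintro rfl
    simp at hx
  -- for a suitable quotient `z` of a power of `x` by an element of `B`, the sum `1 + z` is inverse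
  -- to an approximate idempotent
  have hz : ∃ z : Ω, 0 < w z ∧ w' z < 0 := by
    obtain ⟨m, hm, a, ha, hma⟩ := exists_nsmul_value_eq (k := B) w hx0
      (Algebra.IsAlgebraic.isAlgebraic x)
    have ha0 : algebraMap B Ω a ≠ 0 := (_root_.map_ne_zero _).2 ha
    set y := x ^ m / algebraMap B Ω a with hy
    have hy0 : y ≠ 0 := div_ne_zero (pow_ne_zero _ hx0) ha0
    obtain ⟨g, hg⟩ := WithTop.ne_top_iff_exists.1 (w.ne_top_iff.2 hx0)
    obtain ⟨g', hg'⟩ := WithTop.ne_top_iff_exists.1 (w'.ne_top_iff.2 hx0)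
    rw [← hg, ← hg', WithTop.coe_lt_coe] at hx
    have hva : v a = ((m • g : Γ) : WithTop Γ) := by rw [← h, ← hma, ← hg, WithTop.coe_nsmul]
    have hwy : w y = 0 := by
      rw [hy, AddValuation.map_div, w.map_pow, hma]
      exact (LinearOrderedAddCommGroupWithTop.sub_self_eq_zero_iff_ne_top).2 (w.ne_top_iff.2 ha0)
    have hwy' : w' y < 0 := by
      rw [hy, AddValuation.map_div, w'.map_pow, h', hva, ← hg']
      norm_cast
      rw [← smul_sub]
      have : g' - g < 0 := sub_neg.2 hx
      rw [← neg_pos, ← smul_neg]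
      exact nsmul_pos (neg_pos.2 this) hm.ne'
    obtain ⟨l, hl, b, hb, hlb⟩ := exists_nsmul_value_eq (k := B) w' hy0
      (Algebra.IsAlgebraic.isAlgebraic y)
    have hb0 : algebraMap B Ω b ≠ 0 := (_root_.map_ne_zero _).2 hb
    rw [h'] at hlb
    obtain ⟨q, hq⟩ := WithTop.ne_top_iff_exists.1 (w'.ne_top_iff.2 hy0)
    rw [← hq] at hlb hwy'
    have hq0 : q < 0 := by exact_mod_cast hwy'
    have hvb : v b = ((l • q : Γ) : WithTop Γ) := by rw [← hlb, WithTop.coe_nsmul]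
    have hlq : l • q < 0 := by
      rw [← neg_pos, ← smul_neg]
      exact nsmul_pos (neg_pos.2 hq0) hl.ne'
    refine ⟨y ^ (2 * l) / algebraMap B Ω b, ?_, ?_⟩
    · rw [AddValuation.map_div, w.map_pow, hwy, h, hvb, smul_zero, ← WithTop.coe_zero]
      norm_cast
      simpa using hlq
    · rw [AddValuation.map_div, w'.map_pow, ← hq, h', hvb]
      norm_cast
      rw [mul_smul, two_smul]
      simpa using hlq
  obtain ⟨z, hz, hz'⟩ := hz
  have h1 : w (1 + z) = 0 := value_eq_zero_of_sub_one (by simpa using hz)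
  have h2 : w' (1 + z) = w' z := by
    rw [add_comm]
    exact w'.map_add_eq_of_lt_left (by rwa [w'.map_one])
  have hne : 1 + z ≠ 0 := by
    intro h0
    rw [h0] at h1
    simp at h1
  refine ⟨(1 + z)⁻¹, ?_, ?_⟩
  · have h3 : (1 + z)⁻¹ - 1 = -(z * (1 + z)⁻¹) := by
      field_simp
      ring
    rw [h3, w.map_neg, w.map_mul, AddValuation.map_inv, h1, neg_zero, add_zero]
    exact hz
  · rw [AddValuation.map_inv, h2]
    obtain ⟨q, hq⟩ := WithTop.ne_top_iff_exists.1 (ne_top_of_lt hz')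
    rw [← hq] at hz' ⊢
    norm_cast at hz' ⊢
    exact neg_pos.2 hz'

/-- A spherically complete valuation extends in at most one way to an algebraic extension: two
extensions would be separated by an approximate idempotent, and Newton approximation for
`X ^ 2 - X` with respect to the minimum of the two would turn it into an idempotent. -/
theorem extension_unique {B Ω : Type*} [Field B] [Field Ω] [Algebra B Ω]
    [Algebra.IsAlgebraic B Ω] {v : AddValuation B (WithTop Γ)} (hB : IsSC v (Set.univ : Set B))
    {w w' : AddValuation Ω (WithTop Γ)}
    (h : ∀ b, w (algebraMap B Ω b) = v b) (h' : ∀ b, w' (algebraMap B Ω b) = v b) (x : Ω) :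
    w x ≤ w' x := by
  by_contra hcon
  rw [not_le] at hcon
  obtain ⟨e, he, he'⟩ := exists_approx_idempotent h h' hcon
  let M := IntermediateField.adjoin B {e}
  have : FiniteDimensional B M := IntermediateField.adjoin.finiteDimensional
    (Algebra.IsIntegral.isIntegral e)
  -- finite extensions are spherically complete for the minimum of the two valuations too
  have hN := isNorm_min h h'
  obtain ⟨m, ω, hω, hspan⟩ := exists_isOrth_span hN hB
    (Subalgebra.toSubmodule M.toSubalgebra) (Module.Finite.iff_fg.1 this)
  have hM := hω.isSC_span hN hB
  rw [hspan] at hM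
  have hunit : ∀ y, 0 < w (y - 1) → w y = 0 := fun y => value_eq_zero_of_sub_one
  have hex : ∃ c ∈ {y | y ∈ M ∧ 0 < w (y - 1) ∧ 0 < w' y}, c * c - c = 0 := by
    refine hM.exists_root hN (T := {y | y ∈ M ∧ 0 < w (y - 1) ∧ 0 < w' y}) (fun y hy => hy.1)
      ⟨e, IntermediateField.mem_adjoin_simple_self B e, he, he'⟩ (fun y => y * y - y) ?_ ?_ ?_
    · rintro x ⟨-, hx, hx'⟩ y ⟨-, hy, hy'⟩
      have h1 : x * x - x - (y * y - y) = (x - y) * (x + y - 1) := by ring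
      have h2 : w (x + y - 1) = 0 := hunit _ (by
        have : x + y - 1 - 1 = (x - 1) + (y - 1) := by ring
        rw [this]
        exact w.map_lt_add hx hy)
      have h3 : w' (x + y - 1) = 0 := by
        rw [w'.map_sub_swap]
        refine value_eq_zero_of_sub_one ?_
        have : 1 - (x + y) - 1 = -(x + y) := by ring
        rw [this, w'.map_neg]
        exact w'.map_lt_add hx' hy'
      simp only [h1, w.map_mul, w'.map_mul, h2, h3, add_zero]
    · rintro c hc x ⟨-, hx, hx'⟩ hle
      have h0 : 0 < min (w (c - x)) (w' (c - x)) := by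
        refine lt_of_lt_of_le ?_ hle
        have h1 : x * x - x = x * (x - 1) := by ring
        simp only [h1, w.map_mul, w'.map_mul, hunit x hx, zero_add]
        refine lt_min hx ?_
        have h3 : w' (x - 1) = 0 := by
          rw [w'.map_sub_swap]
          refine value_eq_zero_of_sub_one ?_
          have : 1 - x - 1 = -x := by ring
          rwa [this, w'.map_neg]
        rwa [h3, add_zero]
      refine ⟨hc, ?_, ?_⟩
      · have : c - 1 = (c - x) + (x - 1) := by ring
        rw [this]
        exact w.map_lt_add (lt_min_iff.1 h0).1 hx
      · have : c = (c - x) + x := by ring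
        rw [this]
        exact w'.map_lt_add (lt_min_iff.1 h0).2 hx'
    · rintro c ⟨hcM, hc, hc'⟩ hne
      have hu : w (2 * c - 1) = 0 := hunit _ (by
        have : 2 * c - 1 - 1 = (c - 1) + (c - 1) := by ring
        rw [this]
        exact w.map_lt_add hc hc)
      have hu' : w' (2 * c - 1) = 0 := by
        rw [w'.map_sub_swap]
        refine value_eq_zero_of_sub_one ?_
        have : 1 - 2 * c - 1 = -(c + c) := by ring
        rw [this, w'.map_neg]
        exact w'.map_lt_add hc' hc'
      have h2c : 2 * c - 1 ≠ 0 := fun h0 => by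
        rw [h0] at hu
        simp at hu
      -- a step of the Newton approximation for `X ^ 2 - X`
      set t := (c * c - c) / (2 * c - 1) with ht
      have htM : t ∈ M := by
        have h2M : (2 : Ω) ∈ M := by exact_mod_cast natCast_mem M 2
        exact div_mem (sub_mem (mul_mem hcM hcM) hcM) (sub_mem (mul_mem h2M hcM) (one_mem M))
      have hwt : w t = w (c * c - c) := by
        rw [ht, AddValuation.map_div, hu, sub_zero]
      have hwt' : w' t = w' (c * c - c) := by
        rw [ht, AddValuation.map_div, hu', sub_zero]
      have hfac : c * c - c = c * (c - 1) := by ring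
      have hpos : 0 < w t := by
        rw [hwt, hfac, w.map_mul, hunit c hc, zero_add]
        exact hc
      have hpos' : 0 < w' t := by
        have : w' (c - 1) = 0 := by
          rw [w'.map_sub_swap]
          refine value_eq_zero_of_sub_one ?_
          have : 1 - c - 1 = -c := by ring
          rwa [this, w'.map_neg]
        rw [hwt', hfac, w'.map_mul, this, add_zero]
        exact hc'
      refine ⟨c - t, ⟨sub_mem hcM htM, ?_, ?_⟩, ?_⟩
      · have : c - t - 1 = (c - 1) - t := by ring
        rw [this]
        exact (lt_min hc hpos).trans_le (w.map_sub _ _)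
      · exact (lt_min hc' hpos').trans_le (w'.map_sub _ _)
      · have h1 : (c - t) * (c - t) - (c - t) = t * t := by
          have : t * (2 * c - 1) = c * c - c := div_mul_cancel₀ _ h2c
          linear_combination -this
        simp only [h1, w.map_mul, w'.map_mul, ← hwt, ← hwt']
        have ht0 : t ≠ 0 := div_ne_zero hne h2c
        have h3 : min (w t) (w' t) < min (w t) (w' t) + min (w t) (w' t) := by
          have hp : 0 < min (w t) (w' t) := lt_min hpos hpos'
          obtain ⟨q, hq⟩ := WithTop.ne_top_iff_exists.1
            (ne_top_of_le_ne_top (w.ne_top_iff.2 ht0) (min_le_left (w t) (w' t)))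
          rw [← hq] at hp ⊢
          norm_cast at hp ⊢
          exact lt_add_of_pos_left q hp
        refine lt_of_lt_of_le h3 (le_min ?_ ?_)
        · exact add_le_add (min_le_left _ _) (min_le_left _ _)
        · exact add_le_add (min_le_right _ _) (min_le_right _ _)
  obtain ⟨c, hc, hfc⟩ := hex
  have h1 : c * (c - 1) = 0 := by linear_combination hfc
  rcases mul_eq_zero.1 h1 with h2 | h2
  · have := hunit c hc.2.1
    simp [h2] at this
  · have h3 := hc.2.2
    simp [sub_eq_zero.1 h2] at h3

/-- Automorphisms preserve the unique extension of a spherically complete valuation. -/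
lemma value_algEquiv {B Ω : Type*} [Field B] [Field Ω] [Algebra B Ω] [Algebra.IsAlgebraic B Ω]
    {v : AddValuation B (WithTop Γ)} (hB : IsSC v (Set.univ : Set B))
    {w : AddValuation Ω (WithTop Γ)} (h : ∀ b, w (algebraMap B Ω b) = v b) (σ : Ω ≃ₐ[B] Ω) (x : Ω) :
    w (σ x) = w x := by
  have hcomp : ∀ b, w.comap (σ : Ω →+* Ω) (algebraMap B Ω b) = v b := by
    intro b
    rw [← h b]
    change w (σ (algebraMap B Ω b)) = _
    rw [σ.commutes]
  have h3 : w (σ x) = w.comap (σ : Ω →+* Ω) x := rfl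
  rw [h3]
  exact le_antisymm (extension_unique hB hcomp h x) (extension_unique hB h hcomp x)

/-- The value of the constant coefficient of a minimal polynomial over a spherically complete
field: all conjugates have the same value. -/
lemma value_coeff_zero_minpoly {B Ω : Type*} [Field B] [Field Ω] [Algebra B Ω] [IsAlgClosure B Ω]
    {v : AddValuation B (WithTop Γ)} (hB : IsSC v (Set.univ : Set B))
    {w : AddValuation Ω (WithTop Γ)} (h : ∀ b, w (algebraMap B Ω b) = v b) (x : Ω) :
    v ((minpoly B x).coeff 0) = (minpoly B x).natDegree • w x := by
  have : IsAlgClosed Ω := IsAlgClosure.isAlgClosed B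
  have : Algebra.IsAlgebraic B Ω := IsAlgClosure.isAlgebraic
  have : Normal B Ω := IsAlgClosure.normal B Ω
  have hx : IsIntegral B x := Algebra.IsIntegral.isIntegral x
  set q := (minpoly B x).map (algebraMap B Ω) with hq
  have hspl : q.Splits := IsAlgClosed.splits q
  have hmon : q.Monic := (minpoly.monic hx).map _
  have h1 := hspl.coeff_zero_eq_prod_roots_of_monic hmon
  have h2 : q.coeff 0 = algebraMap B Ω ((minpoly B x).coeff 0) := coeff_map _ _
  have hroot : ∀ y ∈ q.roots, w y = w x := by
    intro y hy
    have hy0 : aeval y (minpoly B x) = 0 := by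
      have := (mem_roots'.1 hy).2
      rwa [hq, IsRoot.def, eval_map_algebraMap] at this
    obtain ⟨σ, hσ⟩ := (isConjRoot_of_aeval_eq_zero hx hy0).exists_algEquiv
    rw [← hσ, value_algEquiv hB h]
  rw [← h, ← h2, h1, w.map_mul, w.map_pow, w.map_neg, w.map_one, smul_zero, zero_add]
  have hprod : ∀ s : Multiset Ω, (∀ y ∈ s, w y = w x) → w s.prod = s.card • w x := by
    intro s
    induction s using Multiset.induction_on with
    | empty => intro _; simp
    | cons a s ih =>
      intro hs
      rw [Multiset.prod_cons, w.map_mul, hs a (by simp), ih fun y hy => hs y (by simp [hy]),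
        Multiset.card_cons, succ_nsmul, add_comm]
  rw [hprod _ hroot, ← hspl.natDegree_eq_card_roots, hq, natDegree_map]

end Extension

/-! ### The properties of the basic fields that are used -/

/-- The valuation-theoretic properties shared by the two basic fields: `v` is the valuation of the
basic field, its values are integral vectors, its residue field is the prime field, and
the fields `B(i)` are spherically complete. -/
structure Good (p n : ℕ) {C : Type} [Field C] (val : C → WithTop (QLex (n + 1)))
    (const : ℕ → Subfield C) (v : AddValuation C (WithTop (QLex (n + 1)))) : Prop where
  val_eq : ∀ x, val x = v x
  integral : ∀ x (g : QLex (n + 1)), v x = g → ∀ k, ∃ z : ℤ, ofLex g k = z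
  param : ∀ (i : ℕ) (k : Fin (n + 1)), (k : ℕ) < i →
    ∃ t ∈ const i, v t = ((toLex (Pi.single k 1) : QLex (n + 1)) : WithTop (QLex (n + 1)))
  coord : ∀ (i : ℕ) (k : Fin (n + 1)), i ≤ (k : ℕ) →
    (∀ x ∈ const i, ∀ g : QLex (n + 1), v x = g → ofLex g k = 0) ∨
      (k = 0 ∧ const 1 ≤ const 0)
  residue : ∀ x, v x = 0 → ∃ m : ℤ, 0 < v (x - m)
  sc : ∀ i, IsSC v (const i : Set C)
  mono : ∀ i j, i ≤ j → const i ≤ const j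
  top : const (n + 1) = ⊤
  p_pos : 0 < v (p : C)

/-- Exponents of Laurent series as values. -/
def toQ (r : ℕ) (g : ZLex r) : QLex r := toLex fun k => (ofLex g k : ℚ)

lemma toQ_lt {r : ℕ} {g h : ZLex r} (hgh : g < h) : toQ r g < toQ r h := by
  obtain ⟨i, hi, hlt⟩ := hgh
  exact ⟨i, fun j hj => by simpa [toQ] using hi j hj, by simpa [toQ] using hlt⟩

lemma toQ_strictMono (r : ℕ) : StrictMono (toQ r) := fun _ _ => toQ_lt

lemma qlex_ext {r : ℕ} {x y : QLex r} (h : ∀ k, ofLex x k = ofLex y k) : x = y :=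
  ofLex.injective (funext h)

lemma toQ_add {r : ℕ} (g h : ZLex r) : toQ r (g + h) = toQ r g + toQ r h :=
  qlex_ext fun k => Int.cast_add (ofLex g k) (ofLex h k)

lemma toQ_zero (r : ℕ) : toQ r 0 = 0 := qlex_ext fun _ => Int.cast_zero

/-- A subring is a subfield if it is spherically complete and each of its elements has an
approximate inverse in it. -/
lemma inv_mem_of_approx {B : Type*} [Field B] {Γ : Type*} [AddCommGroup Γ] [LinearOrder Γ]
    [IsOrderedAddMonoid Γ] {v : AddValuation B (WithTop Γ)} {S : Subring B}
    (hS : IsSC v (S : Set B))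
    (h : ∀ x ∈ S, x ≠ 0 → ∃ y ∈ S, 0 < v (x * y - 1)) {x : B} (hx : x ∈ S) : x⁻¹ ∈ S := by
  by_cases hx0 : x = 0
  · simp [hx0]
  have hN : IsNorm v v := isNorm_of_algebraMap (B := B) (fun b => rfl)
  obtain ⟨y, hy, hb⟩ := hS.exists_best hN x⁻¹
  by_contra hxS
  have hne : x⁻¹ - y ≠ 0 := fun h0 => hxS (by rw [sub_eq_zero.1 h0]; exact hy)
  obtain ⟨z, hz, hpos⟩ := h x hx hx0
  -- `z` is an approximate inverse of `x`: correct the best approximation `y` by `(1 - x y) z`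
  have h1 := hb (y + (1 - x * y) * z)
    (S.add_mem hy (S.mul_mem (S.sub_mem S.one_mem (S.mul_mem hx hy)) hz))
  have h2 : x⁻¹ - (y + (1 - x * y) * z) = -((x⁻¹ - y) * (x * z - 1)) := by
    field_simp
    ring
  rw [h2, v.map_neg, v.map_mul] at h1
  have h3 := v.ne_top_iff.2 hne
  have h4 : v (x⁻¹ - y) + 0 < v (x⁻¹ - y) + v (x * z - 1) := by
    rwa [add_lt_add_iff_right_of_ne_top h3]
  rw [add_zero] at h4
  exact absurd h4 h1.not_gt

/-- Hahn series with compatible initial parts can be glued: spherical completeness for Hahn series.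
The coefficients only have to be compatible modulo a subgroup `Z`. -/
lemma exists_glue {Γ R : Type*} [LinearOrder Γ] [AddCommGroup R] (Z : AddSubgroup R)
    (𝓑 : Set (HahnSeries Γ R × Set Γ)) (hlow : ∀ b ∈ 𝓑, IsLowerSet b.2)
    (hc : ∀ b ∈ 𝓑, ∀ b' ∈ 𝓑, ∀ g ∈ b.2, g ∈ b'.2 → b.1.coeff g - b'.1.coeff g ∈ Z) :
    ∃ c : HahnSeries Γ R, (∀ b ∈ 𝓑, ∀ g ∈ b.2, c.coeff g - b.1.coeff g ∈ Z) ∧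
      ∀ g ∈ c.support, ∃ b ∈ 𝓑, g ∈ b.1.support := by
  classical
  -- coefficients in `Z` are replaced by zero, to keep the support well-founded
  let f : Γ → R := fun g => if h : ∃ b ∈ 𝓑, g ∈ b.2 ∧ b.1.coeff g ∉ Z then
    h.choose.1.coeff g else 0
  have hf : ∀ g, f g = 0 ∨ ∃ b ∈ 𝓑, g ∈ b.2 ∧ b.1.coeff g ∉ Z ∧ f g = b.1.coeff g := by
    intro g
    by_cases h : ∃ b ∈ 𝓑, g ∈ b.2 ∧ b.1.coeff g ∉ Z
    · exact Or.inr ⟨h.choose, h.choose_spec.1, h.choose_spec.2.1, h.choose_spec.2.2, dif_pos h⟩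
    · exact Or.inl (dif_neg h)
  have hfb : ∀ b ∈ 𝓑, ∀ g ∈ b.2, f g - b.1.coeff g ∈ Z := by
    intro b hb g hg
    by_cases h : ∃ b ∈ 𝓑, g ∈ b.2 ∧ b.1.coeff g ∉ Z
    · have : f g = h.choose.1.coeff g := dif_pos h
      rw [this]
      exact hc _ h.choose_spec.1 b hb g h.choose_spec.2.1 hg
    · have : f g = 0 := dif_neg h
      rw [this, zero_sub, Z.neg_mem_iff]
      by_contra hZ
      exact h ⟨b, hb, hg, hZ⟩
  have hpwo : (Function.support f).IsPWO := by
    rw [Set.isPWO_iff_isWF, Set.isWF_iff_no_descending_seq]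
    -- a descending sequence in the support would lie in the support of the series that its first
    -- element comes from
    intro s hs hmem
    rcases hf (s 0) with h0 | ⟨b, hb, hg, -, -⟩
    · exact hmem 0 h0
    refine (Set.isWF_iff_no_descending_seq.1 b.1.isWF_support) s hs fun m => ?_
    have hm : s m ∈ b.2 := hlow b hb (hs.antitone (Nat.zero_le m)) hg
    intro h0
    have h1 := hfb b hb _ hm
    rw [h0, sub_zero] at h1
    rcases hf (s m) with h2 | ⟨b', hb', -, hZ, h2⟩
    · exact hmem m h2
    · rw [h2] at h1
      exact hZ h1
  refine ⟨⟨f, hpwo⟩, hfb, fun g hg => ?_⟩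
  rcases hf g with h | ⟨b, hb, -, hZ, -⟩
  · exact absurd h hg
  · exact ⟨b, hb, fun h0 => hZ (by rw [h0]; exact Z.zero_mem)⟩

/-- Exponents whose coordinates with the property `P` vanish. -/
def IsSupp {r : ℕ} (P : Fin r → Prop) (g : ZLex r) : Prop := ∀ k, P k → ofLex g k = 0

/-- The subring of the series in those variables only whose index does not have the property `P`. -/
def suppSubring {r : ℕ} (R : Type*) [CommRing R] (P : Fin r → Prop) :
    Subring (HahnSeries (ZLex r) R) where
  carrier := {x | ∀ g ∈ x.support, IsSupp P g}
  zero_mem' := by simp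
  one_mem' := by
    intro g hg k _
    by_cases h : g = 0
    · rw [h]
      rfl
    · simp [HahnSeries.coeff_one, h] at hg
  add_mem' := by
    intro x y hx hy g hg
    rcases HahnSeries.support_add_subset x y hg with h | h
    · exact hx g h
    · exact hy g h
  neg_mem' := by
    intro x hx g hg
    rw [HahnSeries.support_neg] at hg
    exact hx g hg
  mul_mem' := by
    intro x y hx hy g hg k hk
    obtain ⟨a, ha, b, hb, rfl⟩ := Set.mem_add.1 (HahnSeries.support_mul_subset hg)
    have h1 := hx a ha k hk
    have h2 := hy b hb k hk
    change ofLex a k + ofLex b k = 0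
    rw [h1, h2, add_zero]

/-! ### The basic field of positive characteristic -/

section CharP

variable (p n : ℕ) [Fact p.Prime]

/-- The valuation of the field of iterated Laurent series. -/
noncomputable def posValuation : AddValuation (LaurentField p n) (WithTop (QLex (n + 1))) :=
  AddValuation.of (fun x => x.orderTop.map (toQ (n + 1))) (by simp)
    (by
      rw [HahnSeries.orderTop_one, ← WithTop.coe_zero, WithTop.map_coe, toQ_zero, WithTop.coe_zero])
    (fun x y => by
      have h := (toQ_strictMono (n + 1)).monotone
      rw [← h.withTop_map.map_min]
      exact h.withTop_map HahnSeries.min_orderTop_le_orderTop_add)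
    (fun x y => by
      rw [HahnSeries.orderTop_mul]
      cases x.orderTop <;> cases y.orderTop <;> simp [← WithTop.coe_add, toQ_add])

lemma posValuation_apply (x : LaurentField p n) :
    posValuation p n x = x.orderTop.map (toQ (n + 1)) := rfl

lemma le_posValuation_iff (x : LaurentField p n) (r : WithTop (QLex (n + 1))) :
    r ≤ posValuation p n x ↔ ∀ g : ZLex (n + 1), (toQ (n + 1) g : WithTop (QLex (n + 1))) < r →
      x.coeff g = 0 := by
  rw [posValuation_apply]
  constructor
  · intro h g hg
    apply HahnSeries.coeff_eq_zero_of_lt_orderTop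
    by_contra hcon
    rw [not_lt] at hcon
    have h1 := (toQ_strictMono (n + 1)).monotone.withTop_map hcon
    exact absurd (hg.trans_le h) (by simpa using h1)
  · intro h
    by_contra hcon
    rw [not_le] at hcon
    obtain ⟨g, hg⟩ := WithTop.ne_top_iff_exists.1 (ne_top_of_lt hcon)
    have hx : ∃ g', x.orderTop = ((g' : ZLex (n + 1)) : WithTop _) := by
      cases hx : x.orderTop with
      | top => rw [hx] at hg; simp at hg
      | coe a => exact ⟨a, rfl⟩
    obtain ⟨g', hg'⟩ := hx
    rw [hg', WithTop.map_coe] at hcon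
    exact HahnSeries.coeff_orderTop_ne hg' (h g' hcon)

/-- The series in some of the variables are spherically complete. -/
lemma isSC_suppSubring_pos (P : Fin (n + 1) → Prop) :
    IsSC (posValuation p n) (suppSubring (ZMod p) P : Set (LaurentField p n)) := by
  intro 𝓑 h𝓑 hc
  obtain ⟨c, hc1, hc2⟩ := exists_glue (⊥ : AddSubgroup (ZMod p))
    ((fun b : LaurentField p n × WithTop (QLex (n + 1)) =>
      (b.1, {g : ZLex (n + 1) | (toQ (n + 1) g : WithTop (QLex (n + 1))) < b.2})) '' 𝓑) (by
        rintro _ ⟨b, hb, rfl⟩ g g' hg' hg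
        exact lt_of_le_of_lt (WithTop.coe_le_coe.2 ((toQ_strictMono (n + 1)).monotone hg')) hg) (by
        rintro _ ⟨b, hb, rfl⟩ _ ⟨b', hb', rfl⟩ g hg hg'
        rw [AddSubgroup.mem_bot, ← HahnSeries.coeff_sub]
        exact (le_posValuation_iff p n _ _).1 (hc b hb b' hb') g (lt_min hg hg'))
  refine ⟨c, fun g hg => ?_, fun b hb => ?_⟩
  · obtain ⟨_, ⟨b, hb, rfl⟩, hgb⟩ := hc2 g hg
    exact h𝓑 b hb g hgb
  · rw [le_posValuation_iff]
    intro g hg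
    rw [HahnSeries.coeff_sub]
    exact hc1 _ ⟨b, hb, rfl⟩ g hg

lemma posValuation_single (g : ZLex (n + 1)) {a : ZMod p} (ha : a ≠ 0) :
    posValuation p n (HahnSeries.single g a) = (toQ (n + 1) g : WithTop (QLex (n + 1))) := by
  rw [posValuation_apply, HahnSeries.orderTop_single ha, WithTop.map_coe]

/-- The field generated by the series in the first `i` variables. -/
noncomputable def posConst (i : ℕ) : Subfield (LaurentField p n) := Subfield.closure
  {x : LaurentField p n | ∀ g ∈ x.support, ∀ k : Fin (n + 1), i ≤ (k : ℕ) → ofLex g k = 0}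

lemma coe_posConst (i : ℕ) : (posConst p n i : Set (LaurentField p n)) =
    suppSubring (ZMod p) (fun k : Fin (n + 1) => i ≤ (k : ℕ)) := by
  set S := suppSubring (ZMod p) (fun k : Fin (n + 1) => i ≤ (k : ℕ)) with hS
  have hinv : ∀ x ∈ S, x⁻¹ ∈ S := fun x hx =>
    inv_mem_of_approx (isSC_suppSubring_pos p n _) (fun x hx hx0 => by
      have hlc : x.leadingCoeff ≠ 0 := HahnSeries.leadingCoeff_ne_zero.2 hx0
      have hord : x.order ∈ x.support := by
        rw [HahnSeries.mem_support]
        exact HahnSeries.coeff_order_eq_zero.not.2 hx0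
      -- the inverse of the leading term is an approximate inverse
      refine ⟨HahnSeries.single (-x.order) x.leadingCoeff⁻¹, ?_, ?_⟩
      · intro g hg k hk
        have : g = -x.order := by
          by_contra hne
          exact hg (HahnSeries.coeff_single_of_ne hne)
        rw [this]
        change -(ofLex x.order k) = 0
        rw [hx _ hord k hk, neg_zero]
      · rw [posValuation_apply]
        have h1 : 0 < (x * HahnSeries.single (-x.order) x.leadingCoeff⁻¹ - 1).orderTop := by
          rw [HahnSeries.orderTop_self_sub_one_pos_iff]
          have h2 : (HahnSeries.single (-x.order) x.leadingCoeff⁻¹).leadingCoeff ≠ 0 := by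
            rw [HahnSeries.leadingCoeff_of_single]
            exact inv_ne_zero hlc
          constructor
          · rw [HahnSeries.orderTop_mul, HahnSeries.orderTop_single (inv_ne_zero hlc),
              ← HahnSeries.order_eq_orderTop_of_ne_zero hx0, ← WithTop.coe_add, add_neg_cancel,
              WithTop.coe_zero]
          · rw [HahnSeries.leadingCoeff_mul, HahnSeries.leadingCoeff_of_single,
              mul_inv_cancel₀ hlc]
        cases h3 : (x * HahnSeries.single (-x.order) x.leadingCoeff⁻¹ - 1).orderTop with
        | top => simp
        | coe a =>
          rw [h3] at h1
          rw [WithTop.map_coe, ← WithTop.coe_zero, WithTop.coe_lt_coe, ← toQ_zero]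
          exact toQ_lt (WithTop.coe_lt_coe.1 h1)) hx
  let F : Subfield (LaurentField p n) := { S with inv_mem' := hinv }
  have hF : Subfield.closure (F : Set (LaurentField p n)) = F := Subfield.closure_eq F
  exact congrArg (fun G : Subfield (LaurentField p n) => (G : Set (LaurentField p n))) hF

/-- The basic field of positive characteristic has the required properties. -/
lemma good_pos : Good p n (fun x : LaurentField p n => x.orderTop.map (toQ (n + 1)))
    (posConst p n) (posValuation p n) where
  val_eq x := rfl
  integral x g hg k := by
    have hx : x.orderTop.map (toQ (n + 1)) = g := hg
    cases hx' : x.orderTop with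
    | top => rw [hx'] at hx; simp at hx
    | coe a =>
      rw [hx', WithTop.map_coe, WithTop.coe_eq_coe] at hx
      exact ⟨ofLex a k, by rw [← hx]; rfl⟩
  param i k hk := by
    refine ⟨HahnSeries.single (toLex (Pi.single k 1)) 1, ?_, ?_⟩
    · rw [← SetLike.mem_coe, coe_posConst]
      intro g hg l hl
      have : g = toLex (Pi.single k 1) := by
        by_contra hne
        exact hg (HahnSeries.coeff_single_of_ne hne)
      have hne : l ≠ k := by
        rintro rfl
        omega
      rw [this]
      exact Pi.single_eq_of_ne hne 1
    · have := posValuation_single p n (toLex (Pi.single k 1)) (one_ne_zero (α := ZMod p))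
      rw [this, WithTop.coe_eq_coe]
      refine qlex_ext fun l => ?_
      by_cases h : l = k
      · subst h
        simp [toQ]
      · simp [toQ, Pi.single_eq_of_ne h]
  coord i k hik := by
    left
    intro x hx g hg
    rw [← SetLike.mem_coe, coe_posConst] at hx
    have hx' : x.orderTop.map (toQ (n + 1)) = g := hg
    cases h : x.orderTop with
    | top => rw [h] at hx'; simp at hx'
    | coe a =>
      rw [h, WithTop.map_coe, WithTop.coe_eq_coe] at hx'
      have := hx a (HahnSeries.coeff_orderTop_ne h) k hik
      rw [← hx']
      change ((ofLex a k : ℤ) : ℚ) = 0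
      rw [this, Int.cast_zero]
  residue x hx := by
    refine ⟨((x.coeff 0).val : ℤ), ?_⟩
    have hpos : ∀ y : LaurentField p n, (∀ g, g ≤ 0 → y.coeff g = 0) → 0 < posValuation p n y := by
      intro y hy
      by_contra hcon
      rw [not_lt, posValuation_apply] at hcon
      cases h : y.orderTop with
      | top => rw [h] at hcon; simp at hcon
      | coe a =>
        rw [h, WithTop.map_coe, ← WithTop.coe_zero, WithTop.coe_le_coe, ← toQ_zero,
          (toQ_strictMono (n + 1)).le_iff_le] at hcon
        exact HahnSeries.coeff_orderTop_ne h (hy a hcon)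
    have hcast : (((x.coeff 0).val : ℤ) : LaurentField p n) = HahnSeries.C (x.coeff 0) := by
      have h1 : x.coeff 0 = (((x.coeff 0).val : ℕ) : ZMod p) := (ZMod.natCast_zmod_val _).symm
      conv_rhs => rw [h1]
      rw [map_natCast]
      norm_cast
    rw [hcast]
    refine hpos _ fun g hg => ?_
    rw [HahnSeries.coeff_sub, HahnSeries.C_apply]
    rcases hg.lt_or_eq with h | h
    · rw [HahnSeries.coeff_single_of_ne h.ne, sub_zero]
      refine (le_posValuation_iff p n x 0).1 hx.ge g ?_
      rw [← WithTop.coe_zero, WithTop.coe_lt_coe, ← toQ_zero]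
      exact toQ_lt h
    · rw [h, HahnSeries.coeff_single_same, sub_self]
  sc i := by
    rw [coe_posConst]
    exact isSC_suppSubring_pos p n _
  mono i j hij := by
    intro x hx
    rw [← SetLike.mem_coe, coe_posConst] at hx ⊢
    exact fun g hg k hk => hx g hg k (hij.trans hk)
  top := by
    rw [eq_top_iff]
    intro x _
    rw [← SetLike.mem_coe, coe_posConst]
    exact fun g hg k hk => absurd k.2 (by omega)
  p_pos := by
    have : ((p : ℕ) : LaurentField p n) = 0 := by
      rw [← map_natCast (HahnSeries.C : ZMod p →+* LaurentField p n), CharP.cast_eq_zero, map_zero]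
    rw [this, AddValuation.map_zero]
    exact WithTop.coe_lt_top _

end CharP

/-! ### Series and their `p`-adic completion -/

section CharZero

variable {p n : ℕ} [Fact p.Prime]

/-- The inclusion of the series into the `p`-adic completion. -/
noncomputable abbrev toInt : LaurentRing p n →+* IntegerRing p n :=
  algebraMap (LaurentRing p n) (IntegerRing p n)

lemma ideal_fg : (Ideal.span {(p : LaurentRing p n)}).FG := ⟨{(p : LaurentRing p n)}, by simp⟩

lemma mem_pow_smul_top (m : ℕ) (x : IntegerRing p n) :
    x ∈ ((Ideal.span {(p : LaurentRing p n)}) ^ m • ⊤ :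
      Submodule (LaurentRing p n) (IntegerRing p n)) ↔
      (p : IntegerRing p n) ^ m ∣ x := by
  rw [Ideal.span_singleton_pow, Submodule.ideal_span_singleton_smul,
    Submodule.mem_smul_pointwise_iff_exists]
  constructor
  · rintro ⟨z, -, rfl⟩
    rw [Algebra.smul_def, map_pow, map_natCast]
    exact dvd_mul_right _ _
  · rintro ⟨z, rfl⟩
    refine ⟨z, trivial, ?_⟩
    rw [Algebra.smul_def, map_pow, map_natCast]

lemma evalₐ_eq_iff (m : ℕ) (x : IntegerRing p n) (r : LaurentRing p n) :
    AdicCompletion.evalₐ _ m x = Ideal.Quotient.mk _ r ↔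
      (p : IntegerRing p n) ^ m ∣ x - toInt r := by
  rw [← mem_pow_smul_top, AdicCompletion.pow_smul_top_eq_ker_eval ideal_fg, LinearMap.mem_ker]
  have h1 : AdicCompletion.evalₐ (Ideal.span {(p : LaurentRing p n)}) m (toInt r) =
    Ideal.Quotient.mk _ r := AlgHom.commutes _ r
  have h2 : AdicCompletion.evalₐ (Ideal.span {(p : LaurentRing p n)}) m x =
      Ideal.Quotient.mk _ r ↔
      AdicCompletion.evalₐ (Ideal.span {(p : LaurentRing p n)}) m (x - toInt r) = 0 := by
    rw [map_sub, h1, sub_eq_zero]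
  rw [h2]
  set y := x - toInt r
  have h3 : (Ideal.span {(p : LaurentRing p n)}) ^ m • (⊤ : Ideal (LaurentRing p n)) ≤
    (Ideal.span {(p : LaurentRing p n)}) ^ m := by simp
  have h4 : (Ideal.span {(p : LaurentRing p n)}) ^ m ≤
    (Ideal.span {(p : LaurentRing p n)}) ^ m • (⊤ : Ideal (LaurentRing p n)) := by simp
  constructor
  · intro h
    rw [← AdicCompletion.factor_evalₐ_eq_eval _ y h4, h, map_zero]
  · intro h
    rw [← AdicCompletion.factor_eval_eq_evalₐ _ y h3, h, map_zero]

/-- The series are dense in the completion. -/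
lemma exists_repr (m : ℕ) (x : IntegerRing p n) :
    ∃ r : LaurentRing p n, (p : IntegerRing p n) ^ m ∣ x - toInt r := by
  obtain ⟨r, hr⟩ := Ideal.Quotient.mk_surjective
    (AdicCompletion.evalₐ (Ideal.span {(p : LaurentRing p n)}) m x)
  exact ⟨r, (evalₐ_eq_iff m x r).1 hr.symm⟩

/-- The completion is separated. -/
lemma eq_zero_of_pow_dvd {x : IntegerRing p n} (h : ∀ m : ℕ, (p : IntegerRing p n) ^ m ∣ x) :
    x = 0 := by
  refine AdicCompletion.ext_evalₐ fun m => ?_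
  have := (evalₐ_eq_iff m x 0).2 (by simpa using h m)
  rw [this, map_zero, map_zero]

lemma pow_dvd_of_toInt {m : ℕ} {r : LaurentRing p n}
    (h : (p : IntegerRing p n) ^ m ∣ toInt r) : (p : LaurentRing p n) ^ m ∣ r := by
  have h1 := (evalₐ_eq_iff m (toInt r) 0).2 (by simpa using h)
  have h2 : AdicCompletion.evalₐ (Ideal.span {(p : LaurentRing p n)}) m (toInt r) =
    Ideal.Quotient.mk _ r := AlgHom.commutes _ r
  rw [h2, map_zero, Ideal.Quotient.eq_zero_iff_mem, Ideal.span_singleton_pow,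
    Ideal.mem_span_singleton] at h1
  exact h1

lemma p_dvd_of_toInt {r : LaurentRing p n} (h : (p : IntegerRing p n) ∣ toInt r) :
    (p : LaurentRing p n) ∣ r := by
  have := pow_dvd_of_toInt (m := 1) (r := r) (by simpa using h)
  simpa using this

lemma p_ne_zero : (p : IntegerRing p n) ≠ 0 := by
  intro h
  have h2 := pow_dvd_of_toInt (m := 2) (r := (p : LaurentRing p n)) (by
    rw [map_natCast, h]
    simp)
  rw [sq] at h2
  have h3 := (mul_dvd_mul_iff_left (prime_p (p := p) (n := n)).ne_zero (b := (p : LaurentRing p n))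
    (c := 1)).1 (by simpa using h2)
  exact prime_p.not_isUnit (isUnit_of_dvd_one h3)

/-- The `p`-adic completion of the ring of series is complete. -/
lemma exists_limit (x : ℕ → IntegerRing p n)
    (h : ∀ m l, m ≤ l → (p : IntegerRing p n) ^ m ∣ x m - x l) :
    ∃ L, ∀ m, (p : IntegerRing p n) ^ m ∣ x m - L := by
  have hc : IsAdicComplete (Ideal.span {(p : LaurentRing p n)}) (IntegerRing p n) :=
    AdicCompletion.isAdicComplete ideal_fg
  obtain ⟨L, hL⟩ := hc.prec' x (fun {m l} hml => by
    rw [SModEq.sub_mem, mem_pow_smul_top]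
    exact h m l hml)
  refine ⟨L, fun m => ?_⟩
  have := hL m
  rwa [SModEq.sub_mem, mem_pow_smul_top] at this

/-- Each nonzero element of the first valuation ring is `p ^ m * (r + p * z)`, where the
leading coefficient of the series `r` is a unit. -/
lemma exists_int_value {x : IntegerRing p n} (hx : x ≠ 0) :
    ∃ (m : ℕ) (r : LaurentRing p n) (z : IntegerRing p n), IsUnit r.leadingCoeff ∧
      x = (p : IntegerRing p n) ^ m * (toInt r + (p : IntegerRing p n) * z) := by
  classical
  have hex : ∃ m : ℕ, ¬ (p : IntegerRing p n) ^ m ∣ x := by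
    by_contra hcon
    push Not at hcon
    exact hx (eq_zero_of_pow_dvd hcon)
  -- `p ^ m` is the largest power of `p` which divides `x`
  obtain ⟨m, hm⟩ : ∃ m, Nat.find hex = m + 1 := by
    refine Nat.exists_eq_succ_of_ne_zero fun h0 => ?_
    have := Nat.find_spec hex
    rw [h0] at this
    simp at this
  have h1 : (p : IntegerRing p n) ^ m ∣ x := not_not.1 (Nat.find_min hex (by omega))
  have h2 : ¬ (p : IntegerRing p n) ^ (m + 1) ∣ x := hm ▸ Nat.find_spec hex
  obtain ⟨y, rfl⟩ := h1
  obtain ⟨u, z, hz⟩ := exists_repr 1 y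
  rw [pow_one] at hz
  have hu : ¬ (p : LaurentRing p n) ∣ u := by
    rintro ⟨u', rfl⟩
    apply h2
    rw [pow_succ]
    refine mul_dvd_mul_left _ ⟨toInt u' + z, ?_⟩
    rw [map_mul, map_natCast] at hz
    linear_combination hz
  -- modulo `p`, the series may be chosen with a unit as leading coefficient
  obtain ⟨w, ⟨w', hw'⟩, hlw⟩ := exists_unit_leading hu
  refine ⟨m, w, toInt w' + z, ?_, ?_⟩
  · by_contra hnu
    apply hlw
    rw [← PadicInt.norm_lt_one_iff_dvd]
    exact lt_of_le_of_ne (PadicInt.norm_le_one _) fun h => hnu (PadicInt.isUnit_iff.2 h)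
  · have h3 : toInt u - toInt w = (p : IntegerRing p n) * toInt w' := by
      rw [← map_sub, hw', map_mul, map_natCast]
    congr 1
    linear_combination hz + h3


/-! ### The valuation of the basic field of characteristic zero -/

/-- Series whose leading coefficient is a unit, modified by multiples of `p`, are units of the
completion. -/
lemma isUnit_of_leadingCoeff {r : LaurentRing p n} (hr : IsUnit r.leadingCoeff)
    (z : IntegerRing p n) : IsUnit (toInt r + (p : IntegerRing p n) * z) := by
  have hr' : IsUnit (toInt r) := (HahnSeries.isUnit_iff.2 hr).map _
  obtain ⟨s, hs⟩ := hr'.exists_right_inv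
  set u := -((p : IntegerRing p n) * z * s) with hu
  have hpu : (p : IntegerRing p n) ∣ u := ⟨-(z * s), by rw [hu]; ring⟩
  -- the geometric series inverts `1 - u`
  obtain ⟨L, hL⟩ := exists_limit (fun m => ∑ i ∈ Finset.range m, u ^ i) (fun m l hml => by
    rw [← Finset.sum_range_add_sum_Ico _ hml, sub_add_cancel_left, dvd_neg]
    refine Finset.dvd_sum fun i hi => ?_
    exact (pow_dvd_pow _ (Finset.mem_Ico.1 hi).1).trans (pow_dvd_pow_of_dvd hpu i))
  have h1 : (1 - u) * L - 1 = 0 := by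
    refine eq_zero_of_pow_dvd fun m => ?_
    have h2 : (1 - u) * L - 1 = -((1 - u) * (∑ i ∈ Finset.range m, u ^ i - L)) - u ^ m := by
      have := mul_neg_geom_sum u m
      linear_combination this
    rw [h2]
    exact dvd_sub (((hL m).mul_left _).neg_right) (pow_dvd_pow_of_dvd hpu m)
  refine IsUnit.of_mul_eq_one (s * L) ?_
  have h3 : (toInt r + (p : IntegerRing p n) * z) * s = 1 - u := by
    rw [hu]
    linear_combination hs
  rw [← mul_assoc, h3]
  linear_combination h1

/-- The inclusion of the first valuation ring into the basic field. -/
noncomputable abbrev toMix : IntegerRing p n →+* MixedField p n :=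
  algebraMap (IntegerRing p n) (MixedField p n)

lemma toMix_injective : Function.Injective (toMix (p := p) (n := n)) :=
  IsFractionRing.injective _ _

lemma pMix_ne_zero : (p : MixedField p n) ≠ 0 := by
  rw [← map_natCast (toMix (p := p) (n := n))]
  exact (map_ne_zero_iff _ toMix_injective).2 p_ne_zero

lemma exists_hasValue {x : MixedField p n} (hx : x ≠ 0) : ∃ m g, HasValue x m g := by
  obtain ⟨a, b, hb, rfl⟩ := IsFractionRing.div_surjective (A := IntegerRing p n) x
  have hb0 : b ≠ 0 := nonZeroDivisors.ne_zero hb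
  have ha0 : a ≠ 0 := by
    rintro rfl
    simp at hx
  obtain ⟨m, r, z, hr, rfl⟩ := exists_int_value ha0
  obtain ⟨l, s, y, hs, rfl⟩ := exists_int_value hb0
  obtain ⟨u, hu⟩ := (isUnit_of_leadingCoeff hs y).exists_right_inv
  obtain ⟨k, t, q, ht, hut⟩ := exists_int_value (x := (toInt r + (p : IntegerRing p n) * z) * u) (by
    intro h0
    rcases mul_eq_zero.1 h0 with h1 | h1
    · exact (isUnit_of_leadingCoeff hr z).ne_zero h1
    · rw [h1, mul_zero] at hu
      exact zero_ne_one hu)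
  refine ⟨(m : ℤ) + k - l, t.order, t, q, rfl, ht, ?_⟩
  have hne : toMix (toInt s + (p : IntegerRing p n) * y) ≠ 0 :=
    (map_ne_zero_iff _ toMix_injective).2 (isUnit_of_leadingCoeff hs y).ne_zero
  have hp0 := pMix_ne_zero (p := p) (n := n)
  have h1 : toMix ((toInt r + (p : IntegerRing p n) * z) * u) =
      (p : MixedField p n) ^ k * toMix (toInt t + (p : IntegerRing p n) * q) := by
    rw [hut, map_mul, map_pow, map_natCast]
  have h2 : toMix (toInt r + (p : IntegerRing p n) * z) =
      toMix ((toInt r + (p : IntegerRing p n) * z) * u) *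
        toMix (toInt s + (p : IntegerRing p n) * y) := by
    rw [← map_mul, mul_assoc, mul_comm u, hu, mul_one]
  rw [map_mul, map_mul, map_pow, map_pow, map_natCast, div_eq_iff
    (mul_ne_zero (pow_ne_zero _ hp0) hne), zpow_sub₀ hp0, zpow_add₀ hp0, zpow_natCast,
    zpow_natCast, zpow_natCast]
  change _ * toMix (toInt r + (p : IntegerRing p n) * z) = _
  rw [h2, h1]
  field_simp

/-- The vector `(m, g)`. -/
def vec (m : ℤ) (g : ZLex n) : QLex (n + 1) :=
  toLex (Fin.cons (m : ℚ) fun k => ((ofLex g k : ℤ) : ℚ))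

lemma vec_zero_apply (m : ℤ) (g : ZLex n) : ofLex (vec m g) 0 = m := rfl

lemma vec_succ_apply (m : ℤ) (g : ZLex n) (k : Fin n) : ofLex (vec m g) k.succ = ofLex g k := rfl

lemma vec_add (m m' : ℤ) (g g' : ZLex n) : vec (m + m') (g + g') = vec m g + vec m' g' := by
  refine qlex_ext fun k => ?_
  refine Fin.cases ?_ (fun k => ?_) k
  · exact Int.cast_add m m'
  · exact Int.cast_add (ofLex g k) (ofLex g' k)

lemma lt_of_head_lt {r : ℕ} {x y : QLex (r + 1)} (h : ofLex x 0 < ofLex y 0) : x < y :=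
  ⟨0, fun j hj => absurd hj (Fin.not_lt_zero j), h⟩

lemma head_le_of_le {r : ℕ} {x y : QLex (r + 1)} (h : x ≤ y) : ofLex x 0 ≤ ofLex y 0 := by
  by_contra hcon
  exact absurd (lt_of_head_lt (not_le.1 hcon)) h.not_gt

lemma vec_lt_of_lt {m m' : ℤ} (h : m < m') (g g' : ZLex n) : vec m g < vec m' g' :=
  lt_of_head_lt (by rw [vec_zero_apply, vec_zero_apply]; exact_mod_cast h)

lemma vec_lt_vec {m : ℤ} {g g' : ZLex n} (h : g < g') : vec m g < vec m g' := by
  obtain ⟨i, hi, hlt⟩ := h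
  refine ⟨i.succ, fun j hj => ?_, by simpa [vec] using hlt⟩
  revert hj
  refine Fin.cases (fun _ => rfl) (fun j hj => ?_) j
  have := hi j (Fin.succ_lt_succ_iff.1 hj)
  change ((ofLex g j : ℤ) : ℚ) = ((ofLex g' j : ℤ) : ℚ)
  exact congrArg _ this

lemma vec_le_vec {m : ℤ} {g g' : ZLex n} (h : g ≤ g') : vec m g ≤ vec m g' := by
  rcases h.lt_or_eq with h | rfl
  · exact (vec_lt_vec h).le
  · exact le_rfl

lemma vec_zero : vec 0 (0 : ZLex n) = 0 := by
  refine qlex_ext fun k => ?_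
  refine Fin.cases ?_ (fun k => ?_) k
  · exact Int.cast_zero
  · exact Int.cast_zero

lemma isUnit_not_dvd {a : ℤ_[p]} (ha : IsUnit a) : ¬ (p : ℤ_[p]) ∣ a := fun h =>
  PadicInt.prime_p.not_isUnit (isUnit_of_dvd_unit h ha)

lemma not_dvd_isUnit {a : ℤ_[p]} (ha : ¬ (p : ℤ_[p]) ∣ a) : IsUnit a := by
  by_contra hnu
  apply ha
  rw [← PadicInt.norm_lt_one_iff_dvd]
  exact lt_of_le_of_ne (PadicInt.norm_le_one _) fun h => hnu (PadicInt.isUnit_iff.2 h)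

/-- How the value of an element is related to an arbitrary representation of it. -/
lemma HasValue.compare {x : MixedField p n} {m' : ℤ} {g' : ZLex n} (h : HasValue x m' g') {m : ℤ}
    {r : LaurentRing p n} {y : IntegerRing p n} (hy : (p : IntegerRing p n) ∣ y - toInt r)
    (hx : x = (p : MixedField p n) ^ m * toMix y) :
    (m < m' ∧ (p : LaurentRing p n) ∣ r) ∨
      (m = m' ∧ ¬ (p : ℤ_[p]) ∣ r.coeff g' ∧ ∀ h < g', (p : ℤ_[p]) ∣ r.coeff h) := by
  obtain ⟨s, w, hs, hu, hxs⟩ := h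
  have hp0 := pMix_ne_zero (p := p) (n := n)
  obtain ⟨z, hz⟩ := hy
  have hy' : y = toInt r + (p : IntegerRing p n) * z := by linear_combination hz
  have hsne : s ≠ 0 := by
    rintro rfl
    simp at hu
  have hsg : s.coeff g' = s.leadingCoeff := by rw [HahnSeries.leadingCoeff_eq, hs]
  rw [hxs] at hx
  change (p : MixedField p n) ^ m' * toMix (toInt s + (p : IntegerRing p n) * w) = _ at hx
  have hnot : ¬ (p : LaurentRing p n) ∣ s := fun hd => isUnit_not_dvd hu (by
    rw [← hsg]
    exact coeff_of_dvd hd g')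
  -- comparing the two representations modulo `p`, after cancelling the smaller power of `p`
  rcases lt_trichotomy m m' with hlt | heq | hgt
  · refine Or.inl ⟨hlt, p_dvd_of_toInt ?_⟩
    obtain ⟨k, hk⟩ := Int.eq_ofNat_of_zero_le (sub_nonneg.2 (Int.add_one_le_iff.2 hlt))
    have hm : m' = m + (1 + k) := by omega
    rw [hm, zpow_add₀ hp0, mul_assoc] at hx
    have h1 := mul_left_cancel₀ (zpow_ne_zero m hp0) hx
    have h2 : (p : MixedField p n) ^ (1 + (k : ℤ)) = toMix ((p : IntegerRing p n) ^ (1 + k)) := by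
      rw [map_pow, map_natCast, ← zpow_natCast]
      push_cast
      rfl
    rw [h2, ← map_mul] at h1
    have h3 := toMix_injective h1
    rw [hy', pow_add, pow_one] at h3
    refine ⟨(p : IntegerRing p n) ^ k * (toInt s + (p : IntegerRing p n) * w) - z, ?_⟩
    linear_combination -h3
  · refine Or.inr ⟨heq, ?_⟩
    subst heq
    have h1 := toMix_injective (mul_left_cancel₀ (zpow_ne_zero m hp0) hx)
    have h2 : (p : LaurentRing p n) ∣ r - s := p_dvd_of_toInt (by
      rw [map_sub]
      refine ⟨w - z, ?_⟩
      rw [hy'] at h1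
      linear_combination -h1)
    have h3 := fun g => coeff_of_dvd h2 g
    simp only [HahnSeries.coeff_sub] at h3
    constructor
    · intro hd
      have h4 := dvd_sub hd (h3 g')
      rw [sub_sub_cancel, hsg] at h4
      exact isUnit_not_dvd hu h4
    · intro h hh
      have h4 := h3 h
      have h5 : s.coeff h = 0 := HahnSeries.coeff_eq_zero_of_lt_order (hs ▸ hh)
      rwa [h5, sub_zero] at h4
  · exfalso
    apply hnot
    apply p_dvd_of_toInt
    obtain ⟨k, hk⟩ := Int.eq_ofNat_of_zero_le (sub_nonneg.2 (Int.add_one_le_iff.2 hgt))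
    have hm : m = m' + (1 + k) := by omega
    rw [hm, zpow_add₀ hp0, mul_assoc] at hx
    have h1 := mul_left_cancel₀ (zpow_ne_zero m' hp0) hx
    have h2 : (p : MixedField p n) ^ (1 + (k : ℤ)) = toMix ((p : IntegerRing p n) ^ (1 + k)) := by
      rw [map_pow, map_natCast, ← zpow_natCast]
      push_cast
      rfl
    rw [h2, ← map_mul] at h1
    have h3 := toMix_injective h1
    rw [pow_add, pow_one] at h3
    refine ⟨(p : IntegerRing p n) ^ k * y - w, ?_⟩
    linear_combination h3

/-- The value of an element is unique. -/
lemma HasValue.vec_eq {x : MixedField p n} {m m' : ℤ} {g g' : ZLex n} (h : HasValue x m g)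
    (h' : HasValue x m' g') : vec m g = vec m' g' := by
  have key : ∀ {m m' : ℤ} {g g' : ZLex n}, HasValue x m g → HasValue x m' g' →
      vec m g ≤ vec m' g' := by
    intro m m' g g' h h'
    obtain ⟨r, z, hr, hu, hx⟩ := h
    rcases h'.compare (r := r) (y := toInt r + (p : IntegerRing p n) * z) ⟨z, by ring⟩ hx with
      ⟨hlt, -⟩ | ⟨rfl, hnd, -⟩
    · exact (vec_lt_of_lt hlt _ _).le
    · refine vec_le_vec ?_
      by_contra hlt
      rw [not_le] at hlt
      rw [HahnSeries.coeff_eq_zero_of_lt_order (hr ▸ hlt)] at hnd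
      exact hnd (dvd_zero _)
  exact le_antisymm (key h h') (key h' h)

lemma not_hasValue_zero (m : ℤ) (g : ZLex n) : ¬ HasValue (0 : MixedField p n) m g := by
  rintro ⟨r, z, -, hu, h0⟩
  have h1 := (mul_eq_zero.1 h0.symm).resolve_left (zpow_ne_zero _ pMix_ne_zero)
  have h2 : toInt r + (p : IntegerRing p n) * z = 0 :=
    (map_eq_zero_iff _ toMix_injective).1 h1
  exact (isUnit_of_leadingCoeff hu z).ne_zero h2

lemma HasValue.mul {x y : MixedField p n} {m m' : ℤ} {g g' : ZLex n} (h : HasValue x m g)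
    (h' : HasValue y m' g') : HasValue (x * y) (m + m') (g + g') := by
  obtain ⟨r, z, rfl, hu, rfl⟩ := h
  obtain ⟨s, w, rfl, hu', rfl⟩ := h'
  have hlc : (r * s).leadingCoeff = r.leadingCoeff * s.leadingCoeff :=
    HahnSeries.leadingCoeff_mul r s
  refine ⟨r * s, toInt r * w + z * toInt s + (p : IntegerRing p n) * z * w, ?_, ?_, ?_⟩
  · rw [HahnSeries.order_mul]
    · rintro rfl
      simp at hu
    · rintro rfl
      simp at hu'
  · rw [hlc]
    exact hu.mul hu'
  · rw [zpow_add₀ pMix_ne_zero, mul_mul_mul_comm, ← map_mul]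
    congr 2
    rw [map_mul]
    ring

open Classical in
/-- The value in the definition of the basic field of characteristic `0`. -/
noncomputable def mixVal (x : MixedField p n) : WithTop (QLex (n + 1)) :=
  if h : ∃ mg : ℤ × ZLex n, HasValue x mg.1 mg.2 then
      ((toLex (Fin.cons (h.choose.1 : ℚ) fun k => ((ofLex h.choose.2 k : ℤ) : ℚ)) :
        QLex (n + 1)) : WithTop (QLex (n + 1)))
    else ⊤

lemma HasValue.mixVal_eq {x : MixedField p n} {m : ℤ} {g : ZLex n} (h : HasValue x m g) :
    mixVal x = (vec m g : WithTop (QLex (n + 1))) := by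
  have hex : ∃ mg : ℤ × ZLex n, HasValue x mg.1 mg.2 := ⟨(m, g), h⟩
  rw [mixVal, dif_pos hex]
  exact congrArg _ (hex.choose_spec.vec_eq h)

lemma mixVal_zero : mixVal (0 : MixedField p n) = ⊤ := by
  rw [mixVal, dif_neg]
  rintro ⟨mg, h⟩
  exact not_hasValue_zero _ _ h

lemma vec_injective {m m' : ℤ} {g g' : ZLex n} (h : vec m g = vec m' g') : m = m' ∧ g = g' := by
  constructor
  · have := congrArg (fun x : QLex (n + 1) => ofLex x 0) h
    simp only [vec_zero_apply] at this
    exact_mod_cast this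
  · apply ofLex.injective
    funext k
    have := congrArg (fun x : QLex (n + 1) => ofLex x k.succ) h
    simp only [vec_succ_apply] at this
    exact_mod_cast this

lemma exists_hasValue_of_mixVal {x : MixedField p n} {γ : QLex (n + 1)} (h : mixVal x = γ) :
    ∃ m g, HasValue x m g ∧ γ = vec m g := by
  have hx : x ≠ 0 := by
    rintro rfl
    rw [mixVal_zero] at h
    exact WithTop.top_ne_coe h
  obtain ⟨m, g, hmg⟩ := exists_hasValue hx
  rw [hmg.mixVal_eq, WithTop.coe_eq_coe] at h
  exact ⟨m, g, hmg, h.symm⟩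

/-- The balls around zero of radius `(m, γ')`, in terms of a representation. -/
lemma le_mixVal_iff {M : ℤ} {γ : QLex (n + 1)} (hγ : ofLex γ 0 = M) {y : IntegerRing p n}
    {r : LaurentRing p n} (hy : (p : IntegerRing p n) ∣ y - toInt r) :
    (γ : WithTop (QLex (n + 1))) ≤ mixVal ((p : MixedField p n) ^ M * toMix y) ↔
      ∀ g, vec M g < γ → (p : ℤ_[p]) ∣ r.coeff g := by
  set x := (p : MixedField p n) ^ M * toMix y with hxdef
  by_cases hx : x = 0
  · have hy0 : y = 0 := by
      have := (mul_eq_zero.1 hx).resolve_left (zpow_ne_zero _ pMix_ne_zero)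
      exact (map_eq_zero_iff _ toMix_injective).1 this
    have hd : (p : LaurentRing p n) ∣ r := p_dvd_of_toInt (by
      rw [hy0, zero_sub, dvd_neg] at hy
      exact hy)
    rw [hx, mixVal_zero]
    exact ⟨fun _ g _ => coeff_of_dvd hd g, fun _ => le_top⟩
  obtain ⟨m', g', h⟩ := exists_hasValue hx
  rw [h.mixVal_eq, WithTop.coe_le_coe]
  rcases h.compare hy hxdef with ⟨hlt, hd⟩ | ⟨rfl, hnd, hall⟩
  · refine ⟨fun _ g _ => coeff_of_dvd hd g, fun _ => (lt_of_head_lt ?_).le⟩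
    rw [hγ, vec_zero_apply]
    exact_mod_cast hlt
  · constructor
    · intro hle g hg
      refine hall g ?_
      by_contra hcon
      exact absurd (hle.trans (vec_le_vec (le_of_not_gt hcon))) hg.not_ge
    · intro hg
      by_contra hcon
      rw [not_le] at hcon
      exact hnd (hg g' hcon)

lemma mixVal_mul (x y : MixedField p n) : mixVal (x * y) = mixVal x + mixVal y := by
  by_cases hx : x = 0
  · simp [hx, mixVal_zero]
  by_cases hy : y = 0
  · simp [hy, mixVal_zero]
  obtain ⟨m, g, h⟩ := exists_hasValue hx
  obtain ⟨m', g', h'⟩ := exists_hasValue hy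
  rw [(h.mul h').mixVal_eq, h.mixVal_eq, h'.mixVal_eq, vec_add, WithTop.coe_add]

lemma exists_repr_of_le_mixVal {x : MixedField p n} {M : ℤ} {γ : QLex (n + 1)}
    (hγ : ofLex γ 0 = M) (hx : (γ : WithTop (QLex (n + 1))) ≤ mixVal x) :
    ∃ y, x = (p : MixedField p n) ^ M * toMix y := by
  by_cases hx0 : x = 0
  · exact ⟨0, by simp [hx0]⟩
  obtain ⟨m, g, h⟩ := exists_hasValue hx0
  rw [h.mixVal_eq, WithTop.coe_le_coe] at hx
  have h1 := head_le_of_le hx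
  rw [hγ, vec_zero_apply] at h1
  have h2 : M ≤ m := by exact_mod_cast h1
  obtain ⟨k, hk⟩ := Int.eq_ofNat_of_zero_le (sub_nonneg.2 h2)
  obtain ⟨r, z, -, -, rfl⟩ := h
  refine ⟨(p : IntegerRing p n) ^ k * (toInt r + (p : IntegerRing p n) * z), ?_⟩
  have hm : m = M + k := by omega
  rw [hm, zpow_add₀ pMix_ne_zero, map_mul, map_pow, map_natCast, zpow_natCast, mul_assoc]

lemma min_le_mixVal_add (x y : MixedField p n) :
    min (mixVal x) (mixVal y) ≤ mixVal (x + y) := by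
  by_cases htop : min (mixVal x) (mixVal y) = ⊤
  · have hx0 : ∀ z : MixedField p n, mixVal z = ⊤ → z = 0 := by
      intro z hz
      by_contra hz0
      obtain ⟨m, g, h⟩ := exists_hasValue hz0
      rw [h.mixVal_eq] at hz
      exact WithTop.coe_ne_top hz
    rw [min_eq_top] at htop
    rw [hx0 x htop.1, hx0 y htop.2, add_zero, mixVal_zero]
    exact le_top
  obtain ⟨γ, hγ⟩ := WithTop.ne_top_iff_exists.1 htop
  have hM : ∃ M : ℤ, ofLex γ 0 = M := by
    rcases min_choice (mixVal x) (mixVal y) with h | h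
    · obtain ⟨m, g, -, hg⟩ := exists_hasValue_of_mixVal (h.symm.trans hγ.symm)
      exact ⟨m, by rw [hg]; rfl⟩
    · obtain ⟨m, g, -, hg⟩ := exists_hasValue_of_mixVal (h.symm.trans hγ.symm)
      exact ⟨m, by rw [hg]; rfl⟩
  obtain ⟨M, hM⟩ := hM
  rw [← hγ]
  have hx := hγ.le.trans (min_le_left _ _)
  have hy := hγ.le.trans (min_le_right _ _)
  obtain ⟨a, ha⟩ := exists_repr_of_le_mixVal hM hx
  obtain ⟨b, hb⟩ := exists_repr_of_le_mixVal hM hy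
  obtain ⟨r, hr⟩ := exists_repr 1 a
  obtain ⟨s, hs⟩ := exists_repr 1 b
  rw [pow_one] at hr hs
  rw [ha, le_mixVal_iff hM hr] at hx
  rw [hb, le_mixVal_iff hM hs] at hy
  rw [ha, hb, ← mul_add, ← map_add, le_mixVal_iff hM (r := r + s) (by
    rw [map_add, add_sub_add_comm]
    exact dvd_add hr hs)]
  intro g hg
  rw [HahnSeries.coeff_add]
  exact dvd_add (hx g hg) (hy g hg)

lemma hasValue_one : HasValue (1 : MixedField p n) 0 0 :=
  ⟨1, 0, HahnSeries.order_one, by simp, by simp⟩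

variable (p n) in
/-- The valuation of the basic field of characteristic `0`. -/
noncomputable def mixValuation : AddValuation (MixedField p n) (WithTop (QLex (n + 1))) :=
  AddValuation.of mixVal mixVal_zero
    (by rw [hasValue_one.mixVal_eq, vec_zero, WithTop.coe_zero]) min_le_mixVal_add mixVal_mul

end CharZero

section CharZero

variable {p n : ℕ} [Fact p.Prime]

/-! ### Fields of constants in characteristic zero -/

variable (p n) in
/-- The series in `t_2, …, t_i` only. -/
noncomputable abbrev constSeries (i : ℕ) : Subring (LaurentRing p n) :=
  suppSubring ℤ_[p] (fun k : Fin n => i ≤ (k : ℕ) + 1)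

variable (p n) in
/-- The `p`-adic limits of series in `t_2, …, t_i` only. -/
noncomputable def constInt (i : ℕ) : Subring (IntegerRing p n) where
  carrier := {x | ∀ m : ℕ, ∃ r ∈ constSeries p n i, (p : IntegerRing p n) ^ m ∣ x - toInt r}
  zero_mem' m := ⟨0, Subring.zero_mem _, by simp⟩
  one_mem' m := ⟨1, Subring.one_mem _, by simp⟩
  add_mem' {x y} hx hy m := by
    obtain ⟨r, hr, hxr⟩ := hx m
    obtain ⟨s, hs, hys⟩ := hy m
    refine ⟨r + s, Subring.add_mem _ hr hs, ?_⟩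
    rw [map_add, add_sub_add_comm]
    exact dvd_add hxr hys
  neg_mem' {x} hx m := by
    obtain ⟨r, hr, hxr⟩ := hx m
    refine ⟨-r, Subring.neg_mem _ hr, ?_⟩
    rw [map_neg, ← neg_sub', dvd_neg]
    exact hxr
  mul_mem' {x y} hx hy m := by
    obtain ⟨r, hr, hxr⟩ := hx m
    obtain ⟨s, hs, hys⟩ := hy m
    refine ⟨r * s, Subring.mul_mem _ hr hs, ?_⟩
    have h : x * y - toInt (r * s) = (x - toInt r) * y + toInt r * (y - toInt s) := by
      rw [map_mul]
      ring
    rw [h]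
    exact dvd_add (hxr.mul_right _) (hys.mul_left _)

lemma toInt_mem_constInt {i : ℕ} {r : LaurentRing p n} (hr : r ∈ constSeries p n i) :
    toInt r ∈ constInt p n i := fun m => ⟨r, hr, by simp⟩

lemma mem_constInt_of_p_mul {i : ℕ} {z : IntegerRing p n}
    (h : (p : IntegerRing p n) * z ∈ constInt p n i) : z ∈ constInt p n i := by
  intro m
  obtain ⟨r, hr, hd⟩ := h (m + 1)
  have h1 : (p : LaurentRing p n) ∣ r := p_dvd_of_toInt (by
    have h2 : (p : IntegerRing p n) ∣ (p : IntegerRing p n) * z - toInt r :=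
      (Dvd.intro_left _ (pow_succ _ m).symm).trans hd
    exact (dvd_sub_right (dvd_mul_right _ _)).1 h2)
  obtain ⟨s, rfl⟩ := h1
  refine ⟨s, fun g hg => hr g ?_, ?_⟩
  · rw [HahnSeries.mem_support] at hg ⊢
    rw [← nsmul_eq_mul, HahnSeries.coeff_nsmul]
    simpa [(Fact.out : p.Prime).ne_zero] using hg
  · rw [map_mul, map_natCast, ← mul_sub, pow_succ', mul_dvd_mul_iff_left p_ne_zero] at hd
    exact hd

lemma mem_constInt_of_pow_mul {i : ℕ} (k : ℕ) {z : IntegerRing p n}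
    (h : (p : IntegerRing p n) ^ k * z ∈ constInt p n i) : z ∈ constInt p n i := by
  induction k with
  | zero => simpa using h
  | succ k ih => exact ih (mem_constInt_of_p_mul (by rwa [pow_succ', mul_assoc] at h))

variable (p n) in
/-- The elements of the basic field which become `p`-adic limits of series in `t_2, …, t_i` after
multiplication by a power of `p`. -/
noncomputable def constMix (i : ℕ) : Subring (MixedField p n) where
  carrier := {x | ∃ k : ℕ, ∃ y ∈ constInt p n i, (p : MixedField p n) ^ k * x = toMix y}
  zero_mem' := ⟨0, 0, Subring.zero_mem _, by simp⟩
  one_mem' := ⟨0, 1, Subring.one_mem _, by simp⟩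
  add_mem' {x y} hx hy := by
    obtain ⟨k, a, ha, hka⟩ := hx
    obtain ⟨l, b, hb, hlb⟩ := hy
    refine ⟨k + l, (p : IntegerRing p n) ^ l * a + (p : IntegerRing p n) ^ k * b,
      Subring.add_mem _ (Subring.mul_mem _ (pow_mem (natCast_mem _ p) _) ha)
        (Subring.mul_mem _ (pow_mem (natCast_mem _ p) _) hb), ?_⟩
    rw [map_add, map_mul, map_mul, ← hka, ← hlb, map_pow, map_pow, map_natCast]
    ring
  neg_mem' {x} hx := by
    obtain ⟨k, a, ha, hka⟩ := hx
    exact ⟨k, -a, Subring.neg_mem _ ha, by rw [map_neg, ← hka, mul_neg]⟩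
  mul_mem' {x y} hx hy := by
    obtain ⟨k, a, ha, hka⟩ := hx
    obtain ⟨l, b, hb, hlb⟩ := hy
    refine ⟨k + l, a * b, Subring.mul_mem _ ha hb, ?_⟩
    rw [map_mul, ← hka, ← hlb]
    ring

lemma p_mem_constMix (i : ℕ) : (p : MixedField p n) ∈ constMix p n i := natCast_mem _ p

lemma toMix_mem_constMix {i : ℕ} {y : IntegerRing p n} (hy : y ∈ constInt p n i) :
    toMix y ∈ constMix p n i := ⟨0, y, hy, by simp⟩

lemma zpow_mem_constMix (i : ℕ) (N : ℤ) : (p : MixedField p n) ^ N ∈ constMix p n i := by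
  obtain ⟨k, rfl | rfl⟩ := N.eq_nat_or_neg
  · rw [zpow_natCast]
    exact pow_mem (p_mem_constMix i) k
  · refine ⟨k, 1, Subring.one_mem _, ?_⟩
    rw [zpow_neg, zpow_natCast, mul_inv_cancel₀ (pow_ne_zero _ pMix_ne_zero), map_one]

lemma zpow_mul_mem_constMix_iff {i : ℕ} (N : ℤ) (y : IntegerRing p n) :
    (p : MixedField p n) ^ N * toMix y ∈ constMix p n i ↔ y ∈ constInt p n i := by
  constructor
  · intro h
    have h1 := (constMix p n i).mul_mem (zpow_mem_constMix i (-N)) h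
    rw [← mul_assoc, ← zpow_add₀ pMix_ne_zero, neg_add_cancel, zpow_zero, one_mul] at h1
    obtain ⟨k, a, ha, hk⟩ := h1
    rw [← map_natCast toMix, ← map_pow, ← map_mul] at hk
    exact mem_constInt_of_pow_mul k (by rwa [toMix_injective hk])
  · exact fun h => (constMix p n i).mul_mem (zpow_mem_constMix i N) (toMix_mem_constMix h)

lemma zero_lt_mixVal {y : IntegerRing p n} {r : LaurentRing p n}
    (hy : (p : IntegerRing p n) ∣ y - toInt r) (hr : ∀ g ≤ 0, (p : ℤ_[p]) ∣ r.coeff g) :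
    0 < mixVal (toMix y) := by
  by_cases h0 : toMix y = 0
  · rw [h0, mixVal_zero]
    exact WithTop.coe_lt_top _
  obtain ⟨m, g, h⟩ := exists_hasValue h0
  rw [h.mixVal_eq, ← WithTop.coe_zero, WithTop.coe_lt_coe, ← vec_zero]
  rcases h.compare (m := 0) hy (by simp) with ⟨hlt, -⟩ | ⟨rfl, hnd, -⟩
  · exact vec_lt_of_lt hlt _ _
  · refine vec_lt_vec ?_
    by_contra hcon
    exact hnd (hr g (le_of_not_gt hcon))

/-- The value and the leading coefficient of an element of the field of constants can be read off a
series in `t_2, …, t_i` only. -/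
lemma exists_const_repr {i : ℕ} {x : MixedField p n} (hx : x ∈ constMix p n i) {m : ℤ} {g : ZLex n}
    (h : HasValue x m g) : ∃ (y : IntegerRing p n) (r : LaurentRing p n),
      r ∈ constSeries p n i ∧ x = (p : MixedField p n) ^ m * toMix y ∧
      (p : IntegerRing p n) ∣ y - toInt r ∧ IsUnit (r.coeff g) ∧
      ∀ h < g, (p : ℤ_[p]) ∣ r.coeff h := by
  obtain ⟨s, z, hs, hu, hxs⟩ := id h
  have hy : toInt s + (p : IntegerRing p n) * z ∈ constInt p n i := by
    rw [← zpow_mul_mem_constMix_iff m]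
    rw [hxs] at hx
    exact hx
  obtain ⟨r, hr, hd⟩ := hy 1
  rw [pow_one] at hd
  refine ⟨toInt s + (p : IntegerRing p n) * z, r, hr, hxs, hd, ?_⟩
  rcases h.compare hd hxs with ⟨hlt, -⟩ | ⟨-, hnd, hall⟩
  · exact absurd hlt (lt_irrefl m)
  · exact ⟨not_dvd_isUnit hnd, hall⟩

lemma isSupp_of_hasValue {i : ℕ} {x : MixedField p n} (hx : x ∈ constMix p n i) {m : ℤ} {g : ZLex n}
    (h : HasValue x m g) : IsSupp (fun k : Fin n => i ≤ (k : ℕ) + 1) g := by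
  obtain ⟨y, r, hr, -, -, hu, -⟩ := exists_const_repr hx h
  refine hr g ?_
  rw [HahnSeries.mem_support]
  exact hu.ne_zero

lemma exists_approx_inv {i : ℕ} {x : MixedField p n} (hx : x ∈ constMix p n i) (hx0 : x ≠ 0) :
    ∃ y ∈ constMix p n i, 0 < mixValuation p n (x * y - 1) := by
  obtain ⟨m, g, h⟩ := exists_hasValue hx0
  have hg := isSupp_of_hasValue hx h
  obtain ⟨y, r, hr, hxy, hd, hu, hlow⟩ := exists_const_repr hx h
  obtain ⟨a, ha⟩ := hu.exists_right_inv
  have ht : HahnSeries.single (-g) a ∈ constSeries p n i := by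
    intro h hh k hk
    have : h = -g := by
      by_contra hne
      exact hh (HahnSeries.coeff_single_of_ne hne)
    rw [this]
    change -(ofLex g k) = 0
    rw [hg k hk, neg_zero]
  -- the inverse of the leading term is an approximate inverse
  refine ⟨(p : MixedField p n) ^ (-m) * toMix (toInt (HahnSeries.single (-g) a)),
    (zpow_mul_mem_constMix_iff _ _).2 (toInt_mem_constInt ht), ?_⟩
  have h1 : x * ((p : MixedField p n) ^ (-m) * toMix (toInt (HahnSeries.single (-g) a))) - 1 =
      toMix (y * toInt (HahnSeries.single (-g) a) - 1) := by
    rw [hxy, map_sub, map_mul, map_one, mul_mul_mul_comm, ← zpow_add₀ pMix_ne_zero, add_neg_cancel,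
      zpow_zero, one_mul]
  rw [h1]
  refine zero_lt_mixVal (r := r * HahnSeries.single (-g) a - 1) ?_ fun h hh => ?_
  · rw [map_sub, map_one, map_mul, sub_sub_sub_cancel_right, ← sub_mul]
    exact hd.mul_right _
  · have h2 : (r * HahnSeries.single (-g) a).coeff h = r.coeff (h + g) * a := by
      have := HahnSeries.coeff_mul_single_add (r := a) (x := r) (a := h + g) (b := -g)
      rwa [add_neg_cancel_right] at this
    rw [HahnSeries.coeff_sub, h2]
    rcases hh.lt_or_eq with hlt | rfl
    · have h3 : (1 : LaurentRing p n).coeff h = 0 := by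
        rw [HahnSeries.coeff_one, if_neg hlt.ne]
      rw [h3, sub_zero]
      exact (hlow _ (add_lt_of_neg_left g hlt)).mul_right _
    · have h3 : (1 : LaurentRing p n).coeff 0 = 1 := by
        rw [HahnSeries.coeff_one, if_pos rfl]
      rw [h3, zero_add, ha, sub_self]
      exact dvd_zero _

/-- A ball around zero whose radius has first coordinate above `M - 1` consists of multiples
of `p ^ M`, as the values are integral. -/
lemma exists_eq_zpow_mul {x : MixedField p n} {M : ℤ} {ρ : WithTop (QLex (n + 1))}
    (hρ : ∀ γ : QLex (n + 1), ρ = γ → (M : ℚ) - 1 < ofLex γ 0) (hx : ρ ≤ mixVal x) :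
    ∃ y, x = (p : MixedField p n) ^ M * toMix y := by
  by_cases hx0 : x = 0
  · exact ⟨0, by simp [hx0]⟩
  obtain ⟨m, g, h⟩ := exists_hasValue hx0
  rw [h.mixVal_eq] at hx
  obtain ⟨γ, rfl⟩ := WithTop.ne_top_iff_exists.1 (ne_top_of_le_ne_top WithTop.coe_ne_top hx)
  have h1 := hρ γ rfl
  have h2 := h1.trans_le (head_le_of_le (WithTop.coe_le_coe.1 hx))
  rw [vec_zero_apply] at h2
  refine exists_repr_of_le_mixVal (γ := vec M g) rfl ?_
  rw [h.mixVal_eq, WithTop.coe_le_coe]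
  have h3 : M ≤ m := by
    have : (M : ℚ) < m + 1 := by linarith
    have : M < m + 1 := by exact_mod_cast this
    omega
  rcases h3.lt_or_eq with h4 | rfl
  · exact (vec_lt_of_lt h4 _ _).le
  · exact le_rfl

lemma le_mixVal_of_head_lt {M : ℤ} {γ : QLex (n + 1)} (h : ofLex γ 0 < M) (y : IntegerRing p n) :
    (γ : WithTop (QLex (n + 1))) ≤ mixVal ((p : MixedField p n) ^ M * toMix y) := by
  by_cases hx0 : (p : MixedField p n) ^ M * toMix y = 0
  · rw [hx0, mixVal_zero]
    exact le_top
  obtain ⟨m, g, hv⟩ := exists_hasValue hx0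
  obtain ⟨r, hr⟩ := exists_repr 1 y
  rw [pow_one] at hr
  rw [hv.mixVal_eq, WithTop.coe_le_coe]
  refine (lt_of_head_lt ?_).le
  rw [vec_zero_apply]
  refine h.trans_le ?_
  rcases hv.compare hr rfl with ⟨hlt, -⟩ | ⟨rfl, -⟩
  · exact_mod_cast hlt.le
  · exact le_rfl

lemma le_mixVal_add {x y : MixedField p n} {ρ : WithTop (QLex (n + 1))} (hx : ρ ≤ mixVal x)
    (hy : ρ ≤ mixVal y) : ρ ≤ mixVal (x + y) := (le_min hx hy).trans (min_le_mixVal_add x y)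

lemma coe_mixValuation : ⇑(mixValuation p n) = mixVal := rfl

/-- Spherical completeness of the fields of constants, for families of balls whose radii have
unbounded first coordinate: this is `p`-adic completeness. -/
lemma exists_center_of_unbounded {i : ℕ} {𝓑 : Set (MixedField p n × WithTop (QLex (n + 1)))}
    (h𝓑 : ∀ b ∈ 𝓑, b.1 ∈ constMix p n i)
    (hc : ∀ b ∈ 𝓑, ∀ b' ∈ 𝓑, min b.2 b'.2 ≤ mixVal (b.1 - b'.1))
    (hub : ∀ N : ℕ, ∃ b ∈ 𝓑, ∀ γ : QLex (n + 1), b.2 = γ → (N : ℚ) ≤ ofLex γ 0) :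
    ∃ c ∈ constMix p n i, ∀ b ∈ 𝓑, b.2 ≤ mixVal (c - b.1) := by
  choose b hb hbig using hub
  have hdiff : ∀ N M : ℕ, N ≤ M → ∃ y, (b N).1 - (b M).1 = (p : MixedField p n) ^ (N : ℤ) *
    toMix y := by
    intro N M hNM
    refine exists_eq_zpow_mul (fun γ hγ => ?_) (hc _ (hb N) _ (hb M))
    have hNM' : (N : ℚ) ≤ M := by exact_mod_cast hNM
    rcases min_choice (b N).2 (b M).2 with h | h
    · have := hbig N γ (h ▸ hγ)
      push_cast
      linarith
    · have := hbig M γ (h ▸ hγ)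
      push_cast
      linarith
  have h0 : ∀ N, ∃ y ∈ constInt p n i, (b N).1 - (b 0).1 = toMix y := by
    intro N
    obtain ⟨y, hy⟩ := hdiff 0 N (Nat.zero_le N)
    have hm : (p : MixedField p n) ^ ((0 : ℕ) : ℤ) * toMix (-y) ∈ constMix p n i := by
      rw [map_neg, mul_neg, ← hy, neg_sub]
      exact (constMix p n i).sub_mem (h𝓑 _ (hb N)) (h𝓑 _ (hb 0))
    refine ⟨-y, (zpow_mul_mem_constMix_iff _ _).1 hm, ?_⟩
    rw [map_neg, ← neg_sub, hy]
    simp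
  choose y hyC hy using h0
  have hdvd : ∀ N M, N ≤ M → (p : IntegerRing p n) ^ N ∣ y N - y M := by
    intro N M hNM
    obtain ⟨z, hz⟩ := hdiff N M hNM
    refine ⟨z, toMix_injective ?_⟩
    rw [map_sub, ← hy, ← hy, sub_sub_sub_cancel_right, hz, map_mul, map_pow, map_natCast,
      zpow_natCast]
  -- the centres of the balls with increasing radii are a Cauchy sequence
  obtain ⟨L, hL⟩ := exists_limit y hdvd
  have hLC : L ∈ constInt p n i := by
    intro m
    obtain ⟨r, hr, hd⟩ := hyC m m
    refine ⟨r, hr, ?_⟩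
    have := dvd_sub hd (hL m)
    rwa [sub_sub_sub_cancel_left] at this
  refine ⟨(b 0).1 + toMix L, (constMix p n i).add_mem (h𝓑 _ (hb 0)) (toMix_mem_constMix hLC),
    fun b' hb' => ?_⟩
  have key : ∀ γ : QLex (n + 1), (γ : WithTop (QLex (n + 1))) ≤ b'.2 →
      (γ : WithTop (QLex (n + 1))) ≤ mixVal ((b 0).1 + toMix L - b'.1) := by
    intro γ hγ
    obtain ⟨N, hN⟩ := exists_nat_gt (ofLex γ 0)
    have h1 : (b 0).1 + toMix L - b'.1 = ((b 0).1 + toMix L - (b N).1) + ((b N).1 - b'.1) := by ring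
    obtain ⟨z, hz⟩ := hL N
    have h2 : (b 0).1 + toMix L - (b N).1 = (p : MixedField p n) ^ (N : ℤ) * toMix (-z) := by
      have h3 := congrArg toMix hz
      rw [map_sub, ← hy N, map_mul, map_pow, map_natCast] at h3
      rw [map_neg, zpow_natCast]
      linear_combination -h3
    rw [h1]
    refine le_mixVal_add ?_ ?_
    · rw [h2]
      exact le_mixVal_of_head_lt (by exact_mod_cast hN) _
    · refine le_trans (le_min ?_ hγ) (hc _ (hb N) _ hb')
      cases hρ : (b N).2 with
      | top => exact le_top
      | coe δ =>
        rw [WithTop.coe_le_coe]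
        exact (lt_of_head_lt (hN.trans_le (hbig N δ hρ))).le
  by_contra hcon
  rw [not_le] at hcon
  obtain ⟨s, hs⟩ := WithTop.ne_top_iff_exists.1 (ne_top_of_lt hcon)
  rw [← hs] at hcon key
  -- the estimates for the finite radii imply that for the radius `⊤`, as the finite ones are
  -- unbounded
  cases hρ : b'.2 with
  | coe δ =>
    rw [hρ] at hcon key
    exact absurd hcon (key δ le_rfl).not_gt
  | top =>
    rw [hρ] at key
    have h1 : s < toLex (fun k => ofLex s k + 1) := lt_of_head_lt (lt_add_one (ofLex s 0))
    exact absurd h1 (WithTop.coe_le_coe.1 (key _ le_top)).not_gt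

/-- Spherical completeness of the fields of constants, for families of balls whose radii have
bounded first coordinate: after the reduction to a single first coordinate `M`, this is a statement
about the Hahn series over the residue field. -/
lemma exists_center_of_bounded {i : ℕ} {𝓑 : Set (MixedField p n × WithTop (QLex (n + 1)))}
    (h𝓑 : ∀ b ∈ 𝓑, b.1 ∈ constMix p n i)
    (hc : ∀ b ∈ 𝓑, ∀ b' ∈ 𝓑, min b.2 b'.2 ≤ mixVal (b.1 - b'.1)) (hne : 𝓑.Nonempty) {N : ℕ}
    (hN : ∀ b ∈ 𝓑, ∃ γ : QLex (n + 1), b.2 = γ ∧ ofLex γ 0 < N) :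
    ∃ c ∈ constMix p n i, ∀ b ∈ 𝓑, b.2 ≤ mixVal (c - b.1) := by
  -- values are integral, so the first coordinate of a radius matters only through its ceiling; `M`
  -- is the largest of these
  obtain ⟨M, ⟨b₀, hb₀, γ₀, hγ₀, hM⟩, hmax⟩ : ∃ M : ℤ,
      (∃ b ∈ 𝓑, ∃ γ : QLex (n + 1), b.2 = γ ∧ ⌈ofLex γ 0⌉ = M) ∧
      ∀ M' : ℤ, (∃ b ∈ 𝓑, ∃ γ : QLex (n + 1), b.2 = γ ∧ ⌈ofLex γ 0⌉ = M') → M' ≤ M := by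
    refine Int.exists_greatest_of_bdd ⟨N, ?_⟩ ?_
    · rintro M' ⟨b, hb, γ, hγ, rfl⟩
      obtain ⟨γ', hγ', hlt⟩ := hN b hb
      rw [hγ, WithTop.coe_eq_coe] at hγ'
      rw [Int.ceil_le, hγ']
      exact_mod_cast hlt.le
    · obtain ⟨b, hb⟩ := hne
      obtain ⟨γ, hγ, -⟩ := hN b hb
      exact ⟨_, b, hb, γ, hγ, rfl⟩
  have hhead : (M : ℚ) - 1 < ofLex γ₀ 0 := by
    have := Int.ceil_lt_add_one (ofLex γ₀ 0)
    rw [hM] at this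
    linarith
  -- the balls with first coordinate `M`, in terms of series
  have hrep : ∀ b : {b : MixedField p n × WithTop (QLex (n + 1)) //
      b ∈ 𝓑 ∧ ∃ γ : QLex (n + 1), b.2 = γ ∧ ofLex γ 0 = M},
      ∃ (y : IntegerRing p n) (r : LaurentRing p n), r ∈ constSeries p n i ∧
        b.1.1 - b₀.1 = (p : MixedField p n) ^ M * toMix y ∧
          (p : IntegerRing p n) ∣ y - toInt r := by
    rintro ⟨b, hb, γ, hγ, hγM⟩
    obtain ⟨y, hy⟩ := exists_eq_zpow_mul (M := M) (fun δ hδ => by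
      rcases min_choice b.2 b₀.2 with h | h
      · rw [h, hγ, WithTop.coe_eq_coe] at hδ
        rw [← hδ, hγM]
        linarith
      · rw [h, hγ₀, WithTop.coe_eq_coe] at hδ
        rwa [← hδ]) (hc b hb b₀ hb₀)
    have hyC : y ∈ constInt p n i := by
      rw [← zpow_mul_mem_constMix_iff M, ← hy]
      exact (constMix p n i).sub_mem (h𝓑 _ hb) (h𝓑 _ hb₀)
    obtain ⟨r, hr, hd⟩ := hyC 1
    exact ⟨y, r, hr, hy, by simpa using hd⟩
  choose y r hr hy hd using hrep
  -- the leading coefficients of the centres are glued modulo `p`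
  obtain ⟨c, hc1, hc2⟩ := exists_glue (Ideal.span {(p : ℤ_[p])}).toAddSubgroup
    (Set.range fun b : {b : MixedField p n × WithTop (QLex (n + 1)) //
      b ∈ 𝓑 ∧ ∃ γ : QLex (n + 1), b.2 = γ ∧ ofLex γ 0 = M} =>
      (r b, {g : ZLex n | (vec M g : WithTop (QLex (n + 1))) < b.1.2})) (by
        rintro _ ⟨b, rfl⟩ g g' hg' hg
        exact lt_of_le_of_lt (WithTop.coe_le_coe.2 (vec_le_vec hg')) hg) (by
        rintro _ ⟨b, rfl⟩ _ ⟨b', rfl⟩ g hg hg'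
        change (r b).coeff g - (r b').coeff g ∈ Ideal.span {(p : ℤ_[p])}
        rw [Ideal.mem_span_singleton, ← HahnSeries.coeff_sub]
        obtain ⟨b, hb, γ, hγ, hγM⟩ := b
        obtain ⟨b', hb', γ', hγ', hγM'⟩ := b'
        have hcc := hc b hb b' hb'
        have h1 : ∃ δ : QLex (n + 1), min b.2 b'.2 = δ ∧ ofLex δ 0 = M := by
          rcases min_choice b.2 b'.2 with h | h
          · exact ⟨γ, h.trans hγ, hγM⟩
          · exact ⟨γ', h.trans hγ', hγM'⟩
        obtain ⟨δ, hδ, hδM⟩ := h1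
        change (vec M g : WithTop (QLex (n + 1))) < b.2 at hg
        change (vec M g : WithTop (QLex (n + 1))) < b'.2 at hg'
        have h2 := lt_min hg hg'
        rw [hδ] at h2 hcc
        have h3 : b.1 - b'.1 = (p : MixedField p n) ^ M *
            toMix (y ⟨b, hb, γ, hγ, hγM⟩ - y ⟨b', hb', γ', hγ', hγM'⟩) := by
          rw [map_sub, mul_sub, ← hy, ← hy, sub_sub_sub_cancel_right]
        rw [h3] at hcc
        exact (le_mixVal_iff hδM (r := r ⟨b, hb, γ, hγ, hγM⟩ - r ⟨b', hb', γ', hγ', hγM'⟩) (by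
          rw [map_sub, sub_sub_sub_comm]
          exact dvd_sub (hd _) (hd _))).1 hcc g (WithTop.coe_lt_coe.1 h2))
  have hcC : c ∈ constSeries p n i := by
    intro g hg
    obtain ⟨_, ⟨b, rfl⟩, hgb⟩ := hc2 g hg
    exact hr b g hgb
  refine ⟨b₀.1 + (p : MixedField p n) ^ M * toMix (toInt c), (constMix p n i).add_mem (h𝓑 _ hb₀)
    ((zpow_mul_mem_constMix_iff _ _).2 (toInt_mem_constInt hcC)), fun b hb => ?_⟩
  obtain ⟨γ, hγ, -⟩ := hN b hb
  have hγM : ofLex γ 0 ≤ M := (Int.le_ceil _).trans (by exact_mod_cast hmax _ ⟨b, hb, γ, hγ, rfl⟩)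
  -- a radius with first coordinate below `M` is controlled by `b₀`, the others by the gluing
  rcases hγM.lt_or_eq with hlt | heq
  · have h1 : b₀.1 + (p : MixedField p n) ^ M * toMix (toInt c) - b.1 =
      (p : MixedField p n) ^ M * toMix (toInt c) + (b₀.1 - b.1) := by ring
    rw [h1, hγ]
    refine le_mixVal_add (le_mixVal_of_head_lt hlt _) ?_
    have h2 := hc b₀ hb₀ b hb
    have h3 : γ < γ₀ ∨ γ₀ ≤ γ := lt_or_ge _ _
    rcases h3 with h3 | h3
    · rw [hγ₀, hγ, min_eq_right (WithTop.coe_le_coe.2 h3.le)] at h2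
      exact h2
    · rw [hγ₀, hγ, min_eq_left (WithTop.coe_le_coe.2 h3)] at h2
      obtain ⟨z, hz⟩ := exists_eq_zpow_mul (M := M) (fun δ hδ => by
        rw [WithTop.coe_eq_coe] at hδ
        rwa [← hδ]) h2
      rw [hz]
      exact le_mixVal_of_head_lt hlt _
  · have h1 := hy ⟨b, hb, γ, hγ, heq⟩
    have h2 : b₀.1 + (p : MixedField p n) ^ M * toMix (toInt c) - b.1 =
        (p : MixedField p n) ^ M * toMix (toInt c - y ⟨b, hb, γ, hγ, heq⟩) := by
      rw [map_sub, mul_sub, ← h1]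
      ring
    rw [h2]
    refine hγ.le.trans ((le_mixVal_iff heq (r := c - r ⟨b, hb, γ, hγ, heq⟩) ?_).2 fun g hg => ?_)
    · rw [map_sub, sub_sub_sub_comm, sub_self, zero_sub, dvd_neg]
      exact hd _
    have h3 := hc1 _ ⟨⟨b, hb, γ, hγ, heq⟩, rfl⟩ g (by
      change (vec M g : WithTop (QLex (n + 1))) < b.2
      rw [hγ]
      exact WithTop.coe_lt_coe.2 hg)
    rw [HahnSeries.coeff_sub]
    exact Ideal.mem_span_singleton.1 h3

/-- The fields of constants of the basic field of characteristic zero are spherically complete. -/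
lemma isSC_constMix (i : ℕ) :
    IsSC (mixValuation p n) (constMix p n i : Set (MixedField p n)) := by
  rw [coe_mixValuation]
  intro 𝓑 h𝓑 hc
  rcases 𝓑.eq_empty_or_nonempty with rfl | hne
  · exact ⟨0, (constMix p n i).zero_mem, by simp⟩
  by_cases hub : ∀ N : ℕ, ∃ b ∈ 𝓑, ∀ γ : QLex (n + 1), b.2 = γ → (N : ℚ) ≤ ofLex γ 0
  · exact exists_center_of_unbounded h𝓑 hc hub
  · push Not at hub
    obtain ⟨N, hN⟩ := hub
    exact exists_center_of_bounded h𝓑 hc hne hN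

end CharZero

section CharZero

variable {p n : ℕ} [Fact p.Prime]

lemma inv_mem_constMix {i : ℕ} {x : MixedField p n} (hx : x ∈ constMix p n i) :
    x⁻¹ ∈ constMix p n i :=
  inv_mem_of_approx (v := mixValuation p n) (S := constMix p n i) (isSC_constMix i)
    (fun _ hx hx0 => exists_approx_inv hx hx0) hx

variable (p n) in
/-- The field generated by the `p`-adic limits of series in `t_2, …, t_i` only. -/
noncomputable def mixConst (i : ℕ) : Subfield (MixedField p n) :=
  Subfield.closure (algebraMap (IntegerRing p n) (MixedField p n) ''
    {x | ∀ m : ℕ, ∃ r : LaurentRing p n,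
      (∀ g ∈ r.support, ∀ k : Fin n, i ≤ (k : ℕ) + 1 → ofLex g k = 0) ∧
      AdicCompletion.evalₐ _ m x = Ideal.Quotient.mk _ r})

/-- The field generated by the limits of series consists of their quotients by powers of `p`. -/
lemma coe_mixConst (i : ℕ) : (mixConst p n i : Set (MixedField p n)) = constMix p n i := by
  let F : Subfield (MixedField p n) :=
    { constMix p n i with inv_mem' := fun _ hx => inv_mem_constMix hx }
  have hset : {x : IntegerRing p n | ∀ m : ℕ, ∃ r : LaurentRing p n,
      (∀ g ∈ r.support, ∀ k : Fin n, i ≤ (k : ℕ) + 1 → ofLex g k = 0) ∧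
      AdicCompletion.evalₐ _ m x = Ideal.Quotient.mk _ r} = constInt p n i := by
    ext x
    exact forall_congr' fun m => exists_congr fun r => and_congr Iff.rfl (evalₐ_eq_iff m x r)
  have hF : mixConst p n i = F := by
    refine le_antisymm (Subfield.closure_le.2 ?_) ?_
    · rintro _ ⟨x, hx, rfl⟩
      rw [hset] at hx
      exact toMix_mem_constMix hx
    · rintro x ⟨k, y, hy, hk⟩
      have h1 : toMix y ∈ mixConst p n i := Subfield.subset_closure ⟨y, by rw [hset]; exact hy, rfl⟩
      have h2 : x = toMix y / (p : MixedField p n) ^ k := by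
        rw [← hk, mul_div_cancel_left₀ _ (pow_ne_zero _ pMix_ne_zero)]
      rw [h2]
      exact div_mem h1 (pow_mem (natCast_mem _ p) k)
  rw [hF]
  rfl

lemma mem_mixConst {i : ℕ} {x : MixedField p n} : x ∈ mixConst p n i ↔ x ∈ constMix p n i := by
  rw [← SetLike.mem_coe, coe_mixConst, SetLike.mem_coe]

lemma hasValue_p : HasValue (p : MixedField p n) 1 0 :=
  ⟨1, 0, HahnSeries.order_one, by simp, by simp⟩

variable (p n) in
/-- The basic field of characteristic zero has the required properties. -/
lemma good_zero : Good p n (mixVal (p := p) (n := n)) (mixConst p n) (mixValuation p n) where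
  val_eq x := rfl
  integral x γ hγ k := by
    obtain ⟨m, g, -, rfl⟩ := exists_hasValue_of_mixVal hγ
    refine Fin.cases ⟨m, rfl⟩ (fun k => ⟨ofLex g k, rfl⟩) k
  param i k hk := by
    revert hk
    refine Fin.cases (fun _ => ?_) (fun k hk => ?_) k
    · refine ⟨p, natCast_mem _ p, hasValue_p.mixVal_eq.trans ?_⟩
      rw [WithTop.coe_eq_coe]
      refine qlex_ext fun l => ?_
      refine Fin.cases ?_ (fun l => ?_) l
      · change ((1 : ℤ) : ℚ) = _
        simp
      · rw [vec_succ_apply]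
        change (((0 : ZLex n) : Fin n → ℤ) l : ℚ) = (Pi.single 0 1 : Fin (n + 1) → ℚ) l.succ
        rw [Pi.single_eq_of_ne (Fin.succ_ne_zero l)]
        exact Int.cast_zero
    · set e : ZLex n := toLex (Pi.single k 1) with he
      have hv : HasValue (toMix (toInt (HahnSeries.single e (1 : ℤ_[p])))) 0 e :=
        ⟨HahnSeries.single e 1, 0, HahnSeries.order_single one_ne_zero, by simp, by simp⟩
      refine ⟨_, ?_, hv.mixVal_eq.trans ?_⟩
      · refine mem_mixConst.2 (toMix_mem_constMix (toInt_mem_constInt ?_))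
        intro g hg l hl
        have : g = e := by
          by_contra hne
          exact hg (HahnSeries.coeff_single_of_ne hne)
        have hne : l ≠ k := by
          rintro rfl
          rw [Fin.val_succ] at hk
          omega
        rw [this]
        exact Pi.single_eq_of_ne hne 1
      · rw [WithTop.coe_eq_coe]
        refine qlex_ext fun l => ?_
        refine Fin.cases ?_ (fun l => ?_) l
        · change ((0 : ℤ) : ℚ) = (Pi.single k.succ 1 : Fin (n + 1) → ℚ) 0
          rw [Pi.single_eq_of_ne (Fin.succ_ne_zero k).symm, Int.cast_zero]
        · rw [vec_succ_apply]
          change (((Pi.single k 1 : Fin n → ℤ) l : ℤ) : ℚ) =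
            (Pi.single k.succ 1 : Fin (n + 1) → ℚ) l.succ
          by_cases h : l = k
          · subst h
            simp
          · rw [Pi.single_eq_of_ne h, Pi.single_eq_of_ne (fun h' => h (Fin.succ_injective _ h')),
              Int.cast_zero]
  coord i k hik := by
    revert hik
    refine Fin.cases (fun hik => Or.inr ⟨rfl, ?_⟩) (fun k hik => Or.inl ?_) k
    -- `p` is a parameter already of `B(0)`, which is equal to `B(1)`
    · have hi : ∀ x ∈ constSeries p n 1, x ∈ constSeries p n 0 := fun x hx g hg k _ =>
        hx g hg k (Nat.le_add_left _ _)
      intro x hx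
      rw [mem_mixConst] at hx ⊢
      obtain ⟨k, y, hy, hk⟩ := hx
      refine ⟨k, y, fun m => ?_, hk⟩
      obtain ⟨r, hr, hd⟩ := hy m
      exact ⟨r, hi r hr, hd⟩
    · intro x hx γ hγ
      obtain ⟨m, g, h, rfl⟩ := exists_hasValue_of_mixVal hγ
      rw [vec_succ_apply, isSupp_of_hasValue (mem_mixConst.1 hx) h k (by simpa using hik),
        Int.cast_zero]
  residue x hx := by
    obtain ⟨m, g, h, hvec⟩ := exists_hasValue_of_mixVal (γ := 0) hx
    rw [← vec_zero] at hvec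
    obtain ⟨rfl, rfl⟩ := vec_injective hvec.symm
    obtain ⟨r, z, hr, -, hxr⟩ := h
    rw [zpow_zero, one_mul] at hxr
    refine ⟨((r.coeff 0).zmodRepr : ℤ), ?_⟩
    have h1 : x - (((r.coeff 0).zmodRepr : ℤ) : MixedField p n) =
        toMix (toInt r + (p : IntegerRing p n) * z - ((r.coeff 0).zmodRepr : IntegerRing p n)) := by
      rw [map_sub, map_natCast, hxr, Int.cast_natCast]
    rw [h1]
    refine zero_lt_mixVal (r := r - ((r.coeff 0).zmodRepr : LaurentRing p n)) ?_ fun g hg => ?_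
    · refine ⟨z, ?_⟩
      rw [map_sub, map_natCast]
      ring
    · have hcast : (((r.coeff 0).zmodRepr : ℕ) : LaurentRing p n).coeff g =
          if g = 0 then ((r.coeff 0).zmodRepr : ℤ_[p]) else 0 := by
        rw [← nsmul_one, HahnSeries.coeff_nsmul, Pi.smul_apply, HahnSeries.coeff_one]
        split_ifs <;> simp
      rw [HahnSeries.coeff_sub, hcast]
      rcases hg.lt_or_eq with hlt | rfl
      · rw [if_neg hlt.ne, sub_zero, HahnSeries.coeff_eq_zero_of_lt_order (hr.symm ▸ hlt)]
        exact dvd_zero _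
      · rw [if_pos rfl]
        have := PadicInt.sub_zmodRepr_mem (r.coeff 0)
        rwa [PadicInt.maximalIdeal_eq_span_p, Ideal.mem_span_singleton] at this
  sc i := by
    rw [coe_mixConst]
    exact isSC_constMix i
  mono i j hij := by
    intro x hx
    rw [mem_mixConst] at hx ⊢
    obtain ⟨k, y, hy, hk⟩ := hx
    refine ⟨k, y, fun m => ?_, hk⟩
    obtain ⟨r, hr, hd⟩ := hy m
    exact ⟨r, fun g hg l hl => hr g hg l (hij.trans hl), hd⟩
  top := by
    rw [eq_top_iff]
    intro x _
    rw [mem_mixConst]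
    obtain ⟨m, y, hy⟩ : ∃ (m : ℤ) (y : IntegerRing p n),
        x = (p : MixedField p n) ^ m * toMix y := by
      by_cases hx0 : x = 0
      · exact ⟨0, 0, by simp [hx0]⟩
      · obtain ⟨m, g, r, z, -, -, h⟩ := exists_hasValue hx0
        exact ⟨m, _, h⟩
    rw [hy, zpow_mul_mem_constMix_iff]
    intro m
    obtain ⟨r, hr⟩ := exists_repr m y
    refine ⟨r, fun g hg k hk => absurd k.2 (by omega), hr⟩
  p_pos := by
    have h : mixValuation p n (p : MixedField p n) = _ := hasValue_p.mixVal_eq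
    rw [h, ← WithTop.coe_zero, WithTop.coe_lt_coe, ← vec_zero]
    exact vec_lt_of_lt zero_lt_one _ _

end CharZero

/-- Both basic fields have the required properties. -/
lemma good_basic (p n : ℕ) [Fact p.Prime] (c : CharKind) :
    ∃ v, Good p n (basicField p n c).val (basicField p n c).const v := by
  cases c with
  | zero => exact ⟨mixValuation p n, good_zero p n⟩
  | pos => exact ⟨posValuation p n, good_pos p n⟩

/-! ### The valuation of the algebraic closure -/

namespace BasicField

variable {n : ℕ}

/-- The field `B(i)` as a subfield of the algebraic closure. -/
noncomputable def constBar (B : BasicField n) (i : ℕ) : Subfield B.Closure :=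
  (B.const i).map (algebraMap B.carrier B.Closure)

/-- The field whose intersection with a local field `K` is `K(i)`. -/
noncomputable def constHull (p : ℕ) (B : BasicField n) (i : ℕ) : Subfield B.Closure :=
  if i = 0 then
    B.constBar 0 ⊔ Subfield.closure {z | ∃ m : ℕ, 0 < m ∧ ¬ p ∣ m ∧ z ^ m = 1}
  else (algebraicClosure (B.constBar i) B.Closure).toSubfield

lemma constants_eq (p : ℕ) {B : BasicField n} (K : Subfield B.Closure) (i : ℕ) :
    constants p K i = K ⊓ constHull p B i := rfl

end BasicField

/-- The properties of the basic field in terms of the valuation `w` of the algebraic closure. -/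
structure GoodBar (p : ℕ) {n : ℕ} (B : BasicField n)
    (w : AddValuation B.Closure (WithTop (QLex (n + 1)))) : Prop where
  valBar_eq : ∀ x : B.Closure, valBar x = w x
  integral : ∀ x ∈ B.base, ∀ g : QLex (n + 1), w x = g → ∀ k, ∃ z : ℤ, ofLex g k = z
  param : ∀ (i : ℕ) (k : Fin (n + 1)), (k : ℕ) < i → ∃ t ∈ B.constBar i,
    w t = ((toLex (Pi.single k 1) : QLex (n + 1)) : WithTop (QLex (n + 1)))
  coord : ∀ (i : ℕ) (k : Fin (n + 1)), i ≤ (k : ℕ) →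
    (∀ x ∈ B.constBar i, ∀ g : QLex (n + 1), w x = g → ofLex g k = 0) ∨
      (k = 0 ∧ B.constBar 1 ≤ B.constBar 0)
  residue : ∀ x ∈ B.base, w x = 0 → ∃ m : ℤ, 0 < w (x - m)
  sc : ∀ i, IsSC w (B.constBar i : Set B.Closure)
  mono : ∀ i j, i ≤ j → B.constBar i ≤ B.constBar j
  top : B.constBar (n + 1) = B.base
  p_pos : 0 < w (p : B.Closure)
  conj : ∀ σ : B.Closure ≃ₐ[B.carrier] B.Closure, ∀ x, w (σ x) = w x

lemma IsSC.map {B Ω : Type*} [Field B] [Field Ω] [Algebra B Ω] {Γ : Type*} [AddCommGroup Γ]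
    [LinearOrder Γ] [IsOrderedAddMonoid Γ] {v : AddValuation B (WithTop Γ)}
    {w : AddValuation Ω (WithTop Γ)} (h : ∀ b, w (algebraMap B Ω b) = v b) {S : Set B}
    (hS : IsSC v S) : IsSC w (algebraMap B Ω '' S) := by
  intro 𝓑 h𝓑 hc
  obtain ⟨c, hcS, hb⟩ := hS {b | b.1 ∈ S ∧ (algebraMap B Ω b.1, b.2) ∈ 𝓑} (fun b hb => hb.1) (by
    rintro b ⟨-, hb⟩ b' ⟨-, hb'⟩
    have := hc _ hb _ hb'
    rwa [← map_sub, h] at this)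
  refine ⟨_, ⟨c, hcS, rfl⟩, fun b hbB => ?_⟩
  obtain ⟨x, hx, hxb⟩ := h𝓑 b hbB
  have := hb (x, b.2) ⟨hx, by rw [hxb]; exact hbB⟩
  rwa [← h, map_sub, hxb] at this

lemma qlex_nsmul_div {r : ℕ} (m : ℕ) (hm : 0 < m) (g : QLex r) :
    scale (fun _ => ((m : ℚ))⁻¹) (m • g) = g := by
  refine qlex_ext fun k => ?_
  change ((m : ℚ))⁻¹ * (m • ofLex g k) = ofLex g k
  have : (m : ℚ) ≠ 0 := by positivity
  rw [nsmul_eq_mul]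
  field_simp

/-- The valuation of the basic field extends uniquely to the algebraic closure, and the extension is
the normalised value of the constant coefficient of the minimal polynomial. -/
lemma Good.exists_goodBar {p n : ℕ} {B : BasicField n}
    {v : AddValuation B.carrier (WithTop (QLex (n + 1)))} (h : Good p n B.val B.const v) :
    ∃ w, GoodBar p B w := by
  have hdiv : ∀ (m : ℕ), 0 < m → ∀ g : QLex (n + 1), ∃ g', m • g' = g := by
    intro m hm g
    refine ⟨scale (fun _ => ((m : ℚ))⁻¹) g, qlex_ext fun k => ?_⟩
    change m • (((m : ℚ))⁻¹ * ofLex g k) = ofLex g k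
    have : (m : ℚ) ≠ 0 := by positivity
    rw [nsmul_eq_mul]
    field_simp
  obtain ⟨w, hw⟩ := exists_extension (Ω := B.Closure) hdiv v
  have hsc : IsSC v (Set.univ : Set B.carrier) := by
    have := h.sc (n + 1)
    rwa [h.top] at this
  have hmem : ∀ i (x : B.Closure), x ∈ B.constBar i ↔
      ∃ y ∈ B.const i, algebraMap B.carrier B.Closure y = x := fun i x => Subfield.mem_map
  refine ⟨w, ?_, ?_, ?_, ?_, ?_, ?_, ?_, ?_, ?_, ?_⟩
  · intro x
    have h1 := value_coeff_zero_minpoly hsc hw x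
    have hd : 0 < (minpoly B.carrier x).natDegree :=
      minpoly.natDegree_pos (Algebra.IsIntegral.isIntegral x)
    rw [valBar, h.val_eq, h1]
    cases hx : w x with
    | top =>
      have : (minpoly B.carrier x).natDegree • (⊤ : WithTop (QLex (n + 1))) = ⊤ := by
        obtain ⟨m, hm⟩ := Nat.exists_eq_succ_of_ne_zero hd.ne'
        rw [hm, succ_nsmul, add_top]
      rw [this]
      rfl
    | coe g =>
      rw [← WithTop.coe_nsmul, WithTop.map_coe, qlex_nsmul_div _ hd]
  · rintro _ ⟨x, rfl⟩ g hg k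
    rw [hw] at hg
    exact h.integral x g hg k
  · intro i k hk
    obtain ⟨t, ht, hv⟩ := h.param i k hk
    exact ⟨_, (hmem _ _).2 ⟨t, ht, rfl⟩, (hw t).trans hv⟩
  · intro i k hk
    rcases h.coord i k hk with h1 | ⟨h1, h2⟩
    · left
      intro x hx g hg
      obtain ⟨y, hy, rfl⟩ := (hmem _ _).1 hx
      rw [hw] at hg
      exact h1 y hy g hg
    · exact Or.inr ⟨h1, Subfield.map_le_iff_le_comap.2
        (h2.trans (Subfield.map_le_iff_le_comap.1 le_rfl))⟩
  · rintro _ ⟨x, rfl⟩ hx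
    rw [hw] at hx
    obtain ⟨m, hm⟩ := h.residue x hx
    refine ⟨m, ?_⟩
    rwa [← map_intCast (algebraMap B.carrier B.Closure), ← map_sub, hw]
  · intro i
    have := (h.sc i).map hw
    exact this
  · intro i j hij
    exact Subfield.map_le_iff_le_comap.2 ((h.mono i j hij).trans
      (Subfield.map_le_iff_le_comap.1 le_rfl))
  · rw [constBar, h.top, BasicField.base, RingHom.fieldRange_eq_map]
  · rw [← map_natCast (algebraMap B.carrier B.Closure), hw]
    exact h.p_pos
  · exact value_algEquiv hsc hw

section Subfields

variable {n : ℕ} {B : BasicField n}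

lemma isAlgebraic_of_base_le {k : Subfield B.Closure} (hk : B.base ≤ k) :
    Algebra.IsAlgebraic k B.Closure := by
  refine ⟨fun x => ?_⟩
  obtain ⟨q, hq, hqx⟩ := Algebra.IsAlgebraic.isAlgebraic (R := B.carrier) x
  let f : B.carrier →+* k := (algebraMap B.carrier B.Closure).codRestrict k
    fun b => hk ⟨b, rfl⟩
  refine ⟨q.map f, (Polynomial.map_ne_zero_iff f.injective).2 hq, ?_⟩
  rw [aeval_def, eval₂_map]
  exact hqx

lemma isAlgClosure_of_base_le {k : Subfield B.Closure} (hk : B.base ≤ k) :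
    IsAlgClosure k B.Closure :=
  ⟨AlgebraicClosure.isAlgClosed _, isAlgebraic_of_base_le hk⟩

lemma normal_of_base_le {k : Subfield B.Closure} (hk : B.base ≤ k) : Normal k B.Closure := by
  have := isAlgClosure_of_base_le hk
  exact IsAlgClosure.normal k B.Closure

lemma GoodBar.value_conj {p : ℕ} {w : AddValuation B.Closure (WithTop (QLex (n + 1)))}
    (h : GoodBar p B w) {k : Subfield B.Closure} (hk : B.base ≤ k)
    (σ : B.Closure ≃ₐ[k] B.Closure) (x : B.Closure) : w (σ x) = w x := by
  let σ' : B.Closure ≃ₐ[B.carrier] B.Closure := AlgEquiv.ofRingEquiv (f := σ.toRingEquiv)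
    fun b => σ.commutes (⟨algebraMap B.carrier B.Closure b, hk ⟨b, rfl⟩⟩ : k)
  exact h.conj σ' x

end Subfields

/-! ### Orthogonal families over subfields -/

section OrthSubfield

variable {Ω : Type*} [Field Ω] {Γ : Type*} [AddCommGroup Γ] [LinearOrder Γ] [IsOrderedAddMonoid Γ]
  {w : AddValuation Ω (WithTop Γ)}

lemma isNorm_subfield (w : AddValuation Ω (WithTop Γ)) (k : Subfield Ω) :
    IsNorm (w.comap (algebraMap k Ω)) w := isNorm_of_algebraMap fun _ => rfl

lemma isSC_univ_iff {k : Subfield Ω} :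
    IsSC (w.comap (algebraMap k Ω)) (Set.univ : Set k) ↔ IsSC w (k : Set Ω) := by
  constructor
  · intro h
    have := h.map (v := w.comap (algebraMap k Ω)) (w := w) (fun _ => rfl)
    rw [Set.image_univ] at this
    convert this
    exact Subtype.range_coe.symm
  · intro h 𝓑 _ hc
    obtain ⟨c, hcS, hb⟩ := h ((fun b : k × WithTop Γ => ((b.1 : Ω), b.2)) '' 𝓑)
      (by rintro _ ⟨b, -, rfl⟩; exact b.1.2) (by
        rintro _ ⟨b, hb, rfl⟩ _ ⟨b', hb', rfl⟩
        exact hc b hb b' hb')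
    exact ⟨⟨c, hcS⟩, trivial, fun b hb' => hb _ ⟨b, hb', rfl⟩⟩

/-- The family `ω` lies in `M`, and each element of `M` is a linear combination of `ω` with
coefficients in `k`. -/
def Spans (k M : Subfield Ω) {ι : Type*} [Fintype ι] (ω : ι → Ω) : Prop :=
  (∀ i, ω i ∈ M) ∧ ∀ x ∈ M, ∃ a : ι → k, ∑ i, a i • ω i = x

lemma sum_smul_mem {k M : Subfield Ω} (hkM : k ≤ M) {ι : Type*} [Fintype ι] {ω : ι → Ω}
    (hω : ∀ i, ω i ∈ M) (a : ι → k) : ∑ i, a i • ω i ∈ M :=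
  sum_mem fun i _ => M.mul_mem (hkM (a i).2) (hω i)

lemma relfinrank_eq_card {k M : Subfield Ω} (hkM : k ≤ M) {ι : Type*} [Fintype ι] {ω : ι → Ω}
    (hω : Spans k M ω) (hli : LinearIndependent k ω) : k.relfinrank M = Fintype.card ι := by
  rw [Subfield.relfinrank_eq_finrank_of_le hkM]
  let ω' : ι → Subfield.extendScalars hkM := fun i => ⟨ω i, hω.1 i⟩
  have hli' : LinearIndependent k ω' :=
    LinearIndependent.of_comp (Subfield.extendScalars hkM).val.toLinearMap hli
  refine Module.finrank_eq_card_basis (Module.Basis.mk hli' ?_)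
  rintro ⟨x, hx⟩ -
  obtain ⟨a, ha⟩ := hω.2 x hx
  rw [Submodule.mem_span_range_iff_exists_fun]
  refine ⟨a, Subtype.ext (Eq.trans ?_ ha)⟩
  simp [ω']

/-- Finite extensions of spherically complete fields have orthogonal bases. -/
lemma exists_orth_basis {k M : Subfield Ω} (hk : IsSC w (k : Set Ω)) (hkM : k ≤ M)
    (hfin : k.relfinrank M ≠ 0) :
    ∃ ω : Fin (k.relfinrank M) → Ω, IsOrth k w ω ∧ Spans k M ω := by
  have hN := isNorm_subfield w k
  rw [Subfield.relfinrank_eq_finrank_of_le hkM] at hfin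
  have hF : Module.Finite k (Subfield.extendScalars hkM) := Module.finite_of_finrank_pos (by omega)
  obtain ⟨m, ω, hω, hspan⟩ := exists_isOrth_span hN (isSC_univ_iff.2 hk)
    (Subalgebra.toSubmodule (Subfield.extendScalars hkM).toSubalgebra)
    (Module.Finite.iff_fg.1 hF)
  have hsp : Spans k M ω := by
    constructor
    · intro i
      have : ω i ∈ Submodule.span k (Set.range ω) := Submodule.subset_span ⟨i, rfl⟩
      rw [hspan] at this
      exact this
    · intro x hx
      have : x ∈ Submodule.span k (Set.range ω) := by
        rw [hspan]
        exact hx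
      exact (Submodule.mem_span_range_iff_exists_fun k).1 this
  have hcard := relfinrank_eq_card hkM hsp (hω.linearIndependent hN)
  rw [Fintype.card_fin] at hcard
  subst hcard
  exact ⟨ω, hω, hsp⟩

lemma Spans.coe_eq_span {k M : Subfield Ω} (hkM : k ≤ M) {ι : Type*} [Fintype ι] {ω : ι → Ω}
    (hω : Spans k M ω) : (M : Set Ω) = Submodule.span k (Set.range ω) := by
  ext x
  rw [SetLike.mem_coe, SetLike.mem_coe, Submodule.mem_span_range_iff_exists_fun]
  constructor
  · exact hω.2 x
  · rintro ⟨a, rfl⟩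
    exact sum_smul_mem hkM hω.1 a

/-- Finite extensions of spherically complete fields are spherically complete. -/
lemma isSC_of_finite {k M : Subfield Ω} (hk : IsSC w (k : Set Ω)) (hkM : k ≤ M)
    (hfin : k.relfinrank M ≠ 0) : IsSC w (M : Set Ω) := by
  obtain ⟨ω, hω, hsp⟩ := exists_orth_basis hk hkM hfin
  rw [hsp.coe_eq_span hkM]
  exact hω.isSC_span (isNorm_subfield w k) (isSC_univ_iff.2 hk)

/-- An orthogonal family in `M` spans `M` if each nonzero element of `M` is approximated by a
linear combination. -/
lemma IsOrth.spans_of_approx {k M : Subfield Ω} (hk : IsSC w (k : Set Ω)) (hkM : k ≤ M) {ι : Type*}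
    [Fintype ι] {ω : ι → Ω} (hω : IsOrth k w ω) (hωM : ∀ i, ω i ∈ M)
    (happ : ∀ x ∈ M, x ≠ 0 → ∃ a : ι → k, w x < w (x - ∑ i, a i • ω i)) : Spans k M ω := by
  refine ⟨hωM, fun x hx => ?_⟩
  have hN := isNorm_subfield w k
  have := (hω.isSC_span hN (isSC_univ_iff.2 hk)).mem_of_approx hN
    (V := (Submodule.span k (Set.range ω)).toAddSubgroup) (S := M.toSubring.toAddSubgroup) (by
      intro y hy
      obtain ⟨a, rfl⟩ := (Submodule.mem_span_range_iff_exists_fun k).1 hy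
      exact sum_smul_mem hkM hωM a) (by
      intro y hy hy0
      obtain ⟨a, ha⟩ := happ y hy hy0
      exact ⟨_, (Submodule.mem_span_range_iff_exists_fun k).2 ⟨a, rfl⟩, ha⟩) hx
  exact (Submodule.mem_span_range_iff_exists_fun k).1 this

/-- Criterion for an orthogonal family over `k` to stay orthogonal over `M`: the coefficients that
matter in a linear combination are approximately elements of `k`, up to a common factor. -/
lemma IsOrth.transfer {k M : Subfield Ω} {ι : Type*} [Fintype ι] {ω : ι → Ω} (hω : IsOrth k w ω)
    (H : ∀ i, ∀ b ∈ M, b ≠ 0 → ∃ T : Ω, ∀ j, ∀ b' ∈ M, b' ≠ 0 → w (b' * ω j) = w (b * ω i) →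
      ∃ c ∈ k, w b' < w (b' - c * T)) : IsOrth M w ω := by
  classical
  refine ⟨hω.1, fun a i₀ => ?_⟩
  have hN := isNorm_subfield w k
  by_cases hw0 : w (a i₀ • ω i₀) = ⊤
  · rw [hw0]
    exact le_top
  obtain ⟨i, -, hi⟩ := Finset.exists_min_image Finset.univ (fun j => w (a j • ω j)) ⟨i₀, by simp⟩
  refine le_trans ?_ (hi i₀ (by simp))
  have hne : w (a i • ω i) ≠ ⊤ := ne_top_of_le_ne_top hw0 (hi i₀ (by simp))
  have hai : (a i : Ω) ≠ 0 := by
    intro h0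
    apply hne
    rw [Subfield.smul_def, h0, zero_smul, w.map_zero]
  obtain ⟨T, HT⟩ := H i (a i) (a i).2 hai
  have hc : ∀ j, ∃ c : k, w (a i • ω i) < w (((a j : Ω) - c * T) * ω j) := by
    intro j
    have hωj : w (ω j) ≠ ⊤ := w.ne_top_iff.2 (hω.1 j)
    rcases (hi j (by simp)).lt_or_eq with hlt | heq
    · exact ⟨0, by simpa [Subfield.smul_def] using hlt⟩
    · have haj : (a j : Ω) ≠ 0 := by
        intro h0
        apply hne
        rw [heq, Subfield.smul_def, h0, zero_smul, w.map_zero]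
      obtain ⟨c, hc, hlt⟩ := HT j (a j) (a j).2 haj heq.symm
      refine ⟨⟨c, hc⟩, ?_⟩
      rw [heq, Subfield.smul_def, smul_eq_mul, w.map_mul, w.map_mul]
      rwa [add_lt_add_iff_left_of_ne_top hωj]
  choose c hc using hc
  -- split off the terms of minimal value, whose coefficients are replaced by multiples of `T` by
  -- elements of `k`
  have h1 : ∑ j, a j • ω j = ∑ j, ((a j : Ω) - c j * T) * ω j + T * ∑ j, c j • ω j := by
    rw [Finset.mul_sum, ← Finset.sum_add_distrib]
    refine Finset.sum_congr rfl fun j _ => ?_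
    rw [Subfield.smul_def, Subfield.smul_def, smul_eq_mul, smul_eq_mul]
    ring
  have h2 : w (a i • ω i) < w (∑ j, ((a j : Ω) - c j * T) * ω j) :=
    hN.lt_sum hne fun j _ => hc j
  have h3 : w (T * ∑ j, c j • ω j) ≤ w (a i • ω i) := by
    have h4 := hω.2 c i
    have h5 : w (T * (c i • ω i)) = w (a i • ω i) := by
      have h6 : w (a i • ω i) < w (a i • ω i - T * (c i • ω i)) := by
        refine (hc i).trans_le (le_of_eq (congrArg w ?_))
        rw [Subfield.smul_def, Subfield.smul_def, smul_eq_mul, smul_eq_mul]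
        ring
      rw [w.map_sub_swap] at h6
      exact w.map_eq_of_lt_sub h6
    rw [← h5, w.map_mul, w.map_mul]
    gcongr
  rw [h1]
  by_contra hcon
  rw [not_le] at hcon
  have h4 := (lt_min hcon h2).trans_le (w.map_sub _ _)
  rw [add_sub_cancel_left] at h4
  exact absurd h4 h3.not_gt

end OrthSubfield

universe u

/-! ### Roots of unity -/

section RootsOfUnity

variable {Ω : Type u} [Field Ω] {Γ : Type*} [AddCommGroup Γ] [LinearOrder Γ] [IsOrderedAddMonoid Γ]
  {w : AddValuation Ω (WithTop Γ)}

lemma pos_add_of_nonneg_of_pos {a b : WithTop Γ} (ha : 0 ≤ a) (hb : 0 < b) : 0 < a + b :=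
  hb.trans_le (le_add_of_nonneg_left ha)

lemma pos_add_of_pos_of_nonneg {a b : WithTop Γ} (ha : 0 < a) (hb : 0 ≤ b) : 0 < a + b :=
  ha.trans_le (le_add_of_nonneg_right hb)

/-- The residue field of a valuation. -/
lemma exists_residue (w : AddValuation Ω (WithTop Γ)) :
    ∃ (F : Type u) (_ : Field F) (O : Subring Ω) (res : O →+* F),
      (∀ x, x ∈ O ↔ 0 ≤ w x) ∧ ∀ x : O, res x = 0 ↔ 0 < w x := by
  let O : ValuationSubring Ω := w.toValuation.valuationSubring
  have hO : ∀ x, x ∈ O ↔ 0 ≤ w x := fun x => Iff.rfl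
  suffices key : ∀ x : O, IsLocalRing.residue O x = 0 ↔ 0 < w x from
    ⟨IsLocalRing.ResidueField O, inferInstance, O.toSubring, IsLocalRing.residue O, hO, key⟩
  intro x
  rw [IsLocalRing.residue_eq_zero_iff, IsLocalRing.mem_maximalIdeal, mem_nonunits_iff]
  have hx := (hO x).1 x.2
  constructor
  · intro h
    refine lt_of_le_of_ne hx fun h0 => h ?_
    have hx0 : (x : Ω) ≠ 0 := by
      intro hx0
      rw [hx0, w.map_zero] at h0
      exact WithTop.zero_ne_top h0
    have hinv : (x : Ω)⁻¹ ∈ O := by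
      rw [hO, AddValuation.map_inv, ← h0, neg_zero]
    exact IsUnit.of_mul_eq_one ⟨_, hinv⟩ (Subtype.ext (mul_inv_cancel₀ hx0))
  · intro h hu
    obtain ⟨y, hy⟩ := hu.exists_right_inv
    have h1 : (x : Ω) * y = 1 := congrArg Subtype.val hy
    have h2 : w x + w y = 0 := by rw [← w.map_mul, h1, w.map_one]
    exact absurd h2 (pos_add_of_pos_of_nonneg h ((hO y).1 y.2)).ne'

lemma le_map_pow {x : Ω} (hx : 0 ≤ w x) (m : ℕ) : 0 ≤ w (x ^ m) := by
  rw [w.map_pow]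
  exact nsmul_nonneg hx m

lemma map_natCast_nonneg (w : AddValuation Ω (WithTop Γ)) (m : ℕ) : 0 ≤ w (m : Ω) := by
  induction m with
  | zero => simp
  | succ m ih =>
    rw [Nat.cast_succ]
    exact (le_min ih w.map_one.ge).trans (w.map_add _ _)

lemma map_intCast_nonneg (w : AddValuation Ω (WithTop Γ)) (m : ℤ) : 0 ≤ w (m : Ω) := by
  obtain ⟨k, rfl | rfl⟩ := m.eq_nat_or_neg
  · simpa using map_natCast_nonneg w k
  · simpa using map_natCast_nonneg w k

lemma map_natCast_eq_zero {p : ℕ} [hp : Fact p.Prime] (hw : 0 < w (p : Ω)) {m : ℕ} (hm : ¬ p ∣ m) :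
    w (m : Ω) = 0 := by
  by_contra hne
  have hpos := lt_of_le_of_ne (map_natCast_nonneg w m) (Ne.symm hne)
  have hcop : IsCoprime (m : ℤ) p := by
    rw [Nat.isCoprime_iff_coprime]
    exact ((Nat.Prime.coprime_iff_not_dvd hp.out).2 hm).symm
  obtain ⟨a, b, hab⟩ := hcop
  have h1 : ((a : Ω) * m + b * p : Ω) = 1 := by exact_mod_cast congrArg (Int.cast : ℤ → Ω) hab
  have h2 : 0 < w ((a : Ω) * m + b * p) := by
    refine (lt_min ?_ ?_).trans_le (w.map_add _ _)
    · rw [w.map_mul]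
      exact pos_add_of_nonneg_of_pos (map_intCast_nonneg w a) hpos
    · rw [w.map_mul]
      exact pos_add_of_nonneg_of_pos (map_intCast_nonneg w b) hw
  rw [h1, w.map_one] at h2
  exact lt_irrefl _ h2

lemma map_eq_zero_of_pow_eq_one {z : Ω} {m : ℕ} (hm : 0 < m) (hz : z ^ m = 1) : w z = 0 := by
  have h := congrArg w hz
  rw [w.map_pow, w.map_one] at h
  have hz0 : z ≠ 0 := by
    rintro rfl
    rw [zero_pow hm.ne'] at hz
    exact zero_ne_one hz
  obtain ⟨g, hg⟩ := WithTop.ne_top_iff_exists.1 (w.ne_top_iff.2 hz0)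
  rw [← hg] at h ⊢
  norm_cast at h ⊢
  exact (smul_eq_zero.1 h).resolve_left hm.ne'

lemma pos_mul_sub_mul {a b a' b' : Ω} (ha' : 0 ≤ w a') (hb : 0 ≤ w b) (h : 0 < w (a - b))
    (h' : 0 < w (a' - b')) : 0 < w (a * a' - b * b') := by
  have h1 : a * a' - b * b' = (a - b) * a' + b * (a' - b') := by ring
  rw [h1]
  refine (lt_min ?_ ?_).trans_le (w.map_add _ _)
  · rw [w.map_mul]
    exact pos_add_of_pos_of_nonneg h ha'
  · rw [w.map_mul]
    exact pos_add_of_nonneg_of_pos hb h'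

lemma pos_pow_sub_pow {a b : Ω} (ha : 0 ≤ w a) (hb : 0 ≤ w b) (h : 0 < w (a - b)) (m : ℕ) :
    0 < w (a ^ m - b ^ m) := by
  induction m with
  | zero => simp
  | succ m ih =>
    rw [pow_succ, pow_succ]
    exact pos_mul_sub_mul ha (le_map_pow hb m) ih h

lemma nonneg_of_pos_sub {x y : Ω} (hx : w x = 0) (hy : 0 < w (y - x)) : w y = 0 := by
  rw [← hx] at hy ⊢
  exact w.map_eq_of_lt_sub hy

/-- The difference quotient of `X ^ m` near a unit is congruent to the derivative. -/
lemma pos_geom_sum_sub {x y z : Ω} (hx : w x = 0) (hy : 0 < w (y - x))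
    (hz : 0 < w (z - x)) (m : ℕ) :
    0 < w (∑ i ∈ Finset.range m, y ^ i * z ^ (m - 1 - i) - m * x ^ (m - 1)) := by
  have h1 : (m : Ω) * x ^ (m - 1) = ∑ i ∈ Finset.range m, x ^ i * x ^ (m - 1 - i) := by
    rw [Finset.sum_congr rfl (g := fun _ => x ^ (m - 1)) fun i hi => by
      rw [← pow_add]
      congr 1
      have := Finset.mem_range.1 hi
      omega]
    simp
  rw [h1, ← Finset.sum_sub_distrib]
  refine w.map_lt_sum WithTop.zero_ne_top fun i _ => ?_
  have hy0 := nonneg_of_pos_sub hx hy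
  have hz0 := nonneg_of_pos_sub hx hz
  exact pos_mul_sub_mul (le_map_pow hz0.ge _) (le_map_pow hx.ge _)
    (pos_pow_sub_pow hy0.ge hx.ge hy _) (pos_pow_sub_pow hz0.ge hx.ge hz _)

lemma map_geom_sum_eq_zero {p : ℕ} [Fact p.Prime] (hw : 0 < w (p : Ω)) {x y z : Ω} (hx : w x = 0)
    (hy : 0 < w (y - x)) (hz : 0 < w (z - x)) {m : ℕ} (hm : ¬ p ∣ m) :
    w (∑ i ∈ Finset.range m, y ^ i * z ^ (m - 1 - i)) = 0 := by
  have h1 : w ((m : Ω) * x ^ (m - 1)) = 0 := by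
    rw [w.map_mul, map_natCast_eq_zero hw hm, w.map_pow, hx, smul_zero, add_zero]
  exact nonneg_of_pos_sub h1 (pos_geom_sum_sub hx hy hz m)

/-- Distinct roots of unity of order prime to `p` are not congruent. -/
lemma map_sub_eq_zero_of_pow_eq_one {p : ℕ} [Fact p.Prime] (hw : 0 < w (p : Ω)) {y z : Ω} {m : ℕ}
    (hm0 : 0 < m) (hm : ¬ p ∣ m) (hy : y ^ m = 1) (hz : z ^ m = 1) (hyz : y ≠ z) :
    w (y - z) = 0 := by
  have hy0 := map_eq_zero_of_pow_eq_one (w := w) hm0 hy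
  have hz0 := map_eq_zero_of_pow_eq_one (w := w) hm0 hz
  by_contra hne
  have hpos : 0 < w (y - z) :=
    lt_of_le_of_ne ((le_min hy0.ge hz0.ge).trans (w.map_sub y z)) (Ne.symm hne)
  have h1 := map_geom_sum_eq_zero hw hz0 hpos (z := z) (by simp) hm
  have h2 := (Commute.all y z).geom_sum₂_mul m
  rw [hy, hz, sub_self] at h2
  rw [(mul_eq_zero.1 h2).resolve_right (sub_ne_zero.2 hyz), w.map_zero] at h1
  exact WithTop.top_ne_zero h1

/-- Hensel's lemma for `X ^ m - 1`. -/
lemma exists_root_of_unity {p : ℕ} [Fact p.Prime] (hw : 0 < w (p : Ω)) {M : Subfield Ω}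
    (hM : IsSC w (M : Set Ω)) {x : Ω} (hxM : x ∈ M) (hx : w x = 0) {m : ℕ}
    (hm : ¬ p ∣ m) (hxm : 0 < w (x ^ m - 1)) : ∃ ζ ∈ M, ζ ^ m = 1 ∧ 0 < w (x - ζ) := by
  have hN := isNorm_subfield w M
  have hiso : ∀ y z : Ω, 0 < w (y - x) → 0 < w (z - x) →
      w (y ^ m - z ^ m) = w (y - z) := by
    intro y z hy hz
    rw [← (Commute.all y z).geom_sum₂_mul m, w.map_mul, map_geom_sum_eq_zero hw hx hy hz hm,
      zero_add]
  have hmx : w ((m : Ω) * x ^ (m - 1)) = 0 := by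
    rw [w.map_mul, map_natCast_eq_zero hw hm, w.map_pow, hx, smul_zero, add_zero]
  have hpow : ∀ c, 0 < w (c - x) → 0 < w (c ^ m - 1) := by
    intro c hc
    have h1 := nonneg_of_pos_sub hx hc
    have h2 := (lt_min (pos_pow_sub_pow h1.ge hx.ge hc m) hxm).trans_le (w.map_add _ _)
    rwa [sub_add_sub_cancel] at h2
  have hex : ∃ c ∈ {y : Ω | y ∈ M ∧ 0 < w (y - x)}, c ^ m - 1 = 0 := by
    refine hM.exists_root hN (T := {y : Ω | y ∈ M ∧ 0 < w (y - x)}) (fun y hy => hy.1)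
      ⟨x, hxM, by simp⟩ (fun y => y ^ m - 1) ?_ ?_ ?_
    · intro y hy z hz
      rw [sub_sub_sub_cancel_right, hiso y z hy.2 hz.2]
    · intro c hc y hy hle
      refine ⟨hc, ?_⟩
      have h1 := (lt_min ((hpow y hy.2).trans_le hle) hy.2).trans_le (w.map_add _ _)
      rwa [sub_add_sub_cancel] at h1
    · rintro c ⟨hcM, hc⟩ hfc
      -- a step of the Newton approximation for `X ^ m - 1`, with the derivative at `x`
      set h := -((c ^ m - 1) / ((m : Ω) * x ^ (m - 1))) with hh
      have hwh : w h = w (c ^ m - 1) := by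
        rw [hh, w.map_neg, AddValuation.map_div, hmx, sub_zero]
      have hch : 0 < w (c + h - x) := by
        have h1 := (lt_min hc (hwh ▸ hpow c hc : 0 < w h)).trans_le (w.map_add _ _)
        rwa [sub_add_eq_add_sub] at h1
      refine ⟨c + h, ⟨M.add_mem hcM (M.neg_mem (M.div_mem (M.sub_mem (M.pow_mem hcM m) M.one_mem)
        (M.mul_mem (natCast_mem M m) (M.pow_mem hxM _)))), hch⟩, ?_⟩
      have hmx0 : (m : Ω) * x ^ (m - 1) ≠ 0 := by
        intro h0
        rw [h0, w.map_zero] at hmx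
        exact WithTop.top_ne_zero hmx
      have h1 := (Commute.all (c + h) c).geom_sum₂_mul m
      have h2 : h * ((m : Ω) * x ^ (m - 1)) = -(c ^ m - 1) := by
        rw [hh, neg_mul, div_mul_cancel₀ _ hmx0]
      have h3 : (c + h) ^ m - 1 = h * (∑ i ∈ Finset.range m, (c + h) ^ i * c ^ (m - 1 - i) -
          m * x ^ (m - 1)) := by
        rw [mul_sub, h2]
        linear_combination -h1
      have h4 := pos_geom_sum_sub hx hch hc m
      have h5 : w h ≠ ⊤ := by
        rw [hwh]
        exact w.ne_top_iff.2 hfc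
      have h6 : w h + 0 < w h + w (∑ i ∈ Finset.range m, (c + h) ^ i * c ^ (m - 1 - i) -
          m * x ^ (m - 1)) := by
        rwa [add_lt_add_iff_right_of_ne_top h5]
      rw [add_zero, hwh, ← hwh, ← w.map_mul, ← h3, hwh] at h6
      exact h6
  obtain ⟨ζ, ⟨hζM, hζ⟩, h0⟩ := hex
  exact ⟨ζ, hζM, sub_eq_zero.1 h0, by rwa [w.map_sub_swap]⟩

/-- The residues of units algebraic over a field with prime residue field are roots of unity of
order prime to `p`. -/
lemma exists_pow_sub_one_pos {p : ℕ} [hp : Fact p.Prime] (hw : 0 < w (p : Ω)) {k : Subfield Ω}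
    (hk : ∀ c ∈ k, w c = 0 → ∃ m : ℤ, 0 < w (c - m)) {x : Ω} (hx : w x = 0)
    (hal : IsAlgebraic k x) :
    ∃ m : ℕ, 0 < m ∧ ¬ p ∣ m ∧ 0 < w (x ^ m - 1) := by
  classical
  obtain ⟨F, _, O, res, hO, hres⟩ := exists_residue w
  obtain ⟨q, hq, hqx⟩ := hal
  -- a relation for `x` whose coefficients have minimal value zero
  obtain ⟨j₀, hj₀, hmin⟩ := Finset.exists_min_image q.support (fun j => w (q.coeff j : Ω))
    (Polynomial.support_nonempty.2 hq)
  have hq0 : (q.coeff j₀ : Ω) ≠ 0 := by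
    simpa using Polynomial.mem_support_iff.1 hj₀
  have hc : ∀ j, ∃ m : ℤ, 0 < w ((q.coeff j : Ω) / q.coeff j₀ - m) := by
    intro j
    by_cases hj : q.coeff j = 0
    · exact ⟨0, by simp [hj]⟩
    have h1 : 0 ≤ w ((q.coeff j : Ω) / q.coeff j₀) := by
      rw [AddValuation.map_div, ← LinearOrderedAddCommGroupWithTop.sub_self_eq_zero_iff_ne_top.2
        (w.ne_top_iff.2 hq0), sub_eq_add_neg, sub_eq_add_neg]
      gcongr
      exact hmin j (Polynomial.mem_support_iff.2 hj)
    rcases h1.lt_or_eq with h2 | h2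
    · exact ⟨0, by simpa using h2⟩
    · exact hk _ (k.div_mem (q.coeff j).2 (q.coeff j₀).2) h2.symm
  -- the coefficients are approximately integers, so the residue of `x` is algebraic over the prime
  -- field and therefore an element of a finite field
  choose m hm using hc
  have hsum : ∑ j ∈ q.support, (q.coeff j : Ω) / q.coeff j₀ * x ^ j = 0 := by
    rw [aeval_def, eval₂_eq_sum, Polynomial.sum_def] at hqx
    have h1 : ∑ j ∈ q.support, (q.coeff j : Ω) * x ^ j = 0 := hqx
    rw [← zero_div (q.coeff j₀ : Ω), ← h1, Finset.sum_div]
    exact Finset.sum_congr rfl fun j _ => by ring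
  have hpos : 0 < w (∑ j ∈ q.support, (m j : Ω) * x ^ j) := by
    have h1 : ∑ j ∈ q.support, (m j : Ω) * x ^ j =
        -∑ j ∈ q.support, ((q.coeff j : Ω) / q.coeff j₀ - m j) * x ^ j := by
      simp only [sub_mul, Finset.sum_sub_distrib, hsum, zero_sub, neg_neg]
    rw [h1, w.map_neg]
    refine w.map_lt_sum WithTop.zero_ne_top fun j _ => ?_
    rw [w.map_mul]
    exact pos_add_of_pos_of_nonneg (hm j) (le_map_pow hx.ge j)
  have hp0 : (p : F) = 0 := by
    have h1 := (hres ⟨p, (hO _).2 hw.le⟩).2 hw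
    rwa [show (⟨p, (hO _).2 hw.le⟩ : O) = (p : O) from rfl, map_natCast] at h1
  have : CharP F p := (CharP.charP_iff_prime_eq_zero hp.out).2 hp0
  let _ := ZMod.algebra F p
  set y : F := res ⟨x, (hO _).2 hx.ge⟩ with hy
  have hy0 : y ≠ 0 := by
    intro h0
    have := (hres _).1 h0
    rw [hx] at this
    exact lt_irrefl _ this
  have hint : IsIntegral (ZMod p) y := by
    rw [← isAlgebraic_iff_isIntegral]
    refine ⟨∑ j ∈ q.support, C ((m j : ℤ) : ZMod p) * X ^ j, ?_, ?_⟩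
    · intro h0
      have h1 := congrArg (fun f => Polynomial.coeff f j₀) h0
      simp only [finsetSum_coeff, coeff_C_mul, coeff_X_pow, mul_ite, mul_one, mul_zero,
        Finset.sum_ite_eq, if_pos hj₀, coeff_zero] at h1
      obtain ⟨a, ha⟩ := (ZMod.intCast_zmod_eq_zero_iff_dvd _ _).1 h1
      have h2 : 0 < w ((m j₀ : ℤ) : Ω) := by
        rw [ha, Int.cast_mul, w.map_mul, Int.cast_natCast]
        exact pos_add_of_pos_of_nonneg hw (map_intCast_nonneg w a)
      have h3 := (lt_min (hm j₀) h2).trans_le (w.map_add _ _)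
      rw [sub_add_cancel, div_self hq0, w.map_one] at h3
      exact lt_irrefl _ h3
    · have h1 : ∑ j ∈ q.support, (m j : Ω) * x ^ j ∈ O := (hO _).2 hpos.le
      have h2 := (hres ⟨_, h1⟩).2 hpos
      have h3 : (⟨_, h1⟩ : O) = ∑ j ∈ q.support, (m j : O) * (⟨x, (hO _).2 hx.ge⟩ : O) ^ j := by
        apply Subtype.ext
        push_cast
        rfl
      rw [h3, map_sum] at h2
      rw [map_sum, ← h2]
      refine Finset.sum_congr rfl fun j _ => ?_
      rw [map_mul, map_mul, map_pow, map_pow, aeval_C, aeval_X, map_intCast, map_intCast, hy]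
  have : FiniteDimensional (ZMod p) (IntermediateField.adjoin (ZMod p) {y}) :=
    IntermediateField.adjoin.finiteDimensional hint
  have hfin : Finite (IntermediateField.adjoin (ZMod p) {y}) := Module.finite_of_finite (ZMod p)
  have := Fintype.ofFinite (IntermediateField.adjoin (ZMod p) {y})
  have : CharP (IntermediateField.adjoin (ZMod p) {y}) p := charP_of_injective_algebraMap
    (algebraMap (ZMod p) (IntermediateField.adjoin (ZMod p) {y})).injective p
  obtain ⟨f, -, hcard⟩ := FiniteField.card (IntermediateField.adjoin (ZMod p) {y}) p
  have h1 := FiniteField.pow_card_sub_one_eq_one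
    (⟨y, IntermediateField.mem_adjoin_simple_self _ y⟩ : IntermediateField.adjoin (ZMod p) {y})
    (fun h => hy0 (congrArg Subtype.val h))
  rw [hcard] at h1
  have h2 : y ^ (p ^ (f : ℕ) - 1) = 1 := congrArg Subtype.val h1
  have h3 : 1 < p ^ (f : ℕ) := Nat.one_lt_pow f.ne_zero hp.out.one_lt
  have hxO : x ^ (p ^ (f : ℕ) - 1) - 1 ∈ O :=
    O.sub_mem (O.pow_mem ((hO _).2 hx.ge) _) O.one_mem
  refine ⟨p ^ (f : ℕ) - 1, by omega, ?_, (hres ⟨_, hxO⟩).1 ?_⟩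
  · intro hd
    have h4 : p ∣ p ^ (f : ℕ) := dvd_pow_self p f.ne_zero
    have h5 := (Nat.dvd_sub h4 hd)
    rw [Nat.sub_sub_self h3.le] at h5
    exact hp.out.one_lt.ne' (Nat.dvd_one.1 h5)
  · have h4 : (⟨_, hxO⟩ : O) = (⟨x, (hO _).2 hx.ge⟩ : O) ^ (p ^ (f : ℕ) - 1) - 1 := rfl
    rw [h4, map_sub, map_pow, map_one, ← hy, h2, sub_self]

lemma coeff_prod_nonneg {ι : Type*} (s : Finset ι) (f : ι → Polynomial Ω)
    (hf : ∀ i ∈ s, ∀ j, 0 ≤ w ((f i).coeff j)) (j : ℕ) : 0 ≤ w ((∏ i ∈ s, f i).coeff j) := by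
  refine Finset.prod_induction f (fun q : Polynomial Ω => ∀ j, 0 ≤ w (q.coeff j)) ?_ ?_ hf j
  · intro a b ha hb j
    rw [coeff_mul]
    refine w.map_le_sum fun i _ => ?_
    rw [w.map_mul]
    exact add_nonneg (ha _) (hb _)
  · intro j
    rw [coeff_one]
    split_ifs <;> simp

/-- A polynomial of degree less than the number of pairwise incongruent points is controlled by its
values at these points. -/
lemma le_coeff_of_le_eval (s : Finset Ω) (hs : ∀ x ∈ s, 0 ≤ w x)
    (hss : ∀ x ∈ s, ∀ y ∈ s, x ≠ y → w (x - y) = 0) (q : Polynomial Ω) (hq : q.degree < s.card)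
    {g : WithTop Γ} (hg : ∀ x ∈ s, g ≤ w (q.eval x)) (j : ℕ) : g ≤ w (q.coeff j) := by
  classical
  rw [Lagrange.eq_interpolate (s := s) (v := id) Function.injective_id.injOn hq,
    Lagrange.interpolate_apply, finsetSum_coeff]
  refine w.map_le_sum fun x hx => ?_
  rw [coeff_C_mul, w.map_mul]
  refine le_add_of_le_of_nonneg (hg x hx) (coeff_prod_nonneg _ _ (fun y hy i => ?_) j)
  obtain ⟨hyx, hys⟩ := Finset.mem_erase.1 hy
  rw [Lagrange.basisDivisor, coeff_C_mul, w.map_mul]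
  have h1 : w ((id x - id y)⁻¹) = 0 := by
    rw [AddValuation.map_inv]
    simp [hss x hx y hys hyx.symm]
  rw [h1, zero_add, coeff_sub]
  refine (le_min ?_ ?_).trans (w.map_sub _ _)
  · rw [coeff_X]
    split_ifs <;> simp
  · rw [coeff_C]
    split_ifs
    · exact hs y hys
    · simp

end RootsOfUnity

/-! ### Fields of constants in the algebraic closure -/

/-- The coordinate `k` of a vector, as a homomorphism. -/
def coordHom {r : ℕ} (k : Fin r) : QLex r →+ ℚ where
  toFun x := ofLex x k
  map_zero' := rfl
  map_add' _ _ := rfl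

lemma coordHom_apply {r : ℕ} (k : Fin r) (x : QLex r) : coordHom k x = ofLex x k := rfl

/-- The value group of a subfield. -/
def valueGroup {Ω : Type*} [Field Ω] {Γ : Type*} [AddCommGroup Γ] [LinearOrder Γ]
    [IsOrderedAddMonoid Γ] (w : AddValuation Ω (WithTop Γ)) (k : Subfield Ω) : AddSubgroup Γ where
  carrier := {g | ∃ t ∈ k, w t = g}
  zero_mem' := ⟨1, k.one_mem, w.map_one⟩
  add_mem' := by
    rintro g g' ⟨t, ht, htg⟩ ⟨t', ht', htg'⟩
    exact ⟨t * t', k.mul_mem ht ht', by rw [w.map_mul, htg, htg', WithTop.coe_add]⟩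
  neg_mem' := by
    rintro g ⟨t, ht, htg⟩
    exact ⟨t⁻¹, k.inv_mem ht, by
      rw [AddValuation.map_inv, htg]
      rfl⟩

lemma mem_valueGroup {Ω : Type*} [Field Ω] {Γ : Type*} [AddCommGroup Γ] [LinearOrder Γ]
    [IsOrderedAddMonoid Γ] {w : AddValuation Ω (WithTop Γ)} {k : Subfield Ω} {g : Γ} :
    g ∈ valueGroup w k ↔ ∃ t ∈ k, w t = g := Iff.rfl

lemma value_div {Ω : Type*} [Field Ω] {Γ : Type*} [AddCommGroup Γ] [LinearOrder Γ]
    [IsOrderedAddMonoid Γ] {w : AddValuation Ω (WithTop Γ)} {x y : Ω} {g g' : Γ} (hx : w x = g)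
    (hy : w y = g') : w (x / y) = ((g - g' : Γ) : WithTop Γ) := by
  rw [AddValuation.map_div, hx, hy]
  rfl

/-- If all values of `k` have vanishing coordinate `l`, so have the values of all elements algebraic
over `k`. -/
lemma coord_eq_zero_of_isAlgebraic {Ω : Type*} [Field Ω] {r : ℕ}
    {w : AddValuation Ω (WithTop (QLex r))} {k : Subfield Ω} {l : Fin r}
    (hk : ∀ x ∈ k, ∀ g : QLex r, w x = g → ofLex g l = 0) {x : Ω} (hx : IsAlgebraic k x)
      {g : QLex r}
    (hg : w x = g) : ofLex g l = 0 := by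
  have hx0 : x ≠ 0 := by
    rintro rfl
    rw [w.map_zero] at hg
    exact WithTop.top_ne_coe hg
  obtain ⟨m, hm, a, -, h⟩ := exists_nsmul_value_eq w hx0 hx
  rw [hg, ← WithTop.coe_nsmul] at h
  have h1 := hk a a.2 _ h.symm
  rw [← coordHom_apply, map_nsmul, coordHom_apply] at h1
  exact (smul_eq_zero.1 h1).resolve_left hm.ne'

section

variable {p n : ℕ} {B : BasicField n} {w : AddValuation B.Closure (WithTop (QLex (n + 1)))}

lemma constBar_le_base (i : ℕ) : B.constBar i ≤ B.base := by
  rintro x hx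
  obtain ⟨y, -, rfl⟩ := Subfield.mem_map.1 hx
  exact ⟨y, rfl⟩

lemma mem_constHull {i : ℕ} (hi : i ≠ 0) {x : B.Closure} :
    x ∈ constHull p B i ↔ IsAlgebraic (B.constBar i) x := by
  rw [constHull, if_neg hi]
  exact mem_algebraicClosure_iff

lemma isAlgebraic_of_pow_eq_one {Ω : Type*} [Field Ω] (k : Subfield Ω) {z : Ω} {m : ℕ} (hm : 0 < m)
    (hz : z ^ m = 1) : IsAlgebraic k z := by
  refine ⟨X ^ m - 1, (monic_X_pow_sub_C (1 : k) hm.ne').ne_zero, ?_⟩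
  simp [hz]

lemma isAlgebraic_of_mem_constHull {i : ℕ} {x : B.Closure} (hx : x ∈ constHull p B i) :
    IsAlgebraic (B.constBar i) x := by
  by_cases hi : i = 0
  · subst hi
    have h1 : constHull p B 0 ≤ (algebraicClosure (B.constBar 0) B.Closure).toSubfield := by
      rw [constHull, if_pos rfl]
      refine sup_le ?_ (Subfield.closure_le.2 ?_)
      · intro y hy
        exact mem_algebraicClosure_iff.2 (isAlgebraic_algebraMap (⟨y, hy⟩ : B.constBar 0))
      · rintro z ⟨m, hm, -, hz⟩
        exact mem_algebraicClosure_iff.2 (isAlgebraic_of_pow_eq_one _ hm hz)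
    exact mem_algebraicClosure_iff.1 (h1 hx)
  · exact (mem_constHull hi).1 hx

lemma isAlgebraic_mono {Ω : Type*} [Field Ω] {k M : Subfield Ω} (h : k ≤ M) {x : Ω}
    (hx : IsAlgebraic k x) : IsAlgebraic M x := by
  obtain ⟨q, hq, hqx⟩ := hx
  refine ⟨q.map (Subfield.inclusion h), (Polynomial.map_ne_zero_iff
    (Subfield.inclusion h).injective).2 hq, ?_⟩
  rw [aeval_def, eval₂_map]
  exact hqx

lemma constBar_le_constHull (i : ℕ) : B.constBar i ≤ constHull p B i := by
  by_cases hi : i = 0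
  · subst hi
    rw [constHull, if_pos rfl]
    exact le_sup_left
  · intro x hx
    exact (mem_constHull hi).2 (isAlgebraic_algebraMap (⟨x, hx⟩ : B.constBar i))

lemma mem_constHull_of_pow_eq_one (i : ℕ) {z : B.Closure} {m : ℕ} (hm : 0 < m) (hp : ¬ p ∣ m)
    (hz : z ^ m = 1) : z ∈ constHull p B i := by
  by_cases hi : i = 0
  · subst hi
    rw [constHull, if_pos rfl]
    exact (le_sup_right : _ ≤ B.constBar 0 ⊔ _) (Subfield.subset_closure ⟨m, hm, hp, hz⟩)
  · exact (mem_constHull hi).2 (isAlgebraic_of_pow_eq_one _ hm hz)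

namespace GoodBar

lemma constHull_mono (h : GoodBar p B w) {i j : ℕ} (hij : i ≤ j) :
    constHull p B i ≤ constHull p B j := by
  by_cases hj : j = 0
  · subst hj
    rw [Nat.le_zero.1 hij]
  · intro x hx
    exact (mem_constHull hj).2 (isAlgebraic_mono (h.mono i j hij) (isAlgebraic_of_mem_constHull hx))

lemma constHull_top (h : GoodBar p B w) : constHull p B (n + 1) = ⊤ := by
  rw [eq_top_iff]
  intro x _
  rw [mem_constHull (Nat.succ_ne_zero n), h.top]
  exact (isAlgebraic_of_base_le le_rfl).isAlgebraic x

lemma constants_top (h : GoodBar p B w) (K : Subfield B.Closure) : constants p K (n + 1) = K := by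
  rw [constants_eq, h.constHull_top, inf_top_eq]

/-- Each field of constants `B(i)` has an index `i'` such that the values have no coordinates from
`i'` on; `i' = i` except that `i' = 1` for `i = 0` in characteristic zero. -/
lemma exists_index (h : GoodBar p B w) (i : ℕ) : ∃ i', B.constBar i' = B.constBar i ∧
    ∀ k : Fin (n + 1), i' ≤ (k : ℕ) → ∀ x ∈ B.constBar i, ∀ g : QLex (n + 1), w x = g →
      ofLex g k = 0 := by
  by_cases hex : ∃ k : Fin (n + 1), i ≤ (k : ℕ) ∧ k = 0 ∧ B.constBar 1 ≤ B.constBar 0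
  · obtain ⟨k, hk, rfl, hle⟩ := hex
    have hi : i = 0 := by simpa using hk
    subst hi
    refine ⟨1, le_antisymm hle (h.mono 0 1 zero_le_one), fun k hk x hx => ?_⟩
    rcases h.coord 1 k hk with h1 | ⟨rfl, -⟩
    · exact h1 x (h.mono 0 1 zero_le_one hx)
    · simp at hk
  · push Not at hex
    refine ⟨i, rfl, fun k hk x hx => ?_⟩
    rcases h.coord i k hk with h1 | ⟨rfl, h1⟩
    · exact h1 x hx
    · exact absurd h1 (hex 0 hk rfl)

lemma exists_monomial (h : GoodBar p B w) (i : ℕ) (z : Fin (n + 1) → ℤ)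
    (hz : ∀ k : Fin (n + 1), i ≤ (k : ℕ) → z k = 0) :
    ∃ t ∈ B.constBar i, w t = ((toLex fun k => (z k : ℚ) : QLex (n + 1)) : WithTop _) := by
  rw [← mem_valueGroup]
  have h1 : (toLex fun k => (z k : ℚ) : QLex (n + 1)) =
      ∑ k, z k • (toLex (Pi.single k 1) : QLex (n + 1)) := by
    refine qlex_ext fun l => ?_
    rw [← coordHom_apply, ← coordHom_apply, map_sum]
    simp only [map_zsmul, coordHom_apply, ofLex_toLex]
    rw [Finset.sum_eq_single l]
    · simp
    · intro k _ hkl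
      rw [Pi.single_eq_of_ne hkl.symm, smul_zero]
    · simp
  rw [h1]
  refine AddSubgroup.sum_mem _ fun k _ => ?_
  by_cases hk : i ≤ (k : ℕ)
  · rw [hz k hk, zero_zsmul]
    exact AddSubgroup.zero_mem _
  · exact AddSubgroup.zsmul_mem _ (h.param i k (not_le.1 hk)) _

/-- An element of `B` is approximately an element of `B(i)` if its value has only the coordinates
of such an element. -/
lemma exists_const_approx (h : GoodBar p B w) (i : ℕ) {x : B.Closure} (hx : x ∈ B.base)
    {g : QLex (n + 1)} (hg : w x = g) (hgi : ∀ k : Fin (n + 1), i ≤ (k : ℕ) → ofLex g k = 0) :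
    ∃ c ∈ B.constBar i, w x < w (x - c) := by
  choose z hz using h.integral x hx g hg
  obtain ⟨t, ht, hwt⟩ := h.exists_monomial i z fun k hk => by
    have := (hz k).symm.trans (hgi k hk)
    exact_mod_cast this
  have hgt : (toLex fun k => (z k : ℚ) : QLex (n + 1)) = g := qlex_ext fun k => (hz k).symm
  rw [hgt] at hwt
  have ht0 : t ≠ 0 := by
    rintro rfl
    rw [w.map_zero] at hwt
    exact WithTop.top_ne_coe hwt
  have hu : w (x / t) = 0 := by
    rw [value_div hg hwt, sub_self, WithTop.coe_zero]
  obtain ⟨m, hm⟩ := h.residue _ (B.base.div_mem hx (constBar_le_base i ht)) hu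
  refine ⟨m * t, (B.constBar i).mul_mem (intCast_mem _ m) ht, ?_⟩
  have h1 : x - m * t = (x / t - m) * t := by field_simp
  rw [h1, w.map_mul, hwt, hg]
  calc (g : WithTop (QLex (n + 1))) = 0 + g := (zero_add _).symm
    _ < w (x / t - m) + g := by rwa [add_lt_add_iff_left_of_ne_top WithTop.coe_ne_top]

/-- The field `B(i)` is algebraically closed in `B`: the values of elements algebraic over `B(i)`
have no further coordinates, so these elements are approximated by elements of `B(i)`. -/
lemma base_inf_constHull (h : GoodBar p B w) (i : ℕ) :
    B.base ⊓ constHull p B i = B.constBar i := by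
  refine le_antisymm ?_ (le_inf (constBar_le_base i) (constBar_le_constHull i))
  obtain ⟨i', heq, hz⟩ := h.exists_index i
  intro x hx
  have hN := isNorm_subfield w B.base
  refine (h.sc i).mem_of_approx hN (V := (B.constBar i).toSubring.toAddSubgroup)
    (S := (B.base ⊓ constHull p B i).toSubring.toAddSubgroup)
    (le_inf (constBar_le_base i) (constBar_le_constHull i)) ?_ hx
  rintro y ⟨hyb, hyc⟩ hy0
  obtain ⟨g, hg⟩ := WithTop.ne_top_iff_exists.1 (w.ne_top_iff.2 hy0)
  obtain ⟨c, hc, hlt⟩ := h.exists_const_approx i' hyb hg.symm fun k hk =>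
    coord_eq_zero_of_isAlgebraic (hz k hk) (isAlgebraic_of_mem_constHull hyc) hg.symm
  exact ⟨c, heq ▸ hc, hlt⟩

lemma constants_base (h : GoodBar p B w) (i : ℕ) : constants p B.base i = B.constBar i :=
  h.base_inf_constHull i

/-- An orthogonal family of constants over `B(i)` is orthogonal over `B`. -/
lemma orth_base (h : GoodBar p B w) (i : ℕ) {ι : Type*} [Fintype ι] {ω : ι → B.Closure}
    (hω : IsOrth (B.constBar i) w ω) (hal : ∀ j, IsAlgebraic (B.constBar i) (ω j)) :
    IsOrth B.base w ω := by
  obtain ⟨i', heq, hz⟩ := h.exists_index i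
  refine hω.transfer fun j b hb hb0 => ?_
  obtain ⟨g, hg⟩ := WithTop.ne_top_iff_exists.1 (w.ne_top_iff.2 hb0)
  choose z hzg using h.integral b hb g hg.symm
  -- the part of the value of `b` which is invisible for the constants
  obtain ⟨T, hT, hwT⟩ := h.exists_monomial (n + 1) (fun k => if i' ≤ (k : ℕ) then z k else 0)
    fun k hk => absurd k.2 (by omega)
  set g' : QLex (n + 1) := toLex fun k => (((if i' ≤ (k : ℕ) then z k else 0 : ℤ)) : ℚ) with hg'
  have hT0 : T ≠ 0 := by
    rintro rfl
    rw [w.map_zero] at hwT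
    exact WithTop.top_ne_coe hwT
  refine ⟨T, fun l b' hb' hb0' hbb' => ?_⟩
  obtain ⟨γ, hγ⟩ := WithTop.ne_top_iff_exists.1 (w.ne_top_iff.2 hb0')
  obtain ⟨a, ha⟩ := WithTop.ne_top_iff_exists.1 (w.ne_top_iff.2 (hω.1 l))
  obtain ⟨a', ha'⟩ := WithTop.ne_top_iff_exists.1 (w.ne_top_iff.2 (hω.1 j))
  rw [w.map_mul, w.map_mul, ← hγ, ← ha, ← hg, ← ha', ← WithTop.coe_add, ← WithTop.coe_add,
    WithTop.coe_eq_coe] at hbb'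
  have hval : w (b' / T) = ((γ - g' : QLex (n + 1)) : WithTop (QLex (n + 1))) :=
    value_div hγ.symm hwT
  have hTb : T ∈ B.base := constBar_le_base _ hT
  obtain ⟨c, hc, hlt⟩ := h.exists_const_approx i' (B.base.div_mem hb' hTb) hval fun k hk => by
    have h1 := coord_eq_zero_of_isAlgebraic (hz k hk) (hal l) ha.symm
    have h2 := coord_eq_zero_of_isAlgebraic (hz k hk) (hal j) ha'.symm
    have h3 := congrArg (coordHom k) hbb'
    rw [map_add, map_add, coordHom_apply, coordHom_apply, coordHom_apply, coordHom_apply, h1, h2,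
      add_zero, add_zero] at h3
    rw [← coordHom_apply, map_sub, coordHom_apply, coordHom_apply, h3, hg', ofLex_toLex, if_pos hk,
      hzg, sub_self]
  refine ⟨c, heq ▸ hc, ?_⟩
  have h1 : b' - c * T = (b' / T - c) * T := by field_simp
  have h2 : w b' = w (b' / T) + w T := by rw [← w.map_mul, div_mul_cancel₀ _ hT0]
  rw [h1, w.map_mul, h2, add_lt_add_iff_left_of_ne_top (w.ne_top_iff.2 hT0)]
  exact hlt

/-- The fields of constants of a local field are finite over those of the basic field. -/
lemma relfinrank_constants_ne_zero (h : GoodBar p B w) {M : Subfield B.Closure} (hM : IsLF M)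
    (i : ℕ) : (B.constBar i).relfinrank (constants p M i) ≠ 0 := by
  classical
  have hle : B.constBar i ≤ constants p M i :=
    le_inf ((constBar_le_base i).trans hM.base_le) (constBar_le_constHull i)
  have hN := isNorm_subfield w (B.constBar i)
  have hNb := isNorm_subfield w B.base
  have hfin := hM.finite
  rw [Subfield.relfinrank_eq_finrank_of_le hM.base_le] at hfin
  have hF : Module.Finite B.base (Subfield.extendScalars hM.base_le) :=
    Module.finite_of_finrank_pos (by omega)
  rw [Subfield.relfinrank_eq_finrank_of_le hle]
  set H := Subfield.extendScalars hle with hH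
  -- linearly independent constants can be made orthogonal, and are then linearly independent over
  -- `B`
  have hrank : Module.rank (B.constBar i) H ≤
      (Module.finrank B.base (Subfield.extendScalars hM.base_le) : ℕ) := by
    refine rank_le fun s hs => ?_
    have hs' : LinearIndependent (B.constBar i) (fun x : s => (x.1 : B.Closure)) :=
      hs.map' H.val.toLinearMap (LinearMap.ker_eq_bot.2 H.val.injective)
    obtain ⟨m, ω, hω, hspan⟩ := exists_isOrth_span hN (isSC_univ_iff.2 (h.sc i))
      (Submodule.span (B.constBar i) (Set.range fun x : s => (x.1 : B.Closure)))
      ⟨Finset.univ.image fun x : s => (x.1 : B.Closure), by simp⟩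
    have hωH : ∀ j, ω j ∈ constants p M i := by
      intro j
      have h1 : ω j ∈ Submodule.span (B.constBar i) (Set.range fun x : s => (x.1 : B.Closure)) := by
        rw [← hspan]
        exact Submodule.subset_span ⟨j, rfl⟩
      have h2 : Submodule.span (B.constBar i) (Set.range fun x : s => (x.1 : B.Closure)) ≤
          Subalgebra.toSubmodule H.toSubalgebra := by
        rw [Submodule.span_le]
        rintro _ ⟨x, rfl⟩
        exact x.1.2
      exact h2 h1
    have hcard : m = s.card := by
      have h1 := finrank_span_eq_card hs'
      have h2 := finrank_span_eq_card (hω.linearIndependent hN)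
      rw [hspan, h1, Fintype.card_fin, Fintype.card_coe] at h2
      exact h2.symm
    have hωb := (h.orth_base i hω fun j =>
      isAlgebraic_of_mem_constHull (p := p) (hωH j).2).linearIndependent hNb
    let ω' : Fin m → Subfield.extendScalars hM.base_le := fun j => ⟨ω j, (hωH j).1⟩
    have hli : LinearIndependent B.base ω' :=
      LinearIndependent.of_comp (Subfield.extendScalars hM.base_le).val.toLinearMap hωb
    have := hli.fintype_card_le_finrank
    rw [Fintype.card_fin] at this
    exact hcard ▸ this
  have hHfin : Module.Finite (B.constBar i) H :=
    Module.rank_lt_aleph0_iff.1 (hrank.trans_lt (Cardinal.natCast_lt_aleph0))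
  exact Module.finrank_pos.ne'

end GoodBar

end

/-! ### Unramified constants have integral values -/

section

variable {p n : ℕ} {B : BasicField n} {w : AddValuation B.Closure (WithTop (QLex (n + 1)))}

lemma lt_sub_mul_of_pos {Ω : Type*} [Field Ω] {Γ : Type*} [AddCommGroup Γ] [LinearOrder Γ]
    [IsOrderedAddMonoid Γ] {w : AddValuation Ω (WithTop Γ)} {x y c : Ω} (hy : y ≠ 0)
    (hxy : w x = w y) (h : 0 < w (x / y - c)) : w x < w (x - c * y) := by
  have h1 : x - c * y = (x / y - c) * y := by field_simp
  rw [h1, w.map_mul, hxy]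
  calc w y = 0 + w y := (zero_add _).symm
    _ < w (x / y - c) + w y := by rwa [add_lt_add_iff_left_of_ne_top (w.ne_top_iff.2 hy)]

/-- The powers of a root of unity of order prime to `p`, up to its degree, are orthogonal: the
conjugates are not congruent to each other. -/
lemma aeval_le_coeff [Fact p.Prime] {k Ω : Type*} [Field k] [Field Ω] [Algebra k Ω] [Normal k Ω]
    {Γ : Type*} [AddCommGroup Γ] [LinearOrder Γ] [IsOrderedAddMonoid Γ]
    {w : AddValuation Ω (WithTop Γ)} (hw : 0 < w (p : Ω))
    (hσ : ∀ (σ : Ω ≃ₐ[k] Ω) (x : Ω), w (σ x) = w x) {ζ : Ω} {m : ℕ} (hm0 : 0 < m) (hm : ¬ p ∣ m)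
    (hζ : ζ ^ m = 1) {q : k[X]} (hq : q.degree < (minpoly k ζ).degree) (j : ℕ) :
    w (aeval ζ q) ≤ w (algebraMap k Ω (q.coeff j)) := by
  classical
  have hmΩ : (m : Ω) ≠ 0 := by
    intro h0
    have := map_natCast_eq_zero hw hm
    rw [h0, w.map_zero] at this
    exact WithTop.top_ne_zero this
  have hmk : (m : k) ≠ 0 := by
    intro h0
    apply hmΩ
    rw [← map_natCast (algebraMap k Ω), h0, map_zero]
  have hdvd : minpoly k ζ ∣ X ^ m - 1 := minpoly.dvd k ζ (by simp [hζ])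
  have hsep : (minpoly k ζ).Separable := by
    refine Separable.of_dvd ?_ hdvd
    have := separable_X_pow_sub_C (1 : k) hmk one_ne_zero
    rwa [C_1] at this
  have hint : IsIntegral k ζ := Normal.isIntegral inferInstance ζ
  set s := ((minpoly k ζ).rootSet Ω).toFinset with hs
  have hroot : ∀ y ∈ s, aeval y (minpoly k ζ) = 0 := by
    intro y hy
    rw [hs, Set.mem_toFinset] at hy
    exact aeval_eq_zero_of_mem_rootSet hy
  have hone : ∀ y ∈ s, y ^ m = 1 := by
    intro y hy
    obtain ⟨q, hq⟩ := hdvd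
    have h1 : aeval y (X ^ m - 1 : k[X]) = 0 := by rw [hq, map_mul, hroot y hy, zero_mul]
    simpa [sub_eq_zero] using h1
  have hcard : s.card = (minpoly k ζ).natDegree := by
    rw [hs, Set.toFinset_card]
    exact card_rootSet_eq_natDegree hsep (Normal.splits inferInstance ζ)
  have hconj : ∀ y ∈ s, w (aeval y q) = w (aeval ζ q) := by
    intro y hy
    obtain ⟨σ, hσy⟩ := (isConjRoot_of_aeval_eq_zero hint (hroot y hy)).exists_algEquiv
    have h1 : σ (aeval y q) = aeval ζ q := by
      rw [← hσy]
      exact (aeval_algHom_apply σ y q).symm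
    rw [← hσ σ, h1]
  -- the value of `q` is the same at all conjugates, and these are pairwise incongruent
  have := le_coeff_of_le_eval (w := w) s
    (fun x hx => (map_eq_zero_of_pow_eq_one hm0 (hone x hx)).ge)
    (fun x hx y hy hxy => map_sub_eq_zero_of_pow_eq_one hw hm0 hm (hone x hx) (hone y hy) hxy)
    (q.map (algebraMap k Ω)) (by
      rw [degree_map, hcard]
      exact hq.trans_le degree_le_natDegree) (g := w (aeval ζ q)) (fun x hx => by
      rw [eval_map_algebraMap, hconj x hx]) j
  rwa [coeff_map] at this

/-- Adjoining a root of unity of order prime to `p` does not change the value group. -/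
lemma GoodBar.mem_valueGroup_of_mem_adjoin [Fact p.Prime] (h : GoodBar p B w)
    {k : Subfield B.Closure} (hk : B.base ≤ k) {ζ : B.Closure} {m : ℕ} (hm0 : 0 < m)
    (hm : ¬ p ∣ m) (hζ : ζ ^ m = 1) {y : B.Closure} (hy : y ∈ IntermediateField.adjoin k {ζ})
    {g : QLex (n + 1)} (hg : w y = g) : g ∈ valueGroup w k := by
  have hNk : Normal k B.Closure := normal_of_base_le hk
  have hint : IsIntegral k ζ := Normal.isIntegral hNk ζ
  have hy2 : y ∈ (IntermediateField.adjoin k {ζ}).toSubalgebra := hy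
  rw [IntermediateField.adjoin_simple_toSubalgebra_of_isAlgebraic hint.isAlgebraic,
    Algebra.adjoin_singleton_eq_range_aeval] at hy2
  obtain ⟨q, rfl⟩ := hy2
  set r := q %ₘ minpoly k ζ with hr
  have hqr : aeval ζ q = aeval ζ r := by
    rw [hr, modByMonic_eq_sub_mul_div, map_sub, map_mul, minpoly.aeval, zero_mul, sub_zero]
  have hdeg : r.degree < (minpoly k ζ).degree := degree_modByMonic_lt _ (minpoly.monic hint)
  change w (aeval ζ q) = g at hg
  rw [hqr] at hg
  have hr0 : r ≠ 0 := by
    rintro h0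
    rw [h0, map_zero, w.map_zero] at hg
    exact WithTop.top_ne_coe hg
  have hle := aeval_le_coeff h.p_pos (fun σ x => h.value_conj hk σ x) hm0 hm hζ hdeg
  obtain ⟨j, hj, hmin⟩ := Finset.exists_min_image r.support
    (fun j => w (algebraMap k B.Closure (r.coeff j))) (support_nonempty.2 hr0)
  have hge : w (algebraMap k B.Closure (r.coeff j)) ≤ w (aeval ζ r) := by
    rw [aeval_def, eval₂_eq_sum, sum_def]
    refine w.map_le_sum fun i hi => ?_
    rw [w.map_mul, w.map_pow, map_eq_zero_of_pow_eq_one hm0 hζ, smul_zero, add_zero]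
    exact hmin i hi
  have heq := le_antisymm (hle j) hge
  rw [hg] at heq
  exact ⟨_, (r.coeff j).2, heq.symm⟩

/-- The values of the elements of an unramified extension are integral. -/
lemma GoodBar.integral_of_mem_sup [Fact p.Prime] (h : GoodBar p B w) {x : B.Closure}
    (hx : x ∈ B.base ⊔ Subfield.closure {z : B.Closure | ∃ m : ℕ, 0 < m ∧ ¬ p ∣ m ∧ z ^ m = 1})
    {g : QLex (n + 1)} (hg : w x = g) (k : Fin (n + 1)) : ∃ z : ℤ, ofLex g k = z := by
  set S := {z : B.Closure | ∃ m : ℕ, 0 < m ∧ ¬ p ∣ m ∧ z ^ m = 1} with hS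
  have hx' : x ∈ IntermediateField.adjoin B.base S := by
    have h1 : B.base ⊔ Subfield.closure S ≤ (IntermediateField.adjoin B.base S).toSubfield := by
      refine sup_le (fun y hy => ?_) (Subfield.closure_le.2 (IntermediateField.subset_adjoin _ _))
      exact (IntermediateField.adjoin B.base S).algebraMap_mem ⟨y, hy⟩
    exact h1 hx
  obtain ⟨T, hTS, hxT⟩ := IntermediateField.exists_finset_of_mem_adjoin hx'
  have key : ∀ y ∈ IntermediateField.adjoin B.base (T : Set B.Closure),
      ∀ g : QLex (n + 1), w y = g → ∀ k, ∃ z : ℤ, ofLex g k = z := by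
    refine IntermediateField.induction_on_adjoin_finset T (fun K => ∀ y ∈ K,
      ∀ g : QLex (n + 1), w y = g → ∀ k, ∃ z : ℤ, ofLex g k = z) ?_ ?_
    · intro y hy
      obtain ⟨b, rfl⟩ := IntermediateField.mem_bot.1 hy
      exact h.integral _ b.2
    · intro K ζ hζT hK y hy g hg
      obtain ⟨m, hm0, hm, hζ⟩ := hTS hζT
      obtain ⟨x, hx, hxg⟩ := h.mem_valueGroup_of_mem_adjoin (k := K.toSubfield)
        (fun b hb => K.algebraMap_mem ⟨b, hb⟩) hm0 hm hζ hy hg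
      exact hK x hx g hxg
  exact key x hxT g hg k

/-- The last coordinate of the value of a constant is an integer, and is realised by an element
of `B(n)`. -/
lemma GoodBar.exists_last [Fact p.Prime] (h : GoodBar p B w) {x : B.Closure}
    (hx : x ∈ constHull p B n) (hx0 : x ≠ 0) : ∃ (D : ℤ), ∃ c ∈ B.constBar n,
      w c = (lastVec n D : WithTop (QLex (n + 1))) ∧
      ∀ g : QLex (n + 1), w x = g → ofLex g (Fin.last n) = D := by
  rcases h.coord n (Fin.last n) le_rfl with h1 | ⟨h1, h2⟩
  · refine ⟨0, 1, one_mem _, ?_, fun g hg => ?_⟩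
    · rw [w.map_one, ← WithTop.coe_zero, WithTop.coe_eq_coe]
      refine qlex_ext fun k => ?_
      change (0 : ℚ) = (Pi.single (Fin.last n) ((0 : ℤ) : ℚ) : Fin (n + 1) → ℚ) k
      simp
    · rw [Int.cast_zero]
      exact coord_eq_zero_of_isAlgebraic h1 (isAlgebraic_of_mem_constHull hx) hg
  · have hn : n = 0 := by simpa using congrArg Fin.val h1
    subst hn
    have hx' : x ∈ B.base ⊔ Subfield.closure {z : B.Closure | ∃ m : ℕ, 0 < m ∧ ¬ p ∣ m ∧
      z ^ m = 1} := by
      rw [constHull, if_pos rfl] at hx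
      exact (sup_le_sup_right (constBar_le_base 0) _) hx
    obtain ⟨g, hg⟩ := WithTop.ne_top_iff_exists.1 (w.ne_top_iff.2 hx0)
    obtain ⟨D, hD⟩ := h.integral_of_mem_sup hx' hg.symm (Fin.last 0)
    obtain ⟨c, hc, hwc⟩ := h.exists_monomial 1 (fun _ => D) (fun k hk => absurd k.2 (by omega))
    refine ⟨D, c, h2 hc, ?_, fun g' hg' => ?_⟩
    · rw [hwc, WithTop.coe_eq_coe]
      refine qlex_ext fun k => ?_
      have hk : k = Fin.last 0 := Subsingleton.elim (α := Fin 1) _ _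
      subst hk
      change (D : ℚ) = (Pi.single (Fin.last 0) (D : ℚ) : Fin 1 → ℚ) (Fin.last 0)
      simp
    · rw [← hg, WithTop.coe_eq_coe] at hg'
      rw [← hg', hD]

end

/-! ### Standard pairs -/

section

variable {Ω : Type*} [Field Ω] {Γ : Type*} [AddCommGroup Γ] [LinearOrder Γ] [IsOrderedAddMonoid Γ]
  {w : AddValuation Ω (WithTop Γ)}

/-- The value of a sum of terms with distinct values is the smallest of these. -/
lemma map_sum_le_of_distinct {ι : Type*} (s : Finset ι) (y : ι → Ω)
    (hy : ∀ i ∈ s, ∀ j ∈ s, i ≠ j → y i ≠ 0 → w (y i) ≠ w (y j)) {i : ι} (hi : i ∈ s) :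
    w (∑ j ∈ s, y j) ≤ w (y i) := by
  classical
  obtain ⟨i₀, hi₀, hmin⟩ := Finset.exists_min_image s (fun j => w (y j)) ⟨i, hi⟩
  refine le_trans ?_ (hmin i hi)
  by_cases h0 : y i₀ = 0
  · rw [h0, w.map_zero]
    exact le_top
  have h1 : w (y i₀) < w (∑ j ∈ s.erase i₀, y j) := by
    refine w.map_lt_sum (w.ne_top_iff.2 h0) fun j hj => ?_
    obtain ⟨hne, hjs⟩ := Finset.mem_erase.1 hj
    exact lt_of_le_of_ne (hmin j hjs) (hy i₀ hi₀ j hjs hne.symm h0)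
  rw [← Finset.add_sum_erase s y hi₀, w.map_add_eq_of_lt_left h1]

/-- A product family is orthogonal if the values belonging to different second factors
never coincide. -/
lemma IsOrth.mul_of_distinct {k : Subfield Ω} {ι κ : Type*} [Fintype ι] [Fintype κ] {ω : ι → Ω}
    (hω : IsOrth k w ω) {η : κ → Ω} (hη : ∀ i, η i ≠ 0)
    (H : ∀ i i', i ≠ i' → ∀ j j', ∀ a ∈ k, ∀ a' ∈ k, a ≠ 0 →
      w (a * ω j * η i) ≠ w (a' * ω j' * η i')) :
    IsOrth k w (fun q : ι × κ => ω q.1 * η q.2) := by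
  classical
  refine ⟨fun q => mul_ne_zero (hω.1 _) (hη _), fun a => ?_⟩
  rintro ⟨j, i⟩
  -- the values of the partial sums with fixed second factor are values of single terms
  have hval : ∀ i, (∑ j, a (j, i) • ω j) ≠ 0 →
      ∃ j, (a (j, i) : Ω) ≠ 0 ∧ w (∑ j, a (j, i) • ω j) = w (a (j, i) * ω j) := by
    intro i h0
    have hne : (Finset.univ : Finset ι).Nonempty := by
      by_contra hcon
      rw [Finset.not_nonempty_iff_eq_empty] at hcon
      rw [hcon] at h0
      simp at h0
    obtain ⟨j, -, hmin⟩ := Finset.exists_min_image Finset.univ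
      (fun j => w (a (j, i) • ω j)) hne
    have h1 : w (∑ j, a (j, i) • ω j) = w (a (j, i) • ω j) :=
      le_antisymm (hω.2 (fun j => a (j, i)) j) (w.map_le_sum fun l hl => hmin l hl)
    refine ⟨j, fun h2 => h0 ?_, h1⟩
    rw [← w.top_iff, h1, Subfield.smul_def, h2, zero_smul, w.map_zero]
  have h1 : ∑ q : ι × κ, a q • (ω q.1 * η q.2) = ∑ i, (∑ j, a (j, i) • ω j) * η i := by
    rw [Fintype.sum_prod_type_right]
    refine Finset.sum_congr rfl fun i _ => ?_
    rw [Finset.sum_mul]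
    exact Finset.sum_congr rfl fun j _ => by rw [smul_mul_assoc]
  rw [h1]
  refine (map_sum_le_of_distinct Finset.univ (fun i => (∑ j, a (j, i) • ω j) * η i) ?_
    (Finset.mem_univ i)).trans ?_
  · intro i _ i' _ hne h0
    have hi0 : (∑ j, a (j, i) • ω j) ≠ 0 := left_ne_zero_of_mul h0
    obtain ⟨j, hj0, hj⟩ := hval i hi0
    by_cases hi0' : (∑ j, a (j, i') • ω j) = 0
    · rw [hi0', zero_mul, w.map_zero]
      exact w.ne_top_iff.2 h0
    · obtain ⟨j', -, hj'⟩ := hval i' hi0'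
      rw [w.map_mul, w.map_mul, hj, hj', ← w.map_mul, ← w.map_mul]
      exact H i i' hne j j' _ (a _).2 _ (a _).2 hj0
  · have h2 := hω.2 (fun j => a (j, i)) j
    change _ ≤ w (a (j, i) • (ω j * η i))
    rw [← smul_mul_assoc, w.map_mul, w.map_mul]
    gcongr

end

lemma lastVec_add (n : ℕ) (a b : ℚ) : lastVec n (a + b) = lastVec n a + lastVec n b := by
  refine qlex_ext fun k => ?_
  change (Pi.single (Fin.last n) (a + b) : Fin (n + 1) → ℚ) k =
    (Pi.single (Fin.last n) a : Fin (n + 1) → ℚ) k + (Pi.single (Fin.last n) b : Fin (n + 1) → ℚ) k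
  rw [Pi.single_add]
  rfl

/-- The last vector as a homomorphism. -/
def lastHom (n : ℕ) : ℚ →+ QLex (n + 1) where
  toFun := lastVec n
  map_zero' := qlex_ext fun k => by
    change (Pi.single (Fin.last n) (0 : ℚ) : Fin (n + 1) → ℚ) k = 0
    simp
  map_add' := lastVec_add n

lemma lastVec_last (n : ℕ) (a : ℚ) : ofLex (lastVec n a) (Fin.last n) = a := by
  change (Pi.single (Fin.last n) a : Fin (n + 1) → ℚ) (Fin.last n) = a
  simp

lemma lastVec_of_ne (n : ℕ) (a : ℚ) {k : Fin (n + 1)} (hk : k ≠ Fin.last n) :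
    ofLex (lastVec n a) k = 0 := by
  change (Pi.single (Fin.last n) a : Fin (n + 1) → ℚ) k = 0
  rw [Pi.single_eq_of_ne hk]

lemma value_zpow {Ω : Type*} [Field Ω] {Γ : Type*} [AddCommGroup Γ] [LinearOrder Γ]
    [IsOrderedAddMonoid Γ] (w : AddValuation Ω (WithTop Γ)) {x : Ω} {g : Γ} (hx : w x = g) (z : ℤ) :
    w (x ^ z) = ((z • g : Γ) : WithTop Γ) := by
  obtain ⟨m, rfl | rfl⟩ := z.eq_nat_or_neg
  · rw [zpow_natCast, w.map_pow, hx, natCast_zsmul, WithTop.coe_nsmul]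
  · rw [zpow_neg, zpow_natCast, AddValuation.map_inv, w.map_pow, hx, neg_smul, natCast_zsmul,
      ← WithTop.coe_nsmul]
    rfl

/-- The properties of a standard pair `(M, E)` with last local parameter `θ` that are used below;
`1 / q` is the last coordinate of the value of `θ`. -/
structure StdPair (p : ℕ) {n : ℕ} {B : BasicField n}
    (w : AddValuation B.Closure (WithTop (QLex (n + 1)))) (M E : Subfield B.Closure)
    (θ : B.Closure) (q : ℕ) : Prop where
  base_le : B.base ≤ M
  sc : IsSC w (M : Set B.Closure)
  eq : E = constants p M n
  mem : θ ∈ M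
  q_pos : 0 < q
  value : w θ = (lastVec n ((q : ℚ)⁻¹) : WithTop (QLex (n + 1)))
  last_int : ∀ x ∈ M, ∀ y : ℚ, w x = (lastVec n y : WithTop (QLex (n + 1))) →
    ∃ z : ℤ, y = z * (q : ℚ)⁻¹
  approx : ∀ x ∈ M, x ≠ 0 → ∃ e ∈ E, ∃ z : ℤ, w x < w (x - e * θ ^ z)

section

variable {p n : ℕ} {B : BasicField n}
  {w : AddValuation B.Closure (WithTop (QLex (n + 1)))}

lemma GoodBar.sc_base (h : GoodBar p B w) : IsSC w (B.base : Set B.Closure) := by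
  rw [← h.top]
  exact h.sc _

lemma GoodBar.sc_of_isLF (h : GoodBar p B w) {M : Subfield B.Closure} (hM : IsLF M) :
    IsSC w (M : Set B.Closure) := isSC_of_finite h.sc_base hM.base_le hM.finite

/-- The residues of the units of a local field lift to roots of unity. -/
lemma GoodBar.exists_residue_lift [Fact p.Prime] (h : GoodBar p B w) {M : Subfield B.Closure}
    (hM : IsSC w (M : Set B.Closure)) {x : B.Closure} (hx : x ∈ M) (hwx : w x = 0) (i : ℕ) :
    ∃ ζ ∈ constants p M i, 0 < w (x - ζ) := by
  obtain ⟨m, hm0, hm, hpos⟩ := exists_pow_sub_one_pos h.p_pos h.residue hwx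
    ((isAlgebraic_of_base_le le_rfl).isAlgebraic x)
  obtain ⟨ζ, hζ, hζm, hlt⟩ := exists_root_of_unity h.p_pos hM hx hwx hm hpos
  exact ⟨ζ, ⟨hζ, mem_constHull_of_pow_eq_one i hm0 hm hζm⟩, hlt⟩

lemma isUniformizerAt_last {M : Subfield B.Closure} {t : Fin n → B.Closure} {θ : B.Closure}
    (h : IsLocalParams M (n + 1) (Fin.snoc t θ : Fin (n + 1) → B.Closure)) :
    IsUniformizerAt M (Fin.last n) θ := by
  have h1 : (Fin.snoc t θ : Fin (n + 1) → B.Closure)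
      ⟨(Fin.last n : Fin (n + 1)), Nat.lt_succ_self n⟩ = θ :=
    Fin.snoc_last (α := fun _ => B.Closure) θ t
  have := h (Fin.last n) (Nat.lt_succ_self n)
  rwa [h1] at this

/-- The last local parameter and the constants account for all values. -/
lemma exists_value_eq (h : GoodBar p B w) {M E : Subfield B.Closure} {θ : B.Closure}
    (hθ : IsLastParam p n M E θ) {x : B.Closure} (hx : x ∈ M) (hx0 : x ≠ 0) :
    ∃ e ∈ E, e ≠ 0 ∧ ∃ z : ℤ, w x = w (e * θ ^ z) := by
  obtain ⟨hLC, t, htE, htM⟩ := hθ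
  have hEM : E ≤ M := by
    rw [show E = constants p M n from hLC]
    exact inf_le_left
  have hθU := isUniformizerAt_last htM
  obtain ⟨hθM, γ, hγ, -, -, -⟩ := hθU
  rw [h.valBar_eq] at hγ
  have hθ0 : θ ≠ 0 := by
    rintro rfl
    rw [w.map_zero] at hγ
    exact WithTop.top_ne_coe hγ
  -- the subgroup of the values of the products `e θ ^ z`
  let G : AddSubgroup (QLex (n + 1)) := valueGroup w E ⊔ AddSubgroup.zmultiples γ
  have hGM : G ≤ valueGroup w M := by
    refine sup_le ?_ ?_
    · rintro g ⟨y, hy, hyg⟩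
      exact ⟨y, hEM hy, hyg⟩
    · rw [AddSubgroup.zmultiples_le]
      exact ⟨θ, hθM, hγ⟩
  have hunif : ∀ k : Fin (n + 1), ∃ (s : B.Closure) (g : QLex (n + 1)),
      IsUniformizerAt M k s ∧ w s = g ∧ g ∈ G := by
    intro k
    refine Fin.lastCases ?_ (fun i => ?_) k
    · exact ⟨θ, γ, isUniformizerAt_last htM, hγ,
        (le_sup_right : _ ≤ G) (AddSubgroup.mem_zmultiples γ)⟩
    · have h1 := htM i.castSucc i.castSucc.2
      have h2 : (Fin.snoc t θ : Fin (n + 1) → B.Closure)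
          ⟨(i.castSucc : Fin (n + 1)), i.castSucc.2⟩ = t i :=
        Fin.snoc_castSucc (α := fun _ => B.Closure) θ t i
      rw [h2] at h1
      obtain ⟨htiE, -⟩ := htE i.castSucc i.2
      obtain ⟨-, g, hg, -⟩ := id h1
      rw [h.valBar_eq] at hg
      exact ⟨t i, g, h1, hg, (le_sup_left : _ ≤ G) ⟨t i, htiE, hg⟩⟩
  obtain ⟨g, hg⟩ := WithTop.ne_top_iff_exists.1 (w.ne_top_iff.2 hx0)
  -- the coordinates of the value of `x` are cleared one after the other, by powers of the
  -- parameters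
  have key : ∀ k : ℕ, k ≤ n + 1 → ∃ g' ∈ G, ∀ l : Fin (n + 1), (l : ℕ) < k →
    ofLex (g - g') l = 0 := by
    intro k
    induction k with
    | zero => exact fun _ => ⟨0, G.zero_mem, fun l hl => absurd hl (Nat.not_lt_zero _)⟩
    | succ k ih =>
      intro hk
      obtain ⟨g', hg', hzero⟩ := ih (by omega)
      obtain ⟨s, γs, ⟨hsM, γs', hγs', hlow, hpos, huni⟩, hγs, hγsG⟩ := hunif ⟨k, by omega⟩
      rw [h.valBar_eq, hγs, WithTop.coe_eq_coe] at hγs'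
      subst hγs'
      obtain ⟨y, hy, hyg⟩ : g - g' ∈ valueGroup w M :=
        AddSubgroup.sub_mem _ ⟨x, hx, hg.symm⟩ (hGM hg')
      obtain ⟨z, hz⟩ := huni y hy (g - g') (by rw [h.valBar_eq, hyg]) fun l hl => hzero l hl
      refine ⟨g' + z • γs, G.add_mem hg' (G.zsmul_mem hγsG z), fun l hl => ?_⟩
      have h1 : ofLex (g - (g' + z • γs)) l = ofLex (g - g') l - z * ofLex γs l := by
        rw [← sub_sub, ← coordHom_apply, map_sub, map_zsmul, zsmul_eq_mul]
        rfl
      rw [h1]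
      rcases Nat.lt_succ_iff_lt_or_eq.1 hl with hlt | heq
      · rw [hzero l hlt, hlow l hlt, mul_zero, sub_zero]
      · have : l = ⟨k, by omega⟩ := Fin.ext heq
        rw [this, hz, sub_self]
  obtain ⟨g', hg', hzero⟩ := key (n + 1) le_rfl
  have hgg : g = g' := sub_eq_zero.1 (qlex_ext fun l => hzero l l.2)
  subst hgg
  obtain ⟨a, ⟨e, he, hea⟩, b, hb, hab⟩ := AddSubgroup.mem_sup.1 hg'
  obtain ⟨z, rfl⟩ := AddSubgroup.mem_zmultiples_iff.1 hb
  refine ⟨e, he, ?_, z, ?_⟩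
  · rintro rfl
    rw [w.map_zero] at hea
    exact WithTop.top_ne_coe hea
  · rw [← hg, ← hab, w.map_mul, hea, value_zpow w hγ, WithTop.coe_add]

/-- A last local parameter makes a standard pair: the value of the parameter has no other
coordinates than the last one, and residues lift to constants. -/
lemma BasicField.IsLastParam.stdPair [Fact p.Prime] (h : GoodBar p B w) {M E : Subfield B.Closure}
    {θ : B.Closure}
    (hθ : IsLastParam p n M E θ) (hbM : B.base ≤ M) (hM : IsSC w (M : Set B.Closure)) :
    ∃ q, StdPair p w M E θ q := by
  obtain ⟨hLC, t, htE, htM⟩ := id hθ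
  have hEM : E ≤ M := by
    rw [show E = constants p M n from hLC]
    exact inf_le_left
  have hθU := isUniformizerAt_last htM
  obtain ⟨hθM, γ, hγ, hlow, hpos, huni⟩ := hθU
  rw [h.valBar_eq] at hγ
  -- the last parameter of the basic field determines the value of `θ`
  obtain ⟨T, hT, hwT⟩ := h.param (n + 1) (Fin.last n) (Nat.lt_succ_self n)
  obtain ⟨z, hz⟩ := huni T (hbM (constBar_le_base _ hT)) _ (by rw [h.valBar_eq, hwT]) fun l hl =>
    Pi.single_eq_of_ne hl.ne _
  have hz' : 1 = z * ofLex γ (Fin.last n) := by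
    rw [← hz]
    change 1 = (Pi.single (Fin.last n) 1 : Fin (n + 1) → ℚ) (Fin.last n)
    simp
  have hzpos : 0 < z := by
    by_contra hcon
    have h1 : (z : ℚ) ≤ 0 := by exact_mod_cast not_lt.1 hcon
    have h2 := mul_nonpos_of_nonpos_of_nonneg h1 hpos.le
    linarith
  obtain ⟨q, rfl⟩ := Int.eq_ofNat_of_zero_le hzpos.le
  have hq0 : (q : ℚ) ≠ 0 := by exact_mod_cast hzpos.ne'
  have hγq : ofLex γ (Fin.last n) = (q : ℚ)⁻¹ := by
    rw [Int.cast_natCast] at hz'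
    field_simp
    linarith
  have hγ' : γ = lastVec n ((q : ℚ)⁻¹) := by
    refine qlex_ext fun k => ?_
    by_cases hk : k = Fin.last n
    · rw [hk, hγq, lastVec_last]
    · rw [lastVec_of_ne n _ hk, hlow k (Fin.lt_last_iff_ne_last.2 hk)]
  refine ⟨q, hbM, hM, hLC, hθM, by exact_mod_cast hzpos, hγ' ▸ hγ, ?_, ?_⟩
  · intro x hx y hxy
    obtain ⟨z, hz⟩ := huni x hx _ (by rw [h.valBar_eq, hxy]) fun l hl => lastVec_of_ne n _ hl.ne
    exact ⟨z, by rw [← hγq, ← hz, lastVec_last]⟩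
  · intro x hx hx0
    obtain ⟨e, he, he0, z, hval⟩ := exists_value_eq h hθ hx hx0
    have hθ0 : θ ≠ 0 := by
      rintro rfl
      rw [w.map_zero] at hγ
      exact WithTop.top_ne_coe hγ
    have hy0 : e * θ ^ z ≠ 0 := mul_ne_zero he0 (zpow_ne_zero _ hθ0)
    have hu : w (x / (e * θ ^ z)) = 0 := by
      rw [AddValuation.map_div, ← hval]
      exact LinearOrderedAddCommGroupWithTop.sub_self_eq_zero_iff_ne_top.2 (w.ne_top_iff.2 hx0)
    obtain ⟨ζ, hζ, hlt⟩ := h.exists_residue_lift hM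
      (M.div_mem hx (M.mul_mem (hEM he) (zpow_mem hθM z))) hu n
    rw [← show E = constants p M n from hLC] at hζ
    refine ⟨ζ * e, E.mul_mem hζ he, z, ?_⟩
    rw [mul_assoc]
    exact lt_sub_mul_of_pos hy0 hval hlt

end

/-! ### Orthogonal bases of powers of the last parameter -/

section

variable {p n : ℕ} {B : BasicField n}
  {w : AddValuation B.Closure (WithTop (QLex (n + 1)))}

lemma zsmul_lastVec (z : ℤ) (a : ℚ) : z • lastVec n a = lastVec n (z * a) := by
  have := map_zsmul (lastHom n) z a
  rw [zsmul_eq_mul] at this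
  exact this.symm

namespace StdPair

variable {M E : Subfield B.Closure} {θ : B.Closure} {q : ℕ}

lemma le (hs : StdPair p w M E θ q) : E ≤ M := by
  rw [hs.eq]
  exact inf_le_left

lemma le_constHull (hs : StdPair p w M E θ q) : E ≤ constHull p B n := by
  rw [hs.eq]
  exact inf_le_right

lemma constBar_le (hs : StdPair p w M E θ q) : B.constBar n ≤ E := by
  rw [hs.eq]
  exact le_inf ((constBar_le_base n).trans hs.base_le) (constBar_le_constHull n)

lemma ne_zero (hs : StdPair p w M E θ q) : θ ≠ 0 := by
  have := hs.value
  rintro rfl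
  rw [w.map_zero] at this
  exact WithTop.top_ne_coe this

lemma map_zpow (hs : StdPair p w M E θ q) (z : ℤ) :
    w (θ ^ z) = (lastVec n (z * (q : ℚ)⁻¹) : WithTop (QLex (n + 1))) := by
  rw [value_zpow w hs.value, zsmul_lastVec]

lemma map_pow (hs : StdPair p w M E θ q) (i : ℕ) :
    w (θ ^ i) = (lastVec n (i * (q : ℚ)⁻¹) : WithTop (QLex (n + 1))) := by
  have := hs.map_zpow i
  rwa [zpow_natCast, Int.cast_natCast] at this

/-- The quotient of two elements of the same value is approximately a constant. -/
lemma exists_lift [Fact p.Prime] (hs : StdPair p w M E θ q) (h : GoodBar p B w) {x y : B.Closure}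
    (hx : x ∈ M) (hy : y ∈ M) (hx0 : x ≠ 0) (hxy : w x = w y) : ∃ ζ ∈ E, w x < w (x - ζ * y) := by
  have hy0 : y ≠ 0 := by
    rw [← w.ne_top_iff, ← hxy]
    exact w.ne_top_iff.2 hx0
  have hu : w (x / y) = 0 := by
    rw [AddValuation.map_div, ← hxy]
    exact LinearOrderedAddCommGroupWithTop.sub_self_eq_zero_iff_ne_top.2 (w.ne_top_iff.2 hx0)
  obtain ⟨ζ, hζ, hlt⟩ := h.exists_residue_lift hs.sc (M.div_mem hx hy) hu n
  rw [← hs.eq] at hζ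
  exact ⟨ζ, hζ, lt_sub_mul_of_pos hy0 hxy hlt⟩

/-- Each value is that of a product of a constant and a power of the last parameter. -/
lemma exists_eq (hs : StdPair p w M E θ q) {x : B.Closure} (hx : x ∈ M) (hx0 : x ≠ 0) :
    ∃ e ∈ E, e ≠ 0 ∧ ∃ z : ℤ, w x = w (e * θ ^ z) := by
  obtain ⟨e, he, z, hlt⟩ := hs.approx x hx hx0
  refine ⟨e, he, ?_, z, ?_⟩
  · rintro rfl
    rw [zero_mul, sub_zero] at hlt
    exact lt_irrefl _ hlt
  · rw [w.map_sub_swap] at hlt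
    exact (w.map_eq_of_lt_sub hlt).symm

/-- An element of `M` is approximately a constant if the last coordinate of its value is that of
a constant. -/
lemma exists_const_approx [Fact p.Prime] (hs : StdPair p w M E θ q) (h : GoodBar p B w)
    {x : B.Closure} (hx : x ∈ M) (hx0 : x ≠ 0) {D : ℤ} {c : B.Closure} (hc : c ∈ B.constBar n)
    (hwc : w c = (lastVec n D : WithTop (QLex (n + 1))))
    (hD : ∀ g : QLex (n + 1), w x = g → ofLex g (Fin.last n) = D) :
    ∃ e ∈ E, w x < w (x - e) := by
  obtain ⟨e, he, he0, z, hval⟩ := hs.exists_eq hx hx0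
  obtain ⟨D', c', hc', hwc', hD'⟩ := h.exists_last (hs.le_constHull he) he0
  obtain ⟨ε, hε⟩ := WithTop.ne_top_iff_exists.1 (w.ne_top_iff.2 he0)
  have hv := hval
  rw [w.map_mul, hs.map_zpow, ← hε, ← WithTop.coe_add] at hv
  have h1 := hD _ hv
  rw [← coordHom_apply, map_add, coordHom_apply, coordHom_apply, hD' ε hε.symm, lastVec_last] at h1
  have hy : w x = w (e * (c / c')) := by
    rw [hv, w.map_mul, ← hε, value_div hwc hwc', ← WithTop.coe_add, WithTop.coe_eq_coe]
    congr 1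
    have := map_sub (lastHom n) (D : ℚ) D'
    rw [← h1, add_sub_cancel_left] at this
    rw [← h1]
    exact this
  have hyE : e * (c / c') ∈ E :=
    E.mul_mem he (E.div_mem (hs.constBar_le hc) (hs.constBar_le hc'))
  obtain ⟨ζ, hζ, hlt⟩ := hs.exists_lift h hx (hs.le hyE) hx0 hy
  exact ⟨_, E.mul_mem hζ hyE, hlt⟩

/-- A family of constants which is orthogonal over the constants of `M` is orthogonal over `M`. -/
lemma transfer [Fact p.Prime] (hs : StdPair p w M E θ q) (h : GoodBar p B w) {ι : Type*} [Fintype ι]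
    {ω : ι → B.Closure} (hω : IsOrth E w ω) (hal : ∀ j, ω j ∈ constHull p B n) :
    IsOrth M w ω := by
  -- terms of the same value have coefficients whose quotient is approximately a constant
  refine hω.transfer fun i b hb hb0 => ⟨b, fun j b' hb' hb0' hval => ?_⟩
  obtain ⟨D, c, hc, hwc, hD⟩ := h.exists_last (hal i) (hω.1 i)
  obtain ⟨D', c', hc', hwc', hD'⟩ := h.exists_last (hal j) (hω.1 j)
  obtain ⟨g, hg⟩ := WithTop.ne_top_iff_exists.1 (w.ne_top_iff.2 hb0)
  obtain ⟨g', hg'⟩ := WithTop.ne_top_iff_exists.1 (w.ne_top_iff.2 hb0')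
  obtain ⟨a, ha⟩ := WithTop.ne_top_iff_exists.1 (w.ne_top_iff.2 (hω.1 i))
  obtain ⟨a', ha'⟩ := WithTop.ne_top_iff_exists.1 (w.ne_top_iff.2 (hω.1 j))
  rw [w.map_mul, w.map_mul, ← hg, ← hg', ← ha, ← ha', ← WithTop.coe_add, ← WithTop.coe_add,
    WithTop.coe_eq_coe] at hval
  have hwcc : w (c / c') = (lastVec n ((D - D' : ℤ) : ℚ) : WithTop (QLex (n + 1))) := by
    rw [value_div hwc hwc', WithTop.coe_eq_coe, Int.cast_sub]
    exact (map_sub (lastHom n) (D : ℚ) D').symm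
  obtain ⟨e, he, hlt⟩ := hs.exists_const_approx h (M.div_mem hb' hb) (div_ne_zero hb0' hb0)
    ((B.constBar n).div_mem hc hc') hwcc fun γ hγ => by
      rw [value_div hg'.symm hg.symm, WithTop.coe_eq_coe] at hγ
      have h1 := congrArg (coordHom (Fin.last n)) hval
      rw [map_add, map_add, coordHom_apply, coordHom_apply, coordHom_apply, coordHom_apply,
        hD a ha.symm, hD' a' ha'.symm] at h1
      rw [← hγ, ← coordHom_apply, map_sub, coordHom_apply, coordHom_apply, Int.cast_sub]
      linarith
  refine ⟨e, he, ?_⟩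
  have h1 : b' - e * b = (b' / b - e) * b := by field_simp
  have h2 : w b' = w (b' / b) + w b := by rw [← w.map_mul, div_mul_cancel₀ _ hb0]
  rw [h1, w.map_mul, h2, add_lt_add_iff_left_of_ne_top (w.ne_top_iff.2 hb0)]
  exact hlt

/-- The degree of `M` over the basic field, in terms of the value of the last parameter. -/
lemma relfinrank_eq [Fact p.Prime] (hs : StdPair p w M E θ q) (h : GoodBar p B w) (hM : IsLF M) :
    B.base.relfinrank M = q * (B.constBar n).relfinrank E := by
  have hfin := h.relfinrank_constants_ne_zero (p := p) hM n
  rw [← hs.eq] at hfin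
  obtain ⟨ω, hω, hsp⟩ := exists_orth_basis (h.sc n) hs.constBar_le hfin
  have hωb := h.orth_base n hω fun j => isAlgebraic_of_mem_constHull (hs.le_constHull (hsp.1 j))
  have hq0 : (q : ℚ) ≠ 0 := by exact_mod_cast hs.q_pos.ne'
  have hint : ∀ j, ∃ D : ℤ, ∀ g : QLex (n + 1), w (ω j) = g → ofLex g (Fin.last n) = D :=
      fun j => by
    obtain ⟨D, -, -, -, hD⟩ := h.exists_last (hs.le_constHull (hsp.1 j)) (hω.1 j)
    exact ⟨D, hD⟩
  -- the last coordinates of the values are integers plus `i / q`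
  have horth : IsOrth B.base w (fun s : Fin ((B.constBar n).relfinrank E) × Fin q =>
      ω s.1 * θ ^ (s.2 : ℕ)) := by
    refine hωb.mul_of_distinct (η := fun i : Fin q => θ ^ (i : ℕ))
      (fun i => pow_ne_zero _ hs.ne_zero) ?_
    intro i i' hne j j' a ha a' ha' ha0 heq
    have ha0' : a' ≠ 0 := by
      rintro rfl
      rw [zero_mul, zero_mul, w.map_zero, w.top_iff] at heq
      exact mul_ne_zero (mul_ne_zero ha0 (hω.1 j)) (pow_ne_zero _ hs.ne_zero) heq
    obtain ⟨g, hg⟩ := WithTop.ne_top_iff_exists.1 (w.ne_top_iff.2 ha0)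
    obtain ⟨g', hg'⟩ := WithTop.ne_top_iff_exists.1 (w.ne_top_iff.2 ha0')
    obtain ⟨b, hb⟩ := WithTop.ne_top_iff_exists.1 (w.ne_top_iff.2 (hω.1 j))
    obtain ⟨b', hb'⟩ := WithTop.ne_top_iff_exists.1 (w.ne_top_iff.2 (hω.1 j'))
    rw [w.map_mul, w.map_mul, w.map_mul, w.map_mul, ← hg, ← hg', ← hb, ← hb',
      hs.map_pow, hs.map_pow, ← WithTop.coe_add, ← WithTop.coe_add, ← WithTop.coe_add, ← WithTop.coe_add,
      WithTop.coe_eq_coe] at heq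
    obtain ⟨z, hz⟩ := h.integral a ha g hg.symm (Fin.last n)
    obtain ⟨z', hz'⟩ := h.integral a' ha' g' hg'.symm (Fin.last n)
    obtain ⟨D, hD⟩ := hint j
    obtain ⟨D', hD'⟩ := hint j'
    have h1 := congrArg (coordHom (Fin.last n)) heq
    simp only [map_add, coordHom_apply, hz, hz', hD b hb.symm, hD' b' hb'.symm, lastVec_last] at h1
    have h2 : ((i : ℕ) : ℚ) - (i' : ℕ) = q * (z' + D' - z - D) := by
      field_simp at h1
      linarith
    have h3 : ((i : ℕ) : ℤ) - (i' : ℕ) = q * (z' + D' - z - D) := by exact_mod_cast h2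
    apply hne
    have hi := i.2
    have hi' := i'.2
    have h4 : ((i : ℕ) : ℤ) - (i' : ℕ) = 0 := by
      refine Int.eq_zero_of_abs_lt_dvd ⟨_, h3⟩ ?_
      rw [abs_lt]
      omega
    exact Fin.ext (by omega)
  have hspan := horth.spans_of_approx h.sc_base hs.base_le
    (fun s => M.mul_mem (hs.le (hsp.1 _)) (M.pow_mem hs.mem _)) (by
    intro x hx hx0
    obtain ⟨e, he, he0, z, hval⟩ := hs.exists_eq hx hx0
    have hqz : (0 : ℤ) < q := by exact_mod_cast hs.q_pos
    obtain ⟨i, hi⟩ := Int.eq_ofNat_of_zero_le (Int.emod_nonneg z hqz.ne')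
    have hiq : i < q := by
      have := Int.emod_lt_of_pos z hqz
      omega
    have hz : z = q * (z / q) + i := by rw [← hi, Int.mul_ediv_add_emod]
    obtain ⟨T, hT, hwT⟩ := h.exists_monomial (n + 1) (Pi.single (Fin.last n) (z / q))
      fun k hk => absurd k.2 (by omega)
    have hTb : T ∈ B.base := constBar_le_base _ hT
    have hwT' : w T = (lastVec n ((z / q : ℤ) : ℚ) : WithTop (QLex (n + 1))) := by
      rw [hwT, WithTop.coe_eq_coe]
      refine qlex_ext fun k => ?_
      by_cases hk : k = Fin.last n
      · rw [hk, lastVec_last, ofLex_toLex, Pi.single_eq_same]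
      · rw [lastVec_of_ne n _ hk, ofLex_toLex, Pi.single_eq_of_ne hk, Int.cast_zero]
    have hy : w x = w (e * T * θ ^ i) := by
      rw [hval, w.map_mul, w.map_mul, w.map_mul, hs.map_zpow, hs.map_pow, hwT', add_assoc,
        ← WithTop.coe_add, ← lastVec_add]
      congr 3
      have h1 : (z : ℚ) = q * ((z / q : ℤ) : ℚ) + i := by exact_mod_cast hz
      rw [h1]
      field_simp
    obtain ⟨ζ, hζ, hlt⟩ := hs.exists_lift h hx
      (M.mul_mem (M.mul_mem (hs.le he) (hs.base_le hTb)) (M.pow_mem hs.mem i)) hx0 hy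
    obtain ⟨a, ha⟩ := hsp.2 (ζ * e) (E.mul_mem hζ he)
    refine ⟨fun s => if s.2 = ⟨i, hiq⟩ then
      ⟨(a s.1 : B.Closure) * T, B.base.mul_mem (constBar_le_base n (a s.1).2) hTb⟩ else 0, ?_⟩
    have hsum : ∑ s : Fin ((B.constBar n).relfinrank E) × Fin q,
        (if s.2 = ⟨i, hiq⟩ then (⟨(a s.1 : B.Closure) * T,
          B.base.mul_mem (constBar_le_base n (a s.1).2) hTb⟩ : B.base) else 0) •
          (ω s.1 * θ ^ (s.2 : ℕ)) = ζ * (e * T * θ ^ i) := by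
      rw [Fintype.sum_prod_type_right, Finset.sum_eq_single ⟨i, hiq⟩]
      · have h1 : ζ * (e * T * θ ^ i) = (∑ j, a j • ω j) * (T * θ ^ i) := by
          rw [ha]
          ring
        rw [h1, Finset.sum_mul]
        refine Finset.sum_congr rfl fun j _ => ?_
        rw [if_pos rfl, Subfield.smul_def, Subfield.smul_def, smul_eq_mul, smul_eq_mul]
        ring
      · intro l _ hl
        exact Finset.sum_eq_zero fun j _ => by rw [if_neg hl, zero_smul]
      · simp
    rw [hsum]
    exact hlt)
  have := relfinrank_eq_card hs.base_le hspan (horth.linearIndependent (isNorm_subfield w _))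
  rw [this, Fintype.card_prod, Fintype.card_fin, Fintype.card_fin, mul_comm]

/-- The powers of the last parameter up to some exponent form an orthogonal basis over any
intermediate field `K` which contains the constants. -/
lemma exists_power_basis [Fact p.Prime] (hs : StdPair p w M E θ q) (h : GoodBar p B w)
    {K : Subfield B.Closure} (hbK : B.base ≤ K) (hEK : E ≤ K) (hKM : K ≤ M)
    (hK : IsSC w (K : Set B.Closure)) :
    ∃ m : ℕ, 0 < m ∧ IsOrth K w (fun i : Fin m => θ ^ (i : ℕ)) ∧
      Spans K M (fun i : Fin m => θ ^ (i : ℕ)) ∧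
      ∀ z : ℤ, (∃ a ∈ K, w a = w (θ ^ z)) → (m : ℤ) ∣ z := by
  -- the exponents of the powers of `θ` with a value in the value group of `K`; the basis consists
  -- of the powers up to the generator of this group
  let H : AddSubgroup ℤ := {
    carrier := {z | ∃ a ∈ K, w a = w (θ ^ z)}
    zero_mem' := ⟨1, K.one_mem, by rw [zpow_zero]⟩
    add_mem' := by
      rintro z z' ⟨a, ha, haz⟩ ⟨a', ha', haz'⟩
      exact ⟨a * a', K.mul_mem ha ha', by
        rw [w.map_mul, haz, haz', ← w.map_mul, zpow_add₀ hs.ne_zero]⟩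
    neg_mem' := by
      rintro z ⟨a, ha, haz⟩
      exact ⟨a⁻¹, K.inv_mem ha, by
        rw [AddValuation.map_inv, haz, ← AddValuation.map_inv, zpow_neg]⟩ }
  have hHmem : ∀ z, z ∈ H ↔ ∃ a ∈ K, w a = w (θ ^ z) := fun z => Iff.rfl
  obtain ⟨z₀, hz₀⟩ := Int.subgroup_cyclic H
  have hH : ∀ z, z ∈ H ↔ z₀ ∣ z := by
    intro z
    rw [hz₀, ← AddSubgroup.zmultiples_eq_closure, Int.mem_zmultiples_iff]
  have hq0 : (q : ℚ) ≠ 0 := by exact_mod_cast hs.q_pos.ne'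
  have hqH : (q : ℤ) ∈ H := by
    obtain ⟨T, hT, hwT⟩ := h.param (n + 1) (Fin.last n) (Nat.lt_succ_self n)
    refine ⟨T, hbK (constBar_le_base _ hT), ?_⟩
    rw [hwT, hs.map_zpow, Int.cast_natCast, mul_inv_cancel₀ hq0]
    rfl
  have hz0 : z₀ ≠ 0 := by
    rintro rfl
    have := zero_dvd_iff.1 ((hH _).1 hqH)
    have := hs.q_pos
    omega
  set m := z₀.natAbs with hm
  have hm0 : 0 < m := Int.natAbs_pos.2 hz0
  have hHm : ∀ z, z ∈ H ↔ (m : ℤ) ∣ z := by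
    intro z
    rw [hH, hm, Int.natAbs_dvd]
  have h1orth : IsOrth K w (fun _ : Unit => (1 : B.Closure)) := by
    refine ⟨fun _ => one_ne_zero, fun a i => ?_⟩
    simp
  have horth' := h1orth.mul_of_distinct (η := fun i : Fin m => θ ^ (i : ℕ))
    (fun i => pow_ne_zero _ hs.ne_zero) (by
    intro i i' hne _ _ a ha a' ha' ha0 heq
    simp only [mul_one] at heq
    have ha0' : a' ≠ 0 := by
      rintro rfl
      rw [zero_mul, w.map_zero, w.top_iff] at heq
      exact mul_ne_zero ha0 (pow_ne_zero _ hs.ne_zero) heq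
    have h1 : ((i : ℕ) : ℤ) - (i' : ℕ) ∈ H := by
      refine ⟨a' / a, K.div_mem ha' ha, ?_⟩
      obtain ⟨g, hg⟩ := WithTop.ne_top_iff_exists.1 (w.ne_top_iff.2 ha0)
      obtain ⟨g', hg'⟩ := WithTop.ne_top_iff_exists.1 (w.ne_top_iff.2 ha0')
      rw [value_div hg'.symm hg.symm, hs.map_zpow, WithTop.coe_eq_coe]
      rw [w.map_mul, w.map_mul, hs.map_pow, hs.map_pow, ← hg, ← hg', ← WithTop.coe_add,
        ← WithTop.coe_add, WithTop.coe_eq_coe] at heq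
      push_cast
      rw [sub_mul]
      have h2 := map_sub (lastHom n) (((i : ℕ) : ℚ) * (q : ℚ)⁻¹) (((i' : ℕ) : ℚ) * (q : ℚ)⁻¹)
      change lastVec n _ = lastVec n _ - lastVec n _ at h2
      rw [h2, sub_eq_sub_iff_add_eq_add, ← heq]
      exact add_comm _ _
    apply hne
    have hi := i.2
    have hi' := i'.2
    have h4 : ((i : ℕ) : ℤ) - (i' : ℕ) = 0 := by
      refine Int.eq_zero_of_abs_lt_dvd ((hHm _).1 h1) ?_
      rw [abs_lt]
      omega
    exact Fin.ext (by omega))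
  have horth : IsOrth K w (fun i : Fin m => θ ^ (i : ℕ)) := by
    refine ⟨fun i => pow_ne_zero _ hs.ne_zero, fun a i => ?_⟩
    have := horth'.2 (fun s => a s.2) ((), i)
    rw [Fintype.sum_prod_type] at this
    simpa using this
  refine ⟨m, hm0, horth, ?_, fun z hz => (hHm z).1 hz⟩
  refine horth.spans_of_approx hK hKM (fun i => M.pow_mem hs.mem _) ?_
  intro x hx hx0
  obtain ⟨e, he, he0, z, hval⟩ := hs.exists_eq hx hx0
  have hmz : (0 : ℤ) < m := by exact_mod_cast hm0
  obtain ⟨i, hi⟩ := Int.eq_ofNat_of_zero_le (Int.emod_nonneg z hmz.ne')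
  have hiq : i < m := by
    have := Int.emod_lt_of_pos z hmz
    omega
  have hz : z = m * (z / m) + i := by rw [← hi, Int.mul_ediv_add_emod]
  obtain ⟨a, ha, hwa⟩ := (hHm (m * (z / m))).2 (dvd_mul_right _ _)
  have hy : w x = w (e * a * θ ^ i) := by
    have h3 : w (θ ^ (m * (z / m))) + w (θ ^ i) = w (θ ^ z) := by
      rw [← w.map_mul, ← zpow_natCast, ← zpow_add₀ hs.ne_zero, ← hz]
    rw [hval, w.map_mul, w.map_mul, w.map_mul, hwa, add_assoc, h3]
  obtain ⟨ζ, hζ, hlt⟩ := hs.exists_lift h hx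
    (M.mul_mem (M.mul_mem (hs.le he) (hKM ha)) (M.pow_mem hs.mem i)) hx0 hy
  refine ⟨Pi.single ⟨i, hiq⟩ ⟨ζ * e * a, K.mul_mem (K.mul_mem (hEK hζ) (hEK he)) ha⟩, ?_⟩
  have hsum : ∑ l : Fin m, (Pi.single (⟨i, hiq⟩ : Fin m) (⟨ζ * e * a,
      K.mul_mem (K.mul_mem (hEK hζ) (hEK he)) ha⟩ : K) : Fin m → K) l • θ ^ (l : ℕ) =
      ζ * (e * a * θ ^ i) := by
    rw [Finset.sum_eq_single ⟨i, hiq⟩]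
    · rw [Pi.single_eq_same, Subfield.smul_def, smul_eq_mul]
      ring
    · intro l _ hl
      rw [Pi.single_eq_of_ne hl, zero_smul]
    · simp
  rw [hsum]
  exact hlt

end StdPair

end

/-! ### Composita with fields of constants, and the valuation ring -/

section

variable {p n : ℕ} {B : BasicField n}
  {w : AddValuation B.Closure (WithTop (QLex (n + 1)))}

/-- A finite spanning family of `E` over `k` spans the compositum `M ⊔ E` over `M`. -/
lemma Spans.sup {k M E : Subfield B.Closure} {ι : Type*} [Fintype ι] {ω : ι → B.Closure}
    (hω : Spans k E ω) (hal : ∀ x ∈ E, IsAlgebraic M x) (hkM : k ≤ M) :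
    Spans M (M ⊔ E) ω := by
  refine ⟨fun i => (le_sup_right : E ≤ M ⊔ E) (hω.1 i), fun x hx => ?_⟩
  rw [← Submodule.mem_span_range_iff_exists_fun]
  have h1 : M ⊔ E ≤ (IntermediateField.adjoin M (E : Set B.Closure)).toSubfield := by
    refine sup_le (fun y hy => ?_) fun y hy => IntermediateField.subset_adjoin _ _ hy
    exact (IntermediateField.adjoin M (E : Set B.Closure)).algebraMap_mem ⟨y, hy⟩
  have h2 : x ∈ (IntermediateField.adjoin M (E : Set B.Closure)).toSubalgebra := h1 hx
  rw [IntermediateField.adjoin_toSubalgebra_of_isAlgebraic hal,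
    ← Subalgebra.mem_toSubmodule, Algebra.adjoin_eq_span,
    show (E : Set B.Closure) = E.toSubmonoid from rfl, Submonoid.closure_eq] at h2
  refine Submodule.span_le.2 ?_ h2
  intro y hy
  obtain ⟨a, rfl⟩ := hω.2 y hy
  exact sum_mem fun i _ => Submodule.smul_mem _ (⟨a i, hkM (a i).2⟩ : M)
    (Submodule.subset_span ⟨i, rfl⟩)

lemma Spans.relfinrank_le {k M : Subfield B.Closure} (hkM : k ≤ M) {ι : Type*} [Fintype ι]
    {ω : ι → B.Closure} (hω : Spans k M ω) :
    k.relfinrank M ≠ 0 ∧ k.relfinrank M ≤ Fintype.card ι := by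
  rw [Subfield.relfinrank_eq_finrank_of_le hkM]
  let ω' : ι → Subfield.extendScalars hkM := fun i => ⟨ω i, hω.1 i⟩
  have hspan : Submodule.span k (Set.range ω') = ⊤ := by
    rw [eq_top_iff]
    rintro ⟨x, hx⟩ -
    obtain ⟨a, ha⟩ := hω.2 x hx
    rw [Submodule.mem_span_range_iff_exists_fun]
    refine ⟨a, Subtype.ext ?_⟩
    exact (map_sum (Subfield.extendScalars hkM).val (fun i => a i • ω' i) Finset.univ).trans ha
  have hfin : Module.Finite k (Subfield.extendScalars hkM) :=
    ⟨hspan ▸ Submodule.fg_span (Set.finite_range ω')⟩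
  refine ⟨Module.finrank_pos.ne', ?_⟩
  have := finrank_range_le_card (R := k) ω'
  rwa [Set.finrank, hspan, finrank_top] at this

/-- The degree does not grow when passing to composita. -/
lemma relfinrank_sup_le {k M E : Subfield B.Closure} (hkM : k ≤ M) (hkE : k ≤ E)
    (hfin : k.relfinrank E ≠ 0) :
    M.relfinrank (M ⊔ E) ≠ 0 ∧ M.relfinrank (M ⊔ E) ≤ k.relfinrank E := by
  rw [Subfield.relfinrank_eq_finrank_of_le hkE] at hfin ⊢
  have hF : Module.Finite k (Subfield.extendScalars hkE) := Module.finite_of_finrank_pos (by omega)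
  let b := Module.finBasis k (Subfield.extendScalars hkE)
  have hsp : Spans k E (fun i => (b i : B.Closure)) := by
    refine ⟨fun i => (b i).2, fun x hx => ⟨b.repr ⟨x, hx⟩, ?_⟩⟩
    have h1 := congrArg (Subfield.extendScalars hkE).val (b.sum_repr ⟨x, hx⟩)
    rw [map_sum] at h1
    exact h1
  have hal : ∀ x ∈ E, IsAlgebraic M x := by
    intro x hx
    have h1 := (Algebra.IsIntegral.isIntegral (R := k)
      (⟨x, hx⟩ : Subfield.extendScalars hkE)).isAlgebraic
    exact isAlgebraic_mono hkM
      (h1.algHom (Subfield.extendScalars hkE).val)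
  have := (hsp.sup hal hkM).relfinrank_le le_sup_left
  rwa [Fintype.card_fin] at this

lemma BasicField.IsLF.sup {L k E : Subfield B.Closure} (hL : IsLF L) (hk : k ≤ L) (hkE : k ≤ E)
    (hfin : k.relfinrank E ≠ 0) : IsLF (L ⊔ E) := by
  refine ⟨hL.base_le.trans le_sup_left, ?_⟩
  rw [← Subfield.relfinrank_mul_relfinrank hL.base_le le_sup_left]
  exact mul_ne_zero hL.finite (relfinrank_sup_le hk hkE hfin).1

namespace StdPair

variable {M E K : Subfield B.Closure} {θ : B.Closure} {q : ℕ}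

/-- The degree of `M` is the degree of the last parameter. -/
lemma relfinrank_eq_natDegree [Fact p.Prime] (hs : StdPair p w M E θ q) (h : GoodBar p B w)
    (hbK : B.base ≤ K) (hEK : E ≤ K) (hKM : K ≤ M) (hK : IsSC w (K : Set B.Closure)) :
    K.relfinrank M = (minpoly K θ).natDegree := by
  obtain ⟨m, -, -, hsp, -⟩ := hs.exists_power_basis h hbK hEK hKM hK
  have hint : IsIntegral K θ := ((isAlgebraic_of_base_le hbK).isAlgebraic θ).isIntegral
  rw [← IntermediateField.adjoin.finrank hint, Subfield.relfinrank_eq_finrank_of_le hKM]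
  have : Subfield.extendScalars hKM = IntermediateField.adjoin K {θ} := by
    refine le_antisymm (fun x hx => ?_) ?_
    · obtain ⟨a, rfl⟩ := hsp.2 x hx
      exact sum_mem fun i _ => (IntermediateField.adjoin K {θ}).smul_mem
        (pow_mem (IntermediateField.mem_adjoin_simple_self K θ) _)
    · rw [IntermediateField.adjoin_simple_le_iff]
      exact hs.mem
  rw [this]

/-- The last parameter generates the valuation ring over any intermediate local field. -/
lemma integers_eq [Fact p.Prime] (hs : StdPair p w M E θ q) (h : GoodBar p B w)
    (hbK : B.base ≤ K) (hEK : E ≤ K) (hKM : K ≤ M) (hK : IsSC w (K : Set B.Closure)) :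
    integers M = (Subring.closure (integers K ∪ {θ}) : Set B.Closure) := by
  obtain ⟨m, hm0, horth, hsp, hdvd⟩ := hs.exists_power_basis h hbK hEK hKM hK
  have hq0 : (0 : ℚ) < (q : ℚ)⁻¹ := by
    have : (0 : ℚ) < q := by exact_mod_cast hs.q_pos
    positivity
  have hpos : ∀ a : ℚ, 0 ≤ a → (0 : WithTop (QLex (n + 1))) ≤ (lastVec n a : QLex (n + 1)) := by
    intro a ha
    rw [← WithTop.coe_zero, WithTop.coe_le_coe]
    exact Pi.toLex_monotone (show (0 : Fin (n + 1) → ℚ) ≤ Pi.single (Fin.last n) a from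
      Pi.single_nonneg.2 ha)
  apply Set.Subset.antisymm
  · rintro x ⟨hx, hx0⟩
    rw [h.valBar_eq] at hx0
    obtain ⟨a, rfl⟩ := hsp.2 x hx
    rw [SetLike.mem_coe]
    refine sum_mem fun i _ => ?_
    have hai := hx0.trans (horth.2 a i)
    rw [Subfield.smul_def, smul_eq_mul] at hai ⊢
    have hθc : θ ∈ Subring.closure (integers K ∪ {θ}) :=
      Subring.subset_closure (Set.mem_union_right _ rfl)
    refine Subring.mul_mem _ (Subring.subset_closure (Set.mem_union_left _ ⟨(a i).2, ?_⟩))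
      (Subring.pow_mem _ hθc _)
    rw [h.valBar_eq]
    by_contra hneg
    rw [not_le] at hneg
    obtain ⟨g, hg⟩ := WithTop.ne_top_iff_exists.1 hneg.ne_top
    rw [w.map_mul, hs.map_pow, ← hg, ← WithTop.coe_add, ← WithTop.coe_zero, WithTop.coe_le_coe]
      at hai
    rw [← hg, ← WithTop.coe_zero, WithTop.coe_lt_coe] at hneg
    -- a negative value that becomes non-negative by adding `(0, …, 0, i / q)` has only a last
    -- coordinate
    have hgl : g = lastVec n (ofLex g (Fin.last n)) ∧ ofLex g (Fin.last n) < 0 ∧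
        0 ≤ ofLex g (Fin.last n) + i * (q : ℚ)⁻¹ := by
      obtain ⟨k, hk, hk0⟩ := hneg
      have hk' : ∀ l < k, ofLex g l = 0 := hk
      have hk0' : ofLex g k < 0 := hk0
      have hkl : k = Fin.last n := by
        by_contra hne
        refine absurd hai (not_le.2 ⟨k, fun l hl => ?_, ?_⟩)
        · change ofLex g l + ofLex (lastVec n _) l = 0
          rw [hk' l hl, lastVec_of_ne, add_zero]
          exact (hl.trans_le (Fin.le_last k)).ne
        · change ofLex g k + ofLex (lastVec n _) k < 0
          rwa [lastVec_of_ne n _ hne, add_zero]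
      subst hkl
      have hgv : g = lastVec n (ofLex g (Fin.last n)) := by
        refine qlex_ext fun l => ?_
        by_cases hl : l = Fin.last n
        · rw [hl, lastVec_last]
        · rw [lastVec_of_ne n _ hl]
          exact hk' l (lt_of_le_of_ne (Fin.le_last l) hl)
      refine ⟨hgv, hk0', ?_⟩
      by_contra hlt
      rw [not_le] at hlt
      rw [hgv, ← lastVec_add] at hai
      refine absurd hai (not_le.2 ⟨Fin.last n, fun l hl => ?_, ?_⟩)
      · exact lastVec_of_ne n _ hl.ne
      · change ofLex (lastVec n _) (Fin.last n) < 0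
        rwa [lastVec_last]
    obtain ⟨hgv, hg0, hg1⟩ := hgl
    rw [hgv] at hg
    -- such a value of an element of `K` belongs to a power of `θ` whose exponent is divisible by
    -- `m`, whereas `i < m`
    obtain ⟨z, hz⟩ := hs.last_int _ (hKM (a i).2) _ hg.symm
    obtain ⟨t, ht⟩ := hdvd z ⟨a i, (a i).2, by rw [hs.map_zpow, ← hz, hg]⟩
    rw [hz] at hg0 hg1
    have hz0 : z < 0 := by
      by_contra hz0
      rw [not_lt] at hz0
      have : (0 : ℚ) ≤ z := by exact_mod_cast hz0
      nlinarith
    have hz1 : -(i : ℤ) ≤ z := by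
      by_contra hz1
      have : (z : ℚ) + i < 0 := by
        have : z + (i : ℤ) < 0 := by omega
        exact_mod_cast this
      nlinarith
    have him := i.2
    have ht1 : -1 < t := by
      by_contra ht1
      have : (m : ℤ) * t ≤ m * (-1) := by gcongr; omega
      omega
    have ht0 : t < 0 := by
      by_contra ht0
      have : (m : ℤ) * 0 ≤ m * t := by gcongr; omega
      omega
    omega
  · have : Subring.closure (integers K ∪ {θ}) ≤
        ({ M.toSubring with
            carrier := integers M
            mul_mem' := fun {x y} hx hy => ⟨M.mul_mem hx.1 hy.1, by
              have h1 := hx.2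
              have h2 := hy.2
              rw [h.valBar_eq] at h1 h2 ⊢
              rw [w.map_mul]
              exact add_nonneg h1 h2⟩
            one_mem' := ⟨M.one_mem, by rw [h.valBar_eq, w.map_one]⟩
            add_mem' := fun {x y} hx hy => ⟨M.add_mem hx.1 hy.1, by
              have h1 := hx.2
              have h2 := hy.2
              rw [h.valBar_eq] at h1 h2 ⊢
              exact w.map_le_add h1 h2⟩
            zero_mem' := ⟨M.zero_mem, by rw [h.valBar_eq, w.map_zero]; exact le_top⟩
            neg_mem' := fun {x} hx => ⟨M.neg_mem hx.1, by
              have h1 := hx.2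
              rw [h.valBar_eq] at h1 ⊢
              rwa [w.map_neg]⟩ } : Subring B.Closure) := by
      rw [Subring.closure_le]
      rintro x (hx | rfl)
      · exact ⟨hKM hx.1, hx.2⟩
      · refine ⟨hs.mem, ?_⟩
        rw [h.valBar_eq, hs.value]
        exact hpos _ hq0.le
    exact this

end StdPair

end

/-! ### Ramification indices and the canonical valuation -/

section

variable {p n : ℕ} {B : BasicField n}
  {w : AddValuation B.Closure (WithTop (QLex (n + 1)))}

lemma constants_mono {K L : Subfield B.Closure} (hKL : K ≤ L) (i : ℕ) :
    constants p K i ≤ constants p L i := inf_le_inf_right _ hKL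

namespace GoodBar

lemma constBar_le_constants {K : Subfield B.Closure} (hK : B.base ≤ K) (i : ℕ) :
    B.constBar i ≤ constants p K i :=
  le_inf ((constBar_le_base i).trans hK) (constBar_le_constHull i)

lemma ramIndex_base_eq (h : GoodBar p B w) (L : Subfield B.Closure) (k : ℕ) :
    ramIndex p B.base L k = ((B.constBar (k + 1)).relfinrank (constants p L (k + 1)) : ℚ) /
      ((B.constBar k).relfinrank (constants p L k) : ℚ) := by
  rw [ramIndex, h.constants_base, h.constants_base]

lemma ramIndex_base_pos (h : GoodBar p B w) {L : Subfield B.Closure} (hL : IsLF L) (k : ℕ) :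
    0 < ramIndex p B.base L k := by
  have h1 := h.relfinrank_constants_ne_zero (p := p) hL k
  have h2 := h.relfinrank_constants_ne_zero (p := p) hL (k + 1)
  rw [h.ramIndex_base_eq]
  positivity

/-- The ramification indices are multiplicative. -/
lemma ramIndex_mul (h : GoodBar p B w) {K L : Subfield B.Closure} (hK : IsLF K) (hKL : K ≤ L)
    (k : ℕ) : ramIndex p B.base L k = ramIndex p B.base K k * ramIndex p K L k := by
  have hk := fun i => Subfield.relfinrank_mul_relfinrank
    (constBar_le_constants (p := p) hK.base_le i) (constants_mono (p := p) hKL i)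
  rw [h.ramIndex_base_eq, h.ramIndex_base_eq, ramIndex, ← hk, ← hk, Nat.cast_mul, Nat.cast_mul,
    mul_div_mul_comm]

lemma constants_eq_of_le (h : GoodBar p B w) {K L : Subfield B.Closure} (hKL : K ≤ L)
    (hc : constants p L n = constants p K n) {i : ℕ} (hi : i ≤ n) :
    constants p L i = constants p K i := by
  refine le_antisymm (le_inf ?_ inf_le_right) (constants_mono hKL i)
  have h1 : constants p L i ≤ constants p L n := inf_le_inf_left _ (h.constHull_mono hi)
  rw [hc] at h1
  exact h1.trans inf_le_left

end GoodBar

lemma relfinrank_ne_zero_of_isLF {K L : Subfield B.Closure} (hK : IsLF K) (hL : IsLF L)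
    (hKL : K ≤ L) : K.relfinrank L ≠ 0 := by
  have := hL.finite
  rw [← Subfield.relfinrank_mul_relfinrank hK.base_le hKL] at this
  exact right_ne_zero_of_mul this

/-- An extension `L / K` without extension of the `n`-dimensional constants, together with a
standard pair `(LE, E)` obtained by an extension of the constants which is linearly disjoint
from `L`. -/
structure StdDatum (p : ℕ) {n : ℕ} {B : BasicField n} (K L E : Subfield B.Closure)
    (θ : B.Closure) : Prop where
  base : IsLF K
  top : IsLF L
  le : K ≤ L
  sep : ∀ x ∈ L, IsSeparable K x
  const_eq : constants p L n = constants p K n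
  le_const : constants p L n ≤ E
  finite : (constants p L n).relfinrank E ≠ 0
  degree : L.relfinrank (L ⊔ E) = (constants p L n).relfinrank E
  param : IsLastParam p n (L ⊔ E) E θ

namespace StdDatum

variable {K L E : Subfield B.Closure} {θ : B.Closure}

lemma const_le_base (hd : StdDatum p K L E θ) : constants p L n ≤ K := by
  rw [hd.const_eq]
  exact inf_le_left

lemma isLF_sup_top (hd : StdDatum p K L E θ) : IsLF (L ⊔ E) :=
  hd.top.sup inf_le_left hd.le_const hd.finite

lemma isLF_sup_base (hd : StdDatum p K L E θ) : IsLF (K ⊔ E) :=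
  hd.base.sup hd.const_le_base hd.le_const hd.finite

lemma sup_le_sup (hd : StdDatum p K L E θ) : K ⊔ E ≤ L ⊔ E := sup_le_sup_right hd.le E

lemma relfinrank_pos (hd : StdDatum p K L E θ) : 0 < K.relfinrank L :=
  Nat.pos_of_ne_zero (relfinrank_ne_zero_of_isLF hd.base hd.top hd.le)

/-- The degree of `L` over `K` does not change under the extension of the constants. -/
lemma relfinrank_sup (hd : StdDatum p K L E θ) :
    (K ⊔ E).relfinrank (L ⊔ E) = K.relfinrank L := by
  have h1 := relfinrank_sup_le hd.const_le_base hd.le_const hd.finite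
  have h2 := relfinrank_sup_le (M := K ⊔ E) (le_sup_left : K ≤ K ⊔ E) hd.le
    hd.relfinrank_pos.ne'
  have h3 : K ⊔ E ⊔ L = L ⊔ E := by
    rw [sup_right_comm, sup_eq_right.2 hd.le]
  rw [h3] at h2
  have h4 := Subfield.relfinrank_mul_relfinrank hd.le (le_sup_left : L ≤ L ⊔ E)
  have h5 := Subfield.relfinrank_mul_relfinrank (le_sup_left : K ≤ K ⊔ E) hd.sup_le_sup
  rw [hd.degree, ← h5] at h4
  refine le_antisymm h2.2 (le_of_not_gt fun hlt => ?_)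
  have h6 := Nat.pos_of_ne_zero h1.1
  have := calc K.relfinrank (K ⊔ E) * (K ⊔ E).relfinrank (L ⊔ E)
      < K.relfinrank (K ⊔ E) * K.relfinrank L := by gcongr
    _ ≤ (constants p L n).relfinrank E * K.relfinrank L := by gcongr; exact h1.2
    _ = _ := mul_comm _ _
  omega

lemma exists_stdPair [Fact p.Prime] (hd : StdDatum p K L E θ) (h : GoodBar p B w) :
    ∃ q, StdPair p w (L ⊔ E) E θ q :=
  hd.param.stdPair h hd.isLF_sup_top.base_le (h.sc_of_isLF hd.isLF_sup_top)

lemma natDegree_minpoly [Fact p.Prime] (hd : StdDatum p K L E θ) (h : GoodBar p B w) :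
    (minpoly ↥(K ⊔ E) θ).natDegree = K.relfinrank L := by
  obtain ⟨q, hs⟩ := hd.exists_stdPair h
  rw [← hd.relfinrank_sup, hs.relfinrank_eq_natDegree h hd.isLF_sup_base.base_le le_sup_right
    hd.sup_le_sup (h.sc_of_isLF hd.isLF_sup_base)]

/-- The last parameter has value `(0, …, 0, 1)` for the valuation of `L`. -/
lemma canonVal_param [Fact p.Prime] (hd : StdDatum p K L E θ) (h : GoodBar p B w) :
    canonVal p L θ = (lastVec n 1 : WithTop (QLex (n + 1))) := by
  obtain ⟨q, hs⟩ := hd.exists_stdPair h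
  have hcl : B.constBar n ≤ constants p L n := GoodBar.constBar_le_constants hd.top.base_le n
  have h1 := hs.relfinrank_eq h hd.isLF_sup_top
  rw [← Subfield.relfinrank_mul_relfinrank hd.top.base_le (le_sup_left : L ≤ L ⊔ E), hd.degree,
    ← Subfield.relfinrank_mul_relfinrank hcl hd.le_const, ← mul_assoc] at h1
  have h2 := Nat.eq_of_mul_eq_mul_right (Nat.pos_of_ne_zero hd.finite) h1
  have h3 : ramIndex p B.base L n = q := by
    have h4 := h.relfinrank_constants_ne_zero (p := p) hd.top n
    have h5 : ((B.constBar n).relfinrank (constants p L n) : ℚ) ≠ 0 := by exact_mod_cast h4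
    rw [h.ramIndex_base_eq, h.top, h.constants_top, h2, Nat.cast_mul, mul_div_cancel_right₀ _ h5]
  rw [canonVal, h.valBar_eq, hs.value, WithTop.map_coe, WithTop.coe_eq_coe]
  refine qlex_ext fun k => ?_
  change ramIndex p B.base L k * ofLex (lastVec n _) k = _
  by_cases hk : k = Fin.last n
  · subst hk
    rw [lastVec_last, lastVec_last, Fin.val_last, h3]
    have : (q : ℚ) ≠ 0 := by exact_mod_cast hs.q_pos.ne'
    field_simp
  · rw [lastVec_of_ne n _ hk, lastVec_of_ne n _ hk, mul_zero]

/-- Only the last ramification index of `L / K` is nontrivial. -/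
lemma ramIndex_eq (hd : StdDatum p K L E θ) (h : GoodBar p B w) (k : Fin (n + 1)) :
    ramIndex p K L k = if k = Fin.last n then (K.relfinrank L : ℚ) else 1 := by
  have hK : ∀ i ≤ n, (constants p K i).relfinrank (constants p L i) = 1 := by
    intro i hi
    rw [h.constants_eq_of_le hd.le hd.const_eq hi, Subfield.relfinrank_self]
  by_cases hk : k = Fin.last n
  · subst hk
    rw [if_pos rfl, Fin.val_last, ramIndex, hK n le_rfl, h.constants_top, h.constants_top]
    simp
  · rw [if_neg hk, ramIndex, hK _ (Nat.succ_le_of_lt (Fin.val_lt_last hk)),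
      hK _ (Fin.val_lt_last hk).le]
    simp

/-- The datum of the theorem is one of those which define the ramification filtration. -/
lemma generates [Fact p.Prime] (hd : StdDatum p K L E θ) (h : GoodBar p B w) :
    IsRamDatum p K L n E θ := by
  obtain ⟨q, hs⟩ := hd.exists_stdPair h
  refine ⟨hd.le_const, hd.finite, ?_, ?_⟩
  · rw [h.constants_top]
    exact hd.param
  · rw [h.constants_top, h.constants_top]
    exact hs.integers_eq h hd.isLF_sup_base.base_le le_sup_right
      hd.sup_le_sup (h.sc_of_isLF hd.isLF_sup_base)

/-- The minimal polynomial of the parameter is separable. -/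
lemma separable (hd : StdDatum p K L E θ) : (minpoly ↥(K ⊔ E) θ).Separable := by
  have h1 : L ⊔ E ≤ (separableClosure ↥(K ⊔ E) B.Closure).toSubfield := by
    refine sup_le (fun x hx => ?_) fun x hx => ?_
    · refine mem_separableClosure_iff.2 ?_
      have h2 := hd.sep x hx
      have h4 := Polynomial.Separable.map (f := Subfield.inclusion (le_sup_left : K ≤ K ⊔ E)) h2
      refine h4.of_dvd (minpoly.dvd _ _ ?_)
      rw [aeval_def, eval₂_map]
      exact minpoly.aeval K x
    · exact (separableClosure ↥(K ⊔ E) B.Closure).algebraMap_mem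
        ⟨x, (le_sup_right : E ≤ K ⊔ E) hx⟩
  have h2 : θ ∈ L ⊔ E := by
    obtain ⟨-, t, -, ht⟩ := hd.param
    exact (isUniformizerAt_last ht).1
  exact mem_separableClosure_iff.1 (h1 h2)

end StdDatum

end

/-! ### Displacement of elements, and extension of embeddings -/

section

variable {p n : ℕ} {B : BasicField n}
  {w : AddValuation B.Closure (WithTop (QLex (n + 1)))}

lemma exists_ringEquiv_algEquiv {Ω : Type*} [Field Ω] {k : Subfield Ω} (σ : Ω ≃+* Ω)
    (hσ : ∀ x ∈ k, σ x = x) : ∃ σ' : Ω ≃ₐ[k] Ω, ∀ x, σ' x = σ x :=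
  ⟨AlgEquiv.ofRingEquiv (f := σ) fun x => hσ x x.2, fun _ => rfl⟩

lemma GoodBar.value_ringEquiv (h : GoodBar p B w) (σ : B.Closure ≃+* B.Closure)
    (hσ : ∀ x ∈ B.base, σ x = x) (x : B.Closure) : w (σ x) = w x := by
  obtain ⟨σ', hσ'⟩ := exists_ringEquiv_algEquiv σ hσ
  rw [← hσ', h.value_conj le_rfl]

/-- `σ` moves `x` by `γ` at least, relative to the value of `x`. -/
def IsDisp (w : AddValuation B.Closure (WithTop (QLex (n + 1)))) (σ : B.Closure ≃+* B.Closure)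
    (γ : WithTop (QLex (n + 1))) (x : B.Closure) : Prop := w x + γ ≤ w (σ x - x)

namespace IsDisp

variable {σ : B.Closure ≃+* B.Closure} {γ : WithTop (QLex (n + 1))}

lemma of_fixed {x : B.Closure} (hx : σ x = x) : IsDisp w σ γ x := by
  rw [IsDisp, hx, sub_self, w.map_zero]
  exact le_top

lemma mul (hσ : ∀ x, w (σ x) = w x) {x y : B.Closure} (hx : IsDisp w σ γ x)
    (hy : IsDisp w σ γ y) : IsDisp w σ γ (x * y) := by
  have h1 : σ (x * y) - x * y = σ x * (σ y - y) + (σ x - x) * y := by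
    rw [map_mul]
    ring
  rw [IsDisp, h1]
  refine w.map_le_add ?_ ?_
  · rw [w.map_mul, w.map_mul, hσ, add_assoc]
    exact add_le_add_right hy _
  · rw [w.map_mul, w.map_mul, add_right_comm]
    exact add_le_add_left hx _

lemma pow (hσ : ∀ x, w (σ x) = w x) {x : B.Closure} (hx : IsDisp w σ γ x) (m : ℕ) :
    IsDisp w σ γ (x ^ m) := by
  induction m with
  | zero => exact of_fixed (by simp)
  | succ m ih =>
    rw [pow_succ]
    exact ih.mul hσ hx

lemma sum {k : Subfield B.Closure} {ι : Type*} [Fintype ι] {ω : ι → B.Closure}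
    (hω : IsOrth k w ω) (a : ι → k) (ha : ∀ i, IsDisp w σ γ (a i • ω i)) :
    IsDisp w σ γ (∑ i, a i • ω i) := by
  have h1 : σ (∑ i, a i • ω i) - ∑ i, a i • ω i = ∑ i, (σ (a i • ω i) - a i • ω i) := by
    rw [map_sum, ← Finset.sum_sub_distrib]
  rw [IsDisp, h1]
  exact w.map_le_sum fun i _ => (add_le_add_left (hω.2 a i) γ).trans (ha i)

end IsDisp

/-- If `σ` moves the last parameter of `M` by `γ` at least, it moves all elements of `M` by `γ` at
least, even after an extension of the constants. -/
lemma StdPair.isDisp [Fact p.Prime] {M E θ q} (hs : StdPair p w M E θ q) (h : GoodBar p B w)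
    (hM : IsLF M) {K : Subfield B.Closure} (hbK : B.base ≤ K) (hEK : E ≤ K) (hKM : K ≤ M)
    (hK : IsSC w (K : Set B.Closure)) {E₂ : Subfield B.Closure} (hE₂ : E ≤ E₂)
    (hfin : E.relfinrank E₂ ≠ 0) (hE₂c : E₂ ≤ constHull p B n) {σ : B.Closure ≃+* B.Closure}
    (hσK : ∀ x ∈ K, σ x = x) (hσE : ∀ x ∈ E₂, σ x = x) {γ : WithTop (QLex (n + 1))}
    (hθ : IsDisp w σ γ θ) {x : B.Closure} (hx : x ∈ M ⊔ E₂) : IsDisp w σ γ x := by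
  have hσ : ∀ x, w (σ x) = w x := h.value_ringEquiv σ fun x hx => hσK x (hbK hx)
  have hEsc : IsSC w (E : Set B.Closure) := by
    refine isSC_of_finite (h.sc n) hs.constBar_le ?_
    rw [hs.eq]
    exact h.relfinrank_constants_ne_zero (p := p) hM n
  obtain ⟨ω, hω, hsp⟩ := exists_orth_basis hEsc hE₂ hfin
  obtain ⟨m, -, horth, hpow, -⟩ := hs.exists_power_basis h hbK hEK hKM hK
  obtain ⟨b, rfl⟩ := (hsp.sup (fun x _ => (isAlgebraic_of_base_le hs.base_le).isAlgebraic x)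
    hs.le).2 x hx
  refine IsDisp.sum (hs.transfer h hω fun j => hE₂c (hsp.1 j)) b fun j => ?_
  rw [Subfield.smul_def, smul_eq_mul]
  refine IsDisp.mul hσ ?_ (IsDisp.of_fixed (hσE _ (hsp.1 j)))
  obtain ⟨a, ha⟩ := hpow.2 (b j) (b j).2
  rw [← ha]
  refine IsDisp.sum horth a fun i => ?_
  rw [Subfield.smul_def, smul_eq_mul]
  exact IsDisp.mul hσ (IsDisp.of_fixed (hσK _ (a i).2)) (hθ.pow hσ i)

/-- An embedding of `L` over `K` extends to `kL` over `k` when `k` and `L` are linearly disjoint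
over `K`. -/
lemma exists_fixing_of_relfinrank_eq {K L k : Subfield B.Closure} (hbK : B.base ≤ K) (hKL : K ≤ L)
    (hKk : K ≤ k) (hsep : ∀ x ∈ L, IsSeparable K x) (hfin : K.relfinrank L ≠ 0)
    (hdeg : k.relfinrank (k ⊔ L) = K.relfinrank L) (σ : B.Closure ≃+* B.Closure)
    (hσ : ∀ x ∈ K, σ x = x) :
    ∃ σ' : B.Closure ≃+* B.Closure, (∀ x ∈ k, σ' x = x) ∧ ∀ x ∈ L, σ' x = σ x := by
  rw [Subfield.relfinrank_eq_finrank_of_le hKL] at hfin hdeg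
  rw [Subfield.relfinrank_eq_finrank_of_le le_sup_left] at hdeg
  have hF : Module.Finite K (Subfield.extendScalars hKL) := Module.finite_of_finrank_pos (by omega)
  have hS : Algebra.IsSeparable K (Subfield.extendScalars hKL) := ⟨fun x => by
    have := hsep x x.2
    rw [IsSeparable] at this ⊢
    rwa [← minpoly.algebraMap_eq (algebraMap (Subfield.extendScalars hKL) B.Closure).injective x]⟩
  obtain ⟨γ, hγ⟩ := Field.exists_primitive_element K (Subfield.extendScalars hKL)
  have hγL : (γ : B.Closure) ∈ L := γ.2
  have hγK : IntermediateField.adjoin K {(γ : B.Closure)} = Subfield.extendScalars hKL := by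
    have := congrArg IntermediateField.lift hγ
    rwa [IntermediateField.lift_adjoin_simple, IntermediateField.lift_top] at this
  have hintK : IsIntegral K (γ : B.Closure) :=
    ((isAlgebraic_of_base_le hbK).isAlgebraic _).isIntegral
  have hbk := hbK.trans hKk
  have hintk : IsIntegral k (γ : B.Closure) :=
    ((isAlgebraic_of_base_le hbk).isAlgebraic _).isIntegral
  have hLclosure : ∀ S : Subfield B.Closure, K ≤ S → (γ : B.Closure) ∈ S → L ≤ S := by
    intro S hKS hγS x hx
    have h1 : x ∈ IntermediateField.adjoin K {(γ : B.Closure)} := by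
      rw [hγK]
      exact hx
    have h2 : (IntermediateField.adjoin K {(γ : B.Closure)}).toSubfield ≤ S := by
      refine Subfield.closure_le.2 ?_
      rintro y (⟨z, rfl⟩ | rfl)
      · exact hKS z.2
      · exact hγS
    exact h2 h1
  have hγk : IntermediateField.adjoin k {(γ : B.Closure)} =
      Subfield.extendScalars (le_sup_left : k ≤ k ⊔ L) := by
    refine le_antisymm ?_ ?_
    · rw [IntermediateField.adjoin_simple_le_iff]
      exact (le_sup_right : L ≤ k ⊔ L) hγL
    · have h1 : k ⊔ L ≤ (IntermediateField.adjoin k {(γ : B.Closure)}).toSubfield := by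
        have hk1 : k ≤ (IntermediateField.adjoin k {(γ : B.Closure)}).toSubfield := fun x hx =>
          (IntermediateField.adjoin k {(γ : B.Closure)}).algebraMap_mem ⟨x, hx⟩
        exact sup_le hk1 (hLclosure _ (hKk.trans hk1)
          (IntermediateField.mem_adjoin_simple_self k _))
      exact h1
  have hdegeq : (minpoly k (γ : B.Closure)).natDegree = (minpoly K (γ : B.Closure)).natDegree := by
    rw [← IntermediateField.adjoin.finrank hintk, ← IntermediateField.adjoin.finrank hintK, hγk,
      hγK]
    exact hdeg
  -- a primitive element of `L` keeps its minimal polynomial over `k`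
  have hpoly : (minpoly K (γ : B.Closure)).map (Subfield.inclusion hKk) =
      minpoly k (γ : B.Closure) := by
    refine (Polynomial.eq_of_dvd_of_natDegree_le_of_leadingCoeff ?_ ?_ ?_).symm
    · refine minpoly.dvd _ _ ?_
      rw [aeval_def, eval₂_map]
      exact minpoly.aeval K _
    · rw [natDegree_map, hdegeq]
    · rw [(minpoly.monic hintk).leadingCoeff, ((minpoly.monic hintK).map _).leadingCoeff]
  obtain ⟨σ₁, hσ₁⟩ := exists_ringEquiv_algEquiv σ hσ
  have hroot : aeval (σ γ) (minpoly k (γ : B.Closure)) = 0 := by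
    rw [← hpoly, aeval_def, eval₂_map, ← hσ₁]
    change aeval (σ₁ (γ : B.Closure)) (minpoly K (γ : B.Closure)) = 0
    rw [aeval_algHom_apply, minpoly.aeval, _root_.map_zero]
  have := normal_of_base_le hbk
  obtain ⟨τ, hτ⟩ := (isConjRoot_iff_exists_algEquiv (K := k)).1
    ((isConjRoot_iff_aeval_eq_zero hintk).2 hroot).symm
  refine ⟨τ.toRingEquiv, fun x hx => τ.commutes ⟨x, hx⟩, fun x hx => ?_⟩
  exact hLclosure (RingHom.eqLocusField (τ.toRingEquiv : B.Closure →+* B.Closure)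
    (σ : B.Closure →+* B.Closure))
    (fun y hy => (τ.commutes ⟨y, hKk hy⟩).trans (hσ y hy).symm) hτ hx

end

/-! ### Independence of the ramification filtration of the choices -/

section

variable {r : ℕ}

lemma scale_apply (c : Fin r → ℚ) (x : QLex r) (k : Fin r) :
    ofLex (scale c x) k = c k * ofLex x k := rfl

lemma scale_add (c : Fin r → ℚ) (x y : QLex r) : scale c (x + y) = scale c x + scale c y :=
  qlex_ext fun k => mul_add (c k) (ofLex x k) (ofLex y k)

lemma scale_scale (c c' : Fin r → ℚ) (x : QLex r) :
    scale c (scale c' x) = scale (fun k => c k * c' k) x :=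
  qlex_ext fun k => (mul_assoc (c k) (c' k) (ofLex x k)).symm

lemma scale_inv {c : Fin r → ℚ} (hc : ∀ k, 0 < c k) (x : QLex r) :
    scale c (scale (fun k => (c k)⁻¹) x) = x :=
  qlex_ext fun k => mul_inv_cancel_left₀ (hc k).ne' (ofLex x k)

lemma scale_strictMono {c : Fin r → ℚ} (hc : ∀ k, 0 < c k) : StrictMono (scale c) := by
  rintro x y ⟨k, hk, hlt⟩
  refine ⟨k, fun l hl => ?_, ?_⟩
  · exact congrArg (c l * ·) (hk l hl)
  · exact mul_lt_mul_of_pos_left hlt (hc k)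

/-- Coordinatewise multiplication as a homomorphism. -/
def scaleHom (c : Fin r → ℚ) : QLex r →+ QLex r where
  toFun := scale c
  map_zero' := qlex_ext fun k => mul_zero (c k)
  map_add' := scale_add c

lemma scaleHom_apply (c : Fin r → ℚ) (x : QLex r) : scaleHom c x = scale c x := rfl

end

section

variable {p n : ℕ} {B : BasicField n}
  {w : AddValuation B.Closure (WithTop (QLex (n + 1)))}

namespace GoodBar

/-- The canonical valuation is a valuation. -/
lemma exists_canonVal (h : GoodBar p B w) {L : Subfield B.Closure} (hL : IsLF L) :
    ∃ v : AddValuation B.Closure (WithTop (QLex (n + 1))), ∀ x, canonVal p L x = v x := by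
  have hm := (scale_strictMono (c := fun k : Fin (n + 1) => ramIndex p B.base L k)
    fun k => h.ramIndex_base_pos hL k).monotone
  refine ⟨w.map (scaleHom fun k => ramIndex p B.base L k).withTopMap rfl hm.withTop_map,
    fun x => ?_⟩
  rw [canonVal, h.valBar_eq]
  rfl

lemma canonVal_eq_map (h : GoodBar p B w) {K L : Subfield B.Closure} (hK : IsLF K) (hKL : K ≤ L)
    (x : B.Closure) :
    canonVal p L x = (canonVal p K x).map (scale fun k => ramIndex p K L k) := by
  rw [canonVal, canonVal, WithTop.map_map]
  congr 1
  funext y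
  rw [Function.comp_apply, scale_scale]
  congr 1
  funext k
  rw [h.ramIndex_mul hK hKL, mul_comm]

lemma canonVal_add_le_iff (h : GoodBar p B w) {L : Subfield B.Closure} (hL : IsLF L)
    (x y : B.Closure) (j : QLex (n + 1)) : canonVal p L x + j ≤ canonVal p L y ↔
      w x + (scale (fun k => (ramIndex p B.base L k)⁻¹) j : QLex (n + 1)) ≤ w y := by
  have hpos := fun k : Fin (n + 1) => h.ramIndex_base_pos hL k
  have hm := scale_strictMono hpos
  rw [canonVal, canonVal, h.valBar_eq, h.valBar_eq]
  have : (WithTop.map (scale fun k : Fin (n + 1) => ramIndex p B.base L k) (w x)) +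
    (j : WithTop _) =
      WithTop.map (scale fun k : Fin (n + 1) => ramIndex p B.base L k)
        (w x + (scale (fun k => (ramIndex p B.base L k)⁻¹) j : QLex (n + 1))) := by
    cases hx : w x with
    | top => rfl
    | coe g =>
      rw [← WithTop.coe_add, WithTop.map_coe, WithTop.map_coe, scale_add, scale_inv hpos,
        WithTop.coe_add]
  rw [this]
  exact WithTop.map_le_iff _ fun {a b} => hm.le_iff_le

end GoodBar

lemma map_trunc_self {N : ℕ} (h : N ≤ N) (x : WithTop (QLex N)) : x.map (trunc h) = x := by
  have : (trunc h : QLex N → QLex N) = id := by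
    funext y
    rfl
  rw [this, WithTop.map_id, id]

namespace StdDatum

variable {K L E : Subfield B.Closure} {θ : B.Closure}

lemma exists_root_index {d : ℕ} {θs : Fin d → B.Closure}
    (hroots : (minpoly ↥(K ⊔ E) θ).map (algebraMap ↥(K ⊔ E) B.Closure) =
      ∏ l, (Polynomial.X - Polynomial.C (θs l))) {y : B.Closure} :
    aeval y (minpoly ↥(K ⊔ E) θ) = 0 ↔ ∃ l, θs l = y := by
  rw [aeval_def, ← eval_map, hroots, eval_prod, Finset.prod_eq_zero_iff]
  simp only [Finset.mem_univ, true_and, eval_sub, eval_X, eval_C, sub_eq_zero]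
  exact exists_congr fun l => eq_comm

lemma roots_injective (hd : StdDatum p K L E θ) {d : ℕ} {θs : Fin d → B.Closure}
    (hroots : (minpoly ↥(K ⊔ E) θ).map (algebraMap ↥(K ⊔ E) B.Closure) =
      ∏ l, (Polynomial.X - Polynomial.C (θs l))) : Function.Injective θs := by
  have := hd.separable.map (f := algebraMap ↥(K ⊔ E) B.Closure)
  rw [hroots] at this
  exact Polynomial.separable_prod_X_sub_C_iff.1 this

lemma exists_conj (hd : StdDatum p K L E θ) {d : ℕ} {θs : Fin d → B.Closure}
    (hroots : (minpoly ↥(K ⊔ E) θ).map (algebraMap ↥(K ⊔ E) B.Closure) =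
      ∏ l, (Polynomial.X - Polynomial.C (θs l))) (l : Fin d) :
    ∃ σ : B.Closure ≃+* B.Closure, (∀ x ∈ K ⊔ E, σ x = x) ∧ σ θ = θs l := by
  have hint : IsIntegral ↥(K ⊔ E) θ :=
    ((isAlgebraic_of_base_le hd.isLF_sup_base.base_le).isAlgebraic θ).isIntegral
  have := normal_of_base_le hd.isLF_sup_base.base_le
  obtain ⟨τ, hτ⟩ := (isConjRoot_iff_exists_algEquiv (K := ↥(K ⊔ E))).1
    ((isConjRoot_iff_aeval_eq_zero hint).2 ((exists_root_index hroots).2 ⟨l, rfl⟩)).symm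
  exact ⟨τ.toRingEquiv, fun x hx => τ.commutes ⟨x, hx⟩, hτ⟩

lemma mem (hd : StdDatum p K L E θ) : θ ∈ L ⊔ E := by
  obtain ⟨-, t, -, ht⟩ := hd.param
  exact (isUniformizerAt_last ht).1

lemma eq_on_of_eq [Fact p.Prime] (hd : StdDatum p K L E θ) (h : GoodBar p B w)
    {σ τ : B.Closure ≃+* B.Closure} (hσ : ∀ x ∈ K ⊔ E, σ x = x) (hτ : ∀ x ∈ K ⊔ E, τ x = x)
    (heq : σ θ = τ θ) {x : B.Closure} (hx : x ∈ L ⊔ E) : σ x = τ x := by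
  obtain ⟨q, hs⟩ := hd.exists_stdPair h
  obtain ⟨m, -, -, hsp, -⟩ := hs.exists_power_basis h hd.isLF_sup_base.base_le le_sup_right
    hd.sup_le_sup (h.sc_of_isLF hd.isLF_sup_base)
  obtain ⟨a, rfl⟩ := hsp.2 x hx
  rw [map_sum, map_sum]
  refine Finset.sum_congr rfl fun i _ => ?_
  rw [Subfield.smul_def, smul_eq_mul, map_mul, map_mul, map_pow, map_pow, heq, hσ _ (a i).2,
    hτ _ (a i).2]

/-- The ramification filtration does not depend on the choice of the extension of the constants and
of the last parameter: an automorphism over `KE₁` which satisfies the condition for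
`(E₁, θ₁)` coincides on `L` with one over `KE` which satisfies the condition for `(E, θ)`. -/
lemma exists_of_ramDatum [Fact p.Prime] (hd : StdDatum p K L E θ) (h : GoodBar p B w)
    {E₁ : Subfield B.Closure} {θ₁ : B.Closure} (hcE₁ : constants p L n ≤ E₁)
    (hfin₁ : (constants p L n).relfinrank E₁ ≠ 0) (hparam₁ : IsLastParam p n (L ⊔ E₁) E₁ θ₁)
    {σ₁ : B.Closure ≃+* B.Closure} (hσ₁ : ∀ x ∈ K ⊔ E₁, σ₁ x = x) {j : QLex (n + 1)}
    (hj : canonVal p L θ₁ + j ≤ canonVal p L (σ₁ θ₁ - θ₁)) :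
    ∃ σ : B.Closure ≃+* B.Closure, (∀ x ∈ K ⊔ E, σ x = x) ∧ (∀ x ∈ L, σ x = σ₁ x) ∧
      canonVal p L θ + j ≤ canonVal p L (σ θ - θ) := by
  rw [h.canonVal_add_le_iff hd.top] at hj
  have hLE₁ : IsLF (L ⊔ E₁) := hd.top.sup inf_le_left hcE₁ hfin₁
  have hKE₁ : IsLF (K ⊔ E₁) := hd.base.sup hd.const_le_base hcE₁ hfin₁
  obtain ⟨q₁, hs₁⟩ := hparam₁.stdPair h hLE₁.base_le (h.sc_of_isLF hLE₁)
  obtain ⟨q, hs⟩ := hd.exists_stdPair h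
  -- the degree of `L E E₁` over `K E E₁` is still that of `L` over `K`
  have hE₂fin : E.relfinrank (E ⊔ E₁) ≠ 0 := (relfinrank_sup_le hd.le_const hcE₁ hfin₁).1
  have hE₁fin : E₁.relfinrank (E ⊔ E₁) ≠ 0 := by
    rw [sup_comm]
    exact (relfinrank_sup_le hcE₁ hd.le_const hd.finite).1
  have hE₂c : E ⊔ E₁ ≤ constHull p B n := sup_le hs.le_constHull hs₁.le_constHull
  have hdeg : (K ⊔ (E ⊔ E₁)).relfinrank (K ⊔ (E ⊔ E₁) ⊔ L) = K.relfinrank L := by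
    have hEsc : IsSC w (E : Set B.Closure) := by
      refine isSC_of_finite (h.sc n) hs.constBar_le ?_
      rw [hs.eq]
      exact h.relfinrank_constants_ne_zero (p := p) hd.isLF_sup_top n
    obtain ⟨ω, hω, hsp⟩ := exists_orth_basis hEsc le_sup_left hE₂fin
    have h1 := relfinrank_eq_card le_sup_left
      (hsp.sup (fun x _ => (isAlgebraic_of_base_le hs.base_le).isAlgebraic x) hs.le)
      ((hs.transfer h hω fun j => hE₂c (hsp.1 j)).linearIndependent (isNorm_subfield w _))
    rw [Fintype.card_fin] at h1
    have h2 := relfinrank_sup_le (le_sup_right : E ≤ K ⊔ E) (le_sup_left : E ≤ E ⊔ E₁) hE₂fin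
    have h3 := relfinrank_sup_le (le_sup_left : K ≤ K ⊔ (E ⊔ E₁)) hd.le hd.relfinrank_pos.ne'
    have h4 : K ⊔ E ⊔ (E ⊔ E₁) = K ⊔ (E ⊔ E₁) := by rw [sup_assoc, ← sup_assoc E E, sup_idem]
    have h5 : L ⊔ E ⊔ (E ⊔ E₁) = K ⊔ (E ⊔ E₁) ⊔ L := by
      rw [sup_assoc, ← sup_assoc E E, sup_idem, sup_right_comm, sup_eq_right.2 hd.le]
    rw [h4] at h2
    rw [h5] at h1
    -- compare the degree of `L E E₁` over `K E` along `L E` and along `K E E₁`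
    have h6 := Subfield.relfinrank_mul_relfinrank hd.sup_le_sup
      (show L ⊔ E ≤ K ⊔ (E ⊔ E₁) ⊔ L from h5 ▸ le_sup_left)
    rw [h1, hd.relfinrank_sup, ← Subfield.relfinrank_mul_relfinrank
      (show K ⊔ E ≤ K ⊔ (E ⊔ E₁) from h4 ▸ le_sup_left) le_sup_left] at h6
    refine le_antisymm h3.2 (le_of_not_gt fun hlt => ?_)
    have h7 := Nat.pos_of_ne_zero h2.1
    have := calc (K ⊔ E).relfinrank (K ⊔ (E ⊔ E₁)) *
          (K ⊔ (E ⊔ E₁)).relfinrank (K ⊔ (E ⊔ E₁) ⊔ L)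
        < (K ⊔ E).relfinrank (K ⊔ (E ⊔ E₁)) * K.relfinrank L := by gcongr
      _ ≤ E.relfinrank (E ⊔ E₁) * K.relfinrank L := by gcongr; exact h2.2
      _ = _ := mul_comm _ _
    omega
  -- the restriction of `σ₁` to `L` is extended by the identity on `K E E₁`
  obtain ⟨σ, hσ, hσL⟩ := exists_fixing_of_relfinrank_eq hd.base.base_le hd.le le_sup_left hd.sep
    hd.relfinrank_pos.ne' hdeg σ₁ fun x hx => hσ₁ x ((le_sup_left : K ≤ K ⊔ E₁) hx)
  have hσE₂ : ∀ x ∈ E ⊔ E₁, σ x = x := fun x hx =>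
    hσ x ((le_sup_right : E ⊔ E₁ ≤ K ⊔ (E ⊔ E₁)) hx)
  have hσK : ∀ x ∈ K, σ x = x := fun x hx => hσ x ((le_sup_left : K ≤ K ⊔ (E ⊔ E₁)) hx)
  have hagree : ∀ x ∈ L ⊔ E₁, σ x = σ₁ x := by
    intro x hx
    have h1 : L ⊔ E₁ ≤ RingHom.eqLocusField (σ : B.Closure →+* B.Closure)
        (σ₁ : B.Closure →+* B.Closure) := sup_le hσL fun y hy =>
      (hσE₂ y ((le_sup_right : E₁ ≤ E ⊔ E₁) hy)).trans
        (hσ₁ y ((le_sup_right : E₁ ≤ K ⊔ E₁) hy)).symm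
    exact h1 hx
  refine ⟨σ, fun x hx => hσ x (sup_le_sup_left (le_sup_left : E ≤ E ⊔ E₁) K hx), hσL, ?_⟩
  rw [h.canonVal_add_le_iff hd.top]
  refine hs₁.isDisp h hLE₁ hKE₁.base_le le_sup_right (sup_le_sup_right hd.le E₁)
    (h.sc_of_isLF hKE₁) le_sup_right hE₁fin hE₂c
    (fun x hx => hσ x (sup_le_sup_left (le_sup_right : E₁ ≤ E ⊔ E₁) K hx)) hσE₂ (x := θ) ?_ ?_
  · rw [IsDisp, hagree _ hs₁.mem]
    exact hj
  · have h1 : L ⊔ E ≤ L ⊔ E₁ ⊔ (E ⊔ E₁) :=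
      sup_le (le_sup_left.trans le_sup_left) (le_sup_left.trans le_sup_right)
    exact h1 hd.mem

/-- The ramification filtration in the top dimension consists of the embeddings which take `θ` to
a root `θ_l` with `v_L(θ_l - θ) ≥ v_L(θ) + j`. -/
lemma mem_lowerRam_iff [Fact p.Prime] (hd : StdDatum p K L E θ) (h : GoodBar p B w)
    {d : ℕ} {θs : Fin d → B.Closure}
    (hroots : (minpoly ↥(K ⊔ E) θ).map (algebraMap ↥(K ⊔ E) B.Closure) =
      ∏ l, (Polynomial.X - Polynomial.C (θs l))) (σs : Fin d → B.Closure ≃+* B.Closure)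
    (hσs : ∀ l, ∀ x ∈ K ⊔ E, σs l x = x) (hσθ : ∀ l, σs l θ = θs l) (j : QLex (n + 1)) :
    lowerRam p K L (Fin.last n) j =
      (fun l => (σs l : B.Closure →+* B.Closure).comp
        (constants p L ((Fin.last n : ℕ) + 1)).subtype) ''
      {l | canonVal p L θ + j ≤ canonVal p L (θs l - θ)} := by
  have hCL : constants p L ((Fin.last n : ℕ) + 1) = L := h.constants_top L
  have hCK : constants p K ((Fin.last n : ℕ) + 1) = K := h.constants_top K
  ext τ
  constructor
  · rintro ⟨E₁, θ₁, hdat, σ₁, hσ₁, hj⟩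
    rw [map_trunc_self, map_trunc_self] at hj
    have hparam := hdat.param
    rw [hCL] at hparam
    obtain ⟨σ, hσ, hσL, hσj⟩ := hd.exists_of_ramDatum h hdat.le hdat.finite hparam
      (σ₁ := σ₁.toRingEquiv) (fun x hx => σ₁.commutes ⟨x, by rwa [hCK]⟩) hj
    obtain ⟨l, hl⟩ : ∃ l, θs l = σ θ := by
      rw [← exists_root_index hroots]
      obtain ⟨σ', hσ'⟩ := exists_ringEquiv_algEquiv σ hσ
      rw [← hσ', aeval_algHom_apply, minpoly.aeval, _root_.map_zero]
    refine ⟨l, ?_, ?_⟩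
    · change canonVal p L θ + j ≤ canonVal p L (θs l - θ)
      rwa [hl]
    · refine RingHom.ext fun x => ?_
      rw [← hσ₁ x]
      have hxL : (x : B.Closure) ∈ L := hCL.le x.2
      exact (hd.eq_on_of_eq h (hσs l) hσ (by rw [hσθ, hl])
        ((le_sup_left : L ≤ L ⊔ E) hxL)).trans (hσL x hxL)
  · rintro ⟨l, hl, rfl⟩
    obtain ⟨σ', hσ'⟩ := exists_ringEquiv_algEquiv (k := constants p K ((Fin.last n : ℕ) + 1) ⊔ E)
      (σs l) (by rw [hCK]; exact hσs l)
    refine ⟨E, θ, hd.generates h, σ', fun x => hσ' x, ?_⟩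
    rw [map_trunc_self, map_trunc_self, hσ', hσθ]
    exact hl

open Classical in
/-- The number of elements of the ramification groups in the top dimension, in terms of the roots
of the minimal polynomial of the last parameter. -/
lemma ncard_lowerRam [Fact p.Prime] (hd : StdDatum p K L E θ) (h : GoodBar p B w)
    {d : ℕ} {θs : Fin d → B.Closure}
    (hroots : (minpoly ↥(K ⊔ E) θ).map (algebraMap ↥(K ⊔ E) B.Closure) =
      ∏ l, (Polynomial.X - Polynomial.C (θs l))) (j : QLex (n + 1)) :
    (lowerRam p K L (Fin.last n) j).ncard =
      (Finset.univ.filter fun l => canonVal p L θ + j ≤ canonVal p L (θs l - θ)).card := by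
  choose σs hσs hσθ using hd.exists_conj hroots
  rw [hd.mem_lowerRam_iff h hroots σs hσs hσθ, Set.ncard_image_of_injective]
  · rw [← Set.ncard_coe_finset]
    congr 1
    ext l
    simp
  · intro l l' hll'
    have hCL : constants p L ((Fin.last n : ℕ) + 1) = L := h.constants_top L
    refine hd.roots_injective hroots ?_
    rw [← hσθ, ← hσθ]
    have h1 : L ⊔ E ≤ RingHom.eqLocusField (σs l : B.Closure →+* B.Closure)
        (σs l' : B.Closure →+* B.Closure) := by
      refine sup_le (fun x hx => ?_) fun x hx => ?_
      · exact RingHom.congr_fun hll' (⟨x, by rwa [hCL]⟩ : constants p L ((Fin.last n : ℕ) + 1))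
      · have := (le_sup_right : E ≤ K ⊔ E) hx
        exact (hσs l x this).trans (hσs l' x this).symm
    exact h1 hd.mem

end StdDatum

end

/-! ### Integrals of step functions -/

section

variable {Γ : Type*} [LinearOrder Γ]

/-- The minimum of `x` and `b`, which is finite as `b` is. -/
def cap (x : WithTop Γ) (b : Γ) : Γ := min (x.untopD b) b

lemma coe_cap (x : WithTop Γ) (b : Γ) : ((cap x b : Γ) : WithTop Γ) = min x b := by
  cases x with
  | top => simp [cap]
  | coe g => simp [cap]

lemma cap_of_le {x : WithTop Γ} {b : Γ} (h : (b : WithTop Γ) ≤ x) : cap x b = b := by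
  rw [← WithTop.coe_eq_coe, coe_cap, min_eq_right h]

lemma cap_coe_of_le {g b : Γ} (h : g ≤ b) : cap (g : WithTop Γ) b = g := by
  rw [← WithTop.coe_eq_coe, coe_cap, min_eq_left (WithTop.coe_le_coe.2 h)]

lemma cap_mono (x : WithTop Γ) : Monotone (cap x) := by
  intro a b hab
  rw [← WithTop.coe_le_coe, coe_cap, coe_cap]
  exact min_le_min_left _ (WithTop.coe_le_coe.2 hab)

variable [AddCommGroup Γ]

lemma cap_add [IsOrderedAddMonoid Γ] (x : WithTop Γ) (b u : Γ) : cap (x + (u : WithTop Γ)) (b + u) =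
    cap x b + u := by
  cases x with
  | top => rw [top_add, cap_of_le le_top, cap_of_le le_top]
  | coe g =>
    rcases le_total g b with h | h
    · rw [← WithTop.coe_add, cap_coe_of_le h, cap_coe_of_le (by gcongr)]
    · rw [← WithTop.coe_add, cap_of_le (WithTop.coe_le_coe.2 h),
        cap_of_le (WithTop.coe_le_coe.2 (by gcongr))]

variable {ι : Type*} [Fintype ι]

/-- The integral over `[0, b]` of the function which counts the indices `l` with `y ≤ i l`. -/
def capSum (i : ι → WithTop Γ) (b : Γ) : Γ := ∑ l, cap (i l) b

lemma capSum_strictMono [IsOrderedAddMonoid Γ] {i : ι → WithTop Γ} {l : ι} (hl : i l = ⊤) :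
    StrictMono (capSum i) := by
  intro a b hab
  refine Finset.sum_lt_sum (fun l _ => cap_mono (i l) hab.le) ⟨l, Finset.mem_univ l, ?_⟩
  rwa [hl, cap_of_le le_top, cap_of_le le_top]

lemma capSum_zero {i : ι → WithTop Γ} (hi : ∀ l, 0 ≤ i l) : capSum i 0 = 0 :=
  Finset.sum_eq_zero fun l _ => cap_of_le (hi l)

/-- Between two points without a finite value of `i` strictly in between, the sum is linear; its
slope is the number of values which are not below the right end. -/
lemma capSum_sub {i : ι → WithTop Γ} {a b : Γ} (hab : a ≤ b)
    (h : ∀ l, i l ≤ a ∨ (b : WithTop Γ) ≤ i l) {s : Finset ι}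
    (hs : ∀ l, l ∈ s ↔ (b : WithTop Γ) ≤ i l) :
    capSum i b = capSum i a + s.card • (b - a) := by
  classical
  rw [← sub_eq_iff_eq_add', capSum, capSum, ← Finset.sum_sub_distrib, ← Finset.sum_const,
    ← Finset.sum_subset (Finset.subset_univ s)]
  · refine Finset.sum_congr rfl fun l hl => ?_
    have h1 := (hs l).1 hl
    rw [cap_of_le h1, cap_of_le (le_trans (WithTop.coe_le_coe.2 hab) h1)]
  · intro l _ hl
    have h1 : i l ≤ a := (h l).resolve_right fun h2 => hl ((hs l).2 h2)
    obtain ⟨g, hg⟩ := WithTop.ne_top_iff_exists.1 (ne_top_of_le_ne_top WithTop.coe_ne_top h1)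
    rw [← hg, WithTop.coe_le_coe] at h1
    rw [← hg, cap_coe_of_le h1, cap_coe_of_le (h1.trans hab), sub_self]

end

section

lemma qlex_exists_between {r : ℕ} {a b : QLex r} (h : a < b) : ∃ y, a < y ∧ y < b := by
  obtain ⟨k, hk, hlt⟩ := h
  have hk' : ∀ l < k, ofLex a l = ofLex b l := hk
  have hlt' : ofLex a k < ofLex b k := hlt
  refine ⟨toLex fun l => (ofLex a l + ofLex b l) / 2, ⟨k, fun l hl => ?_, ?_⟩,
    ⟨k, fun l hl => ?_, ?_⟩⟩
  · change ofLex a l = (ofLex a l + ofLex b l) / 2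
    rw [hk' l hl]
    ring
  · change ofLex a k < (ofLex a k + ofLex b k) / 2
    linarith
  · change (ofLex a l + ofLex b l) / 2 = ofLex b l
    rw [hk' l hl]
    ring
  · change (ofLex a k + ofLex b k) / 2 < ofLex b k
    linarith

variable {n : ℕ} {ι : Type*} [Fintype ι] {i : ι → WithTop (QLex (n + 1))}
  {f : QLex (n + 1) → ℕ}

open Classical in
lemma IsStepIntegral.eq_capSum (hi : ∀ l, 0 ≤ i l)
    (hf : ∀ y : QLex (n + 1), f y = (Finset.univ.filter fun l => (y : WithTop _) ≤ i l).card)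
    {b I : QLex (n + 1)} (h : IsStepIntegral f b I) : I = capSum i b := by
  obtain ⟨m, x, c, hx0, hxm, hstep, rfl⟩ := h
  have hkey : ∀ k ∈ Finset.range m, c k • (x (k + 1) - x k) =
      capSum i (x (k + 1)) - capSum i (x k) := by
    intro k hk
    obtain ⟨hlt, hc⟩ := hstep k (Finset.mem_range.1 hk)
    -- a value of `i` inside the interval would be a jump of the step function
    have hval : ∀ l, i l ≤ x k ∨ (x (k + 1) : WithTop _) ≤ i l := by
      intro l
      by_contra hcon
      rw [not_or, not_le, not_le] at hcon
      obtain ⟨g, hg⟩ := WithTop.ne_top_iff_exists.1 hcon.2.ne_top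
      rw [← hg, WithTop.coe_lt_coe, WithTop.coe_lt_coe] at hcon
      obtain ⟨y, hgy, hy⟩ := qlex_exists_between hcon.2
      have h1 := hc g hcon.1 hcon.2
      rw [← hc y (hcon.1.trans hgy) hy, hf, hf] at h1
      refine absurd h1 (Finset.card_lt_card ?_).ne'
      refine Finset.ssubset_iff_subset_ne.2 ⟨fun l' hl' => ?_, fun heq => ?_⟩
      · rw [Finset.mem_filter] at hl' ⊢
        exact ⟨hl'.1, le_trans (WithTop.coe_le_coe.2 hgy.le) hl'.2⟩
      · have h2 : l ∈ Finset.univ.filter fun l => (g : WithTop _) ≤ i l := by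
          rw [Finset.mem_filter]
          exact ⟨Finset.mem_univ l, hg.le⟩
        rw [← heq, Finset.mem_filter, ← hg, WithTop.coe_le_coe] at h2
        exact absurd h2.2 (not_le.2 hgy)
    obtain ⟨y, hy, hy'⟩ := qlex_exists_between hlt
    have hck := hc y hy hy'
    rw [hf] at hck
    rw [eq_sub_iff_add_eq', ← hck, eq_comm]
    refine capSum_sub hlt.le hval fun l => ?_
    rw [Finset.mem_filter]
    refine ⟨fun h => (hval l).resolve_left fun h2 => ?_, fun h =>
      ⟨Finset.mem_univ l, le_trans (WithTop.coe_le_coe.2 hy'.le) h⟩⟩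
    exact absurd (WithTop.coe_le_coe.1 (h.2.trans h2)) (not_le.2 hy)
  rw [Finset.sum_congr rfl hkey, Finset.sum_range_sub (fun k => capSum i (x k)), hx0, hxm,
    capSum_zero hi, sub_zero]

open Classical in
/-- The function counting the indices `l` with `y ≤ i l` is a step function. -/
lemma exists_isStepIntegral
    (hf : ∀ y : QLex (n + 1), f y = (Finset.univ.filter fun l => (y : WithTop _) ≤ i l).card)
    {b : QLex (n + 1)} (hb : 0 ≤ b) : ∃ I, IsStepIntegral f b I := by
  -- induction on the number of values inside the interval
  induction hN : (Finset.univ.filter fun l => 0 < i l ∧ i l < b).card using Nat.strong_induction_on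
    generalizing b with
  | _ N ih =>
  rcases hb.eq_or_lt with rfl | hb0
  · exact ⟨_, 0, fun _ => 0, fun _ => 0, rfl, rfl, fun k hk => absurd hk (Nat.not_lt_zero k), rfl⟩
  -- it suffices to integrate up to a point after which there are no further values
  have hext : ∀ a : QLex (n + 1), 0 ≤ a → a < b → (∃ I, IsStepIntegral f a I) →
      (∀ l, i l ≤ a ∨ (b : WithTop _) ≤ i l) → ∃ I, IsStepIntegral f b I := by
    rintro a - hab ⟨I, m, x, c, hx0, hxm, hstep, -⟩ hval
    refine ⟨_, m + 1, fun k => if k ≤ m then x k else b, fun k =>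
      if k < m then c k else f b, ?_, ?_,
      fun k hk => ?_, rfl⟩
    · simpa using hx0
    · simp
    · rcases (Nat.lt_succ_iff.1 hk).eq_or_lt with rfl | hkm
      · simp only [le_refl, if_true, lt_irrefl, if_false, Nat.not_succ_le_self, hxm]
        refine ⟨hab, fun y hay hyb => ?_⟩
        rw [hf, hf]
        congr 1
        ext l
        rw [Finset.mem_filter, Finset.mem_filter]
        refine and_congr_right fun _ => ⟨fun h => (hval l).resolve_left fun h2 => ?_, fun h =>
          le_trans (WithTop.coe_le_coe.2 hyb.le) h⟩
        exact absurd (WithTop.coe_le_coe.1 (h.trans h2)) (not_le.2 hay)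
      · simp only [hkm.le, if_true, hkm, Nat.succ_le_of_lt hkm]
        exact hstep k hkm
  by_cases hne : (Finset.univ.filter fun l => 0 < i l ∧ i l < b).Nonempty
  · obtain ⟨l, hl, hmax⟩ := Finset.exists_max_image _ i hne
    rw [Finset.mem_filter] at hl
    obtain ⟨g, hg⟩ := WithTop.ne_top_iff_exists.1 hl.2.2.ne_top
    have hgb := hl.2.2
    have hg0 := hl.2.1
    rw [← hg, WithTop.coe_lt_coe] at hgb
    rw [← hg, ← WithTop.coe_zero, WithTop.coe_lt_coe] at hg0
    refine hext g hg0.le hgb (ih _ ?_ hg0.le rfl) fun l' => ?_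
    · rw [← hN]
      refine Finset.card_lt_card (Finset.ssubset_iff_subset_ne.2 ⟨fun l' hl' => ?_, fun heq => ?_⟩)
      · rw [Finset.mem_filter] at hl' ⊢
        exact ⟨hl'.1, hl'.2.1, hl'.2.2.trans (WithTop.coe_lt_coe.2 hgb)⟩
      · have h2 : l ∈ Finset.univ.filter fun l => 0 < i l ∧ i l < b := by
          rw [Finset.mem_filter]
          exact hl
        rw [← heq, Finset.mem_filter, ← hg] at h2
        exact lt_irrefl _ h2.2.2
    · by_contra hcon
      rw [not_or, not_le, not_le] at hcon
      have h3 := hmax l' (by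
        rw [Finset.mem_filter]
        exact ⟨Finset.mem_univ _, lt_trans (by
          rw [← WithTop.coe_zero, WithTop.coe_lt_coe]
          exact hg0) hcon.1, hcon.2⟩)
      rw [← hg] at h3
      exact absurd h3 (not_le.2 hcon.1)
  · refine hext 0 le_rfl hb0
      ⟨_, 0, fun _ => 0, fun _ => 0, rfl, rfl, fun k hk => absurd hk (Nat.not_lt_zero k), rfl⟩
      fun l => ?_
    by_contra hcon
    rw [not_or, not_le, not_le] at hcon
    refine hne ⟨l, ?_⟩
    rw [Finset.mem_filter]
    exact ⟨Finset.mem_univ _, hcon⟩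

open Classical in
/-- The integral of the function counting the indices `l` with `y ≤ i l`. -/
lemma stepIntegral_eq_capSum (hi : ∀ l, 0 ≤ i l)
    (hf : ∀ y : QLex (n + 1), f y = (Finset.univ.filter fun l => (y : WithTop _) ≤ i l).card)
    {b : QLex (n + 1)} (hb : 0 ≤ b) : stepIntegral f b = capSum i b := by
  have h := exists_isStepIntegral hf hb
  rw [stepIntegral, dif_pos h]
  exact IsStepIntegral.eq_capSum hi hf h.choose_spec

end

/-! ### Discriminants, and the numerical data of the roots -/

section

variable {k Ω : Type*} [Field k] [Field Ω] [Algebra k Ω] {F : k[X]} {d : ℕ} {θs : Fin d → Ω}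

lemma aeval_derivative_eq_prod (hroots : F.map (algebraMap k Ω) = ∏ l, (X - C (θs l))) (l : Fin d) :
    aeval (θs l) (derivative F) = ∏ m ∈ Finset.univ.erase l, (θs l - θs m) := by
  rw [aeval_def, ← eval_map, ← derivative_map, hroots,
    ← Finset.mul_prod_erase Finset.univ _ (Finset.mem_univ l), derivative_mul]
  simp [eval_prod]

lemma aeval_eq_prod (hroots : F.map (algebraMap k Ω) = ∏ l, (X - C (θs l))) (x : Ω) :
    aeval x F = ∏ m, (x - θs m) := by
  rw [aeval_def, ← eval_map, hroots, eval_prod]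
  simp

/-- The discriminant is the product of the values of the derivative at the roots, up to sign. -/
lemma exists_discr_eq_prod (hF : F.Monic) (hd0 : 0 < d)
    (hroots : F.map (algebraMap k Ω) = ∏ l, (X - C (θs l))) :
    ∃ s : ℕ, algebraMap k Ω F.discr = (-1) ^ s * ∏ l, aeval (θs l) (derivative F) := by
  have hdeg : F.natDegree = d := by
    rw [← natDegree_map (algebraMap k Ω), hroots, natDegree_prod_of_monic _ _ fun l _ =>
      monic_X_sub_C _]
    simp
  have hdeg' : (F.map (algebraMap k Ω)).natDegree = F.natDegree := natDegree_map _
  have h1 := resultant_deriv (f := F) (natDegree_pos_iff_degree_pos.1 (hdeg ▸ hd0))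
  set s := F.natDegree * (F.natDegree - 1) / 2
  have h2 := congrArg (algebraMap k Ω) h1
  rw [← resultant_map_map, hF.leadingCoeff, mul_one, map_mul, map_pow, map_neg, map_one] at h2
  refine ⟨s, ?_⟩
  have h3 : (F.map (algebraMap k Ω)).resultant ((derivative F).map (algebraMap k Ω)) F.natDegree
      (F.natDegree - 1) = ∏ l, aeval (θs l) (derivative F) := by
    have h4 : ((derivative F).map (algebraMap k Ω)).natDegree ≤ F.natDegree - 1 := by
      rw [natDegree_map]
      exact natDegree_derivative_le F
    rw [← hdeg', hroots, resultant_prod_left _ _ _ _ (by simp) (by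
      rw [← hroots, hdeg']
      exact h4)]
    refine Finset.prod_congr rfl fun l _ => ?_
    have h5 := resultant_X_sub_C_pow_left (θs l) ((derivative F).map (algebraMap k Ω)) 1
      ((∏ l, (X - C (θs l))).natDegree - 1) (by rw [← hroots, hdeg']; exact h4)
    rw [pow_one, pow_one] at h5
    rw [natDegree_X_sub_C, h5, eval_map, aeval_def]
  rw [← h3, h2, ← mul_assoc, ← mul_pow]
  simp

end

section

variable {p n : ℕ} {B : BasicField n}

/-- The factors between the canonical valuations of the ends of an extension of degree `d` without
extension of the `n`-dimensional constants. -/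
def topScale (n d : ℕ) : Fin (n + 1) → ℚ := fun k => if k = Fin.last n then (d : ℚ) else 1

lemma topScale_pos {n d : ℕ} (hd : 0 < d) (k : Fin (n + 1)) : 0 < topScale n d k := by
  rw [topScale]
  split_ifs
  · exact_mod_cast hd
  · exact one_pos

/-- The numerical data attached to the roots `θ_l` of the minimal polynomial of the last parameter:
the values `i_l = v_L(θ_l - θ) - v_L(θ)`, which determine the Herbrand function. -/
structure RootData (p : ℕ) {n : ℕ} {B : BasicField n} (K L : Subfield B.Closure) {d : ℕ}
    (θs : Fin d → B.Closure) (v : AddValuation B.Closure (WithTop (QLex (n + 1))))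
    (i : Fin d → WithTop (QLex (n + 1))) (l₀ : Fin d) : Prop where
  canonVal_top : ∀ x, canonVal p L x = v x
  canonVal_base : ∀ x, v x = (canonVal p K x).map (scale (topScale n d))
  nonneg : ∀ l, 0 ≤ i l
  eq_top : ∀ l, i l = ⊤ ↔ l = l₀
  conj : ∀ m, ∃ π : Equiv.Perm (Fin d), π m = l₀ ∧
    ∀ l, v (θs l - θs m) = i (π l) + (lastVec n 1 : QLex (n + 1))
  herbrand : ∀ a : QLex (n + 1), 0 ≤ a → herbrandAt p K L (Fin.last n) a =
    scale (fun k => (topScale n d k)⁻¹) (capSum i a)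
  slope : ∀ k, ramIndexInv p K L (Fin.last n) k = (topScale n d k)⁻¹
  slope_zero : (constants p K ((Fin.last n : ℕ) + 1) ⊔ constants p L (Fin.last n : ℕ)).relfinrank
    (constants p L ((Fin.last n : ℕ) + 1)) = d

variable {w : AddValuation B.Closure (WithTop (QLex (n + 1)))}
  {K L E : Subfield B.Closure} {θ : B.Closure}

/-- The numerical data of the roots of the minimal polynomial of the last parameter. -/
lemma StdDatum.exists_rootData [Fact p.Prime] (hd : StdDatum p K L E θ) (h : GoodBar p B w)
    {d : ℕ} {θs : Fin d → B.Closure}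
    (hroots : (minpoly ↥(K ⊔ E) θ).map (algebraMap ↥(K ⊔ E) B.Closure) =
      ∏ l, (Polynomial.X - Polynomial.C (θs l))) :
    d = K.relfinrank L ∧ ∃ v i l₀, RootData p K L θs v i l₀ ∧ θs l₀ = θ := by
  have hdeg : d = K.relfinrank L := by
    rw [← hd.natDegree_minpoly h, ← natDegree_map (algebraMap ↥(K ⊔ E) B.Closure), hroots,
      natDegree_prod_of_monic _ _ fun l _ => monic_X_sub_C _]
    simp
  refine ⟨hdeg, ?_⟩
  obtain ⟨v, hv⟩ := h.exists_canonVal (p := p) hd.top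
  have hρ : ∀ k : Fin (n + 1), ramIndex p K L k = topScale n d k := fun k => by
    rw [hd.ramIndex_eq h, topScale, hdeg]
  obtain ⟨l₀, hl₀⟩ : ∃ l, θs l = θ := (exists_root_index hroots).1 (minpoly.aeval _ _)
  choose σs hσs hσθ using hd.exists_conj hroots
  have hvσ : ∀ l x, v (σs l x) = v x := by
    intro l x
    rw [← hv, ← hv, canonVal, canonVal, h.valBar_eq, h.valBar_eq,
      h.value_ringEquiv _ fun y hy => hσs l y (hd.isLF_sup_base.base_le hy)]
  have hvθ : v θ = (lastVec n 1 : QLex (n + 1)) := by rw [← hv, hd.canonVal_param h]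
  have hinj := hd.roots_injective hroots
  have hge : ∀ l, ((lastVec n 1 : QLex (n + 1)) : WithTop _) ≤ v (θs l - θ) := fun l =>
    v.map_le_sub (by rw [← hσθ, hvσ, hvθ]) hvθ.ge
  have hex : ∀ l, ∃ j : WithTop (QLex (n + 1)), 0 ≤ j ∧
      v (θs l - θ) = j + (lastVec n 1 : QLex (n + 1)) := by
    intro l
    have h1 := hge l
    cases hx : v (θs l - θ) with
    | top => exact ⟨⊤, le_top, rfl⟩
    | coe g =>
      rw [hx, WithTop.coe_le_coe] at h1
      refine ⟨((g - lastVec n 1 : QLex (n + 1)) : WithTop _), ?_, ?_⟩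
      · rw [← WithTop.coe_zero, WithTop.coe_le_coe]
        exact sub_nonneg.2 h1
      · rw [← WithTop.coe_add, sub_add_cancel]
  choose i hi0 hi using hex
  have htop : ∀ l, i l = ⊤ ↔ l = l₀ := by
    intro l
    rw [← hinj.eq_iff, hl₀, ← sub_eq_zero (a := θs l), ← v.top_iff, hi]
    simp
  -- the number of elements of the ramification groups
  have hf : ∀ y : QLex (n + 1), (lowerRam p K L (Fin.last n) y).ncard =
      (Finset.univ.filter fun l => (y : WithTop (QLex (n + 1))) ≤ i l).card := by
    classical
    intro y
    rw [hd.ncard_lowerRam h hroots]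
    congr 1
    ext l
    rw [Finset.mem_filter, Finset.mem_filter, hv, hv, hvθ, hi, add_comm (i l),
      add_le_add_iff_right_of_ne_top WithTop.coe_ne_top]
  refine ⟨v, i, l₀, ⟨hv, fun x => ?_, hi0, htop, fun m => ?_, fun a ha => ?_, fun k => ?_, ?_⟩, hl₀⟩
  · rw [← hv, h.canonVal_eq_map hd.base hd.le]
    congr 2
    funext k
    exact hρ k
  -- an automorphism which takes `θ` to `θ_m` permutes the roots and preserves the values of their
  -- differences
  · have hperm : ∀ l, ∃ l', σs m (θs l') = θs l := by
      intro l
      obtain ⟨l', hl'⟩ : ∃ l', θs l' = (σs m).symm (θs l) := by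
        rw [← exists_root_index hroots]
        obtain ⟨σ', hσ'⟩ := exists_ringEquiv_algEquiv (k := K ⊔ E) (σs m).symm (fun x hx => by
          rw [RingEquiv.symm_apply_eq, hσs m x hx])
        rw [← hσ', aeval_algHom_apply, (exists_root_index hroots).2 ⟨l, rfl⟩, _root_.map_zero]
      exact ⟨l', by rw [hl', RingEquiv.apply_symm_apply]⟩
    choose π hπ using hperm
    have hπinj : Function.Injective π := by
      intro a b hab
      apply hinj
      rw [← hπ, hab, hπ]
    refine ⟨Equiv.ofBijective π (Finite.injective_iff_bijective.1 hπinj), ?_, fun l => ?_⟩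
    · apply hinj
      apply (σs m).injective
      exact (hπ m).trans (by rw [hl₀, hσθ])
    · rw [← hπ l, ← hσθ m, ← map_sub, hvσ, hi]
      rfl
  · change scale (fun k : Fin (n + 1) => (ramIndex p K L k)⁻¹) (stepIntegral _ a) = _
    have hI := stepIntegral_eq_capSum hi0 (fun y => (hf y).trans (by congr!)) ha
    refine (congrArg (scale _) hI).trans ?_
    congr 1
    funext k
    rw [hρ]
  · exact congrArg (·⁻¹) (hρ k)
  · have h1 : constants p K ((Fin.last n : ℕ) + 1) = K := h.constants_top K
    have h2 : constants p L ((Fin.last n : ℕ) + 1) = L := h.constants_top L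
    have h3 : constants p L (Fin.last n : ℕ) ≤ K := hd.const_le_base
    rw [h1, h2, sup_eq_left.2 h3, hdeg]

end

/-! ### Krasner's lemma and edge points -/

section

variable {n : ℕ}

lemma topIdx_lt_iff {a b : QLex (n + 1)} : topIdx a < topIdx b ↔ a < b := by
  constructor
  · intro h
    rcases (Sigma.Lex.lt_def).1 h with h1 | ⟨_, h2⟩
    · exact absurd h1 (lt_irrefl (Fin.last n))
    · exact h2
  · intro h
    exact Sigma.Lex.lt_def.2 (Or.inr ⟨rfl, h⟩)

lemma topIdx_injective {a b : QLex (n + 1)} (h : topIdx a = topIdx b) : a = b :=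
  eq_of_heq (Sigma.mk.inj_iff.1 (toLex.injective h)).2

lemma topIdx_le_iff {a b : QLex (n + 1)} : topIdx a ≤ topIdx b ↔ a ≤ b := by
  exact not_lt.symm.trans ((not_congr topIdx_lt_iff).trans not_lt)

/-- An index is either of the top dimension or smaller than all indices of the top dimension. -/
lemma eq_topIdx_or_lt (j : RamIdx n) (b : QLex (n + 1)) : (∃ a, j = topIdx a) ∨ j < topIdx b := by
  obtain ⟨r, x⟩ := j
  by_cases hr : r = Fin.last n
  · subst hr
    exact Or.inl ⟨x, rfl⟩
  · exact Or.inr (Sigma.Lex.lt_def.2 (Or.inl (lt_of_le_of_ne (Fin.le_last r) hr)))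

lemma lastVec_pos {a : ℚ} (ha : 0 < a) : 0 < lastVec n a := by
  refine ⟨Fin.last n, fun l hl => ?_, ?_⟩
  · exact (lastVec_of_ne n a hl.ne).symm
  · change 0 < ofLex (lastVec n a) (Fin.last n)
    rwa [lastVec_last]

lemma nsmul_left_injective_qlex {r : ℕ} {a b : ℕ} {x : QLex r} (hx : 0 < x) (h : a • x = b • x) :
    a = b :=
  (nsmul_left_strictMono hx).injective h

lemma value_prod {Ω : Type*} [Field Ω] {Γ : Type*} [AddCommGroup Γ] [LinearOrder Γ]
    [IsOrderedAddMonoid Γ] (v : AddValuation Ω (WithTop Γ)) {ι : Type*} (s : Finset ι) (f : ι → Ω) :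
    v (∏ l ∈ s, f l) = ∑ l ∈ s, v (f l) := by
  classical
  induction s using Finset.induction_on with
  | empty => rw [Finset.prod_empty, Finset.sum_empty, v.map_one]
  | insert a s ha ih => rw [Finset.prod_insert ha, Finset.sum_insert ha, v.map_mul, ih]

end

namespace RootData

variable {p n : ℕ} {B : BasicField n} {K L : Subfield B.Closure} {d : ℕ}
  {θs : Fin d → B.Closure} {v : AddValuation B.Closure (WithTop (QLex (n + 1)))}
  {i : Fin d → WithTop (QLex (n + 1))} {l₀ : Fin d}

lemma d_pos (_ : RootData p K L θs v i l₀) : 0 < d := l₀.pos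

lemma scale_herbrand (h : RootData p K L θs v i l₀) {a : QLex (n + 1)} (ha : 0 ≤ a) :
    scale (topScale n d) (herbrandAt p K L (Fin.last n) a) = capSum i a := by
  rw [h.herbrand a ha]
  exact scale_inv (topScale_pos h.d_pos) _

lemma herbrand_strictMono (h : RootData p K L θs v i l₀) {a b : QLex (n + 1)} (ha : 0 ≤ a)
    (hab : a < b) : herbrandAt p K L (Fin.last n) a < herbrandAt p K L (Fin.last n) b := by
  refine (scale_strictMono (topScale_pos h.d_pos)).lt_iff_lt.1 ?_
  have h1 := h.scale_herbrand ha
  have h2 := h.scale_herbrand (ha.trans hab.le)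
  exact h1.trans_lt ((capSum_strictMono ((h.eq_top l₀).2 rfl) hab).trans_eq h2.symm)

/-- The difference of two distinct roots has one of the values `i_l + v_L(θ)` with finite `i_l`. -/
lemma conj_value (h : RootData p K L θs v i l₀) {l m : Fin d} (hlm : l ≠ m) :
    ∃ l', l' ≠ l₀ ∧ v (θs l - θs m) = i l' + (lastVec n 1 : QLex (n + 1)) := by
  obtain ⟨π, hπ, hv⟩ := h.conj m
  exact ⟨π l, fun h0 => hlm (π.injective (h0.trans hπ.symm)), hv l⟩

lemma scale_lastVec {a : ℚ} : scale (topScale n d) (lastVec n a) = lastVec n (d * a) := by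
  refine qlex_ext fun k => ?_
  rw [scale_apply]
  by_cases hk : k = Fin.last n
  · subst hk
    rw [lastVec_last, lastVec_last, topScale, if_pos rfl]
  · rw [lastVec_of_ne n _ hk, lastVec_of_ne n _ hk, mul_zero]

lemma nsmul_lastVec (m : ℕ) (a : ℚ) : m • lastVec n a = lastVec n (m * a) := by
  have := zsmul_lastVec (n := n) (m : ℤ) a
  rwa [natCast_zsmul, Int.cast_natCast] at this

/-- The existence part of Krasner's lemma, for the root which is closest to `α`. -/
lemma exists_root (h : RootData p K L θs v i l₀) {α : B.Closure} {A : QLex (n + 1)} (hA : 0 < A)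
    (hα : canonVal p K (∏ l, (α - θs l)) = ((A + lastVec n 1 : QLex (n + 1)) : WithTop _)) :
    ∃ l, ∃ a : QLex (n + 1), 0 ≤ a ∧
      canonVal p L (α - θs l) = ((a + lastVec n 1 : QLex (n + 1)) : WithTop _) ∧
      herbrandAt p K L (Fin.last n) a = A := by
  set u : QLex (n + 1) := lastVec n 1 with hu
  have hd0 := h.d_pos
  have hsum : ∑ l, v (α - θs l) =
      ((scale (topScale n d) A + d • u : QLex (n + 1)) : WithTop (QLex (n + 1))) := by
    have h1 := h.canonVal_base (∏ l, (α - θs l))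
    rw [hα, WithTop.map_coe, scale_add, hu, scale_lastVec, ← nsmul_lastVec] at h1
    rw [← h1]
    exact (value_prod v Finset.univ fun l => α - θs l).symm
  -- the root closest to `α`
  obtain ⟨m, -, hm⟩ := Finset.exists_max_image Finset.univ (fun l => v (α - θs l))
    ⟨l₀, Finset.mem_univ _⟩
  have hne : v (α - θs m) ≠ ⊤ := by
    intro htop
    rw [WithTop.sum_eq_top.2 ⟨m, Finset.mem_univ m, htop⟩] at hsum
    exact WithTop.top_ne_coe hsum
  obtain ⟨β, hβ⟩ := WithTop.ne_top_iff_exists.1 hne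
  obtain ⟨π, hπ, hconj⟩ := h.conj m
  have hval : ∀ l, v (α - θs l) =
      ((cap (i (π l) + (u : WithTop _)) β : QLex (n + 1)) : WithTop (QLex (n + 1))) := by
    intro l
    rw [coe_cap, hβ, ← hconj]
    have h1 : v (α - θs l) ≤ v (α - θs m) := hm l (Finset.mem_univ l)
    refine le_antisymm (le_min ?_ h1) ?_
    · have h2 : θs l - θs m = (α - θs m) - (α - θs l) := by ring
      rw [h2]
      exact v.map_le_sub h1 le_rfl
    · have h2 : α - θs l = (α - θs m) - (θs l - θs m) := by ring
      rw [h2]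
      exact v.map_le_sub (min_le_right _ _) (min_le_left _ _)
  have hsum' : ∑ l, cap (i l + (u : WithTop _)) β = scale (topScale n d) A + d • u := by
    rw [← Equiv.sum_comp π fun l => cap (i l + (u : WithTop (QLex (n + 1)))) β,
      ← WithTop.coe_eq_coe, ← hsum, WithTop.coe_sum]
    exact Finset.sum_congr rfl fun l _ => (hval l).symm
  have hAs : 0 < scale (topScale n d) A := by
    have := scale_strictMono (topScale_pos (n := n) hd0) hA
    rwa [← scaleHom_apply, ← scaleHom_apply, map_zero] at this
  -- otherwise all differences have a value of `u` at most, and `A` would not be positive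
  have hβu : u ≤ β := by
    by_contra hlt
    rw [not_le] at hlt
    have h1 : ∑ l, cap (i l + (u : WithTop _)) β ≤ d • u := by
      calc ∑ l, cap (i l + (u : WithTop _)) β ≤ ∑ _l : Fin d, u := by
            refine Finset.sum_le_sum fun l _ => ?_
            rw [← WithTop.coe_le_coe, coe_cap]
            exact (min_le_right _ _).trans (WithTop.coe_le_coe.2 hlt.le)
        _ = d • u := by simp
    rw [hsum'] at h1
    exact absurd h1 (not_le.2 (lt_add_of_pos_left _ hAs))
  have ha : 0 ≤ β - u := sub_nonneg.2 hβu
  refine ⟨m, β - u, ha, ?_, ?_⟩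
  · rw [h.canonVal_top, sub_add_cancel, hβ]
  · apply (scale_strictMono (topScale_pos (n := n) hd0)).injective
    rw [h.scale_herbrand ha]
    have h2 : ∀ l, cap (i l + (u : WithTop _)) β = cap (i l) (β - u) + u := by
      intro l
      rw [← cap_add, sub_add_cancel]
    rw [Finset.sum_congr rfl fun l _ => h2 l, Finset.sum_add_distrib] at hsum'
    rw [Finset.sum_const, Finset.card_univ, Fintype.card_fin] at hsum'
    exact add_right_cancel hsum'

lemma herbrand_eq_iff (h : RootData p K L θs v i l₀) {a b z : QLex (n + 1)} (ha : 0 ≤ a)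
    (hb : 0 ≤ b) (g : ℕ) : herbrandAt p K L (Fin.last n) a = herbrandAt p K L (Fin.last n) b +
      scale (fun k => (g : ℚ) * ramIndexInv p K L (Fin.last n) k) z ↔
      capSum i a = capSum i b + g • z := by
  have hz : scale (topScale n d) (scale (fun k => (g : ℚ) * ramIndexInv p K L (Fin.last n) k) z) =
      g • z := by
    refine qlex_ext fun k => ?_
    change topScale n d k * ((g : ℚ) * ramIndexInv p K L (Fin.last n) k * ofLex z k) =
      g • ofLex z k
    have := (topScale_pos (n := n) h.d_pos k).ne'
    rw [h.slope, nsmul_eq_mul]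
    field_simp
  have h1 := h.scale_herbrand ha
  have h2 := h.scale_herbrand hb
  rw [← h1, ← h2, ← hz, ← scale_add]
  exact (scale_strictMono (topScale_pos (n := n) h.d_pos)).injective.eq_iff.symm

/-- The right slope of the Herbrand function, in terms of the sum `capSum`. -/
lemma right_slope (h : RootData p K L θs v i l₀) {j : QLex (n + 1)} (hj : 0 ≤ j) {g : ℕ} :
    HasRightSlope p K L (Fin.last n) j g ↔
      ∃ y, j < y ∧ ∀ x, j ≤ x → x ≤ y → capSum i x = capSum i j + g • (x - j) := by
  constructor
  · rintro ⟨y, hy, hx⟩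
    exact ⟨y, hy, fun x hjx hxy => (h.herbrand_eq_iff (hj.trans hjx) hj g).1 (hx x hjx hxy)⟩
  · rintro ⟨y, hy, hx⟩
    exact ⟨y, hy, fun x hjx hxy => (h.herbrand_eq_iff (hj.trans hjx) hj g).2 (hx x hjx hxy)⟩

/-- The left slope of the Herbrand function at a positive point, in terms of the sum `capSum`. -/
lemma left_slope (h : RootData p K L θs v i l₀) {j : QLex (n + 1)} (hj : 0 < j) {g : ℕ} :
    HasLeftSlope p K L (Fin.last n) j g ↔
      ∃ y, 0 ≤ y ∧ y < j ∧ ∀ x, y ≤ x → x ≤ j → capSum i j = capSum i x + g • (j - x) := by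
  constructor
  · rintro (⟨rfl, -⟩ | ⟨-, y, hy0, hy, hx⟩)
    · exact absurd hj (lt_irrefl _)
    · exact ⟨y, hy0, hy, fun x hyx hxj =>
        (h.herbrand_eq_iff hj.le (hy0.trans hyx) g).1 (hx x hyx hxj)⟩
  · rintro ⟨y, hy0, hy, hx⟩
    exact Or.inr ⟨hj, y, hy0, hy, fun x hyx hxj =>
      (h.herbrand_eq_iff hj.le (hy0.trans hyx) g).2 (hx x hyx hxj)⟩

/-- The last edge point in the top dimension is the largest finite `i_l`. -/
lemma isGreatest_edge (h : RootData p K L θs v i l₀) {b : QLex (n + 1)} (hb : ∃ l, i l = b)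
    (hmax : ∀ l, l ≠ l₀ → i l ≤ b) : IsGreatest {j | IsEdge p K L j} (topIdx b) := by
  obtain ⟨lb, hlb⟩ := hb
  have hb0 : 0 ≤ b := by
    have := h.nonneg lb
    rwa [hlb, ← WithTop.coe_zero, WithTop.coe_le_coe] at this
  have htop : i l₀ = ⊤ := (h.eq_top l₀).2 rfl
  have hlb0 : lb ≠ l₀ := fun h0 => by
    rw [h0, htop] at hlb
    exact WithTop.top_ne_coe hlb
  -- after `b`, all slopes are equal to `1`
  have hslope : ∀ x y, b ≤ x → x < y → capSum i y = capSum i x + 1 • (y - x) := by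
    intro x y hbx hxy
    refine capSum_sub (s := {l₀}) hxy.le (fun l => ?_) fun l => ?_
    · by_cases hl : l = l₀
      · exact Or.inr (by rw [hl, htop]; exact le_top)
      · exact Or.inl ((hmax l hl).trans (WithTop.coe_le_coe.2 hbx))
    · rw [Finset.mem_singleton]
      refine ⟨fun hl => by rw [hl, htop]; exact le_top, fun hl => ?_⟩
      by_contra hne
      exact absurd (WithTop.coe_le_coe.1 (hl.trans (hmax l hne))) (not_le.2 (hbx.trans_lt hxy))
  constructor
  · have hright : HasRightSlope p K L (Fin.last n) b 1 := by
      refine (h.right_slope hb0).2 ⟨b + lastVec n 1, lt_add_of_pos_right _ (lastVec_pos one_pos),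
        fun x hbx _ => ?_⟩
      rcases hbx.eq_or_lt with rfl | hlt
      · simp
      · exact hslope b x le_rfl hlt
    -- the left slope at `b` counts both `l₀` and an index with `i l = b`
    have hleft : ∃ g, 1 < g ∧ HasLeftSlope p K L (Fin.last n) b g := by
      rcases hb0.eq_or_lt with rfl | hbpos
      · refine ⟨d, ?_, Or.inl ⟨rfl, h.slope_zero.symm⟩⟩
        by_contra hd
        have h1 := lb.2
        have h2 := l₀.2
        exact hlb0 (Fin.ext (by omega))
      · classical
        refine ⟨(Finset.univ.filter fun l => (b : WithTop (QLex (n + 1))) ≤ i l).card, ?_, ?_⟩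
        · rw [Finset.one_lt_card]
          refine ⟨lb, ?_, l₀, ?_, hlb0⟩
          · rw [Finset.mem_filter, hlb]
            exact ⟨Finset.mem_univ _, le_rfl⟩
          · rw [Finset.mem_filter, htop]
            exact ⟨Finset.mem_univ _, le_top⟩
        · obtain ⟨y, hy0, hyb, hy⟩ : ∃ y, 0 ≤ y ∧ y < b ∧ ∀ l, i l ≤ y ∨ (b : WithTop _) ≤ i l := by
            rcases (Finset.univ.filter fun l =>
              i l < (b : WithTop (QLex (n + 1)))).eq_empty_or_nonempty
              with hemp | hne
            · refine ⟨0, le_rfl, hbpos, fun l => Or.inr (not_lt.1 fun hl => ?_)⟩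
              have : l ∈ Finset.univ.filter fun l => i l < (b : WithTop (QLex (n + 1))) := by
                rw [Finset.mem_filter]
                exact ⟨Finset.mem_univ _, hl⟩
              rw [hemp] at this
              exact absurd this (Finset.notMem_empty l)
            · obtain ⟨m, hm, hmm⟩ := Finset.exists_max_image _ i hne
              rw [Finset.mem_filter] at hm
              obtain ⟨y, hy⟩ := WithTop.ne_top_iff_exists.1 hm.2.ne_top
              have h1 := h.nonneg m
              have h2 := hm.2
              rw [← hy, ← WithTop.coe_zero, WithTop.coe_le_coe] at h1
              rw [← hy, WithTop.coe_lt_coe] at h2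
              refine ⟨y, h1, h2, fun l => ?_⟩
              by_cases hl : i l < b
              · refine Or.inl ?_
                rw [hy]
                exact hmm l (by rw [Finset.mem_filter]; exact ⟨Finset.mem_univ _, hl⟩)
              · exact Or.inr (not_lt.1 hl)
          refine (h.left_slope hbpos).2 ⟨y, hy0, hyb, fun x hyx hxb => ?_⟩
          refine capSum_sub hxb (fun l => (hy l).imp_left fun h1 => ?_) fun l => ?_
          · exact h1.trans (WithTop.coe_le_coe.2 hyx)
          · simp
    obtain ⟨g, hg, hgl⟩ := hleft
    exact ⟨hb0, g, 1, hgl, hright, hg.ne'⟩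
  · intro j hj
    rcases eq_topIdx_or_lt j b with ⟨a, rfl⟩ | hlt
    · rw [topIdx_le_iff]
      by_contra hba
      rw [not_le] at hba
      obtain ⟨-, g, g', hl, hr, hne⟩ := hj
      have hl' : HasLeftSlope p K L (Fin.last n) a g := hl
      have hr' : HasRightSlope p K L (Fin.last n) a g' := hr
      have hapos := hb0.trans_lt hba
      rw [h.left_slope hapos] at hl'
      rw [h.right_slope hapos.le] at hr'
      obtain ⟨y, hy0, hya, hy⟩ := hl'
      obtain ⟨z, haz, hz⟩ := hr'
      have h1 := hy (max y b) (le_max_left _ _) (max_lt hya hba).le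
      rw [hslope _ a (le_max_right y b) (max_lt hya hba)] at h1
      have h2 := hz z haz.le le_rfl
      rw [hslope a z hba.le haz] at h2
      -- both slopes at a point beyond `b` are equal to `1`
      have h3 := nsmul_left_injective_qlex (sub_pos.2 (max_lt hya hba)) (add_left_cancel h1)
      have h4 := nsmul_left_injective_qlex (sub_pos.2 haz) (add_left_cancel h2)
      exact hne (h3.symm.trans h4)
    · exact hlt.le

/-- The coordinates of the last edge point, provided that `θ` has a further conjugate. -/
lemma exists_last (h : RootData p K L θs v i l₀) {l : Fin d} (hl : l ≠ l₀) :
    ∃ b : QLex (n + 1), 0 ≤ b ∧ (∃ l, l ≠ l₀ ∧ i l = b) ∧ (∀ l, l ≠ l₀ → i l ≤ b) ∧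
      lastLower p K L = topIdx b ∧
      lastUpper p K L = topIdx (herbrandAt p K L (Fin.last n) b) := by
  obtain ⟨m, hm, hmax⟩ := Finset.exists_max_image (Finset.univ.erase l₀) i
    ⟨l, Finset.mem_erase.2 ⟨hl, Finset.mem_univ _⟩⟩
  have hm0 := (Finset.mem_erase.1 hm).1
  obtain ⟨b, hb⟩ := WithTop.ne_top_iff_exists.1 ((h.eq_top m).not.2 hm0)
  have hmax' : ∀ l, l ≠ l₀ → i l ≤ b := fun l hl => by
    rw [hb]
    exact hmax l (Finset.mem_erase.2 ⟨hl, Finset.mem_univ _⟩)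
  have hgr := h.isGreatest_edge ⟨m, hb.symm⟩ hmax'
  have hex : ∃ j, IsGreatest {j | IsEdge p K L j} j := ⟨_, hgr⟩
  have hlow : lastLower p K L = topIdx b := by
    rw [lastLower, dif_pos hex]
    exact hex.choose_spec.unique hgr
  refine ⟨b, ?_, ⟨m, hm0, hb.symm⟩, hmax', hlow, ?_⟩
  · have := h.nonneg m
    rwa [← hb, ← WithTop.coe_zero, WithTop.coe_le_coe] at this
  · rw [lastUpper, hlow]
    rfl

/-- Beyond the last edge point, only one root is as close to `α` as prescribed. -/
lemma root_unique (h : RootData p K L θs v i l₀) {α : B.Closure} {A : QLex (n + 1)}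
    (hA : lastUpper p K L < topIdx A) {l m : Fin d} {a b : QLex (n + 1)} (ha : 0 ≤ a) (hb : 0 ≤ b)
    (hl : canonVal p L (α - θs l) = ((a + lastVec n 1 : QLex (n + 1)) : WithTop _))
    (hm : canonVal p L (α - θs m) = ((b + lastVec n 1 : QLex (n + 1)) : WithTop _))
    (hla : herbrandAt p K L (Fin.last n) a = A) (hmb : herbrandAt p K L (Fin.last n) b = A) :
    l = m := by
  by_contra hlm
  have hab : a = b := by
    rcases lt_trichotomy a b with hlt | heq | hlt
    · exact absurd (hla.trans hmb.symm) (h.herbrand_strictMono ha hlt).ne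
    · exact heq
    · exact absurd (hmb.trans hla.symm) (h.herbrand_strictMono hb hlt).ne
  subst hab
  -- relative to `v_L(θ)`, the difference of the two roots has a value of `a` at least, which is one
  -- of the finite `i l`
  obtain ⟨l', hl'0, hl'⟩ := h.conj_value hlm
  obtain ⟨c, hc0, -, hmax, -, hup⟩ := h.exists_last hl'0
  rw [h.canonVal_top] at hl hm
  have h1 : θs l - θs m = (α - θs m) - (α - θs l) := by ring
  have h2 : ((a + lastVec n 1 : QLex (n + 1)) : WithTop (QLex (n + 1))) ≤ v (θs l - θs m) := by
    rw [h1]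
    exact v.map_le_sub hm.ge hl.ge
  rw [hl', WithTop.coe_add, add_le_add_iff_left_of_ne_top WithTop.coe_ne_top] at h2
  have h3 : a ≤ c := WithTop.coe_le_coe.1 (h2.trans (hmax l' hl'0))
  rw [hup, topIdx_lt_iff, ← hla] at hA
  rcases h3.eq_or_lt with rfl | hlt
  · exact lt_irrefl _ hA
  · exact lt_asymm hA (h.herbrand_strictMono ha hlt)

end RootData

/-! ### The different and the discriminant -/

namespace RootData

variable {p n : ℕ} {B : BasicField n} {K L : Subfield B.Closure} {d : ℕ}
  {θs : Fin d → B.Closure} {v : AddValuation B.Closure (WithTop (QLex (n + 1)))}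
  {i : Fin d → WithTop (QLex (n + 1))} {l₀ : Fin d}

lemma coe_untopD (h : RootData p K L θs v i l₀) {l : Fin d} (hl : l ≠ l₀) :
    (((i l).untopD 0 : QLex (n + 1)) : WithTop (QLex (n + 1))) = i l := by
  obtain ⟨g, hg⟩ := WithTop.ne_top_iff_exists.1 ((h.eq_top l).not.2 hl)
  rw [← hg, WithTop.untopD_coe]

/-- The value of the derivative of the minimal polynomial at each of its roots. -/
lemma value_derivative (h : RootData p K L θs v i l₀) (m : Fin d) :
    v (∏ l ∈ Finset.univ.erase m, (θs m - θs l)) =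
      ((∑ l ∈ Finset.univ.erase l₀, (i l).untopD 0 + lastVec n ((d : ℚ) - 1) : QLex (n + 1)) :
        WithTop (QLex (n + 1))) := by
  obtain ⟨π, hπ, hconj⟩ := h.conj m
  have hd : lastVec n ((d : ℚ) - 1) = ∑ _l ∈ Finset.univ.erase l₀, lastVec n 1 := by
    rw [Finset.sum_const, Finset.card_erase_of_mem (Finset.mem_univ _), Finset.card_univ,
      Fintype.card_fin, nsmul_lastVec, Nat.cast_sub h.d_pos, mul_one, Nat.cast_one]
  rw [value_prod, hd, ← Finset.sum_add_distrib, WithTop.coe_sum]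
  refine Finset.sum_equiv π (fun l => ?_) fun l hl => ?_
  · rw [Finset.mem_erase, Finset.mem_erase, ← hπ, π.injective.ne_iff]
    simp
  · have hl0 : π l ≠ l₀ := by
      rw [← hπ]
      exact π.injective.ne (Finset.ne_of_mem_erase hl)
    rw [v.map_sub_swap, hconj, WithTop.coe_add, h.coe_untopD hl0]

/-- At the last edge point, all finite `i_l` contribute in full, and the root `θ` itself contributes
the point. -/
lemma capSum_last (h : RootData p K L θs v i l₀) {b : QLex (n + 1)}
    (hmax : ∀ l, l ≠ l₀ → i l ≤ b) :
    capSum i b = b + ∑ l ∈ Finset.univ.erase l₀, (i l).untopD 0 := by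
  rw [capSum, ← Finset.add_sum_erase _ _ (Finset.mem_univ l₀), (h.eq_top l₀).2 rfl,
    cap_of_le le_top]
  congr 1
  refine Finset.sum_congr rfl fun l hl => ?_
  have hl0 := Finset.ne_of_mem_erase hl
  have h1 := hmax l hl0
  rw [← h.coe_untopD hl0, WithTop.coe_le_coe] at h1
  rw [← cap_coe_of_le h1, h.coe_untopD hl0]

/-- The invariants of the different and of the discriminant, in terms of the last edge point. -/
lemma last_formulas (h : RootData p K L θs v i l₀) {l : Fin d} (hl : l ≠ l₀) :
    ∃ b j δ : QLex (n + 1), lastLower p K L = topIdx b ∧ lastUpper p K L = topIdx j ∧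
      (∀ m, v (∏ l ∈ Finset.univ.erase m, (θs m - θs l)) = (δ : WithTop (QLex (n + 1)))) ∧
      δ = scale (topScale n d) j - b + lastVec n ((d : ℚ) - 1) ∧
      scale (topScale n d) j ≤ 2 • d • δ := by
  obtain ⟨b, hb0, ⟨m, hm0, hm⟩, hmax, hlow, hup⟩ := h.exists_last hl
  have hT := h.capSum_last hmax
  have hsc := (h.scale_herbrand hb0).trans hT
  set T := ∑ l ∈ Finset.univ.erase l₀, (i l).untopD 0 with hTdef
  have hnn : ∀ l ∈ Finset.univ.erase l₀, 0 ≤ (i l).untopD 0 := by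
    intro l hl
    have h1 := h.nonneg l
    rwa [← h.coe_untopD (Finset.ne_of_mem_erase hl), ← WithTop.coe_zero, WithTop.coe_le_coe] at h1
  -- the largest `i_l` is one of the terms of the sum of all of them
  have hbT : b ≤ T := by
    have h1 := Finset.single_le_sum hnn (Finset.mem_erase.2 ⟨hm0, Finset.mem_univ m⟩)
    rwa [hm, WithTop.untopD_coe] at h1
  have hd1 : (0 : ℚ) ≤ (d : ℚ) - 1 := by
    have : (1 : ℚ) ≤ d := by exact_mod_cast h.d_pos
    linarith
  have hlast : 0 ≤ lastVec n ((d : ℚ) - 1) := by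
    rcases hd1.eq_or_lt with h1 | h1
    · rw [← h1]
      exact (map_zero (lastHom n)).ge
    · exact (lastVec_pos h1).le
  have hT0 : 0 ≤ T := Finset.sum_nonneg hnn
  have hδ0 : 0 ≤ T + lastVec n ((d : ℚ) - 1) := add_nonneg hT0 hlast
  refine ⟨b, herbrandAt p K L (Fin.last n) b, T + lastVec n ((d : ℚ) - 1), hlow, hup,
    h.value_derivative, ?_, ?_⟩
  · rw [hsc, add_sub_cancel_left]
  · rw [hsc]
    have h1 : T ≤ T + lastVec n ((d : ℚ) - 1) := le_add_of_nonneg_right hlast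
    have h2 : T + lastVec n ((d : ℚ) - 1) ≤ d • (T + lastVec n ((d : ℚ) - 1)) :=
      le_self_nsmul hδ0 h.d_pos.ne'
    rw [two_nsmul]
    exact add_le_add (hbT.trans (h1.trans h2)) (h1.trans h2)

/-- The factors for the discriminant are complementary to those between `v_L` and `v_K`. -/
lemma scale_topScale_scale (x : QLex (n + 1)) :
    scale (topScale n d) (scale (fun k => if k = Fin.last n then 1 else (d : ℚ)) x) = d • x := by
  refine qlex_ext fun k => ?_
  change topScale n d k * ((if k = Fin.last n then 1 else (d : ℚ)) * ofLex x k) = d • ofLex x k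
  rw [topScale, nsmul_eq_mul]
  split_ifs <;> ring

end RootData

end HigherLocal

open HigherLocal HigherLocal.BasicField in
theorem proposition3p2 (p : ℕ) [Fact p.Prime] (n : ℕ) (c : CharKind)
    (K L E : Subfield (basicField p n c).Closure)
    (hK : IsLF K) (hL : IsLF L) (hKL : K ≤ L) (hsep : ∀ x ∈ L, IsSeparable K x)
    (hconst : constants p L n = constants p K n)
    (hE : constants p L n ≤ E) (hEfin : (constants p L n).relfinrank E ≠ 0)
    (hEL : L.relfinrank (L ⊔ E) = (constants p L n).relfinrank E)
    (θ : (basicField p n c).Closure) (hθ : IsLastParam p n (L ⊔ E) E θ)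
    (d : ℕ) (θs : Fin d → (basicField p n c).Closure)
    (hroots : (minpoly ↥(K ⊔ E) θ).map (algebraMap ↥(K ⊔ E) (basicField p n c).Closure) =
      ∏ l, (Polynomial.X - Polynomial.C (θs l))) :
    (∀ (α : (basicField p n c).Closure) (A : QLex (n + 1)), 0 < A →
      canonVal p K (Polynomial.aeval α (minpoly ↥(K ⊔ E) θ)) = ↑(A + lastVec n 1) →
      (∃ (l : Fin d) (a : QLex (n + 1)), 0 ≤ a ∧
        canonVal p L (α - θs l) = ↑(a + lastVec n 1) ∧ herbrand p K L (topIdx a) = topIdx A) ∧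
      (lastUpper p K L < topIdx A →
        ∃! l : Fin d, ∃ a : QLex (n + 1), 0 ≤ a ∧
          canonVal p L (α - θs l) = ↑(a + lastVec n 1) ∧
          herbrand p K L (topIdx a) = topIdx A)) ∧
    (K ≠ L → ∃ i j δ : QLex (n + 1),
      lastLower p K L = topIdx i ∧ lastUpper p K L = topIdx j ∧
      canonVal p L (Polynomial.aeval θ (Polynomial.derivative (minpoly ↥(K ⊔ E) θ))) = ↑δ ∧
      δ = scale (fun k => if k = Fin.last n then (d : ℚ) else 1) j - i + lastVec n ((d : ℚ) - 1) ∧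
      canonVal p K (algebraMap ↥(K ⊔ E) (basicField p n c).Closure
        (minpoly ↥(K ⊔ E) θ).discr) =
          ↑(scale (fun k => if k = Fin.last n then 1 else (d : ℚ)) δ) ∧
      j ≤ (2 : ℕ) • scale (fun k => if k = Fin.last n then 1 else (d : ℚ)) δ) := by
  obtain ⟨v₀, hv₀⟩ := good_basic p n c
  obtain ⟨w, hw⟩ := hv₀.exists_goodBar
  have hd : StdDatum p K L E θ := ⟨hK, hL, hKL, hsep, hconst, hE, hEfin, hEL, hθ⟩
  obtain ⟨hdeg, v, i, l₀, h, hl₀⟩ := hd.exists_rootData hw hroots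
  refine ⟨fun α A hA hα => ?_, fun hne => ?_⟩
  · rw [aeval_eq_prod hroots] at hα
    obtain ⟨l, a, ha, hla, hφ⟩ := h.exists_root hA hα
    refine ⟨⟨l, a, ha, hla, congrArg topIdx hφ⟩, fun hAlast =>
      ⟨l, ⟨a, ha, hla, congrArg topIdx hφ⟩, ?_⟩⟩
    rintro m ⟨b, hb, hmb, hφb⟩
    exact h.root_unique hAlast hb ha hmb hla (topIdx_injective hφb) hφ
  · obtain ⟨l, hl⟩ : ∃ l, l ≠ l₀ := by
      have hd1 : d ≠ 1 := by
        rw [hdeg]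
        intro h1
        exact hne (le_antisymm hKL (Subfield.relfinrank_eq_one_iff.1 h1))
      have : Nontrivial (Fin d) := Fin.nontrivial_iff_two_le.2 (by have := h.d_pos; omega)
      exact exists_ne l₀
    obtain ⟨b, j, δ, hlow, hup, hval, hδ, hle⟩ := h.last_formulas hl
    have hder : ∀ m, v (Polynomial.aeval (θs m) (Polynomial.derivative (minpoly ↥(K ⊔ E) θ))) =
        (δ : WithTop (QLex (n + 1))) := fun m => by
      rw [aeval_derivative_eq_prod hroots, hval]
    have hmono := scale_strictMono (topScale_pos (n := n) h.d_pos)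
    refine ⟨b, j, δ, hlow, hup, ?_, hδ, ?_, ?_⟩
    · rw [h.canonVal_top, ← hl₀]
      have := hder l₀
      rwa [hl₀] at this ⊢
    · have hint : IsIntegral ↥(K ⊔ E) θ :=
        ((isAlgebraic_of_base_le hd.isLF_sup_base.base_le).isAlgebraic θ).isIntegral
      obtain ⟨s, hs⟩ := exists_discr_eq_prod (minpoly.monic hint) h.d_pos hroots
      have h1 := h.canonVal_base (algebraMap ↥(K ⊔ E) _ (minpoly ↥(K ⊔ E) θ).discr)
      have h2 : v (algebraMap ↥(K ⊔ E) _ (minpoly ↥(K ⊔ E) θ).discr) =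
          ((d • δ : QLex (n + 1)) : WithTop (QLex (n + 1))) := by
        rw [hs, v.map_mul, v.map_pow, v.map_neg, v.map_one, smul_zero, zero_add, value_prod,
          Finset.sum_congr rfl fun m _ => hder m, Finset.sum_const, Finset.card_univ,
          Fintype.card_fin, WithTop.coe_nsmul]
      rw [h2] at h1
      cases hx : canonVal p K (algebraMap ↥(K ⊔ E) _ (minpoly ↥(K ⊔ E) θ).discr) with
      | top =>
        rw [hx] at h1
        exact absurd h1 WithTop.coe_ne_top
      | coe g =>
        rw [hx, WithTop.map_coe, WithTop.coe_eq_coe, ← RootData.scale_topScale_scale] at h1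
        rw [hmono.injective h1]
    · refine hmono.le_iff_le.1 ?_
      have h1 : scale (topScale n d)
          ((2 : ℕ) • scale (fun k => if k = Fin.last n then 1 else (d : ℚ)) δ) = 2 • d • δ := by
        rw [← scaleHom_apply, map_nsmul, scaleHom_apply, RootData.scale_topScale_scale]
      rw [h1]
      exact hle
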